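/- Let $T=\mathbb C/\Lambda$ be a complex torus and let $\Gamma$ be a finite group acting faithfully on $T$ by biholomorphic maps and faithfully on $\mathfrak{sl}_2=\mathfrak{sl}_2(\mathbb C)$ by Lie algebra automorphisms. Assume, as a normalisation of the origin of $T$, that $\Gamma=G\ltimes K$, where $G$ is the subgroup of elements fixing $0\in T$ and $K$ is the subgroup of elements acting by translations (that is, every $\gamma\in\Gamma$ is a product $gk$ with $g\in G$, $k\in K$). Put $\mathbb T=T\setminus\Gamma\cdot 0$ and let $\mathfrak A$ be the automorphic Lie algebra of all $\Gamma$-equivariant holomorphic maps $\mathbb T\to\mathfrak{sl}_2$ that are meromorphic at the punctures $\Gamma\cdot 0$, with pointwise bracket. Let $t(\Gamma)\le\Gamma$ be the subgroup generated by the elements that have no fixed point in $T$. Then the number of branch points of the projection $\mathbb T\to\mathbb T/\Gamma$ is $0$, $2$ or $3$. Moreover there is a unique class $[\tau]\in\mathrm{SL}_2(\mathbb Z)\backslash\mathbb H$ such that, for $\tau\in\mathbb H$, $\tau$ lies in this class if and only if $\mathbb C/(\mathbb Z\oplus\mathbb Z\tau)$ is biholomorphic to $T/t(\Gamma)$, and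 for every $\tau$ in this class, as complex Lie algebras: - if the number of branch points is $0$, then $\mathfrak A\cong\mathfrak C_\tau=\mathfrak{sl}_2\otimes_{\mathbb C}\mathbb C[x,y]/(y^2-4x^3+g_2(\tau)x+g_3(\tau))$; - if it is $2$, then $\mathfrak A\cong\mathfrak O$, the Onsager algebra; - if it is $3$, then $\mathfrak A\cong\mathfrak S_\tau$. Here $g_2(\tau)=60\sum_{(a,b)\in\mathbb Z^2\setminus 0}(a+b\tau)^{-4}$ and $g_3(\tau)=140\sum_{(a,b)\in\mathbb Z^2\setminus 0}(a+b\tau)^{-6}$. The Lie algebra $\mathfrak O$ has complex basis $A_k$ $(k\in\mathbb Z)$, $G_m$ $(m\ge1)$ with $[A_k,A_l]=4G_{k-l}$, $[A_k,G_m]=2(A_{k-m}-A_{k+m})$, $[G_m,G_n]=0$, where $G_{-m}=-G_m$ and $G_0=0$. The Lie algebra $\mathfrak S_\tau$ is $\mathbb C\langle E,F,H\rangle\otimes_{\mathbb C}\mathbb C[x]$ with the $\mathbb C[x]$-bilinear bracket $[H,E]=2E$, $[H,F]=-2F$, $[E,F]=H\otimes(4x^3-g_2(\tau)x-g_3(\tau))$.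 -/

import Mathlib

open scoped Topology TensorProduct Polynomial UpperHalfPlane

noncomputable section

/-! ## Lie algebra preliminaries -/

/-- The Lie algebra `𝔰𝔩₂(ℂ)` of traceless complex `2 × 2` matrices. -/
abbrev Sl2 : Type := LieAlgebra.SpecialLinear.sl (Fin 2) ℂ

/-- The automorphism group of a complex Lie algebra, under composition. -/
instance lieAutGroup (𝔤 : Type*) [LieRing 𝔤] [LieAlgebra ℂ 𝔤] : Group (𝔤 ≃ₗ⁅ℂ⁆ 𝔤) where
  mul f g := g.trans f
  one := LieEquiv.refl
  inv f := f.symm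
  mul_assoc _ _ _ := rfl
  one_mul _ := rfl
  mul_one _ := rfl
  inv_mul_cancel f := by
    apply LieEquiv.coe_injective
    ext x
    exact f.symm_apply_apply x

/-- The pointwise Lie bracket on maps from a set to a Lie algebra. -/
instance funLieRing (X 𝔤 : Type*) [LieRing 𝔤] : LieRing (X → 𝔤) where
  bracket a b := fun p => ⁅a p, b p⁆
  add_lie a b c := funext fun p => add_lie (a p) (b p) (c p)
  lie_add a b c := funext fun p => lie_add (a p) (b p) (c p)
  lie_self a := funext fun p => lie_self (a p)
  leibniz_lie a b c := funext fun p => leibniz_lie (a p) (b p) (c p)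

instance funLieAlgebra (X 𝔤 : Type*) [LieRing 𝔤] [LieAlgebra ℂ 𝔤] : LieAlgebra ℂ (X → 𝔤) where
  lie_smul t a b := funext fun p => lie_smul t (a p) (b p)

/-! ## The Onsager algebra -/

/-- The Onsager algebra: the complex vector space with basis `A_k` (`k ∈ ℤ`) and
`G_m` (`m = 1, 2, …`); the bracket is defined below. -/
def OnsagerAlgebra : Type := (ℤ →₀ ℂ) × (ℕ+ →₀ ℂ)

namespace OnsagerAlgebra

instance : AddCommGroup OnsagerAlgebra := inferInstanceAs (AddCommGroup ((ℤ →₀ ℂ) × (ℕ+ →₀ ℂ)))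
instance : Module ℂ OnsagerAlgebra := inferInstanceAs (Module ℂ ((ℤ →₀ ℂ) × (ℕ+ →₀ ℂ)))

/-- `G_m` for all integers `m`, with `G_{-m} = -G_m` and `G_0 = 0`. -/
def gVec (m : ℤ) : ℕ+ →₀ ℂ :=
  if h : 0 < m then Finsupp.single ⟨m.toNat, by omega⟩ 1
  else if h : m < 0 then -Finsupp.single ⟨(-m).toNat, by omega⟩ 1
  else 0

/-- The bilinear extension of `(A_k, A_l) ↦ 4 G_{k-l}`. -/
def brAA : (ℤ →₀ ℂ) →ₗ[ℂ] (ℤ →₀ ℂ) →ₗ[ℂ] (ℕ+ →₀ ℂ) :=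
  Finsupp.linearCombination ℂ fun k : ℤ =>
    Finsupp.linearCombination ℂ fun l : ℤ => (4 : ℂ) • gVec (k - l)

/-- The bilinear extension of `(A_k, G_m) ↦ 2 (A_{k-m} - A_{k+m})`. -/
def brAG : (ℤ →₀ ℂ) →ₗ[ℂ] (ℕ+ →₀ ℂ) →ₗ[ℂ] (ℤ →₀ ℂ) :=
  Finsupp.linearCombination ℂ fun k : ℤ =>
    Finsupp.linearCombination ℂ fun m : ℕ+ =>
      (2 : ℂ) • (Finsupp.single (k - (m : ℤ)) (1 : ℂ) - Finsupp.single (k + (m : ℤ)) (1 : ℂ))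

lemma gVec_neg (m : ℤ) : gVec (-m) = -gVec m := by
  unfold gVec
  rcases lt_trichotomy m 0 with h | h | h
  · have h1 : 0 < -m := by omega
    have h2 : ¬ 0 < m := by omega
    simp [h, h2]
  · subst h; simp
  · have h1 : ¬ m < 0 := by omega
    simp [h, h1]

lemma gVec_coe (m : ℕ+) : gVec (m : ℤ) = Finsupp.single m 1 := by
  have h : (0 : ℤ) < (m : ℤ) := by exact_mod_cast m.pos
  unfold gVec
  rw [dif_pos h]
  congr 1

lemma brAA_single (k l : ℤ) (r s : ℂ) :
    brAA (Finsupp.single k r) (Finsupp.single l s) = (r * s * 4) • gVec (k - l) := by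
  simp [brAA, smul_smul, mul_assoc]

lemma brAG_single (k : ℤ) (m : ℕ+) (r s : ℂ) :
    brAG (Finsupp.single k r) (Finsupp.single m s) =
      (r * s * 2) • (Finsupp.single (k - (m : ℤ)) (1 : ℂ) - Finsupp.single (k + (m : ℤ)) 1) := by
  simp only [brAG, Finsupp.linearCombination_single, LinearMap.smul_apply, smul_smul, mul_assoc]

lemma brAG_gVec (k m : ℤ) (r : ℂ) :
    brAG (Finsupp.single k r) (gVec m) =
      (r * 2) • (Finsupp.single (k - m) (1 : ℂ) - Finsupp.single (k + m) 1) := by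
  have key : ∀ n : ℕ+, brAG (Finsupp.single k r) (gVec (n : ℤ)) =
      (r * 2) • (Finsupp.single (k - (n : ℤ)) (1 : ℂ) - Finsupp.single (k + (n : ℤ)) 1) := by
    intro n
    rw [gVec_coe, brAG_single, mul_one]
  rcases lt_trichotomy m 0 with h | h | h
  · obtain ⟨n, hn⟩ : ∃ n : ℕ+, (n : ℤ) = -m :=
      ⟨⟨(-m).toNat, by omega⟩, Int.toNat_of_nonneg (by omega)⟩
    have h1 := key n
    rw [hn, gVec_neg, map_neg, sub_neg_eq_add, ← sub_eq_add_neg, neg_eq_iff_eq_neg] at h1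
    rw [h1, ← smul_neg, neg_sub]
  · subst h; simp [gVec]
  · obtain ⟨n, hn⟩ : ∃ n : ℕ+, (n : ℤ) = m :=
      ⟨⟨m.toNat, by omega⟩, Int.toNat_of_nonneg (by omega)⟩
    have h1 := key n
    rwa [hn] at h1

lemma brAA_skew (a b : ℤ →₀ ℂ) : brAA a b = -brAA b a := by
  induction a using Finsupp.induction_linear with
  | zero => simp
  | add a a' h h' => simp only [map_add, LinearMap.add_apply, h, h']; abel
  | single k r =>
    induction b using Finsupp.induction_linear with
    | zero => simp
    | add b b' h h' => simp only [map_add, LinearMap.add_apply, h, h']; abel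
    | single l s =>
      rw [brAA_single, brAA_single, ← neg_sub l k, gVec_neg, smul_neg, mul_comm r s]

lemma brAA_self (a : ℤ →₀ ℂ) : brAA a a = 0 := self_eq_neg.mp (brAA_skew a a)

lemma jacobi_AAA (a b c : ℤ →₀ ℂ) :
    brAG a (brAA b c) + brAG c (brAA a b) - brAG b (brAA a c) = 0 := by
  induction a using Finsupp.induction_linear with
  | zero => simp
  | add a a' h h' =>
    simp only [map_add, LinearMap.add_apply]
    linear_combination (norm := module) h + h'
  | single k r =>
    induction b using Finsupp.induction_linear with
    | zero => simp
    | add a a' h h' =>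
      simp only [map_add, LinearMap.add_apply]
      linear_combination (norm := module) h + h'
    | single l s =>
      induction c using Finsupp.induction_linear with
      | zero => simp
      | add a a' h h' =>
        simp only [map_add, LinearMap.add_apply]
        linear_combination (norm := module) h + h'
      | single m t =>
        simp only [brAA_single, map_smul, brAG_gVec, smul_smul]
        rw [show k - (l - m) = k + m - l by ring, show k + (l - m) = k + l - m by ring,
          show m - (k - l) = l + m - k by ring, show m + (k - l) = k + m - l by ring,
          show l - (k - m) = l + m - k by ring, show l + (k - m) = k + l - m by ring]
        module

lemma jacobi_AGG (a : ℤ →₀ ℂ) (g h : ℕ+ →₀ ℂ) : brAG (brAG a g) h = brAG (brAG a h) g := by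
  induction a using Finsupp.induction_linear with
  | zero => simp
  | add a a' h h' => simp only [map_add, LinearMap.add_apply, h, h']
  | single k r =>
    induction g using Finsupp.induction_linear with
    | zero => simp
    | add a a' h h' => simp only [map_add, LinearMap.add_apply, h, h']
    | single m s =>
      induction h using Finsupp.induction_linear with
      | zero => simp
      | add a a' h h' => simp only [map_add, LinearMap.add_apply, h, h']
      | single n t =>
        simp only [brAG_single, map_smul, map_sub, LinearMap.smul_apply, LinearMap.sub_apply]
        rw [show k - (m : ℤ) - (n : ℤ) = k - n - m by ring,
          show k - (m : ℤ) + (n : ℤ) = k + n - m by ring,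
          show k + (m : ℤ) - (n : ℤ) = k - n + m by ring,
          show k + (m : ℤ) + (n : ℤ) = k + n + m by ring]
        module

lemma jacobi_AAG (a c : ℤ →₀ ℂ) (g : ℕ+ →₀ ℂ) : brAA (brAG a g) c + brAA a (brAG c g) = 0 := by
  induction a using Finsupp.induction_linear with
  | zero => simp
  | add a a' h h' =>
    simp only [map_add, LinearMap.add_apply]
    linear_combination (norm := module) h + h'
  | single k r =>
    induction c using Finsupp.induction_linear with
    | zero => simp
    | add a a' h h' =>
      simp only [map_add, LinearMap.add_apply]
      linear_combination (norm := module) h + h'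
    | single l s =>
      induction g using Finsupp.induction_linear with
      | zero => simp
      | add a a' h h' =>
        simp only [map_add, LinearMap.add_apply]
        linear_combination (norm := module) h + h'
      | single m t =>
        simp only [brAG_single, map_smul, map_sub, LinearMap.smul_apply, LinearMap.sub_apply,
          brAA_single]
        rw [show k - (m : ℤ) - l = k - (l + m) by ring,
          show k + (m : ℤ) - l = k - (l - m) by ring]
        module

instance : LieRing OnsagerAlgebra where
  bracket x y := (brAG x.1 y.2 - brAG y.1 x.2, brAA x.1 y.1)
  add_lie x y z := by
    refine Prod.ext ?_ ?_
    · change brAG (x.1 + y.1) z.2 - brAG z.1 (x.2 + y.2) =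
        (brAG x.1 z.2 - brAG z.1 x.2) + (brAG y.1 z.2 - brAG z.1 y.2)
      simp only [map_add, LinearMap.add_apply]; abel
    · change brAA (x.1 + y.1) z.1 = brAA x.1 z.1 + brAA y.1 z.1
      simp only [map_add, LinearMap.add_apply]
  lie_add x y z := by
    refine Prod.ext ?_ ?_
    · change brAG x.1 (y.2 + z.2) - brAG (y.1 + z.1) x.2 =
        (brAG x.1 y.2 - brAG y.1 x.2) + (brAG x.1 z.2 - brAG z.1 x.2)
      simp only [map_add, LinearMap.add_apply]; abel
    · change brAA x.1 (y.1 + z.1) = brAA x.1 y.1 + brAA x.1 z.1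
      simp only [map_add]
  lie_self x := Prod.ext (sub_self _) (brAA_self x.1)
  leibniz_lie x y z := by
    refine Prod.ext ?_ ?_
    · change brAG x.1 (brAA y.1 z.1) - brAG (brAG y.1 z.2 - brAG z.1 y.2) x.2 =
        (brAG (brAG x.1 y.2 - brAG y.1 x.2) z.2 - brAG z.1 (brAA x.1 y.1)) +
        (brAG y.1 (brAA x.1 z.1) - brAG (brAG x.1 z.2 - brAG z.1 x.2) y.2)
      simp only [map_sub, LinearMap.sub_apply]
      rw [jacobi_AGG x.1 z.2 y.2, jacobi_AGG y.1 z.2 x.2, jacobi_AGG z.1 y.2 x.2]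
      linear_combination (norm := module) jacobi_AAA x.1 y.1 z.1
    · change brAA x.1 (brAG y.1 z.2 - brAG z.1 y.2) =
        brAA (brAG x.1 y.2 - brAG y.1 x.2) z.1 + brAA y.1 (brAG x.1 z.2 - brAG z.1 x.2)
      simp only [map_sub, LinearMap.sub_apply]
      rw [brAA_skew y.1 (brAG x.1 z.2)]
      linear_combination (norm := module) jacobi_AAG x.1 y.1 z.2 - jacobi_AAG x.1 z.1 y.2 +
        jacobi_AAG y.1 z.1 x.2

instance : LieAlgebra ℂ OnsagerAlgebra where
  lie_smul t x y := by
    refine Prod.ext ?_ ?_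
    · change brAG x.1 (t • y.2) - brAG (t • y.1) x.2 = t • (brAG x.1 y.2 - brAG y.1 x.2)
      simp only [map_smul, LinearMap.smul_apply, smul_sub]
    · change brAA x.1 (t • y.1) = t • brAA x.1 y.1
      simp only [map_smul]

/-- The basis vector `A_k`. -/
def A (k : ℤ) : OnsagerAlgebra := (Finsupp.single k 1, 0)

/-- The vector `G_m`, a basis vector for `m > 0`. -/
def G (m : ℤ) : OnsagerAlgebra := (0, gVec m)

lemma lie_A_A (k l : ℤ) : ⁅A k, A l⁆ = (4 : ℂ) • G (k - l) := by
  refine Prod.ext ?_ ?_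
  · change brAG (Finsupp.single k 1) 0 - brAG (Finsupp.single l 1) 0 = (4 : ℂ) • 0
    simp
  · change brAA (Finsupp.single k 1) (Finsupp.single l 1) = (4 : ℂ) • gVec (k - l)
    rw [brAA_single]; norm_num

lemma lie_A_G (k m : ℤ) : ⁅A k, G m⁆ = (2 : ℂ) • (A (k - m) - A (k + m)) := by
  refine Prod.ext ?_ ?_
  · change brAG (Finsupp.single k 1) (gVec m) - brAG 0 0 =
      (2 : ℂ) • (Finsupp.single (k - m) 1 - Finsupp.single (k + m) 1)
    rw [brAG_gVec]; simp
  · change brAA (Finsupp.single k 1) 0 = (2 : ℂ) • (0 - 0)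
    simp

lemma lie_G_G (m n : ℤ) : ⁅G m, G n⁆ = 0 := by
  refine Prod.ext ?_ ?_
  · change brAG 0 (gVec n) - brAG 0 (gVec m) = 0
    simp
  · change brAA 0 0 = 0
    simp

end OnsagerAlgebra

/-! ## The Lie algebras `ℂ⟨E, F, H⟩ ⊗ ℂ[x]` with `[E, F] = H ⊗ q` -/

/-- The free `ℂ[x]`-module `ℂ⟨E, F, H⟩ ⊗ ℂ[x]`: the triple `(a, b, c)` stands for
`E ⊗ a + F ⊗ b + H ⊗ c`. It carries the `ℂ[x]`-bilinear bracket with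
`[H, E] = 2E`, `[H, F] = -2F`, `[E, F] = H ⊗ q`. -/
def TwistedSl2 (_q : ℂ[X]) : Type := ℂ[X] × ℂ[X] × ℂ[X]

namespace TwistedSl2

variable (q : ℂ[X])

instance : AddCommGroup (TwistedSl2 q) := inferInstanceAs (AddCommGroup (ℂ[X] × ℂ[X] × ℂ[X]))
instance : Module ℂ (TwistedSl2 q) := inferInstanceAs (Module ℂ (ℂ[X] × ℂ[X] × ℂ[X]))

instance : LieRing (TwistedSl2 q) where
  bracket u v :=
    (2 * (u.2.2 * v.1 - u.1 * v.2.2), -2 * (u.2.2 * v.2.1 - u.2.1 * v.2.2),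
      q * (u.1 * v.2.1 - u.2.1 * v.1))
  add_lie u v w := by
    obtain ⟨a, b, c⟩ := u
    obtain ⟨a', b', c'⟩ := v
    obtain ⟨a'', b'', c''⟩ := w
    refine Prod.ext ?_ (Prod.ext ?_ ?_)
    · change 2 * ((c + c') * a'' - (a + a') * c'') =
        2 * (c * a'' - a * c'') + 2 * (c' * a'' - a' * c'')
      ring
    · change -2 * ((c + c') * b'' - (b + b') * c'') =
        -2 * (c * b'' - b * c'') + -2 * (c' * b'' - b' * c'')
      ring
    · change q * ((a + a') * b'' - (b + b') * a'') =
        q * (a * b'' - b * a'') + q * (a' * b'' - b' * a'')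
      ring
  lie_add u v w := by
    obtain ⟨a, b, c⟩ := u
    obtain ⟨a', b', c'⟩ := v
    obtain ⟨a'', b'', c''⟩ := w
    refine Prod.ext ?_ (Prod.ext ?_ ?_)
    · change 2 * (c * (a' + a'') - a * (c' + c'')) =
        2 * (c * a' - a * c') + 2 * (c * a'' - a * c'')
      ring
    · change -2 * (c * (b' + b'') - b * (c' + c'')) =
        -2 * (c * b' - b * c') + -2 * (c * b'' - b * c'')
      ring
    · change q * (a * (b' + b'') - b * (a' + a'')) =
        q * (a * b' - b * a') + q * (a * b'' - b * a'')
      ring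
  lie_self u := by
    obtain ⟨a, b, c⟩ := u
    refine Prod.ext ?_ (Prod.ext ?_ ?_)
    · change 2 * (c * a - a * c) = 0
      ring
    · change -2 * (c * b - b * c) = 0
      ring
    · change q * (a * b - b * a) = 0
      ring
  leibniz_lie u v w := by
    obtain ⟨a, b, c⟩ := u
    obtain ⟨a', b', c'⟩ := v
    obtain ⟨a'', b'', c''⟩ := w
    refine Prod.ext ?_ (Prod.ext ?_ ?_)
    · change 2 * (c * (2 * (c' * a'' - a' * c'')) - a * (q * (a' * b'' - b' * a''))) =
        2 * ((q * (a * b' - b * a')) * a'' - (2 * (c * a' - a * c')) * c'') +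
        2 * (c' * (2 * (c * a'' - a * c'')) - a' * (q * (a * b'' - b * a'')))
      ring
    · change -2 * (c * (-2 * (c' * b'' - b' * c'')) - b * (q * (a' * b'' - b' * a''))) =
        -2 * ((q * (a * b' - b * a')) * b'' - (-2 * (c * b' - b * c')) * c'') +
        -2 * (c' * (-2 * (c * b'' - b * c'')) - b' * (q * (a * b'' - b * a'')))
      ring
    · change q * (a * (-2 * (c' * b'' - b' * c'')) - b * (2 * (c' * a'' - a' * c''))) =
        q * ((2 * (c * a' - a * c')) * b'' - (-2 * (c * b' - b * c')) * a'') +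
        q * (a' * (-2 * (c * b'' - b * c'')) - b' * (2 * (c * a'' - a * c'')))
      ring

instance : LieAlgebra ℂ (TwistedSl2 q) where
  lie_smul t u v := by
    obtain ⟨a, b, c⟩ := u
    obtain ⟨a', b', c'⟩ := v
    refine Prod.ext ?_ (Prod.ext ?_ ?_)
    · change 2 * (c * (t • a') - a * (t • c')) = t • (2 * (c * a' - a * c'))
      simp only [Polynomial.smul_eq_C_mul]; ring
    · change -2 * (c * (t • b') - b * (t • c')) = t • (-2 * (c * b' - b * c'))
      simp only [Polynomial.smul_eq_C_mul]; ring
    · change q * (a * (t • b') - b * (t • a')) = t • (q * (a * b' - b * a'))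
      simp only [Polynomial.smul_eq_C_mul]; ring

/-- The generator `E`. -/
def E : TwistedSl2 q := ((1, 0, 0) : ℂ[X] × ℂ[X] × ℂ[X])
/-- The generator `F`. -/
def F : TwistedSl2 q := ((0, 1, 0) : ℂ[X] × ℂ[X] × ℂ[X])
/-- The element `H ⊗ r`. -/
def H (r : ℂ[X]) : TwistedSl2 q := ((0, 0, r) : ℂ[X] × ℂ[X] × ℂ[X])

lemma lie_H_E : ⁅H q 1, E q⁆ = (2 : ℂ) • E q := by
  refine Prod.ext ?_ (Prod.ext ?_ ?_)
  · change 2 * ((1 : ℂ[X]) * 1 - 0 * 0) = (2 : ℂ) • (1 : ℂ[X])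
    rw [Polynomial.smul_eq_C_mul, Polynomial.C_ofNat]; ring
  · change -2 * ((1 : ℂ[X]) * 0 - 0 * 0) = (2 : ℂ) • (0 : ℂ[X])
    simp
  · change q * ((0 : ℂ[X]) * 0 - 0 * 1) = (2 : ℂ) • (0 : ℂ[X])
    simp

lemma lie_H_F : ⁅H q 1, F q⁆ = (-2 : ℂ) • F q := by
  refine Prod.ext ?_ (Prod.ext ?_ ?_)
  · change 2 * ((1 : ℂ[X]) * 0 - 0 * 0) = (-2 : ℂ) • (0 : ℂ[X])
    simp
  · change -2 * ((1 : ℂ[X]) * 1 - 0 * 0) = (-2 : ℂ) • (1 : ℂ[X])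
    rw [Polynomial.smul_eq_C_mul, Polynomial.C_neg, Polynomial.C_ofNat]; ring
  · change q * ((0 : ℂ[X]) * 1 - 0 * 0) = (-2 : ℂ) • (0 : ℂ[X])
    simp

lemma lie_E_F : ⁅E q, F q⁆ = H q q := by
  refine Prod.ext ?_ (Prod.ext ?_ ?_)
  · change 2 * ((0 : ℂ[X]) * 0 - 1 * 0) = 0
    simp
  · change -2 * ((0 : ℂ[X]) * 1 - 0 * 0) = 0
    simp
  · change q * ((1 : ℂ[X]) * 1 - 0 * 0) = q
    simp

end TwistedSl2

/-! ## The two families parametrised by the upper half plane -/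

/-- The pair of periods `1, τ`, spanning the lattice `ℤ ⊕ ℤτ`. -/
def tauPeriods (τ : ℍ) : PeriodPair where
  ω₁ := 1
  ω₂ := τ
  indep := by
    rw [LinearIndependent.pair_iff]
    intro s t h
    have h1 := congrArg Complex.im h
    have h2 := congrArg Complex.re h
    simp at h1 h2
    have ht : t = 0 := h1.resolve_right τ.im_ne_zero
    subst ht
    simpa using h2

/-- The coordinate ring `ℂ[x, y] / (y² - 4x³ + g₂(τ) x + g₃(τ))`. -/
abbrev EllipticRing (τ : ℍ) : Type :=
  MvPolynomial (Fin 2) ℂ ⧸ Ideal.span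
    {(MvPolynomial.X 1 ^ 2 - 4 * MvPolynomial.X 0 ^ 3 +
      MvPolynomial.C (tauPeriods τ).g₂ * MvPolynomial.X 0 +
      MvPolynomial.C (tauPeriods τ).g₃ : MvPolynomial (Fin 2) ℂ)}

/-- The current algebra `ℭ_τ`, a Lie algebra over `ℂ`. -/
abbrev CurrentAlgebra (τ : ℍ) : Type := EllipticRing τ ⊗[ℂ] Sl2

/-- The Lie algebra `𝔖_τ`, where `[E, F] = H ⊗ (4x³ - g₂(τ) x - g₃(τ))`. -/
abbrev SAlgebra (τ : ℍ) : Type :=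
  TwistedSl2 (4 * Polynomial.X ^ 3 - Polynomial.C (tauPeriods τ).g₂ * Polynomial.X -
    Polynomial.C (tauPeriods τ).g₃)

/-! ## Complex tori and their quotients -/

/-- The complex torus `ℂ / Λ`, where `Λ` is the lattice spanned by a pair of periods. -/
abbrev Torus (L : PeriodPair) : Type := ℂ ⧸ L.lattice

/-- The projection `ℂ → ℂ / Λ`. -/
def torusProj (L : PeriodPair) (z : ℂ) : Torus L := Submodule.Quotient.mk z

/-- Let `π : ℂ → X` and `π' : ℂ → Y` be holomorphic coverings of Riemann surfaces.
The map `f : X → Y` is holomorphic if near every point of `ℂ` it lifts to a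
holomorphic map between the covers. -/
def IsHolomorphicVia {X Y : Type*} (π : ℂ → X) (π' : ℂ → Y) (f : X → Y) : Prop :=
  ∀ z : ℂ, ∃ F : ℂ → ℂ, AnalyticAt ℂ F z ∧ ∀ᶠ w in 𝓝 z, π' (F w) = f (π w)

/-- Existence of a biholomorphism between two Riemann surfaces, each covered by `ℂ`. -/
def IsBiholomorphicVia {X Y : Type*} (π : ℂ → X) (π' : ℂ → Y) : Prop :=
  ∃ e : X ≃ Y, IsHolomorphicVia π π' e ∧ IsHolomorphicVia π' π e.symm

section Action

variable (L : PeriodPair) (Γ : Type*) [Group Γ] [MulAction Γ (Torus L)]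

/-- The punctured torus `𝕋 = T ∖ Γ·0`, with the action of `Γ`. -/
def puncturedTorus : SubMulAction Γ (Torus L) where
  carrier := (MulAction.orbit Γ (0 : Torus L))ᶜ
  smul_mem' γ p hp := fun h => hp (by
    obtain ⟨δ, hδ⟩ := MulAction.mem_orbit_iff.mp h
    exact MulAction.mem_orbit_iff.mpr ⟨γ⁻¹ * δ, by rw [mul_smul, hδ, inv_smul_smul]⟩)

/-- The canonical projection `𝕋 → 𝕋 / Γ`. -/
def puncturedProj (p : puncturedTorus L Γ) :
    MulAction.orbitRel.Quotient Γ (puncturedTorus L Γ) := Quotient.mk _ p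

/-- The branch points of `𝕋 → 𝕋 / Γ`: the images of the ramification points, that is, of
the points in no neighbourhood of which the projection is injective. -/
def branchPoints : Set (MulAction.orbitRel.Quotient Γ (puncturedTorus L Γ)) :=
  puncturedProj L Γ '' {p | ∀ U ∈ 𝓝 p, ¬ Set.InjOn (puncturedProj L Γ) U}

/-- The subgroup `t(Γ)` generated by the elements without fixed point in `T`. -/
def fixedPointFreeSubgroup : Subgroup Γ :=
  Subgroup.closure {γ : Γ | ∀ p : Torus L, γ • p ≠ p}

/-- The quotient surface `T / t(Γ)`. -/
abbrev TorusQuotient : Type :=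
  MulAction.orbitRel.Quotient (fixedPointFreeSubgroup L Γ) (Torus L)

/-- The projection `ℂ → T → T / t(Γ)`. -/
def torusQuotientProj (z : ℂ) : TorusQuotient L Γ := Quotient.mk _ (torusProj L z)

variable {L Γ}

open Classical in
/-- The pullback to `ℂ` of a function on `𝕋`, with value `0` over the punctures. -/
def pullback (f : puncturedTorus L Γ → ℂ) (z : ℂ) : ℂ :=
  if h : torusProj L z ∈ puncturedTorus L Γ then f ⟨torusProj L z, h⟩ else 0

/-- A function on `𝕋` is holomorphic on `𝕋` and meromorphic at the punctures. (The value
that `pullback` takes at a puncture is irrelevant to `MeromorphicAt`.) -/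
def IsRegularFn (f : puncturedTorus L Γ → ℂ) : Prop :=
  (∀ z : ℂ, torusProj L z ∈ puncturedTorus L Γ → AnalyticAt ℂ (pullback f) z) ∧
    ∀ z : ℂ, torusProj L z ∉ puncturedTorus L Γ → MeromorphicAt (pullback f) z

lemma pullback_add (f g : puncturedTorus L Γ → ℂ) :
    pullback (fun p => f p + g p) = pullback f + pullback g := by
  funext z; by_cases h : torusProj L z ∈ puncturedTorus L Γ <;> simp [pullback, h]

lemma pullback_mul (f g : puncturedTorus L Γ → ℂ) :
    pullback (fun p => f p * g p) = pullback f * pullback g := by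
  funext z; by_cases h : torusProj L z ∈ puncturedTorus L Γ <;> simp [pullback, h]

lemma pullback_const_mul (t : ℂ) (f : puncturedTorus L Γ → ℂ) :
    pullback (fun p => t * f p) = (fun _ => t) * pullback f := by
  funext z; by_cases h : torusProj L z ∈ puncturedTorus L Γ <;> simp [pullback, h]

lemma IsRegularFn.add {f g : puncturedTorus L Γ → ℂ} (hf : IsRegularFn f) (hg : IsRegularFn g) :
    IsRegularFn (fun p => f p + g p) := by
  unfold IsRegularFn
  rw [pullback_add]
  exact ⟨fun z h => (hf.1 z h).add (hg.1 z h), fun z h => (hf.2 z h).add (hg.2 z h)⟩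

lemma IsRegularFn.mul {f g : puncturedTorus L Γ → ℂ} (hf : IsRegularFn f) (hg : IsRegularFn g) :
    IsRegularFn (fun p => f p * g p) := by
  unfold IsRegularFn
  rw [pullback_mul]
  exact ⟨fun z h => (hf.1 z h).mul (hg.1 z h), fun z h => (hf.2 z h).mul (hg.2 z h)⟩

lemma IsRegularFn.const_mul (t : ℂ) {f : puncturedTorus L Γ → ℂ} (hf : IsRegularFn f) :
    IsRegularFn (fun p => t * f p) := by
  unfold IsRegularFn
  rw [pullback_const_mul]
  exact ⟨fun z h => analyticAt_const.mul (hf.1 z h),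
    fun z h => (MeromorphicAt.const t z).mul (hf.2 z h)⟩

lemma IsRegularFn.zero : IsRegularFn (fun _ : puncturedTorus L Γ => (0 : ℂ)) := by
  have h0 : pullback (fun _ : puncturedTorus L Γ => (0 : ℂ)) = fun _ => 0 := by
    funext z; simp [pullback]
  unfold IsRegularFn
  rw [h0]
  exact ⟨fun z _ => analyticAt_const, fun z _ => MeromorphicAt.const 0 z⟩

/-- The automorphic Lie algebra: the `Γ`-equivariant maps `𝕋 → 𝔰𝔩₂` that are holomorphic on
`𝕋` and meromorphic at the punctures, with the pointwise operations. -/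
def automorphicLieAlgebra (ρ : Γ →* (Sl2 ≃ₗ⁅ℂ⁆ Sl2)) :
    LieSubalgebra ℂ (puncturedTorus L Γ → Sl2) where
  carrier := {a | (∀ i j : Fin 2, IsRegularFn fun p => (a p).val i j) ∧
    ∀ (γ : Γ) (p : puncturedTorus L Γ), a (γ • p) = ρ γ (a p)}
  add_mem' {a b} ha hb := by
    refine ⟨fun i j => (ha.1 i j).add (hb.1 i j), fun γ p => ?_⟩
    simp only [Pi.add_apply, ha.2, hb.2, map_add]
  zero_mem' := ⟨fun _ _ => IsRegularFn.zero, fun γ _ => (map_zero (ρ γ)).symm⟩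
  smul_mem' t a ha := by
    refine ⟨fun i j => (ha.1 i j).const_mul t, fun γ p => ?_⟩
    simp only [Pi.smul_apply, ha.2, map_smul]
  lie_mem' {a b} ha hb := by
    refine ⟨fun i j => ?_, fun γ p => ?_⟩
    · have h : (fun p => (⁅a, b⁆ p).val i j) = fun p =>
          ((a p).val i 0 * (b p).val 0 j + (a p).val i 1 * (b p).val 1 j) +
          (-1) * ((b p).val i 0 * (a p).val 0 j + (b p).val i 1 * (a p).val 1 j) := by
        funext p
        change ((a p).val * (b p).val - (b p).val * (a p).val) i j = _
        simp only [Matrix.sub_apply, Matrix.mul_apply, Fin.sum_univ_two]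
        ring
      rw [h]
      exact (((ha.1 i 0).mul (hb.1 0 j)).add ((ha.1 i 1).mul (hb.1 1 j))).add
        ((((hb.1 i 0).mul (ha.1 0 j)).add ((hb.1 i 1).mul (ha.1 1 j))).const_mul (-1))
    · change ⁅a (γ • p), b (γ • p)⁆ = ρ γ ⁅a p, b p⁆
      rw [ha.2, hb.2, LieEquiv.map_lie]

end Action

end

open scoped Topology TensorProduct Polynomial UpperHalfPlane

noncomputable section

open Filter

/-! The action lifts to affine maps `z ↦ a γ * z + b γ` of the plane. The translation vectors
occurring in `Γ`, together with the periods of `T`, form a lattice `P`. Since `Γ` splits, `P` is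
also the preimage of the punctures `Γ · 0`. An affine map with `a γ ≠ 1` has a fixed point, so
`t(Γ)` is the group of translations and `T / t(Γ)` is `ℂ / P`. What remains is the finite cyclic
group `a(Γ)` of rotations of `P`. Its order is 1, 2, 3, 4 or 6, because `g₂` and `g₃` of `P` are not
both zero.

The decisive point is the existence of a moving frame (`AffineAction.exists_isMovingFrame`): regular
maps `e`, `f` to `𝔰𝔩₂`, equivariant up to the factors `a` and `a⁻¹`, that form an `𝔰𝔩₂`-triple with
their bracket at every point off `P`. The coefficients of an equivariant map in this frame are
functions of weights `a⁻¹`, `a` and `1`. They are invariant under translations, hence elliptic for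
`P`, and the representation `ρ` has disappeared.

By Liouville's theorem elliptic functions with poles on `P` are polynomials in `℘` and `℘'`, and the
weight selects the monomials (`exists_isOrbitCoordinate`). If `a` is trivial, all of `ℂ[℘, ℘']` is
allowed and the current algebra results. Otherwise the three coefficient modules are free of rank
one over some `ℂ[t]`, with generators `α`, `β`, `1` and `α β = q(t)`; the algebra is then `ℂ⟨E, F,
H⟩ ⊗ ℂ[t]` with `[E, F] = H ⊗ q`. For order 2, `t = ℘` and `q` is the Weierstrass cubic. For orders
3, 4 and 6, `q` is a quadratic with distinct roots, and Chebyshev polynomials identify the result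
with the Onsager algebra. The zeros of `q` are the values of `t` at the branch points
(`encard_branchPoints`), so these number 3 or 2.

The frame is built according to the translations. Without them `Γ` is cyclic and constant
eigenvectors suffice. If the translations fix a common semisimple vector, they act on the root
vectors through a nontrivial character; functions with a simple pole and these multipliers come from
the Weierstrass zeta function, and a combination with a double zero (`exists_double_zero`) yields
the frame. Otherwise the translations form a Klein four-group of half turns, and the frame is made
from the functions `√(℘ - eᵢ)`, whose axes are permuted cyclically if some nontrivial element fixes
the origin.

Finally, biholomorphisms of tori lift to affine maps, so the modular class of `τ` is the homothety
class of `P`. -/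

/-! ## Leading Laurent coefficients at the origin -/

/-- Near `0`, the function `f` is `c / z ^ m` up to terms of lower pole order (`c = 0` allowed). -/
def LaurentLead (f : ℂ → ℂ) (m : ℕ) (c : ℂ) : Prop :=
  ∃ g : ℂ → ℂ, AnalyticAt ℂ g 0 ∧ g 0 = c ∧ ∀ᶠ z in 𝓝[≠] (0 : ℂ), f z * z ^ m = g z

namespace LaurentLead

variable {f g : ℂ → ℂ} {m n : ℕ} {c d : ℂ}

lemma congr (hf : LaurentLead f m c) (h : ∀ᶠ z in 𝓝[≠] (0 : ℂ), f z = g z) :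
    LaurentLead g m c := by
  obtain ⟨u, hu, h0, he⟩ := hf
  exact ⟨u, hu, h0, by filter_upwards [he, h] with z h1 h2; rw [← h2, h1]⟩

lemma add (hf : LaurentLead f m c) (hg : LaurentLead g m d) :
    LaurentLead (fun z => f z + g z) m (c + d) := by
  obtain ⟨u, hu, h0, he⟩ := hf
  obtain ⟨v, hv, h0', he'⟩ := hg
  exact ⟨fun z => u z + v z, hu.add hv, by simp [h0, h0'], by
    filter_upwards [he, he'] with z h1 h2; rw [add_mul, h1, h2]⟩

lemma mul (hf : LaurentLead f m c) (hg : LaurentLead g n d) :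
    LaurentLead (fun z => f z * g z) (m + n) (c * d) := by
  obtain ⟨u, hu, h0, he⟩ := hf
  obtain ⟨v, hv, h0', he'⟩ := hg
  exact ⟨fun z => u z * v z, hu.mul hv, by simp [h0, h0'], by
    filter_upwards [he, he'] with z h1 h2; rw [← h1, ← h2]; ring⟩

lemma const (c : ℂ) : LaurentLead (fun _ => c) 0 c :=
  ⟨fun _ => c, analyticAt_const, rfl, by simp⟩

lemma of_analyticAt (hf : AnalyticAt ℂ f 0) : LaurentLead f 0 (f 0) :=
  ⟨f, hf, rfl, by simp⟩

lemma const_mul (a : ℂ) (hf : LaurentLead f m c) : LaurentLead (fun z => a * f z) m (a * c) := by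
  simpa using (LaurentLead.const a).mul hf

lemma pow (hf : LaurentLead f m c) (n : ℕ) : LaurentLead (fun z => f z ^ n) (m * n) (c ^ n) := by
  induction n with
  | zero => simpa using LaurentLead.const 1
  | succ n ih => simpa [pow_succ, mul_add] using ih.mul hf

/-- The exponent only bounds the pole order, so it may be raised at the price of a zero coefficient.
Functions of different pole orders can thus be added. -/
lemma succ (hf : LaurentLead f m c) : LaurentLead f (m + 1) 0 := by
  obtain ⟨u, hu, h0, he⟩ := hf
  exact ⟨fun z => u z * z, hu.mul analyticAt_id, by simp, by
    filter_upwards [he] with z h1; rw [← h1]; ring⟩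

lemma raise (hf : LaurentLead f m c) (k : ℕ) : LaurentLead f (m + k + 1) 0 := by
  induction k with
  | zero => exact hf.succ
  | succ k ih => exact ih.succ

lemma neg_arg (hf : LaurentLead f m c) : LaurentLead (fun z => f (-z)) m ((-1) ^ m * c) := by
  obtain ⟨u, hu, h0, he⟩ := hf
  have ht : Tendsto (fun z : ℂ => -z) (𝓝[≠] 0) (𝓝[≠] 0) := by
    refine tendsto_nhdsWithin_iff.mpr ⟨?_, ?_⟩
    · exact (continuous_neg.tendsto' (0 : ℂ) 0 neg_zero).mono_left nhdsWithin_le_nhds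
    · filter_upwards [self_mem_nhdsWithin] with z hz
      simpa using hz
  refine ⟨fun z => (-1) ^ m * u (-z), ?_, by simp [h0], ?_⟩
  · refine analyticAt_const.mul (AnalyticAt.fun_comp ?_ analyticAt_id.neg)
    simpa using hu
  · filter_upwards [ht.eventually he] with z h1
    rw [← h1, neg_pow z m, mul_left_comm, ← mul_assoc ((-1 : ℂ) ^ m), ← mul_pow]
    simp

lemma unique (hf : LaurentLead f m c) (hg : LaurentLead f m d) : c = d := by
  obtain ⟨u, hu, h0, he⟩ := hf
  obtain ⟨v, hv, h0', he'⟩ := hg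
  have h : u =ᶠ[𝓝[≠] 0] v := by filter_upwards [he, he'] with z h1 h2; rw [← h1, h2]
  have h1 := hu.continuousAt.tendsto.mono_left (nhdsWithin_le_nhds (s := {0}ᶜ))
  have h2 := hv.continuousAt.tendsto.mono_left (nhdsWithin_le_nhds (s := {0}ᶜ))
  rw [← h0, ← h0']
  exact tendsto_nhds_unique (h1.congr' h) h2

/-- The numerator vanishes at the origin, and `dslope` is its analytic quotient by `z`. All descents
on the pole order go through this step. -/
lemma lower (hf : LaurentLead f (m + 1) 0) : ∃ c, LaurentLead f m c := by
  obtain ⟨u, hu, h0, he⟩ := hf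
  obtain ⟨p, hp⟩ := hu
  have hd : AnalyticAt ℂ (dslope u 0) 0 := ⟨_, hp.has_fpower_series_dslope_fslope⟩
  refine ⟨dslope u 0 0, dslope u 0, hd, rfl, ?_⟩
  filter_upwards [he, self_mem_nhdsWithin] with z h1 hz
  have hz : z ≠ 0 := hz
  rw [dslope_of_ne _ hz, slope_def_field, h0, ← h1]
  field_simp
  ring

/-- An even function has even pole order. -/
lemma lower_of_even (hf : LaurentLead f m c) (hm : Odd m)
    (he : ∀ᶠ z in 𝓝[≠] (0 : ℂ), f (-z) = f z) : c = 0 := by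
  have h := (hf.neg_arg.congr he).unique hf
  rw [hm.neg_one_pow] at h
  linear_combination (-1 / 2 : ℂ) * h

lemma deriv (hf : LaurentLead f m c) : LaurentLead (deriv f) (m + 1) (-m * c) := by
  obtain ⟨u, hu, h0, he⟩ := hf
  have he2 : ∀ᶠ z in 𝓝[≠] (0 : ℂ), f z = u z / z ^ m := by
    filter_upwards [he, self_mem_nhdsWithin] with z h1 hz
    have hz : z ≠ 0 := hz
    rw [← h1]; field_simp
  refine ⟨fun z => _root_.deriv u z * z - m * u z, ?_, by simp [h0], ?_⟩
  · exact (hu.deriv.mul analyticAt_id).sub (analyticAt_const.mul hu)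
  -- The identity on a punctured neighbourhood holds near each point of it, which differentiation at
  -- `z` requires.
  · have h3 : ∀ᶠ z in 𝓝[≠] (0 : ℂ), ∀ᶠ w in 𝓝 z, f w = u w / w ^ m := by
      rw [eventually_nhdsWithin_iff] at he2 ⊢
      filter_upwards [he2.eventually_nhds] with z hz hz0
      filter_upwards [hz, isOpen_ne.mem_nhds hz0] with w h1 h2
      exact h1 h2
    have h4 : ∀ᶠ z in 𝓝[≠] (0 : ℂ), AnalyticAt ℂ u z :=
      hu.eventually_analyticAt.filter_mono nhdsWithin_le_nhds
    filter_upwards [h3, h4, self_mem_nhdsWithin] with z h5 h6 hz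
    have hz : z ≠ 0 := hz
    have h7 : HasDerivAt (fun w => u w / w ^ m)
        ((_root_.deriv u z * z ^ m - u z * (m * z ^ (m - 1))) / (z ^ m) ^ 2) z :=
      h6.differentiableAt.hasDerivAt.div (hasDerivAt_pow m z) (pow_ne_zero _ hz)
    rw [EventuallyEq.deriv_eq h5, h7.deriv]
    rcases m with _ | m
    · simp
    · rw [Nat.add_sub_cancel]
      field_simp
      ring

lemma exists_of_meromorphicAt (hf : MeromorphicAt f 0) : ∃ m c, LaurentLead f m c := by
  obtain ⟨n, hn⟩ := hf
  refine ⟨n, _, _, hn, rfl, ?_⟩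
  filter_upwards with z
  simp [mul_comm]

lemma meromorphicAt (hf : LaurentLead f m c) : MeromorphicAt f 0 := by
  obtain ⟨u, hu, h0, he⟩ := hf
  refine (hu.meromorphicAt.div ((MeromorphicAt.id 0).pow m)).congr ?_
  filter_upwards [he, self_mem_nhdsWithin] with z h1 hz
  have hz : z ≠ 0 := hz
  simp only [Pi.div_apply, Pi.pow_apply, id]
  rw [← h1]; field_simp

/-- A pole of `f` is a zero of its reciprocal. Exponent and coefficient `0` are the form in which
Liouville's theorem concludes that a globally regular reciprocal is identically zero. -/
lemma inv (hf : LaurentLead f m c) (hc : c ≠ 0) (hm : m ≠ 0) :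
    LaurentLead (fun z => (f z)⁻¹) 0 0 := by
  obtain ⟨u, hu, h0, he⟩ := hf
  refine ⟨fun z => z ^ m / u z, (analyticAt_id.pow m).div hu (by rwa [h0]), by simp [hm], ?_⟩
  filter_upwards [he, self_mem_nhdsWithin] with z h1 hz
  have hz : z ≠ 0 := hz
  rw [← h1]
  by_cases hfz : f z = 0
  · simp [hfz]
  · field_simp

end LaurentLead

/-! ## Functions with multipliers along a lattice -/

namespace PeriodPair

variable (P : PeriodPair)

lemma add_notMem {z p : ℂ} (hz : z ∉ P.lattice) (hp : p ∈ P.lattice) : z + p ∉ P.lattice :=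
  fun h => hz (by simpa using P.lattice.sub_mem h hp)

lemma neg_notMem {z : ℂ} (hz : z ∉ P.lattice) : -z ∉ P.lattice :=
  fun h => hz (by simpa using P.lattice.neg_mem h)

lemma eventually_notMem (z : ℂ) : ∀ᶠ w in 𝓝[≠] z, w ∉ P.lattice := by
  filter_upwards [self_mem_nhdsWithin,
    mem_nhdsWithin_of_mem_nhds (P.compl_lattice_sdiff_singleton_mem_nhds z)] with w h1 h2
  intro h
  exact h2 ⟨h, h1⟩

lemma countable_lattice : (P.lattice : Set ℂ).Countable :=
  have : Countable P.lattice := P.latticeEquivProd.injective.countable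
  Set.to_countable _

lemma isPreconnected_compl_lattice : IsPreconnected (P.lattice : Set ℂ)ᶜ :=
  (P.countable_lattice.isConnected_compl_of_one_lt_rank (by simp)).isPreconnected

lemma dense_compl_lattice : Dense (P.lattice : Set ℂ)ᶜ :=
  P.countable_lattice.dense_compl ℝ

lemma exists_notMem : ∃ z, z ∉ P.lattice := ⟨_, P.ω₁_div_two_notMem_lattice⟩

/-- `f` is analytic off the lattice, meromorphic at the origin, and is multiplied by `χ p` under
translation by a lattice point `p`. -/
structure IsSemiElliptic (χ : ℂ → ℂ) (f : ℂ → ℂ) : Prop where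
  analyticAt : ∀ z ∉ P.lattice, AnalyticAt ℂ f z
  meromorphicAt_zero : MeromorphicAt f 0
  map_add : ∀ p ∈ P.lattice, ∀ z ∉ P.lattice, f (z + p) = χ p * f z

/-- Periodic functions, analytic off the lattice and meromorphic on it. -/
abbrev IsElliptic (f : ℂ → ℂ) : Prop := P.IsSemiElliptic (fun _ => 1) f

variable {P} {χ χ' : ℂ → ℂ} {f g : ℂ → ℂ}

namespace IsSemiElliptic

lemma add (hf : P.IsSemiElliptic χ f) (hg : P.IsSemiElliptic χ g) :
    P.IsSemiElliptic χ (fun z => f z + g z) where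
  analyticAt z hz := (hf.analyticAt z hz).add (hg.analyticAt z hz)
  meromorphicAt_zero := hf.meromorphicAt_zero.add hg.meromorphicAt_zero
  map_add p hp z hz := by rw [hf.map_add p hp z hz, hg.map_add p hp z hz]; ring

lemma mul (hf : P.IsSemiElliptic χ f) (hg : P.IsSemiElliptic χ' g) :
    P.IsSemiElliptic (fun p => χ p * χ' p) (fun z => f z * g z) where
  analyticAt z hz := (hf.analyticAt z hz).mul (hg.analyticAt z hz)
  meromorphicAt_zero := hf.meromorphicAt_zero.mul hg.meromorphicAt_zero
  map_add p hp z hz := by rw [hf.map_add p hp z hz, hg.map_add p hp z hz]; ring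

lemma congr_char (hf : P.IsSemiElliptic χ f) (h : ∀ p ∈ P.lattice, χ p = χ' p) :
    P.IsSemiElliptic χ' f where
  analyticAt := hf.analyticAt
  meromorphicAt_zero := hf.meromorphicAt_zero
  map_add p hp z hz := by rw [hf.map_add p hp z hz, h p hp]

lemma const_mul (a : ℂ) (hf : P.IsSemiElliptic χ f) :
    P.IsSemiElliptic χ (fun z => a * f z) where
  analyticAt z hz := analyticAt_const.mul (hf.analyticAt z hz)
  meromorphicAt_zero := (MeromorphicAt.const a 0).mul hf.meromorphicAt_zero
  map_add p hp z hz := by rw [hf.map_add p hp z hz]; ring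

lemma const (a : ℂ) : P.IsElliptic (fun _ => a) where
  analyticAt _ _ := analyticAt_const
  meromorphicAt_zero := MeromorphicAt.const a 0
  map_add p hp z hz := by simp

lemma neg_arg (hf : P.IsSemiElliptic χ f) :
    P.IsSemiElliptic (fun p => χ (-p)) (fun z => f (-z)) where
  analyticAt z hz := (hf.analyticAt _ (P.neg_notMem hz)).fun_comp analyticAt_id.neg
  meromorphicAt_zero := by
    obtain ⟨m, c, h⟩ := LaurentLead.exists_of_meromorphicAt hf.meromorphicAt_zero
    exact h.neg_arg.meromorphicAt
  map_add p hp z hz := by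
    rw [neg_add, hf.map_add _ (P.lattice.neg_mem hp) _ (P.neg_notMem hz)]

lemma derivative (hf : P.IsSemiElliptic χ f) : P.IsSemiElliptic χ (deriv f) where
  analyticAt z hz := (hf.analyticAt z hz).deriv
  meromorphicAt_zero := hf.meromorphicAt_zero.deriv
  map_add p hp z hz := by
    have h1 : ∀ᶠ w in 𝓝 z, f (w + p) = χ p * f w := by
      filter_upwards [P.isClosed_lattice.isOpen_compl.mem_nhds hz] with w hw
      exact hf.map_add p hp w hw
    have h2 := EventuallyEq.deriv_eq h1
    rw [deriv_comp_add_const] at h2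
    rw [h2, deriv_const_mul _ (hf.analyticAt z hz).differentiableAt]

lemma neg (hf : P.IsSemiElliptic χ f) : P.IsSemiElliptic χ (fun z => -f z) := by
  simpa using hf.const_mul (-1)

lemma sub (hf : P.IsSemiElliptic χ f) (hg : P.IsSemiElliptic χ g) :
    P.IsSemiElliptic χ (fun z => f z - g z) := by
  simpa [sub_eq_add_neg] using hf.add hg.neg

lemma mul_elliptic (hf : P.IsSemiElliptic χ f) (hg : P.IsElliptic g) :
    P.IsSemiElliptic χ (fun z => f z * g z) :=
  (hf.mul hg).congr_char (by simp)

lemma meromorphicAt (hf : P.IsSemiElliptic χ f) (z : ℂ) : MeromorphicAt f z := by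
  by_cases hz : z ∈ P.lattice
  · have h1 : MeromorphicAt (fun w => χ z * f (w - z)) z := by
      have h0 : MeromorphicAt f (z - z) := by simpa using hf.meromorphicAt_zero
      exact (MeromorphicAt.const _ _).mul (h0.comp_analyticAt (f := f) (g := fun w => w - z)
        (analyticAt_id.sub analyticAt_const))
    refine h1.congr ?_
    filter_upwards [P.eventually_notMem z] with w hw
    have hw' : w - z ∉ P.lattice := by
      rw [sub_eq_add_neg]; exact P.add_notMem hw (P.lattice.neg_mem hz)
    rw [← hf.map_add z hz _ hw', sub_add_cancel]
  · exact (hf.analyticAt z hz).meromorphicAt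

/-- Liouville's theorem: without a pole at the origin and with unimodular multipliers, the function
is constant. -/
theorem eq_of_laurentLead_zero (hf : P.IsSemiElliptic χ f) (hχ : ∀ p ∈ P.lattice, ‖χ p‖ = 1)
    {c : ℂ} (h0 : LaurentLead f 0 c) : ∀ z ∉ P.lattice, f z = c := by
  classical
  obtain ⟨u, hu, hu0, he⟩ := h0
  simp only [pow_zero, mul_one] at he
  -- Near a lattice point `z` the extension is `w ↦ χ z * u (w - z)`, which explains the value `χ z
  -- * c` there.
  let F : ℂ → ℂ := fun z => if z ∈ P.lattice then χ z * c else f z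
  have hF : Differentiable ℂ F := by
    intro z
    by_cases hz : z ∈ P.lattice
    · have h1 : AnalyticAt ℂ (fun w => χ z * u (w - z)) z := by
        refine analyticAt_const.mul (AnalyticAt.fun_comp (by simpa using hu)
          (analyticAt_id.sub analyticAt_const))
      refine (h1.congr ?_).differentiableAt
      have h2 : Tendsto (fun w => w - z) (𝓝 z) (𝓝 0) := by
        exact (continuous_sub_right z).tendsto' z 0 (sub_self z)
      have h3 := h2.eventually (eventually_nhdsWithin_iff.mp he)
      filter_upwards [h3, P.compl_lattice_sdiff_singleton_mem_nhds z] with w h4 h5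
      by_cases hwz : w = z
      · subst hwz
        simp [F, hz, hu0]
      · have hw : w ∉ P.lattice := fun h => h5 ⟨h, hwz⟩
        have hw' : w - z ∉ P.lattice := by
          rw [sub_eq_add_neg]; exact P.add_notMem hw (P.lattice.neg_mem hz)
        simp only [F, hw, if_false]
        rw [← h4 (sub_ne_zero.mpr hwz), ← hf.map_add z hz _ hw', sub_add_cancel]
    · refine ((hf.analyticAt z hz).congr ?_).differentiableAt
      filter_upwards [P.isClosed_lattice.isOpen_compl.mem_nhds hz] with w hw
      exact (if_neg hw).symm
  -- Only the absolute value is periodic, but this is enough for boundedness.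
  have hper : ∀ z, ∀ p ∈ P.lattice, ‖F (z + p)‖ = ‖F z‖ := by
    intro z p hp
    have hc1 : Continuous fun z => ‖F (z + p)‖ :=
      (hF.continuous.comp (continuous_id.add continuous_const)).norm
    refine congrFun (hc1.ext_on P.dense_compl_lattice hF.continuous.norm ?_) z
    intro w hw
    have hw : w ∉ P.lattice := hw
    simp only [F, P.add_notMem hw hp, hw, if_false]
    rw [hf.map_add p hp w hw, norm_mul, hχ p hp, one_mul]
  have hcpt : IsCompact (Set.range fun z => ‖F z‖) :=
    IsZLattice.isCompact_range_of_periodic P.lattice _ hF.continuous.norm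
      fun z w hw => hper z w hw
  have hb : Bornology.IsBounded (Set.range F) := by
    obtain ⟨C, hC⟩ := hcpt.isBounded.exists_norm_le
    rw [isBounded_iff_forall_norm_le]
    refine ⟨C, ?_⟩
    rintro _ ⟨z, rfl⟩
    simpa using hC _ ⟨z, rfl⟩
  intro z hz
  have h1 : ∀ᶠ w in 𝓝[≠] (0 : ℂ), u w = f z := by
    filter_upwards [he, P.eventually_notMem 0] with w h2 hw
    have h3 := hF.apply_eq_apply_of_bounded hb w z
    simp only [F, hw, hz, if_false] at h3
    rw [← h2, h3]
  have h2 := hu.continuousAt.tendsto.mono_left (nhdsWithin_le_nhds (s := {0}ᶜ))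
  have h3 : Tendsto u (𝓝[≠] 0) (𝓝 (f z)) := tendsto_const_nhds.congr' (by
    filter_upwards [h1] with w hw; exact hw.symm)
  rw [← hu0]
  exact tendsto_nhds_unique h3 h2

end IsSemiElliptic

/-! ## The Weierstrass functions -/

variable (P)

lemma isElliptic_weierstrassP : P.IsElliptic P.weierstrassP where
  analyticAt z hz := P.analyticOnNhd_weierstrassP z hz
  meromorphicAt_zero := P.meromorphic_weierstrassP 0
  map_add p hp z _ := by simpa using P.weierstrassP_add_coe z ⟨p, hp⟩

lemma isElliptic_derivWeierstrassP : P.IsElliptic P.derivWeierstrassP where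
  analyticAt z hz := P.analyticOnNhd_derivWeierstrassP z hz
  meromorphicAt_zero := P.meromorphic_derivWeierstrassP 0
  map_add p hp z _ := by simpa using P.derivWeierstrassP_add_coe z ⟨p, hp⟩

lemma weierstrassP_lead : LaurentLead P.weierstrassP 2 1 := by
  refine ⟨fun z => z ^ 2 * P.weierstrassPExcept 0 z + 1, ?_, by simp, ?_⟩
  · have : AnalyticAt ℂ (P.weierstrassPExcept 0) 0 := P.analyticAt_weierstrassPExcept 0
    fun_prop
  · filter_upwards [self_mem_nhdsWithin] with z hz
    have hz : z ≠ 0 := hz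
    have := P.ite_eq_one_sub_sq_mul_weierstrassP 0 P.lattice.zero_mem z
    simp [hz] at this
    rw [mul_comm, this]

lemma derivWeierstrassP_lead : LaurentLead P.derivWeierstrassP 3 (-2) := by
  have := P.weierstrassP_lead.deriv
  simpa using this

lemma hasDerivAt_weierstrassP {z : ℂ} (hz : z ∉ P.lattice) :
    HasDerivAt P.weierstrassP (P.derivWeierstrassP z) z := by
  have := (P.analyticOnNhd_weierstrassP z hz).differentiableAt.hasDerivAt
  rwa [P.deriv_weierstrassP] at this

/-- Every complex number is a value of the `℘`-function. -/
theorem weierstrassP_surjective (c : ℂ) : ∃ z ∉ P.lattice, P.weierstrassP z = c := by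
  by_contra! h
  have hw : P.IsElliptic (fun z => P.weierstrassP z - c) :=
    P.isElliptic_weierstrassP.sub (.const c)
  have hl : LaurentLead (fun z => P.weierstrassP z - c) 2 1 := by
    have := P.weierstrassP_lead.add ((LaurentLead.const (-c)).raise 1)
    simpa [sub_eq_add_neg] using this
  -- If the value `c` is omitted, `1 / (℘ - c)` is elliptic without poles and vanishes at the
  -- origin, so it is identically zero.
  have hi : P.IsElliptic (fun z => (P.weierstrassP z - c)⁻¹) :=
    { analyticAt := fun z hz => (hw.analyticAt z hz).inv (sub_ne_zero.mpr (h z hz))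
      meromorphicAt_zero := hw.meromorphicAt_zero.inv
      map_add := fun p hp z hz => by rw [hw.map_add p hp z hz]; simp }
  obtain ⟨z, hz⟩ := P.exists_notMem
  have := hi.eq_of_laurentLead_zero (by simp) (hl.inv one_ne_zero two_ne_zero) z hz
  exact sub_ne_zero.mpr (h z hz) (inv_eq_zero.mp this)

/-- The derivative of `℘'` is `6 ℘ ^ 2 - g₂ / 2` off the lattice. -/
lemma deriv_derivWeierstrassP {z : ℂ} (hz : z ∉ P.lattice) :
    deriv P.derivWeierstrassP z = 6 * P.weierstrassP z ^ 2 - P.g₂ / 2 := by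
  have hU : IsOpen (P.lattice : Set ℂ)ᶜ := P.isClosed_lattice.isOpen_compl
  -- Differentiating the Weierstrass equation gives the formula multiplied by `℘'`. This factor is
  -- cancelled by analyticity on the connected complement of the lattice, since `℘'` has a pole and
  -- is not identically zero.
  have key : ∀ w ∉ P.lattice, P.derivWeierstrassP w * (deriv P.derivWeierstrassP w -
      (6 * P.weierstrassP w ^ 2 - P.g₂ / 2)) = 0 := by
    intro w hw
    have h1 : (fun v => P.derivWeierstrassP v ^ 2) =ᶠ[𝓝 w]
        fun v => 4 * P.weierstrassP v ^ 3 - P.g₂ * P.weierstrassP v - P.g₃ := by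
      filter_upwards [hU.mem_nhds hw] with v hv
      exact P.derivWeierstrassP_sq v hv
    have h2 := (P.analyticOnNhd_derivWeierstrassP w hw).differentiableAt.hasDerivAt
    have h3 := P.hasDerivAt_weierstrassP hw
    have h4 := (h2.pow 2).congr_of_eventuallyEq h1.symm
    have h5 := (((h3.pow 3).const_mul 4).sub (h3.const_mul P.g₂)).sub_const P.g₃
    have h6 := h4.unique h5
    simp at h6
    linear_combination (1 / 2 : ℂ) * h6
  have hA : AnalyticOnNhd ℂ P.derivWeierstrassP (P.lattice : Set ℂ)ᶜ :=
    P.analyticOnNhd_derivWeierstrassP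
  have hB : AnalyticOnNhd ℂ (fun w => deriv P.derivWeierstrassP w -
      (6 * P.weierstrassP w ^ 2 - P.g₂ / 2)) (P.lattice : Set ℂ)ᶜ := fun w hw =>
    ((hA w hw).deriv).sub ((analyticAt_const.mul
      ((P.analyticOnNhd_weierstrassP w hw).pow 2)).sub analyticAt_const)
  rcases hA.eq_zero_or_eq_zero_of_mul_eq_zero hB (fun w hw => key w hw)
    P.isPreconnected_compl_lattice with h | h
  · exfalso
    have h1 : LaurentLead P.derivWeierstrassP 3 0 := by
      refine ((LaurentLead.const 0).raise 2).congr ?_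
      filter_upwards [P.eventually_notMem 0] with w hw
      exact (h w hw).symm
    simpa using P.derivWeierstrassP_lead.unique h1
  · exact sub_eq_zero.mp (h z hz)

end PeriodPair

/-! ### The fibres of `℘` and of `(℘, ℘')`; elliptic functions as polynomials -/

namespace PeriodPair

variable (P : PeriodPair)

/-- A point off the lattice is determined modulo the lattice by `℘` and `℘'`. -/
theorem sub_mem_of_weierstrassP_eq {a b : ℂ} (ha : a ∉ P.lattice) (hb : b ∉ P.lattice)
    (h : P.weierstrassP a = P.weierstrassP b)
    (h' : P.derivWeierstrassP a = P.derivWeierstrassP b) : b - a ∈ P.lattice := by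
  set δ := b - a with hδ
  by_contra hδn
  let U : Set ℂ := (P.lattice : Set ℂ)ᶜ ∩ (fun w => w + δ) ⁻¹' (P.lattice : Set ℂ)ᶜ
  have hUo : IsOpen U := P.isClosed_lattice.isOpen_compl.inter
    (P.isClosed_lattice.isOpen_compl.preimage (continuous_add_const δ))
  have hUc : IsPreconnected U := by
    have : U = ((P.lattice : Set ℂ) ∪ (fun w => w + δ) ⁻¹' (P.lattice : Set ℂ))ᶜ := by
      rw [Set.compl_union]; rfl
    rw [this]
    exact ((P.countable_lattice.union (P.countable_lattice.preimage
      (add_left_injective δ))).isConnected_compl_of_one_lt_rank (by simp)).isPreconnected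
  have haU : a ∈ U := ⟨ha, by simpa [hδ] using hb⟩
  -- Uniqueness for a linear differential equation: `D'' = 6 (℘ w + ℘ (w + δ)) D`, and `D` and `D'`
  -- vanish at `a`.
  let D : ℂ → ℂ := fun w => P.weierstrassP w - P.weierstrassP (w + δ)
  have hsh : ∀ w, AnalyticAt ℂ (fun w : ℂ => w + δ) w := fun w => analyticAt_id.add analyticAt_const
  have hD : AnalyticOnNhd ℂ D U := fun w hw => (P.analyticOnNhd_weierstrassP w hw.1).sub
    (AnalyticAt.fun_comp (P.analyticOnNhd_weierstrassP _ hw.2) (hsh w))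
  have hd1 : ∀ w ∈ U, deriv D w = P.derivWeierstrassP w - P.derivWeierstrassP (w + δ) := by
    intro w hw
    exact ((P.hasDerivAt_weierstrassP hw.1).sub
      ((P.hasDerivAt_weierstrassP hw.2).comp_add_const w δ)).deriv
  have hd2 : ∀ w ∈ U, deriv (deriv D) w =
      6 * (P.weierstrassP w + P.weierstrassP (w + δ)) * D w := by
    intro w hw
    have h1 : deriv D =ᶠ[𝓝 w] fun w => P.derivWeierstrassP w - P.derivWeierstrassP (w + δ) := by
      filter_upwards [hUo.mem_nhds hw] with v hv using hd1 v hv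
    have h2 := (P.analyticOnNhd_derivWeierstrassP w hw.1).differentiableAt.hasDerivAt
    have h3 := (P.analyticOnNhd_derivWeierstrassP _ hw.2).differentiableAt.hasDerivAt
    rw [h1.deriv_eq]
    refine (h2.sub (h3.comp_add_const w δ)).deriv.trans ?_
    rw [P.deriv_derivWeierstrassP hw.1, P.deriv_derivWeierstrassP hw.2]
    simp only [D]; ring
  have hDa : D a = 0 := by simp [D, hδ, h]
  have hDa' : deriv D a = 0 := by rw [hd1 a haU]; simp [hδ, h']
  have ho1 := (hD a haU).analyticOrderAt_deriv_add_one
  have ho2 := (hD a haU).deriv.analyticOrderAt_deriv_add_one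
  simp only [hDa, hDa', sub_zero] at ho1 ho2
  have hS : AnalyticAt ℂ (fun w => 6 * (P.weierstrassP w + P.weierstrassP (w + δ))) a :=
    analyticAt_const.mul ((P.analyticOnNhd_weierstrassP a haU.1).add
      (AnalyticAt.fun_comp (P.analyticOnNhd_weierstrassP _ haU.2) (hsh a)))
  have ho3 : analyticOrderAt (deriv (deriv D)) a =
      analyticOrderAt (fun w => 6 * (P.weierstrassP w + P.weierstrassP (w + δ))) a +
        analyticOrderAt D a := by
    rw [← analyticOrderAt_mul hS (hD a haU)]
    refine analyticOrderAt_congr ?_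
    filter_upwards [hUo.mem_nhds haU] with v hv using hd2 v hv
  -- Two derivatives lower a finite vanishing order by two, whereas by the equation the order of
  -- `D''` is at least that of `D`.
  have htop : analyticOrderAt D a = ⊤ := by
    by_contra hne
    obtain ⟨n, hn⟩ := ENat.ne_top_iff_exists.mp hne
    have hn' : analyticOrderAt (fun w => 6 * (P.weierstrassP w + P.weierstrassP (w + δ))) a +
        n + 1 + 1 = n := by
      rw [hn, ← ho3, ho2, ho1]
    generalize analyticOrderAt (fun w => 6 * (P.weierstrassP w + P.weierstrassP (w + δ))) a = s
      at hn'
    cases s with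
    | top => simp at hn'
    | coe s =>
      have : s + n + 1 + 1 = n := by exact_mod_cast hn'
      omega
  have hz := hD.eqOn_zero_of_preconnected_of_eventuallyEq_zero hUc haU
    (analyticOrderAt_eq_top.mp htop)
  -- Now `℘` has period `δ`. As `δ` is off the lattice, `℘` is analytic there, so it would be
  -- regular at the origin.
  have hδU : ∀ᶠ w in 𝓝[≠] (0 : ℂ), w + δ ∉ P.lattice := by
    refine (((continuous_add_const δ).tendsto' (0 : ℂ) δ (zero_add δ)).eventually
      (P.isClosed_lattice.isOpen_compl.mem_nhds hδn)).filter_mono nhdsWithin_le_nhds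
  have h0 : LaurentLead P.weierstrassP 0 (P.weierstrassP (0 + δ)) := by
    refine (LaurentLead.of_analyticAt (f := fun w => P.weierstrassP (w + δ))
      (AnalyticAt.fun_comp (P.analyticOnNhd_weierstrassP _ (by simpa using hδn)) (hsh 0))).congr ?_
    filter_upwards [P.eventually_notMem 0, hδU] with w h1 h2
    have := hz (show w ∈ U from ⟨h1, h2⟩)
    exact (sub_eq_zero.mp this).symm
  exact one_ne_zero (P.weierstrassP_lead.unique (h0.raise 1))

/-- The Weierstrass equation determines `℘'` from `℘` up to sign, and `z ↦ -z` changes that sign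
while preserving `℘`. -/
theorem weierstrassP_eq_iff {a b : ℂ} (ha : a ∉ P.lattice) (hb : b ∉ P.lattice) :
    P.weierstrassP a = P.weierstrassP b ↔ b - a ∈ P.lattice ∨ b + a ∈ P.lattice := by
  constructor
  · intro h
    have h1 := P.derivWeierstrassP_sq a ha
    rw [h, ← P.derivWeierstrassP_sq b hb, sq_eq_sq_iff_eq_or_eq_neg] at h1
    rcases h1 with h1 | h1
    · exact .inl (P.sub_mem_of_weierstrassP_eq ha hb h h1)
    · refine .inr ?_
      have := P.sub_mem_of_weierstrassP_eq (P.neg_notMem ha) hb (by simpa using h) (by simp [h1])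
      simpa using this
  · rintro (h | h)
    · have := P.weierstrassP_add_coe a ⟨_, h⟩
      simpa using this.symm
    · have := P.weierstrassP_add_coe (-a) ⟨_, h⟩
      simpa using this.symm

/-- As `℘'` is odd, a zero of it makes `a` and `-a` indistinguishable for the pair `(℘, ℘')`. -/
theorem derivWeierstrassP_eq_zero_iff {a : ℂ} (ha : a ∉ P.lattice) :
    P.derivWeierstrassP a = 0 ↔ 2 * a ∈ P.lattice := by
  constructor
  · intro h
    have := P.sub_mem_of_weierstrassP_eq (P.neg_notMem ha) ha (by simp) (by simp [h])
    rwa [sub_neg_eq_add, ← two_mul] at this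
  · intro h
    have := P.derivWeierstrassP_add_coe (-a) ⟨_, h⟩
    rw [P.derivWeierstrassP_neg, show -a + 2 * a = a by ring] at this
    linear_combination (1 / 2 : ℂ) * this

lemma ω₁_div_two_sub_ω₂_div_two_notMem : P.ω₁ / 2 - P.ω₂ / 2 ∉ P.lattice := by
  have := P.mul_ω₁_add_mul_ω₂_mem_lattice (α := 1 / 2) (β := -1 / 2)
  intro h
  have h2 := (this.mp (by convert h using 1; push_cast; ring)).1
  norm_num at h2

lemma ω₁_add_ω₂_div_two_notMem : (P.ω₁ + P.ω₂) / 2 ∉ P.lattice := fun h =>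
  P.ω₁_div_two_sub_ω₂_div_two_notMem <| by
    have := P.lattice.sub_mem h P.ω₂_mem_lattice
    rwa [show (P.ω₁ + P.ω₂) / 2 - P.ω₂ = P.ω₁ / 2 - P.ω₂ / 2 by ring] at this

variable {P} {f : ℂ → ℂ}

/-- An odd elliptic function vanishes at the half periods. -/
lemma IsSemiElliptic.eq_zero_of_odd {χ : ℂ → ℂ} (hf : P.IsSemiElliptic χ f)
    (ho : ∀ z ∉ P.lattice, f (-z) = -f z) {p : ℂ} (hp : p ∈ P.lattice) (hχ : χ p = 1)
    (hp2 : p / 2 ∉ P.lattice) : f (p / 2) = 0 := by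
  have h1 := hf.map_add p hp (-(p / 2)) (P.neg_notMem hp2)
  rw [show -(p / 2) + p = p / 2 by ring, ho _ hp2, hχ] at h1
  linear_combination (1 / 2 : ℂ) * h1

/-- There is no elliptic function with a single simple pole. -/
theorem IsSemiElliptic.laurentLead_one_eq_zero (hf : P.IsElliptic f) {c : ℂ}
    (hl : LaurentLead f 1 c) : c = 0 := by
  by_contra hc
  -- The even part has no pole and is constant; subtracting it leaves an odd function `g` with the
  -- same pole. Then `g ^ 2 - c ^ 2 * ℘` is constant. Since `g` vanishes at all half periods, `℘`
  -- would take equal values at two inequivalent ones.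
  have hs : P.IsElliptic (fun z => f z + f (-z)) := hf.add hf.neg_arg
  have hsl : LaurentLead (fun z => f z + f (-z)) 1 0 := by
    simpa using hl.add hl.neg_arg
  obtain ⟨m, hm⟩ := hsl.lower
  have hsm := hs.eq_of_laurentLead_zero (by simp) hm
  set g : ℂ → ℂ := fun z => f z - m / 2 with hg
  have hge : P.IsElliptic g := hf.sub (.const _)
  have hgl : LaurentLead g 1 c := by
    have := hl.add ((LaurentLead.const (-(m / 2))).raise 0)
    simpa [hg, sub_eq_add_neg] using this
  have hgo : ∀ z ∉ P.lattice, g (-z) = -g z := by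
    intro z hz
    have := hsm z hz
    simp only [hg]; linear_combination this
  have hq : P.IsElliptic (fun z => g z ^ 2 + (-c ^ 2) * P.weierstrassP z) := by
    have := (hge.mul_elliptic hge).add (P.isElliptic_weierstrassP.const_mul (-c ^ 2))
    simpa [sq] using this
  have hql : LaurentLead (fun z => g z ^ 2 + (-c ^ 2) * P.weierstrassP z) 2 0 := by
    have := (hgl.pow 2).add (P.weierstrassP_lead.const_mul (-c ^ 2))
    simpa using this
  obtain ⟨d, hd⟩ := hql.lower
  have hd0 : d = 0 := hd.lower_of_even (by decide) (by
    filter_upwards [P.eventually_notMem 0] with z hz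
    rw [hgo z hz, P.weierstrassP_neg]; ring)
  subst hd0
  obtain ⟨d, hd⟩ := hd.lower
  have hqd := hq.eq_of_laurentLead_zero (by simp) hd
  have h1 := hqd _ P.ω₁_div_two_notMem_lattice
  have h2 := hqd _ P.ω₂_div_two_notMem_lattice
  rw [hge.eq_zero_of_odd hgo P.ω₁_mem_lattice rfl P.ω₁_div_two_notMem_lattice] at h1
  rw [hge.eq_zero_of_odd hgo P.ω₂_mem_lattice rfl P.ω₂_div_two_notMem_lattice] at h2
  have h3 : P.weierstrassP (P.ω₂ / 2) = P.weierstrassP (P.ω₁ / 2) := by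
    have : c ^ 2 * (P.weierstrassP (P.ω₂ / 2) - P.weierstrassP (P.ω₁ / 2)) = 0 := by
      linear_combination h1 - h2
    exact sub_eq_zero.mp ((mul_eq_zero.mp this).resolve_left (pow_ne_zero 2 hc))
  refine P.ω₁_div_two_sub_ω₂_div_two_notMem (P.sub_mem_of_weierstrassP_eq
    P.ω₂_div_two_notMem_lattice P.ω₁_div_two_notMem_lattice h3 ?_)
  rw [(P.derivWeierstrassP_eq_zero_iff P.ω₂_div_two_notMem_lattice).mpr
    (by simpa [mul_div_cancel₀] using P.ω₂_mem_lattice),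
    (P.derivWeierstrassP_eq_zero_iff P.ω₁_div_two_notMem_lattice).mpr
    (by simpa [mul_div_cancel₀] using P.ω₁_mem_lattice)]

/-- Elliptic functions with poles on the lattice are polynomials in `℘` and `℘'`. -/
theorem IsSemiElliptic.exists_polynomial (hf : P.IsElliptic f) : ∃ A B : ℂ[X], ∀ z ∉ P.lattice,
    f z = A.eval (P.weierstrassP z) + B.eval (P.weierstrassP z) * P.derivWeierstrassP z := by
  obtain ⟨m, c, hl⟩ := LaurentLead.exists_of_meromorphicAt hf.meromorphicAt_zero
  induction m using Nat.strong_induction_on generalizing f c with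
  | _ m ih =>
    match m, hl, ih with
    | 0, hl, _ =>
      exact ⟨Polynomial.C c, 0, fun z hz => by
        simpa using hf.eq_of_laurentLead_zero (by simp) hl z hz⟩
    | 1, hl, ih =>
      have hc := hf.laurentLead_one_eq_zero hl
      subst hc
      obtain ⟨d, hd⟩ := hl.lower
      exact ih 0 one_pos hf d hd
    | m + 2, hl, ih =>
      have hpow : ∀ i : ℕ, P.IsElliptic (fun z => P.weierstrassP z ^ i) := by
        intro i
        induction i with
        | zero => simpa using IsSemiElliptic.const (P := P) 1
        | succ i hi => simpa [pow_succ] using hi.mul_elliptic P.isElliptic_weierstrassP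
      -- The leading term is removed by `℘ ^ (i + 1)` for even pole order, and for odd pole order by
      -- `℘ ^ i * ℘'`, whose leading coefficient `-2` accounts for the factor `c / 2`.
      rcases Nat.even_or_odd' m with ⟨i, rfl | rfl⟩
      · have h1 := hl.add ((P.weierstrassP_lead.pow (i + 1)).const_mul (-c))
        have h2 : LaurentLead (fun z => f z + -c * P.weierstrassP z ^ (i + 1)) (2 * i + 2) 0 := by
          simpa [mul_add] using h1
        obtain ⟨d, hd⟩ := h2.lower
        obtain ⟨A, B, hAB⟩ := ih (2 * i + 1) (by omega)
          (hf.add ((hpow (i + 1)).const_mul (-c))) d hd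
        refine ⟨A + Polynomial.C c * Polynomial.X ^ (i + 1), B, fun z hz => ?_⟩
        have := hAB z hz
        simp
        linear_combination this
      · have h0 := ((P.weierstrassP_lead.pow i).mul P.derivWeierstrassP_lead).const_mul (c / 2)
        rw [show 2 * i + 3 = 2 * i + 1 + 2 by ring] at h0
        have h1 := hl.add h0
        have h2 : LaurentLead (fun z => f z + c / 2 * (P.weierstrassP z ^ i *
            P.derivWeierstrassP z)) (2 * i + 1 + 2) 0 := by
          convert h1 using 1
          simp
        obtain ⟨d, hd⟩ := h2.lower
        obtain ⟨A, B, hAB⟩ := ih (2 * i + 1 + 1) (by omega)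
          (hf.add (((hpow i).mul_elliptic P.isElliptic_derivWeierstrassP).const_mul (c / 2))) d hd
        refine ⟨A, B + Polynomial.C (-c / 2) * Polynomial.X ^ i, fun z hz => ?_⟩
        have := hAB z hz
        simp
        linear_combination this

/-- Polynomials in `℘` and `℘'` vanish only for trivial reasons. -/
theorem polynomial_eq_zero {A B : ℂ[X]} (h : ∀ z ∉ P.lattice,
    A.eval (P.weierstrassP z) + B.eval (P.weierstrassP z) * P.derivWeierstrassP z = 0) :
    A = 0 ∧ B = 0 := by
  have h2 : ∀ z ∉ P.lattice, A.eval (P.weierstrassP z) = 0 ∧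
      B.eval (P.weierstrassP z) * P.derivWeierstrassP z = 0 := by
    intro z hz
    have h1 := h z hz
    have h3 := h (-z) (P.neg_notMem hz)
    simp only [weierstrassP_neg, derivWeierstrassP_neg] at h3
    exact ⟨by linear_combination (h1 + h3) / 2, by linear_combination (h1 - h3) / 2⟩
  constructor
  · refine Polynomial.funext fun c => ?_
    obtain ⟨z, hz, rfl⟩ := P.weierstrassP_surjective c
    simpa using (h2 z hz).1
  -- Multiplying by `℘'` once more turns `B(℘) ℘' = 0` into a polynomial identity in `℘`, which
  -- takes every complex value.
  · have h4 : B * (4 * Polynomial.X ^ 3 - Polynomial.C P.g₂ * Polynomial.X -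
        Polynomial.C P.g₃) = 0 := by
      refine Polynomial.funext fun c => ?_
      obtain ⟨z, hz, rfl⟩ := P.weierstrassP_surjective c
      have := (h2 z hz).2
      simp only [Polynomial.eval_mul, Polynomial.eval_sub, Polynomial.eval_pow, Polynomial.eval_X,
        Polynomial.eval_C, Polynomial.eval_ofNat, Polynomial.eval_zero]
      rw [← P.derivWeierstrassP_sq z hz]
      linear_combination P.derivWeierstrassP z * this
    refine (mul_eq_zero.mp h4).resolve_right fun h5 => ?_
    have := congrArg (fun p : ℂ[X] => p.coeff 3) h5
    simp at this

end PeriodPair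

namespace PeriodPair

/-! ## Homothety of lattices -/

section Homothety

variable {P Q : PeriodPair} {c : ℂ}

/-- Multiplication by `c` as a bijection between homothetic lattices. -/
def homothety (hc : c ≠ 0) (h : ∀ z, c * z ∈ Q.lattice ↔ z ∈ P.lattice) :
    P.lattice ≃ Q.lattice where
  toFun l := ⟨c * l, (h l).mpr l.2⟩
  invFun l := ⟨c⁻¹ * l, (h _).mp (by rw [mul_inv_cancel_left₀ hc]; exact l.2)⟩
  left_inv l := Subtype.ext (inv_mul_cancel_left₀ hc _)
  right_inv l := Subtype.ext (mul_inv_cancel_left₀ hc _)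

lemma weierstrassP_homothety (hc : c ≠ 0) (h : ∀ z, c * z ∈ Q.lattice ↔ z ∈ P.lattice) (z : ℂ) :
    Q.weierstrassP (c * z) = P.weierstrassP z / c ^ 2 := by
  unfold weierstrassP
  rw [← (homothety hc h).tsum_eq, ← tsum_div_const]
  refine tsum_congr fun l => ?_
  simp only [homothety, Equiv.coe_fn_mk]
  rw [← mul_sub, mul_pow, mul_pow, sub_div, div_div, div_div, mul_comm (c ^ 2), mul_comm (c ^ 2)]

lemma derivWeierstrassP_homothety (hc : c ≠ 0) (h : ∀ z, c * z ∈ Q.lattice ↔ z ∈ P.lattice)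
    (z : ℂ) : Q.derivWeierstrassP (c * z) = P.derivWeierstrassP z / c ^ 3 := by
  unfold derivWeierstrassP
  rw [← (homothety hc h).tsum_eq, neg_div, ← tsum_div_const]
  congr 1
  refine tsum_congr fun l => ?_
  simp only [homothety, Equiv.coe_fn_mk]
  rw [← mul_sub, mul_pow, div_div, mul_comm (c ^ 3)]

lemma G_homothety (hc : c ≠ 0) (h : ∀ z, c * z ∈ Q.lattice ↔ z ∈ P.lattice) (n : ℕ) :
    Q.G n = P.G n / c ^ n := by
  unfold G
  rw [← (homothety hc h).tsum_eq, ← tsum_div_const]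
  refine tsum_congr fun l => ?_
  simp only [homothety, Equiv.coe_fn_mk]
  rw [mul_pow, mul_inv, div_eq_inv_mul]

lemma g₂_homothety (hc : c ≠ 0) (h : ∀ z, c * z ∈ Q.lattice ↔ z ∈ P.lattice) :
    Q.g₂ = P.g₂ / c ^ 4 := by
  unfold g₂; rw [G_homothety hc h, mul_div_assoc]

lemma g₃_homothety (hc : c ≠ 0) (h : ∀ z, c * z ∈ Q.lattice ↔ z ∈ P.lattice) :
    Q.g₃ = P.g₃ / c ^ 6 := by
  unfold g₃; rw [G_homothety hc h, mul_div_assoc]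

end Homothety

/-! ## The Weierstrass zeta function -/

variable (L : PeriodPair)

/-- The three terms combine to `s ^ 2 / (l ^ 2 * (s - l))`, which decays like `‖l‖ ^ (-3)` and is
summable over a lattice in the plane. -/
lemma weierstrassZeta_bound (r : ℝ) (hr : 0 < r) (s : ℂ) (hs : ‖s‖ < r) (l : ℂ)
    (h : 2 * r ≤ ‖l‖) : ‖1 / (s - l) + 1 / l + s / l ^ 2‖ ≤ 2 * r ^ 2 * ‖l‖ ^ (-3 : ℝ) := by
  have hl : 0 < ‖l‖ := by linarith
  have hl0 : l ≠ 0 := norm_pos_iff.mp hl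
  have hsl : s - l ≠ 0 := by
    intro h0
    rw [sub_eq_zero.mp h0] at hs
    linarith
  have h1 : ‖l‖ / 2 ≤ ‖s - l‖ := by
    rw [norm_sub_rev]
    exact .trans (by linarith) (norm_sub_norm_le l s)
  have h2 : 1 / (s - l) + 1 / l + s / l ^ 2 = s ^ 2 / (l ^ 2 * (s - l)) := by
    field_simp; ring
  rw [h2, norm_div, norm_mul, norm_pow, norm_pow]
  calc ‖s‖ ^ 2 / (‖l‖ ^ 2 * ‖s - l‖) ≤ r ^ 2 / (‖l‖ ^ 2 * (‖l‖ / 2)) := by gcongr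
    _ = 2 * r ^ 2 / ‖l‖ ^ 3 := by field_simp
    _ = _ := by norm_cast

/-- The Weierstrass zeta function without its pole at the origin. -/
def weierstrassZetaExcept (z : ℂ) : ℂ :=
  ∑' l : L.lattice, if (l : ℂ) = 0 then 0 else (1 / (z - l) + 1 / l + z / l ^ 2)

lemma hasSumLocallyUniformly_weierstrassZetaExcept :
    HasSumLocallyUniformly (fun (l : L.lattice) (z : ℂ) ↦
      if (l : ℂ) = 0 then 0 else (1 / (z - l) + 1 / l + z / l ^ 2)) L.weierstrassZetaExcept := by
  refine L.hasSumLocallyUniformly_aux (u := fun r l => 2 * r ^ 2 * ‖l‖ ^ (-3 : ℝ)) _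
    (fun _ _ ↦ (ZLattice.summable_norm_rpow _ _ (by simp; norm_num)).mul_left _) fun r hr ↦
    Filter.eventually_atTop.mpr ⟨2 * r, ?_⟩
  rintro _ h s hs l rfl
  split_ifs
  · rw [norm_zero]; positivity
  · exact weierstrassZeta_bound r hr s hs l h

lemma differentiableAt_weierstrassZeta_summand {l : L.lattice} {z : ℂ}
    (hz : z ∈ ((L.lattice : Set ℂ) \ {0})ᶜ) (hl : (l : ℂ) ≠ 0) :
    HasDerivAt (fun z : ℂ => 1 / (z - l) + 1 / l + z / l ^ 2)
      (-(1 / (z - l) ^ 2 - 1 / (l : ℂ) ^ 2)) z := by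
  have hzl : z - l ≠ 0 := fun h => hz ⟨by rw [sub_eq_zero.mp h]; exact l.2, by
    rw [sub_eq_zero.mp h]; exact hl⟩
  have h1 : HasDerivAt (fun z : ℂ => (z - l)⁻¹) (-1 / (z - l) ^ 2) z :=
    ((hasDerivAt_id z).sub_const (l : ℂ)).fun_inv hzl
  have h2 := (h1.add_const (1 / (l : ℂ))).add ((hasDerivAt_id z).div_const ((l : ℂ) ^ 2))
  have h3 : (fun z : ℂ => 1 / (z - l) + 1 / l + z / l ^ 2) =
      ((fun z : ℂ => (z - (l : ℂ))⁻¹ + 1 / (l : ℂ)) + fun z : ℂ => id z / (l : ℂ) ^ 2) := by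
    funext w; simp
  rw [h3]
  refine h2.congr_deriv ?_
  ring

lemma differentiableOn_weierstrassZetaExcept :
    DifferentiableOn ℂ L.weierstrassZetaExcept ((L.lattice : Set ℂ) \ {0})ᶜ := by
  refine L.hasSumLocallyUniformly_weierstrassZetaExcept.hasSumLocallyUniformlyOn.differentiableOn
    (.of_forall fun s ↦ .fun_sum fun l _ ↦ ?_) L.isOpen_compl_lattice_sdiff
  split_ifs with hl
  · simp
  · exact fun z hz => (L.differentiableAt_weierstrassZeta_summand hz hl).differentiableAt
      |>.differentiableWithinAt

lemma deriv_weierstrassZetaExcept :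
    Set.EqOn (deriv L.weierstrassZetaExcept) (fun z => -L.weierstrassPExcept 0 z)
      ((L.lattice : Set ℂ) \ {0})ᶜ := by
  refine (L.hasSumLocallyUniformly_weierstrassZetaExcept.tendstoLocallyUniformlyOn.deriv
    (.of_forall fun s ↦ .fun_sum fun l _ ↦ ?_) L.isOpen_compl_lattice_sdiff).unique ?_
  · split_ifs with hl
    · simp
    · exact fun z hz => (L.differentiableAt_weierstrassZeta_summand hz hl).differentiableAt
        |>.differentiableWithinAt
  · have h0 := (L.hasSumLocallyUniformly_weierstrassPExcept 0).tendstoLocallyUniformlyOn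
      (s := ((L.lattice : Set ℂ) \ {0})ᶜ)
    refine (h0.fun_neg).congr ?_
    intro s z hz
    simp only [Function.comp_apply]
    rw [deriv_fun_sum, ← Finset.sum_neg_distrib]
    · refine Finset.sum_congr rfl fun l _ => ?_
      split_ifs with hl
      · simp
      · exact (L.differentiableAt_weierstrassZeta_summand hz hl).deriv.symm
    · intro l _
      split_ifs with hl
      · simp
      · exact (L.differentiableAt_weierstrassZeta_summand hz hl).differentiableAt

/-- The Weierstrass zeta function. -/
def weierstrassZeta (z : ℂ) : ℂ := z⁻¹ + L.weierstrassZetaExcept z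

lemma hasDerivAt_weierstrassZeta {z : ℂ} (hz : z ∉ L.lattice) :
    HasDerivAt L.weierstrassZeta (-L.weierstrassP z) z := by
  have hz0 : z ≠ 0 := fun h => hz (h ▸ L.lattice.zero_mem)
  have hz1 : z ∈ ((L.lattice : Set ℂ) \ {0})ᶜ := fun h => hz h.1
  have h1 := (L.differentiableOn_weierstrassZetaExcept.differentiableAt
    (L.isOpen_compl_lattice_sdiff.mem_nhds hz1)).hasDerivAt
  rw [L.deriv_weierstrassZetaExcept hz1] at h1
  have h2 := (hasDerivAt_inv hz0).add h1
  have h3 := L.weierstrassPExcept_add 0 z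
  simp only [ZeroMemClass.coe_zero, sub_zero] at h3
  refine h2.congr_deriv ?_
  rw [← h3]
  simp

lemma analyticAt_weierstrassZeta {z : ℂ} (hz : z ∉ L.lattice) :
    AnalyticAt ℂ L.weierstrassZeta z := by
  have h : DifferentiableOn ℂ L.weierstrassZeta (L.lattice : Set ℂ)ᶜ := fun w hw =>
    (L.hasDerivAt_weierstrassZeta hw).differentiableAt.differentiableWithinAt
  exact h.analyticAt (L.isClosed_lattice.isOpen_compl.mem_nhds hz)

lemma weierstrassZeta_lead : LaurentLead L.weierstrassZeta 1 1 := by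
  have h0 : AnalyticAt ℂ L.weierstrassZetaExcept 0 :=
    L.differentiableOn_weierstrassZetaExcept.analyticAt (L.isOpen_compl_lattice_sdiff.mem_nhds
      (by simp))
  refine ⟨fun z => 1 + L.weierstrassZetaExcept z * z, by fun_prop, by simp, ?_⟩
  filter_upwards [self_mem_nhdsWithin] with z hz
  have hz : z ≠ 0 := hz
  simp only [weierstrassZeta, pow_one]
  rw [add_mul, inv_mul_cancel₀ hz]

/-- The zeta function is quasi-periodic. -/
lemma exists_weierstrassZeta_add {l : ℂ} (hl : l ∈ L.lattice) :
    ∃ η : ℂ, ∀ z ∉ L.lattice, L.weierstrassZeta (z + l) = L.weierstrassZeta z + η := by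
  have hd : ∀ z ∈ (L.lattice : Set ℂ)ᶜ,
      HasDerivAt (fun z => L.weierstrassZeta (z + l) - L.weierstrassZeta z) 0 z := by
    intro z hz
    have h1 := (L.hasDerivAt_weierstrassZeta (L.add_notMem hz hl)).comp_add_const z l
    refine (h1.sub (L.hasDerivAt_weierstrassZeta hz)).congr_deriv ?_
    have := L.weierstrassP_add_coe z ⟨l, hl⟩
    simp only at this
    rw [this, sub_self]
  obtain ⟨η, hη⟩ := L.isClosed_lattice.isOpen_compl.exists_is_const_of_deriv_eq_zero
    L.isPreconnected_compl_lattice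
    (fun z hz => (hd z hz).differentiableAt.differentiableWithinAt)
    (fun z hz => (hd z hz).deriv)
  exact ⟨η, fun z hz => by linear_combination hη z hz⟩

/-! ## Functions with a simple pole and prescribed multipliers -/

/-- A unitary character of a lattice, as a function on `ℂ`. -/
structure IsLatticeCharacter (P : PeriodPair) (χ : ℂ → ℂ) : Prop where
  map_add : ∀ p ∈ P.lattice, ∀ q ∈ P.lattice, χ (p + q) = χ p * χ q
  norm_eq_one : ∀ p ∈ P.lattice, ‖χ p‖ = 1

namespace IsLatticeCharacter

variable {P : PeriodPair} {χ : ℂ → ℂ}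

lemma ne_zero (h : P.IsLatticeCharacter χ) {p : ℂ} (hp : p ∈ P.lattice) : χ p ≠ 0 := by
  rw [← norm_ne_zero_iff, h.norm_eq_one p hp]; exact one_ne_zero

lemma map_zero (h : P.IsLatticeCharacter χ) : χ 0 = 1 := by
  have h1 := h.map_add 0 P.lattice.zero_mem 0 P.lattice.zero_mem
  rw [add_zero] at h1
  exact mul_left_cancel₀ (h.ne_zero P.lattice.zero_mem) (by rw [← h1, mul_one])

lemma map_neg (h : P.IsLatticeCharacter χ) {p : ℂ} (hp : p ∈ P.lattice) : χ (-p) = (χ p)⁻¹ := by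
  have h1 := h.map_add p hp (-p) (P.lattice.neg_mem hp)
  rw [add_neg_cancel, h.map_zero] at h1
  exact eq_inv_of_mul_eq_one_right h1.symm

end IsLatticeCharacter

variable {L}

/-- For a nontrivial character of `P.lattice`, trivial on a sublattice of finite index, there is a
function with these multipliers whose only poles are simple and lie on `P.lattice`. -/
theorem exists_isSemiElliptic {P : PeriodPair} (hLP : L.lattice ≤ P.lattice) {ι : Type*} [Finite ι]
    (b : ι → ℂ) (hbP : ∀ i, b i ∈ P.lattice) (hb : ∀ p ∈ P.lattice, ∃! i, p - b i ∈ L.lattice)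
    {χ : ℂ → ℂ} (hχ : P.IsLatticeCharacter χ) (hχL : ∀ l ∈ L.lattice, χ l = 1)
    {q : ℂ} (hq : q ∈ P.lattice) (hχq : χ q ≠ 1) :
    ∃ f, P.IsSemiElliptic χ f ∧ LaurentLead f 1 1 := by
  have := Fintype.ofFinite ι
  -- A twisted sum of zeta functions over the cosets of `L` in `P`. A translation permutes the
  -- cosets, hence multiplies the sum by the character, up to an additive constant made of
  -- quasi-periods.
  let F : ℂ → ℂ := fun z => ∑ i, (χ (b i))⁻¹ * L.weierstrassZeta (z + b i)
  have hcong : ∀ p ∈ P.lattice, ∀ p' ∈ P.lattice, p - p' ∈ L.lattice → χ p = χ p' := by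
    intro p hp p' hp' h
    have := hχ.map_add _ (hLP h) p' hp'
    rwa [sub_add_cancel, hχL _ h, one_mul] at this
  have hnot : ∀ {z : ℂ}, z ∉ P.lattice → ∀ i, z + b i ∉ L.lattice := fun hz i h =>
    P.add_notMem hz (hbP i) (hLP h)
  have hFa : ∀ z ∉ P.lattice, AnalyticAt ℂ F z := by
    intro z hz
    refine Finset.analyticAt_fun_sum _ fun i _ => analyticAt_const.mul ?_
    exact AnalyticAt.fun_comp (L.analyticAt_weierstrassZeta (hnot hz i))
      (analyticAt_id.add analyticAt_const)
  have hFadd : ∀ p ∈ P.lattice, ∃ c, ∀ z ∉ P.lattice, F (z + p) = χ p * F z + c := by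
    intro p hp
    choose σ hσ hσu using fun i => hb (p + b i) (P.lattice.add_mem hp (hbP i))
    simp only at hσ hσu
    have hσi : Function.Injective σ := by
      intro i j hij
      have h1 := L.lattice.sub_mem (hσ i) (hij ▸ hσ j)
      rw [show p + b i - b (σ i) - (p + b j - b (σ i)) = b i - b j by ring] at h1
      obtain ⟨k, hk, hku⟩ := hb (b i) (hbP i)
      rw [hku i (by simp), hku j h1]
    let e : ι ≃ ι := Equiv.ofBijective σ (Finite.injective_iff_bijective.mp hσi)
    choose η hη using fun i => L.exists_weierstrassZeta_add (hσ i)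
    refine ⟨∑ i, (χ (b i))⁻¹ * η i, fun z hz => ?_⟩
    have h1 : χ p * F z = ∑ i, χ p * ((χ (b (e i)))⁻¹ * L.weierstrassZeta (z + b (e i))) := by
      rw [Finset.mul_sum]
      exact (e.sum_comp fun i => χ p * ((χ (b i))⁻¹ * L.weierstrassZeta (z + b i))).symm
    rw [h1, ← Finset.sum_add_distrib]
    refine Finset.sum_congr rfl fun i _ => ?_
    have h2 := hη i (z + b (σ i)) (hnot hz _)
    rw [show z + b (σ i) + (p + b i - b (σ i)) = z + p + b i by ring] at h2
    have h3 : χ (b (σ i)) = χ p * χ (b i) := by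
      rw [← hχ.map_add p hp _ (hbP i)]
      exact (hcong _ (P.lattice.add_mem hp (hbP i)) _ (hbP _) (hσ i)).symm
    have h4 := hχ.ne_zero hp
    have h5 := hχ.ne_zero (hbP i)
    simp only [e, Equiv.ofBijective_apply]
    rw [h2, h3]
    field_simp
  have hFl : LaurentLead F 1 1 := by
    -- Only the summand of the trivial coset has a pole at the origin.
    obtain ⟨i₀, hi₀, hu⟩ := hb 0 P.lattice.zero_mem
    simp only [zero_sub] at hi₀ hu
    have hi₁ : b i₀ ∈ L.lattice := by simpa using L.lattice.neg_mem hi₀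
    obtain ⟨η, hη⟩ := L.exists_weierstrassZeta_add hi₁
    have hrest : ∀ s : Finset ι, i₀ ∉ s →
        AnalyticAt ℂ (fun z => ∑ i ∈ s, (χ (b i))⁻¹ * L.weierstrassZeta (z + b i)) 0 := by
      intro s hs
      refine Finset.analyticAt_fun_sum _ fun i hi => analyticAt_const.mul ?_
      refine AnalyticAt.fun_comp (L.analyticAt_weierstrassZeta ?_)
        (analyticAt_id.add analyticAt_const)
      simp only [zero_add]
      intro h
      exact hs (hu i (L.lattice.neg_mem h) ▸ hi)
    classical
    have h1 := ((LaurentLead.of_analyticAt (hrest (Finset.univ.erase i₀) (by simp))).succ).add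
      ((L.weierstrassZeta_lead).add ((LaurentLead.const η).succ))
    have h2 := h1.congr (g := F) (by
      filter_upwards [L.eventually_notMem 0] with z hz
      simp only [F]
      rw [← Finset.add_sum_erase _ _ (Finset.mem_univ i₀), hη z hz, hχL _ hi₁]
      ring)
    simpa using h2
  choose! c hc using hFadd
  -- Translating by `p` and `q` in either order gives `c p * (1 - χ q) = c q * (1 - χ p)`. The
  -- additive constants are therefore those produced by the constant function `d`, and subtracting
  -- `d` removes them.
  set d : ℂ := c q / (1 - χ q) with hd
  have hq1 : 1 - χ q ≠ 0 := sub_ne_zero.mpr hχq.symm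
  refine ⟨fun z => F z - d, ⟨fun z hz => (hFa z hz).sub analyticAt_const,
    hFl.meromorphicAt.sub (MeromorphicAt.const _ _), ?_⟩, ?_⟩
  · intro p hp z hz
    have h1 := hc p hp (z + q) (P.add_notMem hz hq)
    have h2 := hc q hq (z + p) (P.add_notMem hz hp)
    rw [show z + q + p = z + p + q by ring, h2, hc p hp z hz, hc q hq z hz] at h1
    have h3 : c p = d * (1 - χ p) := by
      rw [hd]
      field_simp
      linear_combination -h1
    change F (z + p) - d = χ p * (F z - d)
    rw [hc p hp z hz, h3]
    ring
  · simpa [sub_eq_add_neg] using hFl.add ((LaurentLead.const (-d)).succ)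

/-- Such a function is unique. -/
theorem IsSemiElliptic.eq_of_laurentLead_one {P : PeriodPair} {χ : ℂ → ℂ} {f g : ℂ → ℂ}
    (hχ : P.IsLatticeCharacter χ) {q : ℂ} (hq : q ∈ P.lattice) (hχq : χ q ≠ 1) {c : ℂ}
    (hf : P.IsSemiElliptic χ f) (hg : P.IsSemiElliptic χ g) (hfl : LaurentLead f 1 c)
    (hgl : LaurentLead g 1 c) : ∀ z ∉ P.lattice, f z = g z := by
  have h1 := hf.sub hg
  have h2 : LaurentLead (fun z => f z - g z) 1 0 := by
    simpa [sub_eq_add_neg] using hfl.add (hgl.const_mul (-1))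
  obtain ⟨d, hd⟩ := h2.lower
  have h3 := h1.eq_of_laurentLead_zero hχ.norm_eq_one hd
  intro z hz
  have h4 := h1.map_add q hq z hz
  rw [h3 z hz, h3 _ (P.add_notMem hz hq)] at h4
  -- The difference of the two functions is a constant `d`, but it is multiplied by `χ q ≠ 1` under
  -- a translation.
  have h5 : (1 - χ q) * d = 0 := by linear_combination h4
  have h6 := (mul_eq_zero.mp h5).resolve_left (sub_ne_zero.mpr hχq.symm)
  have := h3 z hz
  rw [h6] at this
  exact sub_eq_zero.mp this

end PeriodPair

/-! ### Even elliptic functions, half periods, and products `f z * g (-z)` -/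

namespace PeriodPair

variable {P : PeriodPair} {χ : ℂ → ℂ} {f g F : ℂ → ℂ}

/-- Even elliptic functions with a pole of order at most two. -/
theorem IsSemiElliptic.eq_of_even_of_laurentLead_two (hf : P.IsElliptic f)
    (he : ∀ z ∉ P.lattice, f (-z) = f z) {c : ℂ} (hl : LaurentLead f 2 c) :
    ∃ d, ∀ z ∉ P.lattice, f z = c * P.weierstrassP z + d := by
  have hg : P.IsElliptic (fun z => f z + -c * P.weierstrassP z) :=
    hf.add (P.isElliptic_weierstrassP.const_mul (-c))
  have hgl : LaurentLead (fun z => f z + -c * P.weierstrassP z) 2 0 := by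
    simpa using hl.add (P.weierstrassP_lead.const_mul (-c))
  obtain ⟨d, hd⟩ := hgl.lower
  have hd0 := hd.lower_of_even (by decide) (by
    filter_upwards [P.eventually_notMem 0] with z hz
    rw [he z hz, P.weierstrassP_neg])
  subst hd0
  obtain ⟨d, hd⟩ := hd.lower
  refine ⟨d, fun z hz => ?_⟩
  have := hg.eq_of_laurentLead_zero (by simp) hd z hz
  linear_combination this

/-- The multipliers `χ p` and `χ (-p)` cancel. This product acts as a norm that leads from
semi-elliptic functions back to elliptic ones. -/
lemma IsSemiElliptic.mul_neg_arg (hχ : P.IsLatticeCharacter χ) (hf : P.IsSemiElliptic χ f)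
    (hg : P.IsSemiElliptic χ g) : P.IsElliptic (fun z => f z * g (-z)) :=
  (hf.mul hg.neg_arg).congr_char fun p hp => by
    rw [hχ.map_neg hp, mul_inv_cancel₀ (hχ.ne_zero hp)]

section HalfPeriods

variable (P)

/-- The three values of `℘` at the half periods. -/
lemma exists_cubic_roots : ∃ e₁ e₂ e₃ : ℂ, e₁ ≠ e₂ ∧ e₁ ≠ e₃ ∧ e₂ ≠ e₃ ∧ ∀ x : ℂ,
    4 * x ^ 3 - P.g₂ * x - P.g₃ = 4 * ((x - e₁) * (x - e₂) * (x - e₃)) := by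
  have m1 := P.ω₁_mem_lattice
  have m2 := P.ω₂_mem_lattice
  have n1 := P.ω₁_div_two_notMem_lattice
  have n2 := P.ω₂_div_two_notMem_lattice
  have n3 := P.ω₁_add_ω₂_div_two_notMem
  have hroot : ∀ p ∈ P.lattice, p / 2 ∉ P.lattice → 4 * P.weierstrassP (p / 2) ^ 3 -
      P.g₂ * P.weierstrassP (p / 2) - P.g₃ = 0 := by
    intro p hp hp2
    rw [← P.derivWeierstrassP_sq _ hp2, (P.derivWeierstrassP_eq_zero_iff hp2).mpr
      (by rwa [mul_div_cancel₀ p two_ne_zero]), zero_pow two_ne_zero]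
  have h1 := hroot _ m1 n1
  have h2 := hroot _ m2 n2
  have h3 := hroot _ (P.lattice.add_mem m1 m2) n3
  have d12 : P.weierstrassP (P.ω₁ / 2) ≠ P.weierstrassP (P.ω₂ / 2) := by
    rw [ne_eq, P.weierstrassP_eq_iff n1 n2]
    rintro (h | h)
    · refine P.ω₁_div_two_sub_ω₂_div_two_notMem ?_
      simpa using P.lattice.neg_mem h
    · refine n3 ?_
      rwa [add_div, add_comm]
  have d13 : P.weierstrassP (P.ω₁ / 2) ≠ P.weierstrassP ((P.ω₁ + P.ω₂) / 2) := by
    rw [ne_eq, P.weierstrassP_eq_iff n1 n3]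
    rintro (h | h)
    · exact n2 (by convert h using 1; ring)
    · refine n2 ?_
      convert P.lattice.sub_mem h m1 using 1; ring
  have d23 : P.weierstrassP (P.ω₂ / 2) ≠ P.weierstrassP ((P.ω₁ + P.ω₂) / 2) := by
    rw [ne_eq, P.weierstrassP_eq_iff n2 n3]
    rintro (h | h)
    · exact n1 (by convert h using 1; ring)
    · refine n1 ?_
      convert P.lattice.sub_mem h m2 using 1; ring
  generalize P.weierstrassP (P.ω₁ / 2) = e₁ at *
  generalize P.weierstrassP (P.ω₂ / 2) = e₂ at *
  generalize P.weierstrassP ((P.ω₁ + P.ω₂) / 2) = e₃ at *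
  refine ⟨e₁, e₂, e₃, d12, d13, d23, ?_⟩
  -- Divided differences of the cubic at its three distinct roots give Vieta's relations.
  have k1 : 4 * (e₁ ^ 2 + e₁ * e₂ + e₂ ^ 2) = P.g₂ :=
    mul_left_cancel₀ (sub_ne_zero.mpr d12) (by linear_combination h1 - h2)
  have k2 : 4 * (e₁ ^ 2 + e₁ * e₃ + e₃ ^ 2) = P.g₂ :=
    mul_left_cancel₀ (sub_ne_zero.mpr d13) (by linear_combination h1 - h3)
  have k3 : e₁ + e₂ + e₃ = 0 :=
    mul_left_cancel₀ (sub_ne_zero.mpr d23) (by linear_combination (k1 - k2) / 4)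
  have k4 : e₃ = -e₁ - e₂ := by linear_combination k3
  intro x
  have k5 : P.g₃ = 4 * e₁ ^ 3 - P.g₂ * e₁ := by linear_combination -h1
  rw [k5, ← k1, k4]
  ring

/-- At a half period `℘''` is half the derivative of the Weierstrass cubic at one of its roots, and
the roots are simple. -/
lemma deriv_derivWeierstrassP_ne_zero {a : ℂ} (ha : a ∉ P.lattice)
    (h : P.derivWeierstrassP a = 0) : deriv P.derivWeierstrassP a ≠ 0 := by
  rw [P.deriv_derivWeierstrassP ha]
  have h1 := P.derivWeierstrassP_sq a ha
  obtain ⟨e₁, e₂, e₃, d12, d13, d23, he⟩ := P.exists_cubic_roots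
  rw [h, he] at h1
  generalize P.weierstrassP a = x at *
  have hv0 := he 0
  have hv1 := he 1
  have hv2 := he (-1)
  -- The factorisation at `0`, `1` and `-1` recovers the coefficients of the cubic, hence its
  -- derivative.
  have hg : ∀ x, 6 * x ^ 2 - P.g₂ / 2 =
      2 * ((x - e₁) * (x - e₂) + (x - e₁) * (x - e₃) + (x - e₂) * (x - e₃)) := by
    intro x
    linear_combination (1 + 2 * x) / 4 * hv1 - (1 - 2 * x) / 4 * hv2 - x * hv0
  rw [hg]
  have h2 : (x - e₁) * (x - e₂) * (x - e₃) = 0 := by linear_combination -h1 / 4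
  have e12 := sub_ne_zero.mpr d12
  have e13 := sub_ne_zero.mpr d13
  have e23 := sub_ne_zero.mpr d23
  have e21 := sub_ne_zero.mpr d12.symm
  have e31 := sub_ne_zero.mpr d13.symm
  have e32 := sub_ne_zero.mpr d23.symm
  rcases mul_eq_zero.mp h2 with h3 | h3
  · rcases mul_eq_zero.mp h3 with h3 | h3
    · rw [sub_eq_zero.mp h3]; simp [e12, e13]
    · rw [sub_eq_zero.mp h3]; simp [e21, e23]
  · rw [sub_eq_zero.mp h3]; simp [e31, e32]

end HalfPeriods

/-- Second derivative of `f (a + t) * g (a - t)` type products. -/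
lemma hasDerivAt_mul_neg {a : ℂ} {f' g' : ℂ} (hf : HasDerivAt f f' a) (hg : HasDerivAt g g' (-a)) :
    HasDerivAt (fun z => f z * g (-z)) (f' * g (-a) - f a * g') a := by
  have h1 : HasDerivAt (fun z => g (-z)) (-g') a := by
    exact (hg.scomp a (hasDerivAt_neg a)).congr_deriv (by simp)
  exact (hf.mul h1).congr_deriv (by ring)

lemma second_deriv_mul_neg {a : ℂ} (hf : AnalyticAt ℂ f a) (hg : AnalyticAt ℂ g (-a)) :
    deriv (deriv fun z => f z * g (-z)) a =
      deriv (deriv f) a * g (-a) - 2 * deriv f a * deriv g (-a) + f a * deriv (deriv g) (-a) := by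
  have h1 : deriv (fun z => f z * g (-z)) =ᶠ[𝓝 a]
      fun z => deriv f z * g (-z) - f z * deriv g (-z) := by
    have hg' : ∀ᶠ z in 𝓝 a, AnalyticAt ℂ g (-z) :=
      (continuous_neg.tendsto a).eventually hg.eventually_analyticAt
    filter_upwards [hf.eventually_analyticAt, hg'] with z h1 h2
    exact (hasDerivAt_mul_neg h1.differentiableAt.hasDerivAt h2.differentiableAt.hasDerivAt).deriv
  rw [h1.deriv_eq]
  refine ((hasDerivAt_mul_neg hf.deriv.differentiableAt.hasDerivAt
    hg.differentiableAt.hasDerivAt).sub (hasDerivAt_mul_neg hf.differentiableAt.hasDerivAt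
    hg.deriv.differentiableAt.hasDerivAt)).deriv.trans ?_
  ring

/-- The function `F` with a simple pole satisfies `F z * F (-z) = d - ℘ z`. -/
lemma IsSemiElliptic.mul_neg_eq (hχ : P.IsLatticeCharacter χ) (hF : P.IsSemiElliptic χ F)
    (hl : LaurentLead F 1 1) : ∃ d, ∀ z ∉ P.lattice, F z * F (-z) = d - P.weierstrassP z := by
  have h1 : LaurentLead (fun z => F z * F (-z)) 2 (-1) := by
    simpa using hl.mul hl.neg_arg
  obtain ⟨d, hd⟩ := (hF.mul_neg_arg hχ hF).eq_of_even_of_laurentLead_two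
    (fun z _ => by rw [neg_neg, mul_comm]) h1
  exact ⟨d, fun z hz => by rw [hd z hz]; ring⟩

/-- A point where the logarithmic derivative of `F` is critical. -/
lemma IsSemiElliptic.exists_wronskian_zero (hχ : P.IsLatticeCharacter χ)
    (hF : P.IsSemiElliptic χ F) (hl : LaurentLead F 1 1) :
    ∃ a ∉ P.lattice, deriv F a ^ 2 = F a * deriv (deriv F) a := by
  by_contra! h
  -- The leading term of `W` is `1 / z ^ 4 - 2 / z ^ 4`. If `W` had no zero, `1 / W` would be
  -- regular with unimodular multipliers and vanish at the origin, against Liouville's theorem.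
  set W : ℂ → ℂ := fun z => deriv F z * deriv F z - F z * deriv (deriv F) z with hW
  have hWs : P.IsSemiElliptic (fun p => χ p * χ p) W :=
    (hF.derivative.mul hF.derivative).sub (hF.mul hF.derivative.derivative)
  have hWl : LaurentLead W 4 (-1) := by
    have h1 := (hl.deriv.mul hl.deriv).add ((hl.mul hl.deriv.deriv).const_mul (-1))
    have h2 : LaurentLead W 4 (-(1 : ℕ) * 1 * (-(1 : ℕ) * 1) +
      -1 * (1 * (-(1 + 1 : ℕ) * (-(1 : ℕ) * 1)))) :=
      h1.congr (.of_forall fun z => by simp only [hW]; ring)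
    convert h2 using 1
    norm_num
  have hW0 : ∀ z ∉ P.lattice, W z ≠ 0 := fun z hz h0 => h z hz (by
    simp only [hW] at h0; linear_combination h0)
  have hi : P.IsSemiElliptic (fun p => (χ p * χ p)⁻¹) (fun z => (W z)⁻¹) :=
    { analyticAt := fun z hz => (hWs.analyticAt z hz).inv (hW0 z hz)
      meromorphicAt_zero := hWs.meromorphicAt_zero.inv
      map_add := fun p hp z hz => by rw [hWs.map_add p hp z hz, mul_inv] }
  obtain ⟨z, hz⟩ := P.exists_notMem
  refine inv_ne_zero (hW0 z hz) (hi.eq_of_laurentLead_zero (fun p hp => ?_)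
    (hWl.inv (by norm_num) (by norm_num)) z hz)
  simp [hχ.norm_eq_one p hp]

/-- A semi-elliptic function whose divisor is twice a point minus twice the origin, together with a
complementary relation. -/
theorem IsSemiElliptic.exists_double_zero (hχ : P.IsLatticeCharacter χ)
    (hF : P.IsSemiElliptic χ F) (hl : LaurentLead F 1 1) :
    ∃ (v : ℂ → ℂ) (x₀ m s : ℂ), P.IsSemiElliptic χ v ∧ m ≠ 0 ∧
      (∀ z ∉ P.lattice, v z * v (-z) = (P.weierstrassP z - x₀) ^ 2) ∧
      ∀ z ∉ P.lattice, v z * F (-z) + v (-z) * F z = m + s * (P.weierstrassP z - x₀) := by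
  obtain ⟨a, ha, hWa⟩ := hF.exists_wronskian_zero hχ hl
  obtain ⟨d, hd⟩ := hF.mul_neg_eq hχ hl
  have hna := P.neg_notMem ha
  have hU : (P.lattice : Set ℂ)ᶜ ∈ 𝓝 a := P.isClosed_lattice.isOpen_compl.mem_nhds ha
  have hFa := hF.analyticAt a ha
  have hFna := hF.analyticAt _ hna
  have hdev : (fun z => F z * F (-z)) =ᶠ[𝓝 a] fun z => d - P.weierstrassP z := by
    filter_upwards [hU] with z hz using hd z hz
  -- If `℘' a = 0`, then `a` and `-a` differ by a lattice point, so the values and derivatives of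
  -- `F` at them agree up to the factor `χ (2 * a)`. The second derivative of `F z * F (-z)` at `a`
  -- is then a multiple of `F F'' - F' ^ 2 = 0`, whereas `℘'' a ≠ 0`.
  have hya : P.derivWeierstrassP a ≠ 0 := by
    intro hy
    have h2a := (P.derivWeierstrassP_eq_zero_iff ha).mp hy
    have h1 := hdev.deriv.deriv_eq
    have h2 : deriv (fun z => d - P.weierstrassP z) = fun z => -P.derivWeierstrassP z := by
      funext z
      rw [deriv_const_sub, P.deriv_weierstrassP]
    rw [second_deriv_mul_neg hFa hFna, h2, deriv.fun_neg] at h1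
    have e1 := hF.map_add _ h2a _ hna
    have e2 := hF.derivative.map_add _ h2a _ hna
    have e3 := hF.derivative.derivative.map_add _ h2a _ hna
    rw [show -a + 2 * a = a by ring] at e1 e2 e3
    have hχ0 := hχ.ne_zero h2a
    refine P.deriv_derivWeierstrassP_ne_zero ha hy ?_
    have h3 : χ (2 * a) * deriv P.derivWeierstrassP a = 0 := by
      linear_combination χ (2 * a) * h1 + deriv (deriv F) a * e1 - 2 * deriv F a * e2 +
        F a * e3 + 2 * hWa
    exact (mul_eq_zero.mp h3).resolve_left hχ0
  -- A zero of `F` at `a` would be a double zero by the choice of `a`, and differentiating `F z * F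
  -- (-z) = d - ℘ z` would give `℘' a = 0`.
  have hFa0 : F a ≠ 0 := by
    intro h0
    rw [h0, zero_mul, sq_eq_zero_iff] at hWa
    have h1 := hdev.deriv_eq
    rw [(hasDerivAt_mul_neg hFa.differentiableAt.hasDerivAt
      hFna.differentiableAt.hasDerivAt).deriv, deriv_const_sub, P.deriv_weierstrassP, h0, hWa] at h1
    exact hya (by linear_combination h1)
  set lam := deriv F a / F a with hlam
  -- The factor `lam` makes `v` vanish at `a`; the relation `F' ^ 2 = F F''` there makes the zero
  -- double.
  set v : ℂ → ℂ := fun z => -deriv F z + lam * F z with hv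
  have hvs : P.IsSemiElliptic χ v := hF.derivative.neg.add (hF.const_mul lam)
  have hvl : LaurentLead v 2 1 := by
    have h1 := (hl.deriv.const_mul (-1)).add ((hl.const_mul lam).succ)
    simpa [hv] using h1
  have hva : v a = 0 := by simp only [hv, hlam]; field_simp; ring
  have hva' : deriv v a = 0 := by
    have h1 : HasDerivAt v (-deriv (deriv F) a + lam * deriv F a) a :=
      hFa.deriv.differentiableAt.hasDerivAt.neg.add
        (hFa.differentiableAt.hasDerivAt.const_mul lam)
    rw [h1.deriv, hlam]
    field_simp
    linear_combination hWa
  have hxa := P.hasDerivAt_weierstrassP ha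
  set x₀ := P.weierstrassP a with hx₀
  -- the norm of `v`
  have hEe : P.IsElliptic (fun z => v z * v (-z)) := hvs.mul_neg_arg hχ hvs
  have hEl : LaurentLead (fun z => v z * v (-z)) 4 1 := by
    simpa using hvl.mul hvl.neg_arg
  have hxx : P.IsElliptic (fun z => P.weierstrassP z * P.weierstrassP z) :=
    P.isElliptic_weierstrassP.mul_elliptic P.isElliptic_weierstrassP
  have hE2 : LaurentLead (fun z => v z * v (-z) - P.weierstrassP z * P.weierstrassP z) 4 0 := by
    simpa [sub_eq_add_neg] using
      hEl.add ((P.weierstrassP_lead.mul P.weierstrassP_lead).const_mul (-1))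
  obtain ⟨c₁, hc₁⟩ := hE2.lower
  have hEeven : ∀ z ∉ P.lattice, v (-z) * v (- -z) - P.weierstrassP (-z) * P.weierstrassP (-z) =
      v z * v (-z) - P.weierstrassP z * P.weierstrassP z := fun z _ => by
    rw [neg_neg, P.weierstrassP_neg]; ring
  have hc0 := hc₁.lower_of_even (by decide) (by
    filter_upwards [P.eventually_notMem 0] with z hz using hEeven z hz)
  subst hc0
  obtain ⟨c₁, hc₁⟩ := hc₁.lower
  obtain ⟨c₂, hc₂⟩ := (hEe.sub hxx).eq_of_even_of_laurentLead_two hEeven hc₁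
  -- The norm of `v` is a monic quadratic in `℘`. The double zero of `v` at `a`, where `℘` is
  -- unramified, makes `x₀` a double root.
  have hE : ∀ z ∉ P.lattice, v z * v (-z) =
      P.weierstrassP z ^ 2 + c₁ * P.weierstrassP z + c₂ := fun z hz => by
    linear_combination hc₂ z hz
  have hEev : (fun z => v z * v (-z)) =ᶠ[𝓝 a]
      fun z => P.weierstrassP z ^ 2 + c₁ * P.weierstrassP z + c₂ := by
    filter_upwards [hU] with z hz using hE z hz
  have hvna := hvs.analyticAt _ hna
  have hvA := hvs.analyticAt _ ha
  have hrel1 : x₀ ^ 2 + c₁ * x₀ + c₂ = 0 := by rw [← hE a ha, hva, zero_mul]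
  have hrel2 : c₁ = -2 * x₀ := by
    have h1 := hEev.deriv_eq
    rw [(hasDerivAt_mul_neg hvA.differentiableAt.hasDerivAt
      hvna.differentiableAt.hasDerivAt).deriv, hva, hva'] at h1
    have h2 := (((hxa.pow 2).add (hxa.const_mul c₁)).add_const c₂).deriv
    have h3 := h1.trans h2
    simp only [Nat.cast_ofNat, Nat.add_one_sub_one, pow_one] at h3
    have h4 : P.derivWeierstrassP a * (c₁ + 2 * x₀) = 0 := by linear_combination -h3
    linear_combination (mul_eq_zero.mp h4).resolve_left hya
  have hE' : ∀ z ∉ P.lattice, v z * v (-z) = (P.weierstrassP z - x₀) ^ 2 := fun z hz => by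
    rw [hE z hz]
    linear_combination hrel1 + (P.weierstrassP z - x₀) * hrel2
  -- Otherwise the norm would vanish at `a` to order three, whereas `(℘ - x₀) ^ 2` vanishes to order
  -- exactly two.
  have hvna0 : v (-a) ≠ 0 := by
    intro h0
    have h1 : (fun z => v z * v (-z)) =ᶠ[𝓝 a] fun z => (P.weierstrassP z - x₀) ^ 2 := by
      filter_upwards [hU] with z hz using hE' z hz
    have h2 := h1.deriv.deriv_eq
    rw [second_deriv_mul_neg hvA hvna, hva, hva', h0] at h2
    have h3 : deriv (fun z => (P.weierstrassP z - x₀) ^ 2) =ᶠ[𝓝 a]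
        fun z => 2 * (P.weierstrassP z - x₀) * P.derivWeierstrassP z := by
      filter_upwards [hU] with z hz
      have := ((P.hasDerivAt_weierstrassP hz).sub_const x₀).pow 2
      exact this.deriv.trans (by simp)
    have h4 := ((hxa.sub_const x₀).const_mul 2).mul
      (P.analyticOnNhd_derivWeierstrassP a ha).differentiableAt.hasDerivAt
    rw [h3.deriv_eq] at h2
    have h5 := h2.trans h4.deriv
    simp only [mul_zero, zero_mul, add_zero, ← hx₀, sub_self] at h5
    exact hya (by simpa using h5.symm)
  -- The mixed product is even and its terms of order three cancel, so it is affine in `℘`. Its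
  -- value at `a` is `v (-a) * F a`, which is the constant `m`.
  have hMe : P.IsElliptic (fun z => v z * F (-z) + F z * v (-z)) :=
    (hvs.mul_neg_arg hχ hF).add (hF.mul_neg_arg hχ hvs)
  have hMl : LaurentLead (fun z => v z * F (-z) + F z * v (-z)) 3 0 := by
    simpa using (hvl.mul hl.neg_arg).add (hl.mul hvl.neg_arg)
  obtain ⟨s, hs⟩ := hMl.lower
  obtain ⟨r, hr⟩ := hMe.eq_of_even_of_laurentLead_two (fun z _ => by rw [neg_neg]; ring) hs
  refine ⟨v, x₀, v (-a) * F a, s, hvs, mul_ne_zero hvna0 hFa0, hE', fun z hz => ?_⟩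
  have h1 := hr a ha
  rw [hva] at h1
  linear_combination hr z hz - h1

/-- For a character of order two the function with a simple pole is odd, with square `℘ - e`. -/
theorem IsSemiElliptic.odd_of_sq_eq_one (hχ : P.IsLatticeCharacter χ)
    (hχ2 : ∀ p ∈ P.lattice, χ p * χ p = 1) {q : ℂ} (hq : q ∈ P.lattice) (hχq : χ q ≠ 1)
    (hF : P.IsSemiElliptic χ F) (hl : LaurentLead F 1 1) :
    (∀ z ∉ P.lattice, F (-z) = -F z) ∧ ∀ p ∈ P.lattice, χ p = 1 → p / 2 ∉ P.lattice →
      ∀ z ∉ P.lattice, F z ^ 2 = P.weierstrassP z - P.weierstrassP (p / 2) := by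
  -- As `χ` is its own inverse, `F (-z)` and `-F z` have the same multipliers and the same polar
  -- part, so uniqueness applies.
  have hodd : ∀ z ∉ P.lattice, F (-z) = -F z := by
    have h1 : P.IsSemiElliptic χ (fun z => F (-z)) := hF.neg_arg.congr_char fun p hp => by
      rw [hχ.map_neg hp]
      exact inv_eq_of_mul_eq_one_left (hχ2 p hp)
    have h2 : LaurentLead (fun z => F (-z)) 1 (-1) := by simpa using hl.neg_arg
    have h3 : LaurentLead (fun z => -F z) 1 (-1) := by simpa using hl.const_mul (-1)
    exact h1.eq_of_laurentLead_one hχ hq hχq hF.neg h2 h3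
  refine ⟨hodd, fun p hp hp1 hp2 z hz => ?_⟩
  obtain ⟨d, hd⟩ := hF.mul_neg_eq hχ hl
  have h0 := hF.eq_zero_of_odd hodd hp hp1 hp2
  have h1 := hd _ hp2
  have h2 := hd z hz
  rw [h0, zero_mul] at h1
  rw [hodd z hz] at h2
  linear_combination h1 - h2

end PeriodPair

/-! ## The Lie algebra `𝔰𝔩₂` and its automorphisms -/

namespace Sl2

lemma apply_one_one (x : Sl2) : x.val 1 1 = -x.val 0 0 := by
  have h : Matrix.trace x.val = 0 := x.2
  rw [Matrix.trace_fin_two] at h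
  linear_combination h

/-- The trace form `tr (x y)`. -/
def form : Sl2 →ₗ[ℂ] Sl2 →ₗ[ℂ] ℂ :=
  LinearMap.mk₂ ℂ (fun x y => Matrix.trace (x.val * y.val))
    (fun x y z => by
      change Matrix.trace ((x.val + y.val) * z.val) = _
      rw [add_mul, Matrix.trace_add])
    (fun c x z => by
      change Matrix.trace ((c • x.val) * z.val) = _
      rw [smul_mul_assoc, Matrix.trace_smul])
    (fun x y z => by
      change Matrix.trace (x.val * (y.val + z.val)) = _
      rw [mul_add, Matrix.trace_add])
    (fun c x z => by
      change Matrix.trace (x.val * (c • z.val)) = _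
      rw [mul_smul_comm, Matrix.trace_smul])

lemma form_apply (x y : Sl2) : form x y =
    2 * x.val 0 0 * y.val 0 0 + x.val 0 1 * y.val 1 0 + x.val 1 0 * y.val 0 1 := by
  change Matrix.trace (x.val * y.val) = _
  simp only [Matrix.trace_fin_two, Matrix.mul_apply, Fin.sum_univ_two, apply_one_one]
  ring

lemma form_comm (x y : Sl2) : form x y = form y x := by
  rw [form_apply, form_apply]; ring

lemma ext' {x y : Sl2} (h0 : x.val 0 0 = y.val 0 0) (h1 : x.val 0 1 = y.val 0 1)
    (h2 : x.val 1 0 = y.val 1 0) : x = y := by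
  refine Subtype.ext (Matrix.ext fun i j => ?_)
  fin_cases i <;> fin_cases j
  · exact h0
  · exact h1
  · exact h2
  · change x.val 1 1 = y.val 1 1
    rw [apply_one_one, apply_one_one, h0]

lemma lie_apply (x y : Sl2) (i j : Fin 2) : (⁅x, y⁆ : Sl2).val i j =
    x.val i 0 * y.val 0 j + x.val i 1 * y.val 1 j -
      (y.val i 0 * x.val 0 j + y.val i 1 * x.val 1 j) := by
  change (x.val * y.val - y.val * x.val) i j = _
  simp only [Matrix.sub_apply, Matrix.mul_apply, Fin.sum_univ_two]

lemma smul_apply (c : ℂ) (x : Sl2) (i j : Fin 2) : (c • x : Sl2).val i j = c * x.val i j := rfl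
lemma sub_apply (x y : Sl2) (i j : Fin 2) : (x - y : Sl2).val i j = x.val i j - y.val i j := rfl

/-- The analogue of the vector triple product. It converts brackets into values of the form, so that
triples can be handled without matrices. -/
lemma lie_lie_eq (x y z : Sl2) :
    ⁅⁅x, y⁆, z⁆ = (2 * form y z) • x - (2 * form x z) • y := by
  apply ext' <;>
  simp only [lie_apply, smul_apply, sub_apply, form_apply, apply_one_one] <;> ring

lemma form_lie_left (x y z : Sl2) : form ⁅x, y⁆ z = form x ⁅y, z⁆ := by
  simp only [lie_apply, form_apply, apply_one_one]; ring

lemma form_lie_self (x y : Sl2) : form x ⁅x, y⁆ = 0 := by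
  simp only [lie_apply, form_apply, apply_one_one]; ring

lemma exists_form_eq_one {x : Sl2} (hx : x ≠ 0) : ∃ y, form x y = 1 := by
  have key : ∃ y, form x y ≠ 0 := by
    by_contra! h
    apply hx
    let m (a b c : ℂ) : Sl2 := ⟨!![a, b; c, -a], by
      change Matrix.trace !![a, b; c, -a] = 0
      simp [Matrix.trace_fin_two]⟩
    have h1 := h (m 1 0 0)
    have h2 := h (m 0 1 0)
    have h3 := h (m 0 0 1)
    simp [form_apply, m] at h1 h2 h3
    exact ext' h1 h3 h2
  obtain ⟨y, hy⟩ := key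
  exact ⟨(form x y)⁻¹ • y, by simp [hy]⟩

lemma exists_not_smul (h : Sl2) : ∃ z : Sl2, ∀ c : ℂ, z ≠ c • h := by
  by_contra! H
  let m (a b c : ℂ) : Sl2 := ⟨!![a, b; c, -a], by
    change Matrix.trace !![a, b; c, -a] = 0
    simp [Matrix.trace_fin_two]⟩
  obtain ⟨s, hs⟩ := H (m 0 1 0)
  obtain ⟨t, ht⟩ := H (m 0 0 1)
  have h1 : (m 0 1 0).val 0 1 = s * h.val 0 1 := by rw [hs]; rfl
  have h2 : (m 0 1 0).val 1 0 = s * h.val 1 0 := by rw [hs]; rfl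
  have h3 : (m 0 0 1).val 1 0 = t * h.val 1 0 := by rw [ht]; rfl
  simp [m] at h1 h2 h3
  rcases h2 with h2 | h2
  · simp [h2] at h1
  · simp [h2] at h3

/-- The data of an `𝔰𝔩₂`-triple, in terms of the trace form. -/
structure IsTriple (h e f : Sl2) : Prop where
  form_e_e : form e e = 0
  form_f_f : form f f = 0
  form_e_f : form e f = 1
  lie_e_f : ⁅e, f⁆ = h

namespace IsTriple

variable {h e f : Sl2} (t : IsTriple h e f)

include t

lemma lie_h_e : ⁅h, e⁆ = (2 : ℂ) • e := by
  rw [← t.lie_e_f, lie_lie_eq, form_comm f e, t.form_e_f, t.form_e_e]; simp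

lemma lie_h_f : ⁅h, f⁆ = (-2 : ℂ) • f := by
  rw [← t.lie_e_f, lie_lie_eq, t.form_e_f, t.form_f_f]; simp

lemma form_h_e : form h e = 0 := by
  rw [← t.lie_e_f, form_comm, form_lie_self]

lemma form_h_f : form h f = 0 := by
  rw [← t.lie_e_f, ← lie_skew, map_neg, LinearMap.neg_apply, form_comm, form_lie_self, neg_zero]

lemma form_h_h : form h h = 2 := by
  nth_rewrite 1 [← t.lie_e_f]
  rw [form_lie_left, ← lie_skew, t.lie_h_f]
  simp [t.form_e_f]

/-- Computing `⁅h, ⁅h, x⁆⁆` in two ways by `lie_lie_eq` yields the coordinates without a dimension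
count. -/
lemma expand (x : Sl2) : x = form f x • e + form e x • f + (form h x / 2) • h := by
  have h1 : ⁅h, x⁆ = (2 * form f x) • e - (2 * form e x) • f := by rw [← t.lie_e_f, lie_lie_eq]
  have h2 : ⁅h, ⁅h, x⁆⁆ = (4 * form f x) • e + (4 * form e x) • f := by
    rw [h1, lie_sub, lie_smul, lie_smul, t.lie_h_e, t.lie_h_f]
    module
  have h3 : ⁅h, ⁅h, x⁆⁆ = (4 : ℂ) • x - (2 * form h x) • h := by
    rw [← lie_skew, lie_lie_eq, t.form_h_h, form_comm x h]
    module
  have h4 : (4 : ℂ) • x = (4 : ℂ) • (form f x • e + form e x • f + (form h x / 2) • h) := by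
    linear_combination (norm := module) h2 - h3
  exact smul_right_injective Sl2 (by norm_num : (4 : ℂ) ≠ 0) h4

lemma ne_zero : h ≠ 0 ∧ e ≠ 0 ∧ f ≠ 0 := by
  refine ⟨?_, ?_, ?_⟩ <;> rintro rfl
  · simpa using t.form_h_h
  · simpa using t.form_e_f
  · simpa using t.form_e_f

lemma neg_swap : IsTriple (-h) f e :=
  ⟨t.form_f_f, t.form_e_e, by rw [form_comm, t.form_e_f], by rw [← lie_skew, t.lie_e_f]⟩

lemma rescale {s : ℂ} (hs : s ≠ 0) : IsTriple h (s • e) (s⁻¹ • f) where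
  form_e_e := by simp [t.form_e_e]
  form_f_f := by simp [t.form_f_f]
  form_e_f := by simp [t.form_e_f, hs]
  lie_e_f := by rw [smul_lie, lie_smul, t.lie_e_f, smul_smul, mul_inv_cancel₀ hs, one_smul]

lemma eq_smul_e {x : Sl2} (hx : ⁅h, x⁆ = (2 : ℂ) • x) : x = form f x • e := by
  have h1 : form h x = 0 := by
    have := form_lie_self h x
    rw [hx] at this
    simpa using this
  have h2 : form e x = 0 := by
    have := form_lie_left e h x
    rw [hx, ← lie_skew, t.lie_h_e] at this
    simp at this
    linear_combination -(1 / 4 : ℂ) * this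
  have := t.expand x
  rw [h1, h2] at this
  simpa using this

lemma eq_smul_f {x : Sl2} (hx : ⁅h, x⁆ = (-2 : ℂ) • x) : x = form e x • f := by
  have := t.neg_swap.eq_smul_e (x := x) (by rw [neg_lie, hx]; module)
  exact this

end IsTriple

/-- The form stays nondegenerate on the orthogonal complement of `h`. If a vector `a` there is
isotropic, one pairs it with some `y` in the complement, and one of `a + y`, `a - y` is anisotropic.
-/
lemma exists_orthogonal {h : Sl2} (hh : form h h = 2) : ∃ a, form h a = 0 ∧ form a a = 2 := by
  suffices H : ∃ a, form h a = 0 ∧ form a a ≠ 0 by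
    obtain ⟨a, h1, h2⟩ := H
    obtain ⟨s, hs⟩ := IsAlgClosed.exists_pow_nat_eq (2 / form a a) two_pos
    refine ⟨s • a, by simp [h1], ?_⟩
    simp only [map_smul, LinearMap.smul_apply, smul_eq_mul]
    rw [← mul_assoc, ← sq, hs]
    field_simp
  obtain ⟨z, hz⟩ := exists_not_smul h
  set a := z - (form h z / 2) • h with ha
  have ha0 : a ≠ 0 := fun h0 => hz _ (sub_eq_zero.mp h0)
  have hha : form h a = 0 := by simp [ha, hh]
  by_cases haa : form a a = 0
  · obtain ⟨y', hy'⟩ := exists_form_eq_one ha0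
    set y := y' - (form h y' / 2) • h with hy
    have hhy : form h y = 0 := by simp [hy, hh]
    have hay : form a y = 1 := by simp [hy, hy', form_comm a h, hha]
    have hya : form y a = 1 := by rw [form_comm, hay]
    by_cases h1 : form (a + y) (a + y) = 0
    · refine ⟨a - y, by simp [hha, hhy], fun h2 => ?_⟩
      simp [haa, hay, hya] at h1 h2
      have : (4 : ℂ) = 0 := by linear_combination h1 - h2
      norm_num at this
    · exact ⟨a + y, by simp [hha, hhy], h1⟩
  · exact ⟨a, hha, haa⟩

/-- Two orthogonal vectors of square length two give a triple. -/
lemma isTriple_of_orthogonal {h a : Sl2} (hh : form h h = 2) (ha : form a a = 2)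
    (hha : form h a = 0) :
    IsTriple h ((1 / 2 : ℂ) • a + (1 / 4 : ℂ) • ⁅h, a⁆)
      ((1 / 2 : ℂ) • a - (1 / 4 : ℂ) • ⁅h, a⁆) := by
  have h1 : form a ⁅h, a⁆ = 0 := by rw [← lie_skew, map_neg, form_lie_self, neg_zero]
  have h2 : form ⁅h, a⁆ a = 0 := by rw [form_comm, h1]
  have h3 : form ⁅h, a⁆ ⁅h, a⁆ = -8 := by
    rw [form_lie_left, ← lie_skew a ⁅h, a⁆, lie_lie_eq, ha, hha]
    simp [hh]; norm_num
  have h4 : ⁅⁅h, a⁆, a⁆ = (4 : ℂ) • h := by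
    rw [lie_lie_eq, ha, hha]; module
  refine ⟨?_, ?_, ?_, ?_⟩
  · simp [ha, h1, h2, h3]; norm_num
  · simp [ha, h1, h2, h3]; norm_num
  · simp [ha, h1, h2, h3]; norm_num
  · simp only [add_lie, lie_sub, smul_lie, lie_smul, lie_self]
    rw [← lie_skew a ⁅h, a⁆, h4]
    module

lemma exists_isTriple {h : Sl2} (hh : form h h = 2) : ∃ e f, IsTriple h e f := by
  obtain ⟨a, h1, h2⟩ := exists_orthogonal hh
  exact ⟨_, _, isTriple_of_orthogonal hh h2 h1⟩

/-! ### Automorphisms -/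

lemma aut_mul_apply (φ ψ : Sl2 ≃ₗ⁅ℂ⁆ Sl2) (x : Sl2) : (φ * ψ) x = φ (ψ x) := rfl
lemma eq_refl_of_forall {φ : Sl2 ≃ₗ⁅ℂ⁆ Sl2} (h : ∀ x, φ x = x) : φ = LieEquiv.refl :=
  LieEquiv.coe_injective (by ext1 x; exact h x)

/-- By `lie_lie_eq` the form is determined by the bracket: if its value on `x`, `y` changed under
`φ`, then `φ z` would be a multiple of `φ x` for every `z`. -/
lemma form_map (φ : Sl2 ≃ₗ⁅ℂ⁆ Sl2) (x y : Sl2) : form (φ x) (φ y) = form x y := by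
  obtain ⟨z, hz⟩ := exists_not_smul x
  have h1 := congrArg φ (lie_lie_eq z x y)
  rw [LieEquiv.map_lie, LieEquiv.map_lie, lie_lie_eq, map_sub, map_smul, map_smul] at h1
  by_contra hne
  have hne' : form (φ x) (φ y) - form x y ≠ 0 := sub_ne_zero.mpr hne
  refine hz ((form (φ x) (φ y) - form x y)⁻¹ * (form (φ z) (φ y) - form z y)) ?_
  apply φ.injective
  rw [map_smul, mul_smul, eq_inv_smul_iff₀ hne']
  have h2 : (2 : ℂ) • ((form (φ x) (φ y) - form x y) • φ z) =
      (2 : ℂ) • ((form (φ z) (φ y) - form z y) • φ x) := by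
    linear_combination (norm := module) h1
  exact smul_right_injective Sl2 (two_ne_zero (α := ℂ)) h2

lemma IsTriple.map {h e f : Sl2} (t : IsTriple h e f) (φ : Sl2 ≃ₗ⁅ℂ⁆ Sl2) :
    IsTriple (φ h) (φ e) (φ f) where
  form_e_e := by rw [form_map, t.form_e_e]
  form_f_f := by rw [form_map, t.form_f_f]
  form_e_f := by rw [form_map, t.form_e_f]
  lie_e_f := by rw [← LieEquiv.map_lie, t.lie_e_f]

/-- An automorphism fixing `h` scales `e` and `f` inversely. -/
lemma IsTriple.exists_smul_of_fixed {h e f : Sl2} (t : IsTriple h e f) {φ : Sl2 ≃ₗ⁅ℂ⁆ Sl2}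
    (hφ : φ h = h) : ∃ ζ : ℂ, ζ ≠ 0 ∧ φ e = ζ • e ∧ φ f = ζ⁻¹ • f := by
  have h1 := t.eq_smul_e (x := φ e) (by
    rw [← map_smul, ← t.lie_h_e, LieEquiv.map_lie, hφ])
  have h2 := t.eq_smul_f (x := φ f) (by
    rw [← map_smul, ← t.lie_h_f, LieEquiv.map_lie, hφ])
  have h3 := (t.map φ).form_e_f
  rw [h1, h2] at h3
  simp only [map_smul, LinearMap.smul_apply, smul_eq_mul, t.form_e_f, mul_one] at h3
  rw [mul_comm] at h3
  refine ⟨form f (φ e), left_ne_zero_of_mul_eq_one h3, h1, ?_⟩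
  rwa [← eq_inv_of_mul_eq_one_right h3]

/-- An automorphism negating `h` interchanges the lines of `e` and `f`. -/
lemma IsTriple.exists_smul_of_neg {h e f : Sl2} (t : IsTriple h e f) {φ : Sl2 ≃ₗ⁅ℂ⁆ Sl2}
    (hφ : φ h = -h) : ∃ c : ℂ, c ≠ 0 ∧ φ e = c • f ∧ φ f = c⁻¹ • e := by
  have h1 := t.eq_smul_f (x := φ e) (by
    rw [neg_smul, ← map_smul, ← t.lie_h_e, LieEquiv.map_lie, hφ, neg_lie, neg_neg])
  have h2 := t.eq_smul_e (x := φ f) (by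
    rw [← neg_neg (2 : ℂ), neg_smul, ← map_smul, ← t.lie_h_f, LieEquiv.map_lie, hφ, neg_lie,
      neg_neg])
  have h3 := (t.map φ).form_e_f
  rw [h1, h2] at h3
  simp only [map_smul, LinearMap.smul_apply, smul_eq_mul, form_comm f e, t.form_e_f,
    mul_one] at h3
  rw [mul_comm] at h3
  refine ⟨form e (φ e), left_ne_zero_of_mul_eq_one h3, h1, ?_⟩
  rwa [← eq_inv_of_mul_eq_one_right h3]

lemma IsTriple.aut_ext {h e f : Sl2} (t : IsTriple h e f) {φ ψ : Sl2 ≃ₗ⁅ℂ⁆ Sl2}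
    (he : φ e = ψ e) (hf : φ f = ψ f) : φ = ψ := by
  apply LieEquiv.coe_injective
  ext1 x
  rw [t.expand x]
  simp only [map_add, map_smul, he, hf]
  rw [← t.lie_e_f, LieEquiv.map_lie, LieEquiv.map_lie, he, hf]

lemma aut_ext_orthogonal {h a : Sl2} (hh : form h h = 2) (ha : form a a = 2)
    (hha : form h a = 0) {φ ψ : Sl2 ≃ₗ⁅ℂ⁆ Sl2} (h1 : φ h = ψ h) (h2 : φ a = ψ a) : φ = ψ :=
  (isTriple_of_orthogonal hh ha hha).aut_ext
    (by simp only [map_add, map_smul, LieEquiv.map_lie, h1, h2])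
    (by simp only [map_sub, map_smul, LieEquiv.map_lie, h1, h2])

/-- Vectors fixed by a nontrivial automorphism that fixes `h`. -/
lemma IsTriple.eq_smul_of_fixed {h e f : Sl2} (t : IsTriple h e f) {φ : Sl2 ≃ₗ⁅ℂ⁆ Sl2}
    (hφ : φ h = h) (hφ1 : ∃ y, φ y ≠ y) {x : Sl2} (hx : φ x = x) : x = (form h x / 2) • h := by
  obtain ⟨ζ, hζ0, he, hf⟩ := t.exists_smul_of_fixed hφ
  have hζ : ζ ≠ 1 := by
    rintro rfl
    obtain ⟨y, hy⟩ := hφ1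
    have := t.aut_ext (φ := φ) (ψ := LieEquiv.refl) (by simpa using he) (by simpa using hf)
    exact hy (congrArg (fun ψ => ψ y) this)
  have h1 : form f x = 0 := by
    have := form_map φ f x
    rw [hx, hf] at this
    simp only [map_smul, LinearMap.smul_apply, smul_eq_mul] at this
    have h2 : (ζ⁻¹ - 1) * form f x = 0 := by linear_combination this
    refine (mul_eq_zero.mp h2).resolve_left (sub_ne_zero.mpr ?_)
    simpa using hζ
  have h3 : form e x = 0 := by
    have := form_map φ e x
    rw [hx, he] at this
    simp only [map_smul, LinearMap.smul_apply, smul_eq_mul] at this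
    have h2 : (ζ - 1) * form e x = 0 := by linear_combination this
    exact (mul_eq_zero.mp h2).resolve_left (sub_ne_zero.mpr hζ)
  have := t.expand x
  rw [h1, h3] at this
  simpa using this

lemma exists_normalize {x : Sl2} (hx : form x x ≠ 0) :
    ∃ s : ℂ, s ≠ 0 ∧ form (s • x) (s • x) = 2 := by
  obtain ⟨s, hs⟩ := IsAlgClosed.exists_pow_nat_eq (2 / form x x) two_pos
  refine ⟨s, ?_, ?_⟩
  · rintro rfl
    rw [zero_pow two_ne_zero] at hs
    exact div_ne_zero two_ne_zero hx hs.symm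
  · simp only [map_smul, LinearMap.smul_apply, smul_eq_mul]
    rw [← mul_assoc, ← sq, hs]
    field_simp

/-- An automorphism of finite order fixes a semisimple element. -/
theorem exists_fixed {φ : Sl2 ≃ₗ⁅ℂ⁆ Sl2} (hφ : IsOfFinOrder φ) : ∃ h, φ h = h ∧ form h h = 2 := by
  have : Nontrivial Sl2 := by
    obtain ⟨z, hz⟩ := exists_not_smul 0
    exact ⟨z, 0, fun h => hz 0 (by simpa using h)⟩
  suffices H : ∃ h, φ h = h ∧ form h h ≠ 0 by
    obtain ⟨h, h1, h2⟩ := H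
    obtain ⟨s, -, hs⟩ := exists_normalize h2
    exact ⟨s • h, by rw [map_smul, h1], hs⟩
  obtain ⟨lam, hlam⟩ := Module.End.exists_eigenvalue ((φ : Sl2 →ₗ⁅ℂ⁆ Sl2) : Module.End ℂ Sl2)
  obtain ⟨w, hw⟩ := hlam.exists_hasEigenvector
  have hw1 : φ w = lam • w := hw.apply_eq_smul
  have hw0 : w ≠ 0 := hw.2
  have hlam0 : lam ≠ 0 := by
    rintro rfl
    rw [zero_smul] at hw1
    exact hw0 (φ.injective (hw1.trans (map_zero φ).symm))
  by_cases hww : form w w = 0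
  · obtain ⟨y, hy⟩ := exists_form_eq_one hw0
    obtain ⟨n, hn, hn1⟩ := hφ.exists_pow_eq_one
    have hpw : ∀ i : ℕ, (φ ^ i) w = lam ^ i • w := by
      intro i
      induction i with
      | zero => rw [pow_zero, pow_zero, one_smul]; rfl
      | succ i ih => rw [pow_succ, aut_mul_apply, hw1, map_smul, ih, smul_smul, pow_succ, mul_comm]
    have hlamn : lam ^ n = 1 := by
      have := hpw n
      rw [hn1] at this
      replace this : w = lam ^ n • w := this
      by_contra hne
      refine hw0 ((smul_eq_zero.mp (?_ : (lam ^ n - 1) • w = 0)).resolve_left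
        (sub_ne_zero.mpr hne))
      rw [sub_smul, one_smul, ← this, sub_self]
    have hnC : (n : ℂ) ≠ 0 := Nat.cast_ne_zero.mpr hn.ne'
    -- Averaging projects `y` to the eigenspace of `lam⁻¹` and keeps its pairing with `w`. The
    -- bracket of the two eigenvectors is fixed, and it is anisotropic.
    set Y : Sl2 := (n : ℂ)⁻¹ • ∑ i ∈ Finset.range n, lam ^ i • (φ ^ i) y with hY
    have hYφ : φ Y = lam⁻¹ • Y := by
      rw [eq_inv_smul_iff₀ hlam0, hY, map_smul, smul_comm, map_sum, Finset.smul_sum]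
      congr 1
      have h1 : ∀ i, lam • φ (lam ^ i • (φ ^ i) y) = lam ^ (i + 1) • (φ ^ (i + 1)) y := by
        intro i
        rw [map_smul, smul_smul, ← pow_succ', pow_succ' φ, aut_mul_apply]
      simp only [h1]
      rw [← sub_eq_zero, ← Finset.sum_sub_distrib, Finset.sum_range_sub (fun i => lam ^ i • (φ ^ i) y),
        hlamn, hn1]
      simp
    have hwY : form w Y = 1 := by
      have h1 : ∀ i ∈ Finset.range n, lam ^ i * form w ((φ ^ i) y) = 1 := by
        intro i _
        have := form_map (φ ^ i) w y
        rw [hpw, map_smul, LinearMap.smul_apply, smul_eq_mul, hy] at this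
        exact this
      simp only [hY, map_smul, map_sum, smul_eq_mul, Finset.sum_congr rfl h1]
      simp [hnC]
    refine ⟨⁅w, Y⁆, ?_, ?_⟩
    · rw [LieEquiv.map_lie, hw1, hYφ, smul_lie, lie_smul, smul_smul, mul_inv_cancel₀ hlam0,
        one_smul]
    · rw [form_lie_left, ← lie_skew Y, lie_lie_eq, hwY]
      simp [hww, hwY]
  · have hl2 : lam * lam = 1 := by
      have := form_map φ w w
      rw [hw1] at this
      simp only [map_smul, LinearMap.smul_apply, smul_eq_mul] at this
      exact mul_right_cancel₀ hww (by linear_combination this)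
    rcases mul_self_eq_one_iff.mp hl2 with rfl | rfl
    · exact ⟨w, by simpa using hw1, hww⟩
    -- For the eigenvalue `-1` the lines of `e` and `f` are interchanged, and a suitable sum of the
    -- two vectors is fixed.
    · obtain ⟨s, -, hs⟩ := exists_normalize hww
      obtain ⟨e, f, t⟩ := exists_isTriple hs
      obtain ⟨c, hc, he, hf⟩ := t.exists_smul_of_neg (φ := φ) (by
        rw [map_smul, hw1]; module)
      refine ⟨e + c • f, ?_, ?_⟩
      · rw [map_add, map_smul, he, hf, smul_smul, mul_inv_cancel₀ hc, one_smul, add_comm]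
      · simp [t.form_e_e, t.form_f_f, t.form_e_f, form_comm f e, hc]

end Sl2

/-! ## Groups of affine maps of the plane -/

/-- A finite group acting on `ℂ / L` through the affine maps `z ↦ a γ * z + b γ`, in such a way that
`P.lattice` is the orbit of the origin under the subgroup of translations, and every element is the
product of one fixing the origin and a translation. -/
structure AffineAction (L P : PeriodPair) (Γ : Type*) [Group Γ] where
  a : Γ →* ℂˣ
  b : Γ → ℂ
  b_mul : ∀ γ δ, b (γ * δ) - (a γ * b δ + b γ) ∈ L.lattice
  mul_mem : ∀ γ, ∀ l ∈ L.lattice, (a γ : ℂ) * l ∈ L.lattice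
  faithful : ∀ γ, a γ = 1 → b γ ∈ L.lattice → γ = 1
  mem_iff : ∀ z, z ∈ P.lattice ↔ ∃ k, a k = 1 ∧ z - b k ∈ L.lattice
  split : ∀ γ, ∃ g k, γ = g * k ∧ b g ∈ L.lattice ∧ a k = 1

namespace AffineAction

variable {L P : PeriodPair} {Γ : Type*} [Group Γ] (A : AffineAction L P Γ)

lemma b_one : A.b 1 ∈ L.lattice := by
  have h := A.b_mul 1 1
  simp only [mul_one, map_one, Units.val_one, one_mul] at h
  have := L.lattice.neg_mem h
  rwa [show -(A.b 1 - (A.b 1 + A.b 1)) = A.b 1 by ring] at this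

lemma b_mem {k : Γ} (hk : A.a k = 1) : A.b k ∈ P.lattice :=
  (A.mem_iff _).mpr ⟨k, hk, by simp⟩

lemma lattice_le (A : AffineAction L P Γ) : L.lattice ≤ P.lattice := fun l hl =>
  (A.mem_iff l).mpr ⟨1, map_one _, L.lattice.sub_mem hl A.b_one⟩

lemma b_mul_mem {γ δ : Γ} (hγ : A.b γ ∈ L.lattice) (hδ : A.b δ ∈ L.lattice) :
    A.b (γ * δ) ∈ L.lattice := by
  have := L.lattice.add_mem (A.b_mul γ δ) (L.lattice.add_mem (A.mul_mem γ _ hδ) hγ)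
  rwa [sub_add_cancel] at this

lemma b_inv_mem {γ : Γ} (hγ : A.b γ ∈ L.lattice) : A.b γ⁻¹ ∈ L.lattice := by
  have h1 := A.b_mul γ⁻¹ γ
  rw [inv_mul_cancel] at h1
  have h2 := L.lattice.sub_mem (L.lattice.sub_mem A.b_one h1) (A.mul_mem γ⁻¹ _ hγ)
  rwa [show A.b 1 - (A.b 1 - (↑(A.a γ⁻¹) * A.b γ + A.b γ⁻¹)) - ↑(A.a γ⁻¹) * A.b γ = A.b γ⁻¹ by
    ring] at h2

lemma b_conj {γ k : Γ} (hk : A.a k = 1) :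
    A.b (γ * k * γ⁻¹) - A.a γ * A.b k ∈ L.lattice := by
  have h1 := A.b_mul (γ * k) γ⁻¹
  have h2 := A.b_mul γ k
  have h3 := A.b_mul γ γ⁻¹
  rw [mul_inv_cancel] at h3
  rw [map_mul, hk, mul_one] at h1
  have h4 := L.lattice.add_mem (L.lattice.add_mem h1 h2)
    (L.lattice.sub_mem A.b_one h3)
  convert h4 using 1
  ring

/-- Translations form a normal subgroup, and conjugation by `γ` multiplies their vectors by `a γ`.
-/
lemma mul_mem_of_mem (γ : Γ) {z : ℂ} (hz : z ∈ P.lattice) : (A.a γ : ℂ) * z ∈ P.lattice := by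
  obtain ⟨k, hk, hzk⟩ := (A.mem_iff z).mp hz
  refine (A.mem_iff _).mpr ⟨γ * k * γ⁻¹, by simp [hk], ?_⟩
  have h1 := A.mul_mem γ _ hzk
  have h2 := L.lattice.sub_mem h1 (A.b_conj (γ := γ) hk)
  convert h2 using 1
  ring

lemma mul_mem_iff (γ : Γ) (z : ℂ) : (A.a γ : ℂ) * z ∈ P.lattice ↔ z ∈ P.lattice := by
  refine ⟨fun h => ?_, A.mul_mem_of_mem γ⟩
  have := A.mul_mem_of_mem γ⁻¹ h
  rwa [← mul_assoc, ← Units.val_mul, ← map_mul, inv_mul_cancel, map_one, Units.val_one,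
    one_mul] at this

/-- Here the splitting of `Γ` enters: the orbit of the origin under `Γ` is no larger than its orbit
under the translations. -/
lemma b_mem_lattice (γ : Γ) : A.b γ ∈ P.lattice := by
  obtain ⟨g, k, rfl, hg, hk⟩ := A.split γ
  have h1 := A.lattice_le (A.b_mul g k)
  have h2 := P.lattice.add_mem h1 (P.lattice.add_mem (A.mul_mem_of_mem g (A.b_mem hk))
    (A.lattice_le hg))
  rwa [sub_add_cancel] at h2

lemma apply_notMem (γ : Γ) {z : ℂ} (hz : z ∉ P.lattice) : (A.a γ : ℂ) * z + A.b γ ∉ P.lattice :=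
  P.add_notMem (fun h => hz ((A.mul_mem_iff γ z).mp h)) (A.b_mem_lattice γ)

lemma eq_of_b_sub_mem {k k' : Γ} (hk : A.a k = 1) (hk' : A.a k' = 1)
    (h : A.b k - A.b k' ∈ L.lattice) : k = k' := by
  rw [← mul_inv_eq_one]
  refine A.faithful _ (by simp [hk, hk']) ?_
  have h1 := A.b_mul k k'⁻¹
  have h2 := A.b_mul k' k'⁻¹
  rw [mul_inv_cancel] at h2
  simp only [hk, hk', Units.val_one, one_mul] at h1 h2
  have h3 := L.lattice.add_mem (L.lattice.sub_mem h1 h2) (L.lattice.add_mem h A.b_one)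
  convert h3 using 1
  ring

/-- Translations commute. -/
lemma mul_comm_of_a_eq_one {k k' : Γ} (hk : A.a k = 1) (hk' : A.a k' = 1) : k * k' = k' * k := by
  refine A.eq_of_b_sub_mem (by simp [hk, hk']) (by simp [hk, hk']) ?_
  have h1 := A.b_mul k k'
  have h2 := A.b_mul k' k
  simp only [hk, hk', Units.val_one, one_mul] at h1 h2
  convert L.lattice.sub_mem h1 h2 using 1
  ring

lemma b_pow {k : Γ} (hk : A.a k = 1) (n : ℕ) : A.b (k ^ n) - n * A.b k ∈ L.lattice := by
  induction n with
  | zero => simpa using A.b_one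
  | succ n ih =>
    have h1 := A.b_mul (k ^ n) k
    simp only [map_pow, hk, one_pow, Units.val_one, one_mul] at h1
    convert L.lattice.add_mem h1 ih using 1
    rw [pow_succ]
    push_cast
    ring

lemma conj_eq_iff {γ k k' : Γ} (hk : A.a k = 1) (hk' : A.a k' = 1) :
    γ * k * γ⁻¹ = k' ↔ (A.a γ : ℂ) * A.b k - A.b k' ∈ L.lattice := by
  have h1 := A.b_conj (γ := γ) hk
  constructor
  · rintro rfl
    simpa using L.lattice.neg_mem h1
  · intro h2
    refine A.eq_of_b_sub_mem (by simp [hk]) hk' ?_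
    simpa using L.lattice.add_mem h1 h2

/-! ### Characters -/

/-- The translation that represents a lattice point. -/
def translation (p : ℂ) : A.a.ker := by
  classical
  -- The value off `P.lattice` is immaterial.
  exact if h : ∃ k, A.a k = 1 ∧ p - A.b k ∈ L.lattice then ⟨h.choose, h.choose_spec.1⟩ else 1

lemma sub_translation_mem {p : ℂ} (hp : p ∈ P.lattice) :
    p - A.b (A.translation p) ∈ L.lattice := by
  have h := (A.mem_iff p).mp hp
  rw [translation, dif_pos h]
  exact h.choose_spec.2

lemma translation_eq {p : ℂ} {k : A.a.ker} (h : p - A.b k ∈ L.lattice) : A.translation p = k := by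
  have hp : p ∈ P.lattice := (A.mem_iff p).mpr ⟨k, k.2, h⟩
  refine Subtype.ext (A.eq_of_b_sub_mem (A.translation p).2 k.2 ?_)
  simpa using L.lattice.sub_mem h (A.sub_translation_mem hp)

lemma translation_b (k : A.a.ker) : A.translation (A.b k) = k := A.translation_eq (by simp)

lemma translation_add {p q : ℂ} (hp : p ∈ P.lattice) (hq : q ∈ P.lattice) :
    A.translation (p + q) = A.translation p * A.translation q := by
  refine A.translation_eq ?_
  have h1 := A.b_mul (A.translation p) (A.translation q)
  have h0 : A.a (A.translation p) = 1 := (A.translation p).2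
  rw [h0, Units.val_one, one_mul] at h1
  have h2 := L.lattice.sub_mem (L.lattice.add_mem (A.sub_translation_mem hp)
    (A.sub_translation_mem hq)) h1
  convert h2 using 1
  rw [Subgroup.coe_mul]
  ring

/-- The lattice character defined by a character of the group of translations. -/
def latticeCharacter (ζ : A.a.ker →* ℂˣ) (p : ℂ) : ℂ := ζ (A.translation p)

lemma isLatticeCharacter [Finite Γ] (ζ : A.a.ker →* ℂˣ) :
    P.IsLatticeCharacter (A.latticeCharacter ζ) where
  map_add p hp q hq := by
    simp only [latticeCharacter]
    rw [A.translation_add hp hq, map_mul, Units.val_mul]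
  norm_eq_one p hp := by
    have h1 : IsOfFinOrder (ζ (A.translation p)) := ζ.isOfFinOrder (isOfFinOrder_of_finite _)
    obtain ⟨n, hn, hn1⟩ := h1.exists_pow_eq_one
    refine Complex.norm_eq_one_of_pow_eq_one (n := n) ?_ hn.ne'
    simp only [latticeCharacter]
    rw [← Units.val_pow_eq_pow_val, hn1, Units.val_one]

lemma latticeCharacter_b (ζ : A.a.ker →* ℂˣ) (k : A.a.ker) :
    A.latticeCharacter ζ (A.b k) = ζ k := by
  rw [latticeCharacter, A.translation_b]

lemma latticeCharacter_eq_one (ζ : A.a.ker →* ℂˣ) {l : ℂ} (hl : l ∈ L.lattice) :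
    A.latticeCharacter ζ l = 1 := by
  rw [latticeCharacter, A.translation_eq (k := 1) (L.lattice.sub_mem hl A.b_one), map_one,
    Units.val_one]

theorem exists_isSemiElliptic [Finite Γ] {ζ : A.a.ker →* ℂˣ} {k : A.a.ker} (hk : ζ k ≠ 1) :
    ∃ f, P.IsSemiElliptic (A.latticeCharacter ζ) f ∧ LaurentLead f 1 1 := by
  refine PeriodPair.exists_isSemiElliptic A.lattice_le (fun k : A.a.ker => A.b k)
    (fun k => A.b_mem k.2) (fun p hp => ⟨A.translation p, A.sub_translation_mem hp, fun k hk =>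
      (A.translation_eq hk).symm⟩) (A.isLatticeCharacter ζ) (fun l => A.latticeCharacter_eq_one ζ)
    (A.b_mem k.2) ?_
  rw [latticeCharacter_b]
  exact fun h => hk (Units.ext h)

lemma map_add_b {ζ : A.a.ker →* ℂˣ} {f : ℂ → ℂ} (hf : P.IsSemiElliptic (A.latticeCharacter ζ) f)
    (k : A.a.ker) {z : ℂ} (hz : z ∉ P.lattice) : f (z + A.b k) = ζ k * f z := by
  rw [hf.map_add _ (A.b_mem k.2) z hz, A.latticeCharacter_b]

lemma map_add_lattice {ζ : A.a.ker →* ℂˣ} {f : ℂ → ℂ}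
    (hf : P.IsSemiElliptic (A.latticeCharacter ζ) f)
    {l : ℂ} (hl : l ∈ L.lattice) {z : ℂ} (hz : z ∉ P.lattice) : f (z + l) = f z := by
  rw [hf.map_add _ (A.lattice_le hl) z hz, A.latticeCharacter_eq_one ζ hl, one_mul]

end AffineAction

/-- The character by which a group acts on an invariant line. -/
lemma exists_lineCharacter {H : Type*} [Group H] (ρ : H →* (Sl2 ≃ₗ⁅ℂ⁆ Sl2)) {x : Sl2} (hx : x ≠ 0)
    (h : ∀ k, ∃ c : ℂ, ρ k x = c • x) :
    ∃ ζ : H →* ℂˣ, ∀ k, ρ k x = (ζ k : ℂ) • x := by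
  choose c hc using h
  have hone : c 1 = 1 := by
    have h1 := hc 1
    rw [map_one] at h1
    replace h1 : (1 : ℂ) • x = c 1 • x := by rw [one_smul]; exact h1
    exact (smul_left_injective ℂ hx h1).symm
  have hmul : ∀ k k', c (k * k') = c k * c k' := by
    intro k k'
    have h1 := hc (k * k')
    rw [map_mul, Sl2.aut_mul_apply, hc k', map_smul, hc k, smul_smul, mul_comm] at h1
    exact (smul_left_injective ℂ hx h1).symm
  let ζ : H →* ℂ := { toFun := c, map_one' := hone, map_mul' := hmul }
  refine ⟨ζ.toHomUnits, fun k => ?_⟩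
  rw [MonoidHom.coe_toHomUnits]
  exact hc k

/-! ## Covariant maps -/

/-- Functions that are analytic off `P.lattice`, meromorphic on it and periodic for `L.lattice`. -/
structure RegularOff (L P : PeriodPair) (g : ℂ → ℂ) : Prop where
  analyticAt : ∀ z ∉ P.lattice, AnalyticAt ℂ g z
  meromorphicAt : ∀ z, MeromorphicAt g z
  map_add : ∀ l ∈ L.lattice, ∀ z ∉ P.lattice, g (z + l) = g z

namespace RegularOff

variable {L P : PeriodPair} {g g' : ℂ → ℂ}

lemma add (h : RegularOff L P g) (h' : RegularOff L P g') :
    RegularOff L P (fun z => g z + g' z) where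
  analyticAt z hz := (h.analyticAt z hz).add (h'.analyticAt z hz)
  meromorphicAt z := (h.meromorphicAt z).add (h'.meromorphicAt z)
  map_add l hl z hz := by simp only [h.map_add l hl z hz, h'.map_add l hl z hz]

lemma mul (h : RegularOff L P g) (h' : RegularOff L P g') :
    RegularOff L P (fun z => g z * g' z) where
  analyticAt z hz := (h.analyticAt z hz).mul (h'.analyticAt z hz)
  meromorphicAt z := (h.meromorphicAt z).mul (h'.meromorphicAt z)
  map_add l hl z hz := by simp only [h.map_add l hl z hz, h'.map_add l hl z hz]

lemma const (c : ℂ) : RegularOff L P (fun _ => c) where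
  analyticAt _ _ := analyticAt_const
  meromorphicAt _ := MeromorphicAt.const c _
  map_add _ _ _ _ := rfl

end RegularOff

/-- Maps to `𝔰𝔩₂` all of whose coordinates are regular. -/
def RegularVecOff (L P : PeriodPair) (u : ℂ → Sl2) : Prop :=
  ∀ x, RegularOff L P (fun z => Sl2.form x (u z))

lemma Sl2.eq_of_form_eq {x y : Sl2} (h : ∀ z, Sl2.form z x = Sl2.form z y) : x = y := by
  by_contra hne
  obtain ⟨z, hz⟩ := Sl2.exists_form_eq_one (sub_ne_zero.mpr hne)
  rw [Sl2.form_comm, map_sub, h z, sub_self] at hz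
  exact zero_ne_one hz

namespace RegularVecOff

variable {L P : PeriodPair} {u v : ℂ → Sl2} {g : ℂ → ℂ}

lemma map_add (h : RegularVecOff L P u) {l : ℂ} (hl : l ∈ L.lattice) {z : ℂ} (hz : z ∉ P.lattice) :
    u (z + l) = u z := Sl2.eq_of_form_eq fun x => (h x).map_add l hl z hz

lemma add (h : RegularVecOff L P u) (h' : RegularVecOff L P v) :
    RegularVecOff L P (fun z => u z + v z) := fun x => by
  simpa only [_root_.map_add] using (h x).add (h' x)

lemma smul (hg : RegularOff L P g) (h : RegularVecOff L P u) :
    RegularVecOff L P (fun z => g z • u z) := fun x => by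
  simpa only [map_smul, smul_eq_mul] using hg.mul (h x)

lemma const (y : Sl2) : RegularVecOff L P (fun _ => y) := fun _ => RegularOff.const _

lemma form (h : RegularVecOff L P u) (h' : RegularVecOff L P v) :
    RegularOff L P (fun z => Sl2.form (u z) (v z)) := by
  -- The identity automorphism is used only to obtain some triple, in whose coordinates the form is
  -- bilinear.
  obtain ⟨k, -, hk⟩ := Sl2.exists_fixed (φ := (LieEquiv.refl : Sl2 ≃ₗ⁅ℂ⁆ Sl2))
    (isOfFinOrder_iff_pow_eq_one.mpr ⟨1, one_pos, rfl⟩)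
  obtain ⟨e, f, t⟩ := Sl2.exists_isTriple hk
  have h1 : (fun z => Sl2.form (u z) (v z)) = fun z => (Sl2.form f (u z) * Sl2.form e (v z) +
      Sl2.form e (u z) * Sl2.form f (v z)) + (1 / 2) * Sl2.form k (u z) * Sl2.form k (v z) := by
    funext z
    conv_lhs => rw [t.expand (u z)]
    simp only [_root_.map_add, LinearMap.add_apply, map_smul, LinearMap.smul_apply, smul_eq_mul]
    ring
  rw [h1]
  exact (((h f).mul (h' e)).add ((h e).mul (h' f))).add (((RegularOff.const (1 / 2)).mul (h k)).mul
    (h' k))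

end RegularVecOff

/-- Regular maps `u` with `u (γ z) = ψ γ • ρ γ (u z)`. -/
structure IsCovariant {L P : PeriodPair} {Γ : Type*} [Group Γ] (A : AffineAction L P Γ)
    (ρ : Γ →* (Sl2 ≃ₗ⁅ℂ⁆ Sl2)) (ψ : Γ →* ℂˣ) (u : ℂ → Sl2) : Prop where
  regular : RegularVecOff L P u
  map_smul : ∀ γ, ∀ z ∉ P.lattice, u (A.a γ * z + A.b γ) = (ψ γ : ℂ) • ρ γ (u z)

namespace AffineAction

variable {L P : PeriodPair} {Γ : Type*} [Group Γ] (A : AffineAction L P Γ)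

lemma isRegular_of_isSemiElliptic {ζ : A.a.ker →* ℂˣ} {g : ℂ → ℂ}
    (hg : P.IsSemiElliptic (A.latticeCharacter ζ) g) : RegularOff L P g where
  analyticAt := hg.analyticAt
  meromorphicAt := hg.meromorphicAt
  map_add _ hl _ hz := A.map_add_lattice hg hl hz

lemma isRegular_of_isElliptic (A : AffineAction L P Γ) {g : ℂ → ℂ} (hg : P.IsElliptic g) :
    RegularOff L P g where
  analyticAt := hg.analyticAt
  meromorphicAt := hg.meromorphicAt
  map_add l hl z hz := by simpa using hg.map_add l (A.lattice_le hl) z hz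

variable {ρ : Γ →* (Sl2 ≃ₗ⁅ℂ⁆ Sl2)}

lemma equivariant_mul {ψ : Γ →* ℂˣ} {u : ℂ → Sl2} (hu : RegularVecOff L P u) {γ δ : Γ}
    (hγ : ∀ z ∉ P.lattice, u (A.a γ * z + A.b γ) = (ψ γ : ℂ) • ρ γ (u z))
    (hδ : ∀ z ∉ P.lattice, u (A.a δ * z + A.b δ) = (ψ δ : ℂ) • ρ δ (u z)) :
    ∀ z ∉ P.lattice, u (A.a (γ * δ) * z + A.b (γ * δ)) = (ψ (γ * δ) : ℂ) • ρ (γ * δ) (u z) := by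
  intro z hz
  have h1 := A.apply_notMem γ (A.apply_notMem δ hz)
  have h2 := hu.map_add (A.b_mul γ δ) h1
  rw [hγ _ (A.apply_notMem δ hz), hδ z hz] at h2
  rw [map_mul, map_mul, map_mul, Sl2.aut_mul_apply]
  convert h2 using 1
  · congr 1
    push_cast
    ring
  · rw [map_smul, smul_smul, Units.val_mul]

/-- Regular maps that are equivariant for translations. -/
structure IsTranslationCovariant (ρ : Γ →* (Sl2 ≃ₗ⁅ℂ⁆ Sl2)) (u : ℂ → Sl2) : Prop where
  regular : RegularVecOff L P u
  map_add : ∀ k, A.a k = 1 → ∀ z ∉ P.lattice, u (z + A.b k) = ρ k (u z)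

variable {A} in
lemma IsTranslationCovariant.add {u v : ℂ → Sl2} (hu : A.IsTranslationCovariant ρ u)
    (hv : A.IsTranslationCovariant ρ v) : A.IsTranslationCovariant ρ (fun z => u z + v z) where
  regular := hu.regular.add hv.regular
  map_add k hk z hz := by rw [hu.map_add k hk z hz, hv.map_add k hk z hz, _root_.map_add]

lemma isTranslationCovariant_smul {ζ : A.a.ker →* ℂˣ} {g : ℂ → ℂ}
    (hg : P.IsSemiElliptic (A.latticeCharacter ζ) g) {x : Sl2}
    (hx : ∀ k : A.a.ker, ρ k x = (ζ k : ℂ) • x) :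
    A.IsTranslationCovariant ρ (fun z => g z • x) where
  regular := RegularVecOff.smul (A.isRegular_of_isSemiElliptic hg) (RegularVecOff.const x)
  map_add k hk z hz := by
    rw [A.map_add_b hg ⟨k, hk⟩ hz, _root_.map_smul, hx ⟨k, hk⟩, smul_smul, mul_comm]

lemma isTranslationCovariant_smul_of_fixed {g : ℂ → ℂ}
    (hg : P.IsElliptic g) {x : Sl2} (hx : ∀ k, A.a k = 1 → ρ k x = x) :
    A.IsTranslationCovariant ρ (fun z => g z • x) where
  regular := RegularVecOff.smul (A.isRegular_of_isElliptic hg) (RegularVecOff.const x)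
  map_add k hk z hz := by
    rw [hg.map_add _ (A.b_mem hk) z hz, _root_.map_smul, hx k hk, one_mul]

variable {A} in
-- Normality of the translations makes the `g`-translate of a solution a solution. This carries a
-- map along one axis to the other axes.
lemma IsTranslationCovariant.translate {u : ℂ → Sl2} (hu : A.IsTranslationCovariant ρ u)
    {g : Γ} : A.IsTranslationCovariant ρ (fun z => ρ g (u ((A.a g⁻¹ : ℂ) * z))) where
  regular x := by
    have hform : ∀ y, Sl2.form x (ρ g y) = Sl2.form (ρ g⁻¹ x) y := by
      intro y
      rw [← Sl2.form_map (ρ g⁻¹) x, ← Sl2.aut_mul_apply, ← map_mul, inv_mul_cancel, map_one]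
      rfl
    simp only [hform]
    have hr := hu.regular (ρ g⁻¹ x)
    have hne : ((A.a g⁻¹ : ℂ) : ℂ) ≠ 0 := Units.ne_zero _
    refine ⟨fun z hz => ?_, fun z => ?_, fun l hl z hz => ?_⟩
    · exact AnalyticAt.fun_comp (f := fun z => (A.a g⁻¹ : ℂ) * z)
        (hr.analyticAt _ (fun h => hz ((A.mul_mem_iff _ _).mp h)))
        (analyticAt_const.mul analyticAt_id)
    · exact MeromorphicAt.comp_analyticAt (g := fun z => (A.a g⁻¹ : ℂ) * z) (hr.meromorphicAt _)
        (analyticAt_const.mul analyticAt_id)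
    · rw [mul_add]
      exact hr.map_add _ (A.mul_mem _ l hl) _ (fun h => hz ((A.mul_mem_iff _ _).mp h))
  map_add k hk z hz := by
    have hz' : ((A.a g⁻¹ : ℂ) : ℂ) * z ∉ P.lattice := fun h => hz ((A.mul_mem_iff _ _).mp h)
    have h1 := A.b_conj (γ := g⁻¹) hk
    rw [inv_inv] at h1
    have hk' : A.a (g⁻¹ * k * g) = 1 := by simp [hk]
    have h2 := hu.map_add _ hk' _ hz'
    have h3 := hu.regular.map_add (L.lattice.neg_mem h1)
      (P.add_notMem hz' (A.b_mem hk'))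
    rw [h2] at h3
    rw [mul_add, show ((A.a g⁻¹ : ℂ) : ℂ) * z + (A.a g⁻¹ : ℂ) * A.b k =
      (A.a g⁻¹ : ℂ) * z + A.b (g⁻¹ * k * g) +
        -(A.b (g⁻¹ * k * g) - (A.a g⁻¹ : ℂ) * A.b k) by ring, h3,
      ← Sl2.aut_mul_apply, ← map_mul, ← Sl2.aut_mul_apply, ← map_mul]
    congr 2
    group

/-- Covariance follows from covariance for translations and for a cyclic complement. -/
lemma isCovariant_of_translation {ψ : Γ →* ℂˣ} {u : ℂ → Sl2} {g : Γ}
    (hu : A.IsTranslationCovariant ρ u) (hψ : ∀ k, A.a k = 1 → ψ k = 1)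
    (hg : A.b g ∈ L.lattice)
    (hgu : ∀ z ∉ P.lattice, u (A.a g * z) = (ψ g : ℂ) • ρ g (u z))
    (hG : ∀ γ, A.b γ ∈ L.lattice → ∃ n : ℕ, γ = g ^ n) : IsCovariant A ρ ψ u where
  regular := hu.regular
  map_smul γ := by
    have hK : ∀ k, A.a k = 1 → ∀ z ∉ P.lattice,
        u (A.a k * z + A.b k) = (ψ k : ℂ) • ρ k (u z) := by
      intro k hk z hz
      rw [hk, Units.val_one, one_mul, hu.map_add k hk z hz, hψ k hk, Units.val_one, one_smul]
    obtain ⟨γ', k, rfl, hγ', hk⟩ := A.split γ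
    refine A.equivariant_mul hu.regular ?_ (hK k hk)
    obtain ⟨n, rfl⟩ := hG γ' hγ'
    induction n with
    | zero => exact hK _ (by simp)
    | succ n ih =>
      have hb : ∀ m : ℕ, A.b (g ^ m) ∈ L.lattice := by
        intro m
        induction m with
        | zero => simpa using A.b_one
        | succ m ih => rw [pow_succ]; exact A.b_mul_mem ih hg
      have h1 := A.equivariant_mul hu.regular (ih (hb n)) (δ := g) (fun z hz => by
        rw [hu.regular.map_add hg (fun h => hz ((A.mul_mem_iff _ _).mp h)), hgu z hz])
      rwa [← pow_succ] at h1

end AffineAction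

/-! ### Moving frames -/

/-- A pair of covariant maps of opposite weights that complete to an `𝔰𝔩₂`-triple. -/
structure IsMovingFrame {L P : PeriodPair} {Γ : Type*} [Group Γ] (A : AffineAction L P Γ)
    (ρ : Γ →* (Sl2 ≃ₗ⁅ℂ⁆ Sl2)) (ψ : Γ →* ℂˣ) (e f : ℂ → Sl2) : Prop where
  left : IsCovariant A ρ ψ e
  right : IsCovariant A ρ ψ⁻¹ f
  isTriple : ∀ z ∉ P.lattice, Sl2.IsTriple ⁅e z, f z⁆ (e z) (f z)

lemma IsMovingFrame.swap {L P : PeriodPair} {Γ : Type*} [Group Γ] {A : AffineAction L P Γ}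
    {ρ : Γ →* (Sl2 ≃ₗ⁅ℂ⁆ Sl2)} {ψ : Γ →* ℂˣ} {e f : ℂ → Sl2} (h : IsMovingFrame A ρ ψ e f) :
    IsMovingFrame A ρ ψ⁻¹ f e where
  left := h.right
  right := by rw [show ψ⁻¹⁻¹ = ψ from MonoidHom.ext fun γ => inv_inv (ψ γ)]; exact h.left
  isTriple z hz := by
    have := (h.isTriple z hz).neg_swap
    rwa [lie_skew] at this

/-- It suffices to find covariant maps `e` and `y` with `e` isotropic and `form e y = 1`. -/
lemma exists_isMovingFrame_of_form {L P : PeriodPair} {Γ : Type*} [Group Γ] {A : AffineAction L P Γ}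
    {ρ : Γ →* (Sl2 ≃ₗ⁅ℂ⁆ Sl2)} {ψ : Γ →* ℂˣ} {e y : ℂ → Sl2} (he : IsCovariant A ρ ψ e)
    (hy : IsCovariant A ρ ψ⁻¹ y) (hee : ∀ z ∉ P.lattice, Sl2.form (e z) (e z) = 0)
    (hey : ∀ z ∉ P.lattice, Sl2.form (e z) (y z) = 1) :
    ∃ f, IsMovingFrame A ρ ψ e f := by
  -- Subtracting `form y y / 2` times `e` makes `y` isotropic without changing its pairing with `e`.
  -- The weight `ψ⁻¹` persists because `form y y` has weight `ψ⁻²`.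
  refine ⟨fun z => y z + (-(1 / 2) * Sl2.form (y z) (y z)) • e z, he, ⟨?_, fun γ z hz => ?_⟩,
    fun z hz => ⟨hee z hz, ?_, ?_, rfl⟩⟩
  · exact hy.regular.add (RegularVecOff.smul ((RegularOff.const _).mul (hy.regular.form hy.regular))
      he.regular)
  · rw [he.map_smul γ z hz, hy.map_smul γ z hz]
    simp only [map_smul, LinearMap.smul_apply, smul_eq_mul, Sl2.form_map, map_add, smul_add,
      smul_smul]
    congr 2
    have : (ψ γ : ℂ) ≠ 0 := Units.ne_zero _
    rw [MonoidHom.inv_apply, Units.val_inv_eq_inv_val]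
    field_simp
  · simp only [map_add, LinearMap.add_apply, map_smul, LinearMap.smul_apply, smul_eq_mul,
      hee z hz, hey z hz, Sl2.form_comm (y z) (e z)]
    ring
  · simp only [map_add, map_smul, smul_eq_mul, hee z hz, hey z hz]
    ring

/-- Otherwise the Weierstrass cubic would be `4 * x ^ 3`, without distinct roots. -/
lemma PeriodPair.g₂_ne_zero_or_g₃_ne_zero (P : PeriodPair) : P.g₂ ≠ 0 ∨ P.g₃ ≠ 0 := by
  by_contra! h
  obtain ⟨e₁, e₂, e₃, h12, -, -, hx⟩ := P.exists_cubic_roots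
  rw [h.1, h.2] at hx
  have h1 : e₁ = 0 := by simpa using hx e₁
  have h2 : e₂ = 0 := by simpa using hx e₂
  exact h12 (h1.trans h2.symm)

namespace AffineAction

variable {L P : PeriodPair} {Γ : Type*} [Group Γ] (A : AffineAction L P Γ)

lemma g₂_mul (γ : Γ) : P.g₂ * (A.a γ : ℂ) ^ 4 = P.g₂ := by
  have h0 : (A.a γ : ℂ) ≠ 0 := Units.ne_zero _
  have h := PeriodPair.g₂_homothety h0 (A.mul_mem_iff γ)
  rw [eq_div_iff (pow_ne_zero 4 h0)] at h
  exact h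

lemma g₃_mul (γ : Γ) : P.g₃ * (A.a γ : ℂ) ^ 6 = P.g₃ := by
  have h0 : (A.a γ : ℂ) ≠ 0 := Units.ne_zero _
  have h := PeriodPair.g₃_homothety h0 (A.mul_mem_iff γ)
  rw [eq_div_iff (pow_ne_zero 6 h0)] at h
  exact h

/-- Multiplication by `a γ` preserves `P.lattice` but scales `g₂` and `g₃` by its inverse fourth and
sixth powers. -/
lemma pow_four_or_pow_six_eq_one (γ : Γ) : A.a γ ^ 4 = 1 ∨ A.a γ ^ 6 = 1 := by
  rcases P.g₂_ne_zero_or_g₃_ne_zero with h | h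
  · left
    ext
    simpa [h] using A.g₂_mul γ
  · right
    ext
    simpa [h] using A.g₃_mul γ

end AffineAction

/-- The two units have the same order, one of 1, 2, 3, 4, 6. For each of these the primitive roots
of unity are a single pair of inverses: for orders 3, 4, 6 they are the roots of `x ^ 2 = c * x - 1`
with `c = -1, 0, 1`. -/
lemma eq_or_eq_inv_of_pow_eq_one_iff {w z : ℂˣ} (h : ∀ n : ℕ, w ^ n = 1 ↔ z ^ n = 1)
    (hw : w ^ 4 = 1 ∨ w ^ 6 = 1) : z = w ∨ z = w⁻¹ := by
  have key : ∀ c : ℂ, (w : ℂ) ^ 2 = c * w - 1 → (z : ℂ) ^ 2 = c * z - 1 → z = w ∨ z = w⁻¹ := by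
    intro c h1 h2
    have h3 : ((z : ℂ) - w) * ((z : ℂ) - ((w⁻¹ : ℂˣ) : ℂ)) = 0 := by
      have h4 : (w : ℂ) * ((w⁻¹ : ℂˣ) : ℂ) = 1 := by simp
      have hc : c = w + ((w⁻¹ : ℂˣ) : ℂ) := by
        have : (w : ℂ) ≠ 0 := Units.ne_zero _
        apply mul_right_cancel₀ this
        linear_combination -h1 - h4
      rw [hc] at h2
      linear_combination h2 + h4
    rcases mul_eq_zero.mp h3 with h4 | h4
    · exact Or.inl (Units.ext (sub_eq_zero.mp h4))
    · exact Or.inr (Units.ext (sub_eq_zero.mp h4))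
  have hC : ∀ (x : ℂˣ) (n : ℕ), x ^ n = 1 ↔ (x : ℂ) ^ n = 1 := fun x n => by
    rw [Units.ext_iff]; simp
  by_cases h1 : w ^ 1 = 1
  · have h2 := (h 1).mp h1
    rw [pow_one] at h1 h2
    rw [h1, h2]; simp
  have h1' := mt (h 1).mpr h1
  rw [hC, pow_one] at h1 h1'
  have sq : ∀ x : ℂ, x ≠ 1 → x ^ 2 = 1 → x = -1 := fun x hx hx2 =>
    (sq_eq_sq_iff_eq_or_eq_neg.mp (hx2.trans (one_pow 2).symm)).resolve_left hx
  by_cases h2 : w ^ 2 = 1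
  · have h2' := (h 2).mp h2
    rw [hC] at h2 h2'
    left
    ext
    rw [sq _ h1 h2, sq _ h1' h2']
  have h2' := mt (h 2).mpr h2
  rw [hC] at h2 h2'
  rcases hw with h4 | h6
  · have h4' := (h 4).mp h4
    rw [hC] at h4 h4'
    have a1 := sq _ h2 (by rw [← pow_mul]; exact h4)
    have a2 := sq _ h2' (by rw [← pow_mul]; exact h4')
    exact key 0 (by rw [a1]; ring) (by rw [a2]; ring)
  · have h6' := (h 6).mp h6
    by_cases h3 : w ^ 3 = 1
    · have h3' := (h 3).mp h3
      rw [hC] at h3 h3'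
      refine key (-1) ?_ ?_
      · exact mul_left_cancel₀ (sub_ne_zero.mpr h1) (by linear_combination h3)
      · exact mul_left_cancel₀ (sub_ne_zero.mpr h1') (by linear_combination h3')
    · have h3' := mt (h 3).mpr h3
      rw [hC] at h3 h3' h6 h6'
      have a1 := sq _ h3 (by rw [← pow_mul]; exact h6)
      have a2 := sq _ h3' (by rw [← pow_mul]; exact h6')
      have b : ∀ x : ℂ, x ^ 2 ≠ 1 → x ^ 3 = -1 → x ^ 2 = 1 * x - 1 := by
        intro x hx hx3
        have : x + 1 ≠ 0 := fun h0 => hx (by rw [eq_neg_of_add_eq_zero_left h0]; norm_num)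
        exact mul_left_cancel₀ this (by linear_combination hx3)
      exact key 1 (b _ h2 a1) (b _ h2' a2)

/-! ### The frame when there are no translations -/

namespace AffineAction

variable {L P : PeriodPair} {Γ : Type*} [Group Γ] (A : AffineAction L P Γ)
  {ρ : Γ →* (Sl2 ≃ₗ⁅ℂ⁆ Sl2)}

lemma eq_one_of_map_apply (hρ : Function.Injective ρ) {γ : Γ} (h : ∀ x, ρ γ x = x) : γ = 1 :=
  hρ ((Sl2.eq_refl_of_forall h).trans (map_one ρ).symm)

/-- Without translations the group is cyclic and a constant frame exists. -/
theorem exists_isMovingFrame_of_injective [Finite Γ] (hρ : Function.Injective ρ)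
    (ha : ∀ γ, A.a γ = 1 → γ = 1) : ∃ e f, IsMovingFrame A ρ A.a e f := by
  have hcyc : IsCyclic Γ := isCyclic_of_injective_ringHom ((Units.coeHom ℂ).comp A.a)
    ((injective_iff_map_eq_one _).mpr fun γ h => ha γ (Units.ext h))
  obtain ⟨g, hg⟩ := hcyc.exists_generator
  have hg' : ∀ γ, ∃ n : ℕ, g ^ n = γ := fun γ => mem_powers_iff_mem_zpowers.mpr (hg γ)
  obtain ⟨h, hgh, hh⟩ := Sl2.exists_fixed (ρ.isOfFinOrder (isOfFinOrder_of_finite g))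
  obtain ⟨e, f, t⟩ := Sl2.exists_isTriple hh
  have hfix : ∀ γ, ρ γ h = h := by
    intro γ
    obtain ⟨n, rfl⟩ := hg' γ
    induction n with
    | zero => rw [pow_zero, map_one]; rfl
    | succ n ih => rw [pow_succ, map_mul, Sl2.aut_mul_apply, hgh, ih]
  obtain ⟨ζ, hζ⟩ := exists_lineCharacter ρ t.ne_zero.2.1 (fun γ => by
    obtain ⟨c, -, hc, -⟩ := t.exists_smul_of_fixed (hfix γ)
    exact ⟨c, hc⟩)
  have hζf : ∀ γ, ρ γ f = ((ζ γ)⁻¹ : ℂˣ) • f := by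
    intro γ
    obtain ⟨c, hc0, hc, hc'⟩ := t.exists_smul_of_fixed (hfix γ)
    rw [hζ γ] at hc
    have : (ζ γ : ℂ) = c := smul_left_injective ℂ t.ne_zero.2.1 hc
    rw [hc', ← this, Units.smul_def, Units.val_inv_eq_inv_val]
  have frame : IsMovingFrame A ρ ζ⁻¹ (fun _ => e) (fun _ => f) := by
    refine ⟨⟨RegularVecOff.const e, fun γ z _ => ?_⟩, ⟨RegularVecOff.const f, fun γ z _ => ?_⟩,
      fun z _ => by rw [t.lie_e_f]; exact t⟩
    · rw [hζ γ, smul_smul, MonoidHom.inv_apply, ← Units.val_mul, inv_mul_cancel, Units.val_one,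
        one_smul]
    · rw [hζf γ, MonoidHom.inv_apply, MonoidHom.inv_apply, inv_inv, Units.smul_def, smul_smul,
        ← Units.val_mul, mul_inv_cancel, Units.val_one, one_smul]
  have hker : ∀ γ, ζ γ = 1 → γ = 1 := by
    intro γ h1
    refine eq_one_of_map_apply hρ fun x => ?_
    have := t.aut_ext (φ := ρ γ) (ψ := LieEquiv.refl) (by rw [hζ, h1]; simp)
      (by rw [hζf, h1]; simp)
    exact congrArg (fun φ => φ x) this
  have hext : ∀ ξ : Γ →* ℂˣ, ξ g = A.a g → ξ = A.a := by
    intro ξ h1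
    refine MonoidHom.ext fun γ => ?_
    obtain ⟨n, rfl⟩ := hg' γ
    rw [map_pow, map_pow, h1]
  -- Both characters are injective, so their values at the generator have equal order and agree up
  -- to inversion. Interchanging `e` and `f` inverts the weight of the frame.
  rcases eq_or_eq_inv_of_pow_eq_one_iff (w := A.a g) (z := ζ g) (fun n => by
    rw [← map_pow, ← map_pow]
    exact ⟨fun h => by rw [ha _ h, map_one], fun h => by rw [hker _ h, map_one]⟩)
    (A.pow_four_or_pow_six_eq_one g) with h1 | h1
  · have := frame.swap
    rw [hext ζ⁻¹⁻¹ (by simpa using h1)] at this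
    exact ⟨_, _, this⟩
  · rw [hext ζ⁻¹ (by simp [h1])] at frame
    exact ⟨_, _, frame⟩

end AffineAction

namespace Sl2

lemma IsTriple.form_smul_add {h e f : Sl2} (t : IsTriple h e f) (a b c a' b' c' : ℂ) :
    form (a • h + b • e + c • f) (a' • h + b' • e + c' • f) = 2 * a * a' + b * c' + c * b' := by
  simp only [map_add, LinearMap.add_apply, map_smul, LinearMap.smul_apply, smul_eq_mul, t.form_h_h,
    t.form_h_e, t.form_h_f, t.form_e_e, t.form_f_f, t.form_e_f, form_comm e h, form_comm f h,
    form_comm f e]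
  ring

lemma eq_or_eq_neg_of_fixed {h : Sl2} (hh : form h h = 2) {φ : Sl2 ≃ₗ⁅ℂ⁆ Sl2} (hφ : φ h = h)
    (hφ1 : ∃ y, φ y ≠ y) {x : Sl2} (hx : φ x = x) (hxx : form x x = 2) : x = h ∨ x = -h := by
  obtain ⟨e, f, t⟩ := exists_isTriple hh
  have h1 := t.eq_smul_of_fixed hφ hφ1 hx
  set c := form h x / 2
  rw [h1] at hxx
  simp only [map_smul, LinearMap.smul_apply, smul_eq_mul, hh] at hxx
  have h2 : c * c = 1 := by linear_combination hxx / 2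
  rcases mul_self_eq_one_iff.mp h2 with h3 | h3
  · left; rw [h1, h3, one_smul]
  · right; rw [h1, h3, neg_one_smul]

end Sl2

/-! ### The frame when all translations fix a common axis -/

namespace AffineAction

variable {L P : PeriodPair} {Γ : Type*} [Group Γ] (A : AffineAction L P Γ)
  {ρ : Γ →* (Sl2 ≃ₗ⁅ℂ⁆ Sl2)}

lemma exists_map_apply_ne (hρ : Function.Injective ρ) {γ : Γ} (h : γ ≠ 1) : ∃ y, ρ γ y ≠ y := by
  by_contra! h1
  exact h (eq_one_of_map_apply hρ h1)

lemma b_pow_mem {g : Γ} (hg : A.b g ∈ L.lattice) (n : ℕ) : A.b (g ^ n) ∈ L.lattice := by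
  induction n with
  | zero => simpa using A.b_one
  | succ n ih => rw [pow_succ]; exact A.b_mul_mem ih hg

lemma a_mul_sub_mem_of_commute {g k : Γ} (hk : A.a k = 1) (h : g * k = k * g) :
    (A.a g : ℂ) * A.b k - A.b k ∈ L.lattice :=
  (A.conj_eq_iff hk hk).mp (by rw [h, mul_inv_cancel_right])

/-- An element that fixes the origin and commutes with all translations has trivial linear part,
if all of them fix a common semisimple vector. -/
lemma a_eq_one_of_fixed [Finite Γ] (hρ : Function.Injective ρ) {h : Sl2} (hh : Sl2.form h h = 2)
    (hK : ∀ k, A.a k = 1 → ρ k h = h) (hK1 : ∃ k, A.a k = 1 ∧ k ≠ 1) {g : Γ}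
    (hg : A.b g ∈ L.lattice) (hgh : ρ g h = h) : A.a g = 1 := by
  obtain ⟨k, hk, hk1⟩ := hK1
  obtain ⟨e, f, t⟩ := Sl2.exists_isTriple hh
  obtain ⟨z, hz0, hze, hzf⟩ := t.exists_smul_of_fixed hgh
  obtain ⟨w, hw0, hwe, hwf⟩ := t.exists_smul_of_fixed (hK k hk)
  -- Both elements are diagonal in the triple, hence commute. The aim is to show that `k` is a power
  -- of `g`: it then fixes the origin and is trivial, a contradiction.
  have hcomm : g * k = k * g := hρ (t.aut_ext
    (by rw [map_mul, map_mul, Sl2.aut_mul_apply, Sl2.aut_mul_apply, hze, hwe, map_smul, map_smul,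
      hze, hwe, smul_smul, smul_smul, mul_comm])
    (by rw [map_mul, map_mul, Sl2.aut_mul_apply, Sl2.aut_mul_apply, hzf, hwf, map_smul, map_smul,
      hzf, hwf, smul_smul, smul_smul, mul_comm]))
  by_contra hne
  set N := orderOf (A.a g) with hN
  have hN0 : 0 < N := (A.a.isOfFinOrder (isOfFinOrder_of_finite g)).orderOf_pos
  have hpow : ∀ (γ : Γ) (c : ℂ), ρ γ e = c • e → ∀ n : ℕ, ρ (γ ^ n) e = c ^ n • e := by
    intro γ c hc n
    induction n with
    | zero => rw [pow_zero, pow_zero, map_one, one_smul]; rfl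
    | succ n ih => rw [pow_succ, map_mul, Sl2.aut_mul_apply, hc, map_smul, ih, smul_smul, pow_succ']
  have hpowf : ∀ (γ : Γ) (c : ℂ), ρ γ f = c • f → ∀ n : ℕ, ρ (γ ^ n) f = c ^ n • f := by
    intro γ c hc n
    induction n with
    | zero => rw [pow_zero, pow_zero, map_one, one_smul]; rfl
    | succ n ih => rw [pow_succ, map_mul, Sl2.aut_mul_apply, hc, map_smul, ih, smul_smul, pow_succ']
  have hzpow : ∀ n : ℕ, z ^ n = 1 ↔ g ^ n = 1 := by
    intro n
    have h1 := hpow g z hze n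
    have h2 := hpowf g z⁻¹ hzf n
    constructor
    · intro h3
      rw [h3, one_smul] at h1
      rw [inv_pow, h3, inv_one, one_smul] at h2
      refine hρ (t.aut_ext ?_ ?_)
      · rw [h1, map_one]; rfl
      · rw [h2, map_one]; rfl
    · intro h3
      rw [h3, map_one] at h1
      have h1' : (1 : ℂ) • e = z ^ n • e := by rw [one_smul]; exact h1
      exact (smul_left_injective ℂ t.ne_zero.2.1 h1').symm
  have hgpow : ∀ n : ℕ, g ^ n = 1 ↔ A.a g ^ n = 1 := by
    intro n
    rw [← map_pow]
    exact ⟨fun h => by rw [h, map_one], fun h => A.faithful _ h (A.b_pow_mem hg n)⟩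
  have hprim : IsPrimitiveRoot z N := by
    refine ⟨(hzpow N).mpr ((hgpow N).mpr (pow_orderOf_eq_one _)), fun l hl => ?_⟩
    exact orderOf_dvd_of_pow_eq_one ((hgpow l).mp ((hzpow l).mp hl))
  have hkN : k ^ N = 1 := by
    refine A.faithful _ (by rw [map_pow, hk, one_pow]) ?_
    have h1 := A.a_mul_sub_mem_of_commute hk hcomm
    have h2 : ∀ i : ℕ, (A.a g : ℂ) ^ i * A.b k - A.b k ∈ L.lattice := by
      intro i
      induction i with
      | zero => simp
      | succ i ih =>
        have := L.lattice.add_mem (A.mul_mem g _ ih) h1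
        convert this using 1
        ring
    -- Every power of `a g` fixes `b k` modulo `L`, while these powers sum to zero. Hence `N * b k`
    -- lies in `L` and `k ^ N = 1`.
    have h3 : ∑ i ∈ Finset.range N, ((A.a g : ℂ) ^ i * A.b k - A.b k) ∈ L.lattice :=
      Submodule.sum_mem _ fun i _ => h2 i
    have h4 : ∑ i ∈ Finset.range N, (A.a g : ℂ) ^ i = 0 := by
      have h5 := geom_sum_mul (A.a g : ℂ) N
      rw [← Units.val_pow_eq_pow_val, hN, pow_orderOf_eq_one, Units.val_one, sub_self] at h5
      exact (mul_eq_zero.mp h5).resolve_right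
        (sub_ne_zero.mpr fun h => hne (Units.ext h))
    rw [Finset.sum_sub_distrib, ← Finset.sum_mul, h4, zero_mul] at h3
    simp only [Finset.sum_const, Finset.card_range, nsmul_eq_mul, zero_sub] at h3
    have := L.lattice.add_mem (A.b_pow hk N) (L.lattice.neg_mem h3)
    simpa using this
  have hwN : w ^ N = 1 := by
    have h1 := hpow k w hwe N
    rw [hkN, map_one] at h1
    have h1' : (1 : ℂ) • e = w ^ N • e := by rw [one_smul]; exact h1
    exact (smul_left_injective ℂ t.ne_zero.2.1 h1').symm
  -- The eigenvalue of `k` is an `N`-th root of unity and that of `g` is a primitive one.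
  obtain ⟨i, -, hi⟩ := (haveI : NeZero N := ⟨hN0.ne'⟩; hprim.eq_pow_of_pow_eq_one hwN)
  have hkg : k = g ^ i := by
    refine hρ (t.aut_ext ?_ ?_)
    · rw [hwe, hpow g z hze, hi]
    · rw [hwf, hpowf g z⁻¹ hzf, inv_pow, hi]
  exact hk1 (A.faithful k hk (hkg ▸ A.b_pow_mem hg i))

end AffineAction

namespace AffineAction

variable {L P : PeriodPair} {Γ : Type*} [Group Γ] (A : AffineAction L P Γ)
  {ρ : Γ →* (Sl2 ≃ₗ⁅ℂ⁆ Sl2)}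

/-- By normality of the translations `ρ γ h` is fixed by `ρ k`, whose fixed vectors form the line of
`h`; its square length leaves only the sign. -/
lemma map_apply_eq_or_neg (hρ : Function.Injective ρ) {h : Sl2} (hh : Sl2.form h h = 2)
    (hK : ∀ k, A.a k = 1 → ρ k h = h) (hK1 : ∃ k, A.a k = 1 ∧ k ≠ 1) (γ : Γ) :
    ρ γ h = h ∨ ρ γ h = -h := by
  obtain ⟨k, hk, hk1⟩ := hK1
  refine Sl2.eq_or_eq_neg_of_fixed hh (hK k hk) (exists_map_apply_ne hρ hk1) ?_
    (by rw [Sl2.form_map, hh])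
  rw [← Sl2.aut_mul_apply, ← map_mul, show k * γ = γ * (γ⁻¹ * k * γ) by group, map_mul,
    Sl2.aut_mul_apply, hK (γ⁻¹ * k * γ) (by simp [hk])]

lemma latticeCharacter_neg [Finite Γ] (ζ : A.a.ker →* ℂˣ) {p : ℂ} (hp : p ∈ P.lattice) :
    A.latticeCharacter ζ (-p) = A.latticeCharacter ζ⁻¹ p := by
  rw [(A.isLatticeCharacter ζ).map_neg hp, latticeCharacter, latticeCharacter,
    MonoidHom.inv_apply, Units.val_inv_eq_inv_val]

/-- When a semisimple vector is fixed by all translations, elements fixing the origin that act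
nontrivially on it form at most one class. -/
lemma exists_adapted_triple [Finite Γ] (hρ : Function.Injective ρ) {h : Sl2}
    (hh : Sl2.form h h = 2) (hK : ∀ k, A.a k = 1 → ρ k h = h) (hK1 : ∃ k, A.a k = 1 ∧ k ≠ 1) :
    ∃ e f g, Sl2.IsTriple h e f ∧ A.b g ∈ L.lattice ∧
      (∀ γ, A.b γ ∈ L.lattice → ∃ n : ℕ, γ = g ^ n) ∧
      (g = 1 ∨ ((A.a g : ℂ) = -1 ∧ ρ g h = -h ∧ ρ g e = f ∧ ρ g f = e)) := by
  obtain ⟨e, f, t⟩ := Sl2.exists_isTriple hh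
  have hone : ∀ γ, A.b γ ∈ L.lattice → ρ γ h = h → γ = 1 := fun γ hγ hγh =>
    A.faithful γ (A.a_eq_one_of_fixed hρ hh hK hK1 hγ hγh) hγ
  by_cases H : ∀ γ, A.b γ ∈ L.lattice → ρ γ h = h
  · exact ⟨e, f, 1, t, A.b_one, fun γ hγ => ⟨0, (hone γ hγ (H γ hγ)).trans (pow_zero 1).symm⟩, Or.inl rfl⟩
  push Not at H
  obtain ⟨g, hg, hgh'⟩ := H
  have hgh := (A.map_apply_eq_or_neg hρ hh hK hK1 g).resolve_left hgh'
  obtain ⟨c, hc, hce, hcf⟩ := t.exists_smul_of_neg hgh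
  -- With `s ^ 2 = c⁻¹`, rescaling to `s • e` and `s⁻¹ • f` makes `ρ g` interchange them exactly.
  obtain ⟨s, hs⟩ := IsAlgClosed.exists_pow_nat_eq c⁻¹ two_pos
  have hs0 : s ≠ 0 := by
    rintro rfl
    rw [zero_pow two_ne_zero] at hs
    exact inv_ne_zero hc hs.symm
  -- The product of two elements negating `h` and fixing the origin fixes both, so it is trivial.
  -- Hence there is only one such element, an involution.
  have hneg : ∀ γ, A.b γ ∈ L.lattice → ρ γ h = -h → γ * g = 1 := fun γ hγ hγh =>
    hone _ (A.b_mul_mem hγ hg) (by rw [map_mul, Sl2.aut_mul_apply, hgh, map_neg, hγh, neg_neg])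
  have hgg := hneg g hg hgh
  refine ⟨s • e, s⁻¹ • f, g, t.rescale hs0, hg, fun γ hγ => ?_, Or.inr ⟨?_, hgh, ?_, ?_⟩⟩
  · rcases A.map_apply_eq_or_neg hρ hh hK hK1 γ with h1 | h1
    · exact ⟨0, (hone γ hγ h1).trans (pow_zero g).symm⟩
    · exact ⟨1, by rw [pow_one]; exact mul_right_cancel ((hneg γ hγ h1).trans hgg.symm)⟩
  · have h1 : (A.a g : ℂ) * A.a g = 1 := by rw [← Units.val_mul, ← map_mul, hgg, map_one]; rfl
    refine (mul_self_eq_one_iff.mp h1).resolve_left fun h2 => ?_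
    have := A.faithful g (Units.ext h2) hg
    rw [this, map_one] at hgh'
    exact hgh' rfl
  · rw [map_smul, hce, smul_smul]
    congr 1
    field_simp
    rw [hs, inv_mul_cancel₀ hc]
  · rw [map_smul, hcf, smul_smul]
    congr 1
    field_simp
    rw [hs, inv_mul_cancel₀ hc]

/-- The frame when translations exist and fix a common semisimple vector. -/
theorem exists_isMovingFrame_of_fixed [Finite Γ] (hρ : Function.Injective ρ) {h : Sl2}
    (hh : Sl2.form h h = 2) (hK : ∀ k, A.a k = 1 → ρ k h = h) (hK1 : ∃ k, A.a k = 1 ∧ k ≠ 1) :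
    ∃ e f, IsMovingFrame A ρ A.a e f := by
  obtain ⟨e, f, g, t, hg, hG, hgt⟩ := A.exists_adapted_triple hρ hh hK hK1
  obtain ⟨ζ, hζ'⟩ := exists_lineCharacter (ρ.comp A.a.ker.subtype) t.ne_zero.2.1 (fun k => by
    obtain ⟨c, -, hc, -⟩ := t.exists_smul_of_fixed (hK k k.2)
    exact ⟨c, hc⟩)
  have hζ : ∀ k : A.a.ker, ρ k e = (ζ k : ℂ) • e := hζ'
  have hζf : ∀ k : A.a.ker, ρ k f = (ζ⁻¹ k : ℂˣ) • f := by
    intro k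
    obtain ⟨c, hc0, hc, hc'⟩ := t.exists_smul_of_fixed (hK k k.2)
    rw [hζ k] at hc
    have : (ζ k : ℂ) = c := smul_left_injective ℂ t.ne_zero.2.1 hc
    rw [hc', ← this, Units.smul_def, MonoidHom.inv_apply, Units.val_inv_eq_inv_val]
  obtain ⟨k, hk, hk1⟩ := hK1
  have hζk : ζ ⟨k, hk⟩ ≠ 1 := fun h1 => hk1 (hρ (t.aut_ext
    (by rw [hζ ⟨k, hk⟩, h1, map_one]; exact one_smul ℂ e)
    (by rw [hζf ⟨k, hk⟩, MonoidHom.inv_apply, h1, map_one, inv_one]; exact one_smul ℂˣ f)))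
  obtain ⟨F, hF, hF1⟩ := A.exists_isSemiElliptic hζk
  obtain ⟨v, x₀, m, s, hv, hm, hvv, hvF⟩ := hF.exists_double_zero (A.isLatticeCharacter ζ) hF1
  have hneg : ∀ {w : ℂ → ℂ}, P.IsSemiElliptic (A.latticeCharacter ζ) w →
      P.IsSemiElliptic (A.latticeCharacter ζ⁻¹) (fun z => w (-z)) := fun hw =>
    hw.neg_arg.congr_char fun p hp => A.latticeCharacter_neg ζ hp
  have hu : P.IsElliptic (fun z => P.weierstrassP z - x₀) :=
    P.isElliptic_weierstrassP.sub (.const x₀)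
  have hcov : ∀ {p q r : ℂ → ℂ}, P.IsElliptic p → P.IsSemiElliptic (A.latticeCharacter ζ) q →
      P.IsSemiElliptic (A.latticeCharacter ζ⁻¹) r →
      A.IsTranslationCovariant ρ (fun z => p z • h + q z • e + r z • f) := fun hp hq hr =>
    ((A.isTranslationCovariant_smul_of_fixed hp hK).add (A.isTranslationCovariant_smul hq hζ)).add
      (A.isTranslationCovariant_smul hr hζf)
  -- The isotropic map is `(℘ - x₀) h + v z e - v (-z) f`, with square length `2 (℘ - x₀) ^ 2 - 2 v
  -- z * v (-z) = 0`. The coefficients of its partner are chosen so that the mixed relation between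
  -- `v` and `F` makes the pairing `1`.
  have he := hcov hu hv ((hneg hv).const_mul (-1))
  have hy := hcov (.const (-(s / (2 * m)))) (hF.const_mul (-m⁻¹)) ((hneg hF).const_mul m⁻¹)
  -- The element `g` changes the sign of the argument, negates `h` and interchanges `e` and `f`.
  -- Under these parity conditions the total effect is the factor `-1`, the value of both `a` and
  -- `a⁻¹` at `g`.
  have hgcov : ∀ {p q r : ℂ → ℂ} {ψ : Γ →* ℂˣ}, (∀ γ, ψ γ = A.a γ ∨ ψ γ = (A.a γ)⁻¹) →
      (∀ z ∉ P.lattice, p (-z) = p z ∧ q (-z) = - r z) →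
      A.IsTranslationCovariant ρ (fun z => p z • h + q z • e + r z • f) →
      IsCovariant A ρ ψ (fun z => p z • h + q z • e + r z • f) := by
    intro p q r ψ hψ hpqr hc
    refine A.isCovariant_of_translation hc (fun k hk => ?_) hg (fun z hz => ?_) hG
    · rcases hψ k with h1 | h1 <;> simp [h1, hk]
    · rcases hgt with rfl | ⟨hag, hgh, hge, hgf⟩
      · rw [map_one, map_one, map_one, Units.val_one, one_mul, one_smul]; rfl
      · have h1 : (ψ g : ℂ) = -1 := by
          rcases hψ g with h1 | h1
          · rw [h1, hag]
          · rw [h1, Units.val_inv_eq_inv_val, hag, inv_neg_one]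
        have h2 := (hpqr _ (P.neg_notMem hz)).2
        rw [neg_neg] at h2
        rw [hag, h1, neg_one_mul, (hpqr z hz).1, (hpqr z hz).2, show r (-z) = -q z by rw [h2, neg_neg]]
        simp only [map_add, map_smul, hgh, hge, hgf]
        module
  have he' := hgcov (ψ := A.a) (fun γ => Or.inl rfl) (fun z hz => ⟨by simp, by simp⟩) he
  have hy' := hgcov (ψ := A.a⁻¹) (fun γ => Or.inr rfl) (fun z hz => ⟨rfl, by simp⟩) hy
  obtain ⟨f', hf'⟩ := exists_isMovingFrame_of_form he' hy' (fun z hz => by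
      rw [t.form_smul_add]
      linear_combination -2 * hvv z hz) (fun z hz => by
      rw [t.form_smul_add]
      have := hvF z hz
      field_simp
      linear_combination this)
  exact ⟨_, f', hf'⟩

end AffineAction

lemma Sl2.eq_zero_of_eq_neg {x : Sl2} (h : x = -x) : x = 0 := by
  have h1 : (2 : ℂ) • x = 0 := by
    rw [two_smul]
    nth_rewrite 2 [h]
    exact add_neg_cancel x
  exact (smul_eq_zero.mp h1).resolve_left two_ne_zero

/-! ### Translations acting as a Klein four-group of half turns -/

namespace AffineAction

variable {L P : PeriodPair} {Γ : Type*} [Group Γ] (A : AffineAction L P Γ)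
  {ρ : Γ →* (Sl2 ≃ₗ⁅ℂ⁆ Sl2)}

/-- Two translations acting as the half turns about two orthogonal axes. -/
structure IsKlein (ρ : Γ →* (Sl2 ≃ₗ⁅ℂ⁆ Sl2)) (k₁ k₂ : Γ) (h₁ h₂ : Sl2) : Prop where
  a_left : A.a k₁ = 1
  a_right : A.a k₂ = 1
  form_left : Sl2.form h₁ h₁ = 2
  form_right : Sl2.form h₂ h₂ = 2
  form_orthogonal : Sl2.form h₁ h₂ = 0
  left_left : ρ k₁ h₁ = h₁
  left_right : ρ k₁ h₂ = -h₂
  right_left : ρ k₂ h₁ = -h₁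
  right_right : ρ k₂ h₂ = h₂

lemma map_apply_eq_of_commute (hρ : Function.Injective ρ) {h : Sl2} (hh : Sl2.form h h = 2) {k : Γ}
    (hk1 : k ≠ 1) (hk : ρ k h = h) {γ : Γ} (hγ : γ * k = k * γ) : ρ γ h = h ∨ ρ γ h = -h :=
  Sl2.eq_or_eq_neg_of_fixed hh hk (exists_map_apply_ne hρ hk1)
    (by rw [← Sl2.aut_mul_apply, ← map_mul, ← hγ, map_mul, Sl2.aut_mul_apply, hk])
    (by rw [Sl2.form_map, hh])

variable {A}

/-- Two distinct nontrivial translations generate a Klein four-group, unless all translations fix a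
common vector. -/
lemma exists_isKlein_of_ne (hρ : Function.Injective ρ)
    (hK : ∀ h, Sl2.form h h = 2 → ∃ k, A.a k = 1 ∧ ρ k h ≠ h) {k₁ k₂ : Γ} (ha₁ : A.a k₁ = 1)
    (ha₂ : A.a k₂ = 1) (h1 : k₁ ≠ 1) (h2 : k₂ ≠ 1) (h12 : k₁ ≠ k₂) {h₁ h₂ : Sl2}
    (hh₁ : Sl2.form h₁ h₁ = 2) (hh₂ : Sl2.form h₂ h₂ = 2) (hf₁ : ρ k₁ h₁ = h₁)
    (hf₂ : ρ k₂ h₂ = h₂) : A.IsKlein ρ k₁ k₂ h₁ h₂ := by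
  have hcomm := A.mul_comm_of_a_eq_one ha₁ ha₂
  obtain ⟨k, hk, hkh⟩ := hK h₁ hh₁
  have hkneg := (map_apply_eq_of_commute hρ hh₁ h1 hf₁
    (A.mul_comm_of_a_eq_one hk ha₁)).resolve_left hkh
  obtain ⟨e, f, t⟩ := Sl2.exists_isTriple hh₁
  obtain ⟨c, hc0, hce, hcf⟩ := t.exists_smul_of_neg hkneg
  -- A translation fixing `h₁` commutes with `k`, which interchanges the lines of `e` and `f`. Its
  -- eigenvalue thus equals its own inverse, and it is `-1` unless the translation is trivial. So
  -- `k₁` is the only nontrivial one that fixes `h₁`.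
  have key : ∀ γ, A.a γ = 1 → γ ≠ 1 → ρ γ h₁ = h₁ →
      ρ γ e = (-1 : ℂ) • e ∧ ρ γ f = (-1 : ℂ) • f := by
    intro γ hγ hγ1 hγh
    obtain ⟨w, hw0, hwe, hwf⟩ := t.exists_smul_of_fixed hγh
    have h3 : ρ (k * γ) e = ρ (γ * k) e := by rw [A.mul_comm_of_a_eq_one hk hγ]
    rw [map_mul, map_mul, Sl2.aut_mul_apply, Sl2.aut_mul_apply, hwe, hce, map_smul, map_smul, hce,
      hwf, smul_smul, smul_smul] at h3
    have h4 : w * c = c * w⁻¹ := smul_left_injective ℂ t.ne_zero.2.2 h3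
    have h5 : w * w = 1 := by field_simp at h4; linear_combination h4
    rcases mul_self_eq_one_iff.mp h5 with h6 | h6
    · refine absurd (hρ (t.aut_ext ?_ ?_)) hγ1
      · rw [hwe, h6, map_one]; exact one_smul ℂ e
      · rw [hwf, h6, map_one, inv_one]; exact one_smul ℂ f
    · rw [h6] at hwe hwf
      exact ⟨hwe, by rw [hwf, inv_neg_one]⟩
  have hneg : ρ k₂ h₁ = -h₁ := by
    refine (map_apply_eq_of_commute hρ hh₁ h1 hf₁ hcomm.symm).resolve_left fun h3 => h12 ?_
    obtain ⟨e1, f1⟩ := key k₁ ha₁ h1 hf₁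
    obtain ⟨e2, f2⟩ := key k₂ ha₂ h2 h3
    exact hρ (t.aut_ext (e1.trans e2.symm) (f1.trans f2.symm))
  have horth : Sl2.form h₁ h₂ = 0 := by
    have h3 := Sl2.form_map (ρ k₂) h₁ h₂
    rw [hneg, hf₂, map_neg, LinearMap.neg_apply] at h3
    linear_combination -(1 / 2 : ℂ) * h3
  refine ⟨ha₁, ha₂, hh₁, hh₂, horth, hf₁, ?_, hneg, hf₂⟩
  refine (map_apply_eq_of_commute hρ hh₂ h2 hf₂ hcomm).resolve_left fun h3 => h1 ?_
  exact hρ (Sl2.aut_ext_orthogonal hh₁ hh₂ horth (by rw [hf₁, map_one]; rfl)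
    (by rw [h3, map_one]; rfl))

lemma exists_isKlein [Finite Γ] (hρ : Function.Injective ρ) (hK1 : ∃ k, A.a k = 1 ∧ k ≠ 1)
    (hK : ∀ h, Sl2.form h h = 2 → ∃ k, A.a k = 1 ∧ ρ k h ≠ h) :
    ∃ k₁ k₂ h₁ h₂, A.IsKlein ρ k₁ k₂ h₁ h₂ := by
  obtain ⟨k₁, ha₁, h1⟩ := hK1
  obtain ⟨h₁, hf₁, hh₁⟩ := Sl2.exists_fixed (ρ.isOfFinOrder (isOfFinOrder_of_finite k₁))
  obtain ⟨k₂, ha₂, hkh⟩ := hK h₁ hh₁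
  obtain ⟨h₂, hf₂, hh₂⟩ := Sl2.exists_fixed (ρ.isOfFinOrder (isOfFinOrder_of_finite k₂))
  refine ⟨k₁, k₂, h₁, h₂, exists_isKlein_of_ne hρ hK ha₁ ha₂ h1 ?_ ?_ hh₁ hh₂ hf₁ hf₂⟩
  · rintro rfl
    rw [map_one] at hkh
    exact hkh rfl
  · rintro rfl
    exact hkh hf₁

namespace IsKlein

variable {k₁ k₂ : Γ} {h₁ h₂ : Sl2}

lemma symm (K : A.IsKlein ρ k₁ k₂ h₁ h₂) : A.IsKlein ρ k₂ k₁ h₂ h₁ :=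
  ⟨K.a_right, K.a_left, K.form_right, K.form_left, by rw [Sl2.form_comm, K.form_orthogonal],
    K.right_right, K.right_left, K.left_right, K.left_left⟩

lemma ne_zero (K : A.IsKlein ρ k₁ k₂ h₁ h₂) : h₁ ≠ 0 := by
  rintro rfl
  simpa using K.form_left

lemma left_ne_one (K : A.IsKlein ρ k₁ k₂ h₁ h₂) : k₁ ≠ 1 := by
  rintro rfl
  have h := K.left_right
  rw [map_one] at h
  exact K.symm.ne_zero (Sl2.eq_zero_of_eq_neg h)

lemma left_ne_right (K : A.IsKlein ρ k₁ k₂ h₁ h₂) : k₁ ≠ k₂ := by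
  rintro rfl
  exact K.ne_zero (Sl2.eq_zero_of_eq_neg (K.left_left.symm.trans K.right_left))

/-- An element commuting with both half turns preserves both axes up to sign, and the four patterns
of signs are already realised. The Klein group is its own centralizer. -/
lemma eq_of_commute (K : A.IsKlein ρ k₁ k₂ h₁ h₂) (hρ : Function.Injective ρ) {γ : Γ}
    (hγ₁ : γ * k₁ = k₁ * γ) (hγ₂ : γ * k₂ = k₂ * γ) :
    γ = 1 ∨ γ = k₁ ∨ γ = k₂ ∨ γ = k₁ * k₂ := by
  have ext : ∀ δ, ρ γ h₁ = ρ δ h₁ → ρ γ h₂ = ρ δ h₂ → γ = δ := fun δ h1 h2 =>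
    hρ (Sl2.aut_ext_orthogonal K.form_left K.form_right K.form_orthogonal h1 h2)
  rcases map_apply_eq_of_commute hρ K.form_left K.left_ne_one K.left_left hγ₁ with h1 | h1 <;>
  rcases map_apply_eq_of_commute hρ K.form_right K.symm.left_ne_one K.right_right hγ₂ with h2 | h2
  · exact Or.inl (ext 1 (by rw [h1, map_one]; rfl) (by rw [h2, map_one]; rfl))
  · exact Or.inr (Or.inl (ext k₁ (by rw [h1, K.left_left]) (by rw [h2, K.left_right])))
  · exact Or.inr (Or.inr (Or.inl (ext k₂ (by rw [h1, K.right_left]) (by rw [h2, K.right_right]))))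
  · refine Or.inr (Or.inr (Or.inr (ext (k₁ * k₂) ?_ ?_)))
    · rw [h1, map_mul, Sl2.aut_mul_apply, K.right_left, map_neg, K.left_left]
    · rw [h2, map_mul, Sl2.aut_mul_apply, K.right_right, K.left_right]

lemma eq_of_a_eq_one (K : A.IsKlein ρ k₁ k₂ h₁ h₂) (hρ : Function.Injective ρ) {k : Γ}
    (hk : A.a k = 1) : k = 1 ∨ k = k₁ ∨ k = k₂ ∨ k = k₁ * k₂ :=
  K.eq_of_commute hρ (A.mul_comm_of_a_eq_one hk K.a_left) (A.mul_comm_of_a_eq_one hk K.a_right)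

lemma left_mul_left (K : A.IsKlein ρ k₁ k₂ h₁ h₂) (hρ : Function.Injective ρ) : k₁ * k₁ = 1 :=
  hρ (Sl2.aut_ext_orthogonal K.form_left K.form_right K.form_orthogonal
    (by rw [map_mul, Sl2.aut_mul_apply, K.left_left, K.left_left, map_one]; rfl)
    (by rw [map_mul, Sl2.aut_mul_apply, K.left_right, map_neg, K.left_right, neg_neg, map_one]; rfl))

lemma mul_self (K : A.IsKlein ρ k₁ k₂ h₁ h₂) (hρ : Function.Injective ρ) {k : Γ}
    (hk : A.a k = 1) : k * k = 1 := by
  rcases K.eq_of_a_eq_one hρ hk with rfl | rfl | rfl | rfl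
  · exact one_mul 1
  · exact K.left_mul_left hρ
  · exact K.symm.left_mul_left hρ
  · rw [mul_assoc, ← mul_assoc k₂, ← A.mul_comm_of_a_eq_one K.a_left K.a_right, mul_assoc k₁ k₂ k₂,
      K.symm.left_mul_left hρ, mul_one, K.left_mul_left hρ]

/-- Nontrivial translations are not divisible by two. -/
lemma eq_one_of_two_mul_sub_mem (K : A.IsKlein ρ k₁ k₂ h₁ h₂) (hρ : Function.Injective ρ) {k : Γ}
    (hk : A.a k = 1) {q : ℂ} (hq : q ∈ P.lattice) (h : 2 * q - A.b k ∈ L.lattice) : k = 1 := by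
  obtain ⟨l, hl, hql⟩ := (A.mem_iff q).mp hq
  rw [← K.mul_self hρ hl]
  refine A.eq_of_b_sub_mem hk (by simp [hl]) ?_
  have h1 := A.b_mul l l
  rw [hl, Units.val_one, one_mul] at h1
  have h2 := L.lattice.sub_mem (L.lattice.sub_mem (L.lattice.add_mem hql hql) h) h1
  convert h2 using 1
  ring

lemma left_right_div_two_notMem (K : A.IsKlein ρ k₁ k₂ h₁ h₂) (hρ : Function.Injective ρ) :
    A.b k₁ / 2 ∉ P.lattice := fun h =>
  K.left_ne_one (K.eq_one_of_two_mul_sub_mem hρ K.a_left h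
    (by rw [mul_div_cancel₀ _ (two_ne_zero (α := ℂ)), sub_self]; exact L.lattice.zero_mem))

/-- The values of `℘` at half of a representative of each translation differ. -/
lemma weierstrassP_ne (K : A.IsKlein ρ k₁ k₂ h₁ h₂) (hρ : Function.Injective ρ) {q : ℂ}
    (hq : q ∉ P.lattice) (h : 2 * q - A.b k₂ ∈ L.lattice) :
    P.weierstrassP (A.b k₁ / 2) ≠ P.weierstrassP q := by
  intro h1
  have h3 := A.b_mul k₁ k₂
  rw [K.a_left, Units.val_one, one_mul] at h3
  have hab : A.a (k₁ * k₂) = 1 := by rw [map_mul, K.a_left, K.a_right, one_mul]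
  -- Equal values of `℘` make the sum or the difference of the two halves a point of `P`. Its double
  -- represents `k₁ * k₂`, as signs do not matter for translations of order two, but nontrivial
  -- translations are not divisible by two.
  have hk : k₁ * k₂ = 1 := by
    rcases (P.weierstrassP_eq_iff (K.left_right_div_two_notMem hρ) hq).mp h1 with h2 | h2
    · have hb2 : A.b (k₂ * k₂) ∈ L.lattice := by rw [K.mul_self hρ K.a_right]; exact A.b_one
      have hb1 : A.b (k₁ * k₁) ∈ L.lattice := by rw [K.mul_self hρ K.a_left]; exact A.b_one
      have h5 := A.b_mul k₁ k₁
      rw [K.a_left, Units.val_one, one_mul] at h5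
      refine K.eq_one_of_two_mul_sub_mem hρ hab h2 ?_
      have := L.lattice.sub_mem (L.lattice.add_mem (L.lattice.sub_mem h h3) h5) hb1
      convert this using 1
      ring
    · refine K.eq_one_of_two_mul_sub_mem hρ hab h2 ?_
      convert L.lattice.sub_mem h h3 using 1
      ring
  exact K.left_ne_right (mul_right_cancel (hk.trans (K.mul_self hρ K.a_right).symm))

/-- The third axis. -/
lemma exists_third (K : A.IsKlein ρ k₁ k₂ h₁ h₂) :
    ∃ h₃, A.IsKlein ρ k₂ (k₁ * k₂) h₂ h₃ ∧ A.IsKlein ρ (k₁ * k₂) k₁ h₃ h₁ := by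
  have h1 : Sl2.form ⁅h₁, h₂⁆ ⁅h₁, h₂⁆ ≠ 0 := by
    rw [Sl2.form_lie_left, ← lie_skew h₂, Sl2.lie_lie_eq, K.form_right, K.form_orthogonal]
    simp [K.form_left]
  obtain ⟨s, hs0, hs⟩ := Sl2.exists_normalize h1
  have ha : A.a (k₁ * k₂) = 1 := by rw [map_mul, K.a_left, K.a_right, one_mul]
  have hl1 : ρ k₁ (s • ⁅h₁, h₂⁆) = -(s • ⁅h₁, h₂⁆) := by
    rw [map_smul, LieEquiv.map_lie, K.left_left, K.left_right, lie_neg, smul_neg]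
  have hl2 : ρ k₂ (s • ⁅h₁, h₂⁆) = -(s • ⁅h₁, h₂⁆) := by
    rw [map_smul, LieEquiv.map_lie, K.right_left, K.right_right, neg_lie, smul_neg]
  have h3 : ρ (k₁ * k₂) (s • ⁅h₁, h₂⁆) = s • ⁅h₁, h₂⁆ := by
    rw [map_mul, Sl2.aut_mul_apply, hl2, map_neg, hl1, neg_neg]
  have h4 : ρ (k₁ * k₂) h₁ = -h₁ := by
    rw [map_mul, Sl2.aut_mul_apply, K.right_left, map_neg, K.left_left]
  have h5 : ρ (k₁ * k₂) h₂ = -h₂ := by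
    rw [map_mul, Sl2.aut_mul_apply, K.right_right, K.left_right]
  refine ⟨s • ⁅h₁, h₂⁆, ⟨K.a_right, ha, K.form_right, hs, ?_, K.right_right, hl2, h5, h3⟩,
    ⟨ha, K.a_left, hs, K.form_left, ?_, h3, h4, hl1, K.left_left⟩⟩
  · rw [← lie_skew, smul_neg, map_neg, map_smul, Sl2.form_lie_self, smul_zero, neg_zero]
  · rw [Sl2.form_comm, map_smul, Sl2.form_lie_self, smul_zero]

/-- A function spanning, together with the axis, a translation covariant map. -/
lemma exists_function [Finite Γ] (K : A.IsKlein ρ k₁ k₂ h₁ h₂) (hρ : Function.Injective ρ) :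
    ∃ f : ℂ → ℂ, (∀ c : ℂ, A.IsTranslationCovariant ρ (fun z => (c * f z) • h₁)) ∧
      ∀ z ∉ P.lattice, f z ^ 2 = P.weierstrassP z - P.weierstrassP (A.b k₁ / 2) := by
  obtain ⟨ζ, hζ'⟩ := exists_lineCharacter (ρ.comp A.a.ker.subtype) K.ne_zero (fun k => by
    rcases map_apply_eq_of_commute hρ K.form_left K.left_ne_one K.left_left
      (A.mul_comm_of_a_eq_one k.2 K.a_left) with h | h
    · exact ⟨1, by rw [one_smul]; exact h⟩
    · exact ⟨-1, by rw [neg_one_smul]; exact h⟩)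
  have hζ : ∀ k : A.a.ker, ρ k h₁ = (ζ k : ℂ) • h₁ := hζ'
  have hinj := smul_left_injective ℂ K.ne_zero
  have hζ1 : (ζ ⟨k₁, K.a_left⟩ : ℂ) = 1 := hinj (by
    change (ζ ⟨k₁, K.a_left⟩ : ℂ) • h₁ = (1 : ℂ) • h₁
    rw [← hζ, one_smul]; exact K.left_left)
  have hζ2 : (ζ ⟨k₂, K.a_right⟩ : ℂ) = -1 := hinj (by
    change (ζ ⟨k₂, K.a_right⟩ : ℂ) • h₁ = (-1 : ℂ) • h₁
    rw [← hζ, neg_one_smul]; exact K.right_left)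
  have hζne : ζ ⟨k₂, K.a_right⟩ ≠ 1 := fun h => by
    rw [h] at hζ2
    norm_num at hζ2
  -- The signs by which translations act on the axis form a character of order two, trivial at `k₁`.
  -- The function with a simple pole and these multipliers is the square root required.
  obtain ⟨f, hf, hf1⟩ := A.exists_isSemiElliptic hζne
  refine ⟨f, fun c => A.isTranslationCovariant_smul (hf.const_mul c) hζ, ?_⟩
  refine (hf.odd_of_sq_eq_one (A.isLatticeCharacter ζ) (fun p hp => ?_) (A.b_mem K.a_right) ?_
    hf1).2 _ (A.b_mem K.a_left) ?_ (K.left_right_div_two_notMem hρ)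
  · simp only [latticeCharacter]
    rw [← Units.val_mul, ← map_mul,
      show A.translation p * A.translation p = 1 from Subtype.ext (K.mul_self hρ (A.translation p).2),
      map_one, Units.val_one]
  · rw [A.latticeCharacter_b ζ ⟨k₂, K.a_right⟩, hζ2]; norm_num
  · rw [A.latticeCharacter_b ζ ⟨k₁, K.a_left⟩, hζ1]

end IsKlein

end AffineAction

namespace AffineAction

variable {L P : PeriodPair} {Γ : Type*} [Group Γ] {A : AffineAction L P Γ}
  {ρ : Γ →* (Sl2 ≃ₗ⁅ℂ⁆ Sl2)}

lemma form_smul_add_of_orthogonal {h₁ h₂ h₃ : Sl2} (h11 : Sl2.form h₁ h₁ = 2)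
    (h22 : Sl2.form h₂ h₂ = 2) (h33 : Sl2.form h₃ h₃ = 2) (h12 : Sl2.form h₁ h₂ = 0)
    (h23 : Sl2.form h₂ h₃ = 0) (h31 : Sl2.form h₃ h₁ = 0) (a b c a' b' c' : ℂ) :
    Sl2.form (a • h₁ + b • h₂ + c • h₃) (a' • h₁ + b' • h₂ + c' • h₃) =
      2 * (a * a' + b * b' + c * c') := by
  simp only [map_add, LinearMap.add_apply, map_smul, LinearMap.smul_apply, smul_eq_mul, h11, h22,
    h33, h12, h23, h31, Sl2.form_comm h₂ h₁, Sl2.form_comm h₃ h₂, Sl2.form_comm h₁ h₃]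
  ring

namespace IsKlein

variable {k₁ k₂ : Γ} {h₁ h₂ : Sl2}

/-- With `fᵢ ^ 2 = ℘ - Eᵢ`, the map `∑ cᵢ fᵢ hᵢ` is isotropic if both `∑ cᵢ ^ 2` and `∑ cᵢ ^ 2 Eᵢ`
vanish; the cyclic differences `c₁ ^ 2 = E₂ - E₃` and so on solve this. The partner lives on two
axes, and `t` normalises the pairing `2 t (f₁ ^ 2 - f₂ ^ 2) = 2 t (E₂ - E₁)` to `1`. -/
theorem exists_isMovingFrame_of_trivial [Finite Γ] (K : A.IsKlein ρ k₁ k₂ h₁ h₂)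
    (hρ : Function.Injective ρ) (hG : ∀ γ, A.b γ ∈ L.lattice → γ = 1) :
    ∃ e f, IsMovingFrame A ρ A.a e f := by
  obtain ⟨h₃, K₂, K₃⟩ := K.exists_third
  obtain ⟨f₁, hf₁, hs₁⟩ := K.exists_function hρ
  obtain ⟨f₂, hf₂, hs₂⟩ := K₂.exists_function hρ
  obtain ⟨f₃, hf₃, hs₃⟩ := K₃.exists_function hρ
  have hne : ∀ {k k' : Γ} {h h' : Sl2}, A.IsKlein ρ k k' h h' →
      P.weierstrassP (A.b k / 2) ≠ P.weierstrassP (A.b k' / 2) := fun K' =>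
    K'.weierstrassP_ne hρ (K'.symm.left_right_div_two_notMem hρ) (by
      rw [mul_div_cancel₀ _ (two_ne_zero (α := ℂ)), sub_self]; exact L.lattice.zero_mem)
  have h12 := hne K
  have h23 := hne K₂
  have h31 := hne K₃
  set E₁ := P.weierstrassP (A.b k₁ / 2)
  set E₂ := P.weierstrassP (A.b k₂ / 2)
  set E₃ := P.weierstrassP (A.b (k₁ * k₂) / 2)
  obtain ⟨c₁, hc₁⟩ := IsAlgClosed.exists_pow_nat_eq (E₂ - E₃) two_pos
  obtain ⟨c₂, hc₂⟩ := IsAlgClosed.exists_pow_nat_eq (E₃ - E₁) two_pos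
  obtain ⟨c₃, hc₃⟩ := IsAlgClosed.exists_pow_nat_eq (E₁ - E₂) two_pos
  have ne : ∀ {c x y : ℂ}, c ^ 2 = x - y → x ≠ y → c ≠ 0 := by
    rintro c x y h hxy rfl
    rw [zero_pow two_ne_zero] at h
    exact sub_ne_zero.mpr hxy h.symm
  have hc₁0 := ne hc₁ h23
  have hc₂0 := ne hc₂ h31
  have ha : ∀ γ, A.a γ = 1 := by
    intro γ
    obtain ⟨g, k, rfl, hg, hk⟩ := A.split γ
    rw [hG g hg, one_mul, hk]
  have hcov : ∀ (c d s : ℂ) (ψ : Γ →* ℂˣ), (∀ γ, ψ γ = 1) → IsCovariant A ρ ψ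
      (fun z => (c * f₁ z) • h₁ + (d * f₂ z) • h₂ + (s * f₃ z) • h₃) := fun c d s ψ hψ =>
    A.isCovariant_of_translation (((hf₁ c).add (hf₂ d)).add (hf₃ s)) (fun k _ => hψ k) A.b_one
      (fun z _ => by rw [map_one, map_one, map_one, Units.val_one, one_mul, one_smul]; rfl)
      (fun γ hγ => ⟨0, (hG γ hγ).trans (pow_zero 1).symm⟩)
  have hform := form_smul_add_of_orthogonal K.form_left K.form_right K₃.form_left K.form_orthogonal
    K₂.form_orthogonal K₃.form_orthogonal
  set t : ℂ := -1 / (2 * (E₁ - E₂)) with ht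
  obtain ⟨f, hf⟩ := exists_isMovingFrame_of_form (hcov c₁ c₂ c₃ A.a ha)
    (hcov (t / c₁) (-t / c₂) 0 A.a⁻¹ fun γ => by rw [MonoidHom.inv_apply, ha, inv_one])
    (fun z hz => by
      rw [hform]
      linear_combination 2 * (f₁ z ^ 2 * hc₁ + f₂ z ^ 2 * hc₂ + f₃ z ^ 2 * hc₃ +
        (E₂ - E₃) * hs₁ z hz + (E₃ - E₁) * hs₂ z hz + (E₁ - E₂) * hs₃ z hz))
    (fun z hz => by
      have h1 : E₁ - E₂ ≠ 0 := sub_ne_zero.mpr h12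
      have h2 : t * (2 * (E₁ - E₂)) = -1 := by rw [ht]; field_simp
      rw [hform, show c₁ * f₁ z * (t / c₁ * f₁ z) = t * f₁ z ^ 2 by field_simp,
        show c₂ * f₂ z * (-t / c₂ * f₂ z) = -t * f₂ z ^ 2 by field_simp]
      linear_combination 2 * t * (hs₁ z hz - hs₂ z hz) - h2)
  exact ⟨_, f, hf⟩

/-- An element that fixes the origin and commutes with a nontrivial translation is trivial. -/
lemma eq_one_of_commute_left (K : A.IsKlein ρ k₁ k₂ h₁ h₂) (hρ : Function.Injective ρ) {g : Γ}
    (hg : A.b g ∈ L.lattice) (h : g * k₁ = k₁ * g) : g = 1 := by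
  -- Conjugation by `g` fixes `k₁`, so it preserves the pair `k₂`, `k₁ * k₂`. Hence `g * g`
  -- centralises the Klein group and lies in it, which gives `a g = 1` or `a g = -1`.
  have hconj : g * k₂ * g⁻¹ = k₂ ∨ g * k₂ * g⁻¹ = k₁ * k₂ := by
    rcases K.eq_of_a_eq_one hρ (k := g * k₂ * g⁻¹) (by simp [K.a_right]) with h1 | h1 | h1 | h1
    · rw [mul_inv_eq_one, mul_eq_left] at h1
      exact absurd h1 K.symm.left_ne_one
    · rw [mul_inv_eq_iff_eq_mul, ← h] at h1
      exact absurd (mul_left_cancel h1).symm K.left_ne_right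
    · exact Or.inl h1
    · exact Or.inr h1
  have h2 : (g * g) * k₂ = k₂ * (g * g) := by
    rcases hconj with h1 | h1 <;> rw [mul_inv_eq_iff_eq_mul] at h1
    · rw [mul_assoc, h1, ← mul_assoc, h1, mul_assoc]
    · rw [mul_assoc, h1, ← mul_assoc, ← mul_assoc, h, mul_assoc k₁ g k₂, h1, ← mul_assoc, ← mul_assoc,
        K.left_mul_left hρ, one_mul, mul_assoc]
  have h3 : (g * g) * k₁ = k₁ * (g * g) := by rw [mul_assoc, h, ← mul_assoc, h, mul_assoc]
  have h4 : A.a (g * g) = 1 := by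
    rcases K.eq_of_commute hρ h3 h2 with h5 | h5 | h5 | h5 <;> rw [h5] <;>
      simp [K.a_left, K.a_right]
  rcases mul_self_eq_one_iff.mp (show (A.a g : ℂ) * A.a g = 1 by
    rw [← Units.val_mul, ← map_mul, h4, Units.val_one]) with h5 | h5
  · exact A.faithful g (Units.ext h5) hg
  -- The rotation by `-1` commutes with translations of order two, so `g` itself would lie in the
  -- Klein group.
  · have h6 : ∀ k, A.a k = 1 → g * k = k * g := by
      intro k hk
      have h7 : g * k * g⁻¹ = k := by
        rw [A.conj_eq_iff hk hk, h5]
        have h8 := A.b_mul k k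
        rw [K.mul_self hρ hk, hk, Units.val_one, one_mul] at h8
        convert L.lattice.sub_mem h8 A.b_one using 1
        ring
      exact mul_inv_eq_iff_eq_mul.mp h7
    have h7 : A.a g = 1 := by
      rcases K.eq_of_commute hρ (h6 _ K.a_left) (h6 _ K.a_right) with h8 | h8 | h8 | h8 <;>
        rw [h8] <;> simp [K.a_left, K.a_right]
    exact A.faithful g h7 hg

end IsKlein

end AffineAction

/-! ### Rotations of order three permuting the axes -/

namespace AffineAction

variable {L P : PeriodPair} {Γ : Type*} [Group Γ] {A : AffineAction L P Γ}
  {ρ : Γ →* (Sl2 ≃ₗ⁅ℂ⁆ Sl2)}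

namespace IsKlein

variable {k₁ k₂ : Γ} {h₁ h₂ : Sl2}

/-- A nontrivial element fixing the origin permutes the three axes cyclically. -/
lemma conj_right_eq (hρ : Function.Injective ρ) {g : Γ} (hg : A.b g ∈ L.lattice) (hg1 : g ≠ 1)
    (K : A.IsKlein ρ k₁ (g * k₁ * g⁻¹) h₁ h₂) :
    g * (g * k₁ * g⁻¹) * g⁻¹ = k₁ * (g * k₁ * g⁻¹) := by
  obtain ⟨h₃, -, K₃⟩ := K.exists_third
  rcases K.eq_of_a_eq_one hρ (k := g * (g * k₁ * g⁻¹) * g⁻¹) (by simp [K.a_left]) with h | h | h | h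
  · rw [mul_inv_eq_one, mul_eq_left] at h
    exact absurd h K.symm.left_ne_one
  · refine absurd (K₃.eq_one_of_commute_left hρ hg ?_) hg1
    rw [← mul_inv_eq_iff_eq_mul]
    calc g * (k₁ * (g * k₁ * g⁻¹)) * g⁻¹ = (g * k₁ * g⁻¹) * (g * (g * k₁ * g⁻¹) * g⁻¹) := by group
      _ = (g * k₁ * g⁻¹) * k₁ := by rw [h]
      _ = k₁ * (g * k₁ * g⁻¹) := A.mul_comm_of_a_eq_one K.a_right K.a_left
  · exact absurd (K.symm.eq_one_of_commute_left hρ hg (mul_inv_eq_iff_eq_mul.mp h)) hg1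
  · exact h

/-- Conjugation by `g` is a three-cycle on the nontrivial translations, so `g ^ 3` commutes with
`k₁` while fixing the origin. -/
lemma pow_three_eq_one (hρ : Function.Injective ρ) {g : Γ} (hg : A.b g ∈ L.lattice) (hg1 : g ≠ 1)
    (K : A.IsKlein ρ k₁ (g * k₁ * g⁻¹) h₁ h₂) : g ^ 3 = 1 := by
  have h := conj_right_eq hρ hg hg1 K
  refine K.eq_one_of_commute_left hρ (A.b_pow_mem hg 3) ?_
  rw [← mul_inv_eq_iff_eq_mul]
  calc g ^ 3 * k₁ * (g ^ 3)⁻¹ = g * (g * (g * k₁ * g⁻¹) * g⁻¹) * g⁻¹ := by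
        simp only [pow_succ, pow_zero, one_mul, mul_inv_rev, mul_assoc]
    _ = (g * k₁ * g⁻¹) * (g * (g * k₁ * g⁻¹) * g⁻¹) := by
        nth_rewrite 1 [h]; group
    _ = (g * k₁ * g⁻¹) * ((g * k₁ * g⁻¹) * k₁) := by
        rw [h, A.mul_comm_of_a_eq_one K.a_left K.a_right]
    _ = k₁ := by rw [← mul_assoc, K.symm.left_mul_left hρ, one_mul]

/-- An element fixing the origin is determined by the conjugate of `k₁` that it produces, and the
powers of `g` produce all three possibilities. -/
lemma exists_eq_pow (hρ : Function.Injective ρ) {g : Γ} (hg : A.b g ∈ L.lattice) (hg1 : g ≠ 1)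
    (K : A.IsKlein ρ k₁ (g * k₁ * g⁻¹) h₁ h₂) {γ : Γ} (hγ : A.b γ ∈ L.lattice) :
    ∃ n : ℕ, γ = g ^ n := by
  have key : ∀ n : ℕ, γ * k₁ * γ⁻¹ = g ^ n * k₁ * (g ^ n)⁻¹ → ∃ n : ℕ, γ = g ^ n := fun n hn => by
    refine ⟨n, eq_of_inv_mul_eq_one (a := g ^ n) ?_ |>.symm⟩
    refine K.eq_one_of_commute_left hρ
      (A.b_mul_mem (A.b_inv_mem (A.b_pow_mem hg n)) hγ) ?_
    rw [← mul_inv_eq_iff_eq_mul]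
    calc (g ^ n)⁻¹ * γ * k₁ * ((g ^ n)⁻¹ * γ)⁻¹ = (g ^ n)⁻¹ * (γ * k₁ * γ⁻¹) * g ^ n := by group
      _ = k₁ := by rw [hn]; group
  have h := conj_right_eq hρ hg hg1 K
  rcases K.eq_of_a_eq_one hρ (k := γ * k₁ * γ⁻¹) (by simp [K.a_left]) with h1 | h1 | h1 | h1
  · rw [mul_inv_eq_one, mul_eq_left] at h1
    exact absurd h1 K.left_ne_one
  · exact key 0 (by rw [h1]; group)
  · exact key 1 (by rw [h1, pow_one])
  · exact key 2 (by rw [h1, ← h, pow_two, mul_inv_rev]; simp only [mul_assoc])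

/-- A single function `F` on the first axis is carried to the others by `g`, with squares `℘ - E`,
`w² ℘ - E`, `w ℘ - E` for the cube root of unity `w = a g`. Weighting the axes by `1, w, w²` makes
the sum of squares vanish. Pairing with the weights `1, w², w` gives a multiple of the sum `-3 E`,
normalised by `-1 / (6 E)`. -/
theorem exists_isMovingFrame_of_rotation [Finite Γ] (hρ : Function.Injective ρ) {g : Γ}
    (hg : A.b g ∈ L.lattice) (hg1 : g ≠ 1) (K : A.IsKlein ρ k₁ (g * k₁ * g⁻¹) h₁ (ρ g h₁)) :
    ∃ e f, IsMovingFrame A ρ A.a e f := by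
  have hg3 := pow_three_eq_one hρ hg hg1 K
  have hG : ∀ γ, A.b γ ∈ L.lattice → ∃ n : ℕ, γ = g ^ n := fun γ hγ => exists_eq_pow hρ hg hg1 K hγ
  set w : ℂ := ((A.a g : ℂˣ) : ℂ) with hw
  have hw1 : w ≠ 1 := fun h => hg1 (A.faithful g (Units.ext h) hg)
  have hw3 : w ^ 3 = 1 := by
    rw [hw, ← Units.val_pow_eq_pow_val, ← map_pow, hg3, map_one, Units.val_one]
  have hw0 : w ≠ 0 := Units.ne_zero _
  have hsum : 1 + w + w ^ 2 = 0 :=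
    mul_left_cancel₀ (sub_ne_zero.mpr hw1) (by linear_combination hw3)
  have hwinv : ((A.a g⁻¹ : ℂˣ) : ℂ) = w ^ 2 := by
    rw [map_inv, Units.val_inv_eq_inv_val, ← hw]
    exact inv_eq_of_mul_eq_one_right (by linear_combination hw3)
  have hnot : ∀ z ∉ P.lattice, w ^ 2 * z ∉ P.lattice := fun z hz h =>
    hz ((A.mul_mem_iff g⁻¹ z).mp (by rwa [hwinv]))
  have hwp : ∀ z, P.weierstrassP (w ^ 2 * z) = w ^ 2 * P.weierstrassP z := by
    intro z
    have := P.weierstrassP_homothety (Q := P) (c := w ^ 2) (pow_ne_zero 2 hw0)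
      (fun z => by rw [← hwinv]; exact A.mul_mem_iff g⁻¹ z) z
    rw [this, div_eq_iff (pow_ne_zero 2 (pow_ne_zero 2 hw0))]
    linear_combination -(w ^ 3 + 1) * P.weierstrassP z * hw3
  obtain ⟨F, hF, hFs⟩ := K.exists_function hρ
  have hq := K.left_right_div_two_notMem hρ
  set E := P.weierstrassP (A.b k₁ / 2) with hE
  -- If `E` vanished, so would `℘` at half of the rotated vector, contradicting the distinctness of
  -- these values for different translations.
  have hE0 : E ≠ 0 := by
    intro h0
    have h1 := A.b_conj (γ := g) K.a_left
    refine K.weierstrassP_ne hρ (q := w * (A.b k₁ / 2))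
      (fun h => hq ((A.mul_mem_iff g _).mp h)) ?_ ?_
    · convert L.lattice.neg_mem h1 using 1
      ring
    · have h2 := hwp (w * (A.b k₁ / 2))
      rw [show w ^ 2 * (w * (A.b k₁ / 2)) = A.b k₁ / 2 by linear_combination (A.b k₁ / 2) * hw3,
        ← hE, h0] at h2
      rw [← hE, h0]
      exact ((mul_eq_zero.mp h2.symm).resolve_left (pow_ne_zero 2 hw0)).symm
  have horth : Sl2.form (ρ g h₁) (ρ g (ρ g h₁)) = 0 := by rw [Sl2.form_map, K.form_orthogonal]
  have hcube : ρ g (ρ g (ρ g h₁)) = h₁ := by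
    rw [← Sl2.aut_mul_apply, ← Sl2.aut_mul_apply, ← map_mul, ← map_mul, ← pow_three', hg3, map_one]
    rfl
  have horth' : Sl2.form (ρ g (ρ g h₁)) h₁ = 0 := by
    have h := Sl2.form_map (ρ g) (ρ g (ρ g h₁)) h₁
    rw [hcube] at h
    rw [← h, K.form_orthogonal]
  have hform := form_smul_add_of_orthogonal K.form_left K.form_right
    (h₃ := ρ g (ρ g h₁)) (by rw [Sl2.form_map, K.form_right]) K.form_orthogonal horth horth'
  have hcov : ∀ (c s : ℂ) (ψ : Γ →* ℂˣ), (∀ k, A.a k = 1 → ψ k = 1) → (ψ g : ℂ) = s → s ^ 3 = 1 →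
      IsCovariant A ρ ψ (fun z => (c * F z) • h₁ + (s * c * F (w ^ 2 * z)) • ρ g h₁ +
        (s ^ 2 * c * F (w ^ 2 * (w ^ 2 * z))) • ρ g (ρ g h₁)) := by
    intro c s ψ hψ hψg hs
    have t2 := (hF (s * c)).translate (g := g)
    have t3 := ((hF (s ^ 2 * c)).translate (g := g)).translate (g := g)
    simp only [map_smul, hwinv] at t2 t3
    refine A.isCovariant_of_translation (((hF c).add t2).add t3) hψ hg (fun z hz => ?_) hG
    rw [← hw, show w ^ 2 * (w * z) = z by linear_combination z * hw3,
      show w ^ 2 * (w ^ 2 * z) = w * z by linear_combination w * z * hw3, hψg]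
    simp only [map_add, map_smul, hcube, smul_add, smul_smul]
    rw [show s * (s ^ 2 * c * F (w * z)) = c * F (w * z) by linear_combination c * F (w * z) * hs]
    module
  have h2 : ∀ z ∉ P.lattice, F (w ^ 2 * z) ^ 2 = w ^ 2 * P.weierstrassP z - E := fun z hz => by
    rw [hFs _ (hnot z hz), hwp]
  have h3 : ∀ z ∉ P.lattice, F (w ^ 2 * (w ^ 2 * z)) ^ 2 = w * P.weierstrassP z - E := fun z hz => by
    rw [hFs _ (hnot _ (hnot z hz)), hwp, hwp]
    linear_combination w * P.weierstrassP z * hw3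
  obtain ⟨f, hf⟩ := exists_isMovingFrame_of_form
    (hcov 1 w A.a (fun _ h => h) rfl hw3)
    (hcov (-1 / (6 * E)) (w ^ 2) A.a⁻¹ (fun k h => by rw [MonoidHom.inv_apply, h, inv_one])
      (by rw [← hwinv, map_inv, MonoidHom.inv_apply]) (by rw [← pow_mul, mul_comm, pow_mul, hw3, one_pow]))
    (fun z hz => by
      rw [hform]
      linear_combination 2 * (hFs z hz + w ^ 2 * h2 z hz + w ^ 4 * h3 z hz) +
        2 * (P.weierstrassP z * (w + w ^ 2) - E * w) * hw3 +
        2 * (P.weierstrassP z - E) * hsum)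
    (fun z hz => by
      rw [hform]
      have hc : -1 / (6 * E) * E = -1 / 6 := by field_simp
      linear_combination 2 * (-1 / (6 * E)) * (hFs z hz + w ^ 3 * h2 z hz + w ^ 6 * h3 z hz) +
        2 * (-1 / (6 * E)) * (P.weierstrassP z * (w ^ 2 + w * (w ^ 3 + 1)) - E * (2 + w ^ 3)) * hw3 +
        2 * (-1 / (6 * E)) * P.weierstrassP z * hsum - 6 * hc)
  exact ⟨_, f, hf⟩

end IsKlein

/-- Existence of a frame of weight given by the linear parts. -/
theorem exists_isMovingFrame [Finite Γ] (A : AffineAction L P Γ) (hρ : Function.Injective ρ) :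
    ∃ e f, IsMovingFrame A ρ A.a e f := by
  by_cases hK1 : ∃ k, A.a k = 1 ∧ k ≠ 1
  · by_cases hK : ∃ h, Sl2.form h h = 2 ∧ ∀ k, A.a k = 1 → ρ k h = h
    · obtain ⟨h, hh, hK⟩ := hK
      exact A.exists_isMovingFrame_of_fixed hρ hh hK hK1
    · push Not at hK
      obtain ⟨k₁, k₂, h₁, h₂, K⟩ := exists_isKlein hρ hK1 hK
      by_cases hG : ∀ γ, A.b γ ∈ L.lattice → γ = 1
      · exact K.exists_isMovingFrame_of_trivial hρ hG
      · push Not at hG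
        obtain ⟨g, hg, hg1⟩ := hG
        refine IsKlein.exists_isMovingFrame_of_rotation (k₁ := k₁) (h₁ := h₁) hρ hg hg1
          (exists_isKlein_of_ne hρ hK K.a_left (by simp [K.a_left]) K.left_ne_one ?_ ?_ K.form_left
            (by rw [Sl2.form_map, K.form_left]) K.left_left ?_)
        · rw [Ne, conj_eq_one_iff]
          exact K.left_ne_one
        · intro h
          exact hg1 (K.eq_one_of_commute_left hρ hg (mul_inv_eq_iff_eq_mul.mp h.symm))
        · rw [← Sl2.aut_mul_apply, ← map_mul, inv_mul_cancel_right, map_mul, Sl2.aut_mul_apply,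
            K.left_left]
  · push Not at hK1
    exact A.exists_isMovingFrame_of_injective hρ hK1

end AffineAction

/-! ## The Onsager algebra as a twisted `𝔰𝔩₂` -/

namespace Polynomial.Chebyshev

lemma C_eval_add_inv {x : ℂ} (hx : x ≠ 0) (n : ℤ) :
    (C ℂ n).eval (x + x⁻¹) = x ^ n + x ^ (-n) := by
  induction n using Polynomial.Chebyshev.induct with
  | zero => simp; norm_num
  | one => simp
  | add_two n ih1 ih2 =>
    rw [C_add_two, eval_sub, eval_mul, eval_X, ih1, ih2]
    simp only [neg_add, zpow_add₀ hx, zpow_neg, zpow_ofNat]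
    field_simp
    ring
  | neg_add_one n ih1 ih2 =>
    rw [C_sub_one, eval_sub, eval_mul, eval_X, ih1, ih2]
    simp only [neg_add, neg_sub, neg_neg, zpow_add₀ hx, zpow_sub₀ hx, zpow_neg, zpow_one]
    field_simp
    ring

lemma S_eval_add_inv {x : ℂ} (hx : x ≠ 0) (n : ℤ) :
    (x - x⁻¹) * (S ℂ n).eval (x + x⁻¹) = x ^ (n + 1) - x ^ (-n - 1) := by
  induction n using Polynomial.Chebyshev.induct with
  | zero => simp
  | one => simp; field_simp; ring
  | add_two n ih1 ih2 =>
    rw [S_add_two, eval_sub, eval_mul, eval_X]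
    rw [show (x - x⁻¹) * ((x + x⁻¹) * eval (x + x⁻¹) (S ℂ (n + 1)) - eval (x + x⁻¹) (S ℂ n)) =
      (x + x⁻¹) * ((x - x⁻¹) * eval (x + x⁻¹) (S ℂ (n + 1))) -
        (x - x⁻¹) * eval (x + x⁻¹) (S ℂ n) by ring, ih1, ih2]
    simp only [neg_add, zpow_add₀ hx, zpow_sub₀ hx, zpow_neg, zpow_ofNat]
    field_simp
    ring
  | neg_add_one n ih1 ih2 =>
    rw [S_sub_one, eval_sub, eval_mul, eval_X]
    rw [show (x - x⁻¹) * ((x + x⁻¹) * eval (x + x⁻¹) (S ℂ (-n)) - eval (x + x⁻¹) (S ℂ (-n + 1))) =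
      (x + x⁻¹) * ((x - x⁻¹) * eval (x + x⁻¹) (S ℂ (-n))) -
        (x - x⁻¹) * eval (x + x⁻¹) (S ℂ (-n + 1)) by ring, ih1, ih2]
    simp only [neg_add, neg_sub, neg_neg, zpow_add₀ hx, zpow_sub₀ hx, zpow_neg, zpow_one]
    field_simp
    ring

/-- Identities between Chebyshev polynomials may therefore be checked after substituting `x + x⁻¹`,
where they concern powers of `x`. -/
lemma exists_add_inv_eq (y : ℂ) : ∃ x : ℂ, x ≠ 0 ∧ x + x⁻¹ = y := by
  obtain ⟨s, hs⟩ := IsAlgClosed.exists_pow_nat_eq (y ^ 2 - 4) two_pos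
  have h : ((y + s) / 2) * ((y - s) / 2) = 1 := by linear_combination -hs / 4
  refine ⟨(y + s) / 2, left_ne_zero_of_mul_eq_one h, ?_⟩
  rw [inv_eq_of_mul_eq_one_right h]
  ring

lemma S_mul_S (k m : ℤ) :
    (X ^ 2 - 4) * S ℂ (k - 1) * S ℂ (m - 1) = C ℂ (k + m) - C ℂ (k - m) := by
  refine Polynomial.funext fun y => ?_
  obtain ⟨x, hx, rfl⟩ := exists_add_inv_eq y
  have h1 := S_eval_add_inv hx (k - 1)
  have h2 := S_eval_add_inv hx (m - 1)
  simp only [eval_mul, eval_sub, eval_pow, eval_X, eval_ofNat, C_eval_add_inv hx]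
  have h3 : (x + x⁻¹) ^ 2 - 4 = (x - x⁻¹) * (x - x⁻¹) := by field_simp; ring
  rw [h3, show ∀ a b c : ℂ, a * a * b * c = (a * b) * (a * c) by intros; ring, h1, h2]
  simp only [neg_add, neg_sub, sub_add_cancel, zpow_add₀ hx, zpow_sub₀ hx, zpow_neg, zpow_one]
  field_simp
  ring

lemma X_sq_sub_four_ne_zero : (X ^ 2 - 4 : ℂ[X]) ≠ 0 := fun h => by
  have := congrArg (eval 0) h
  simp at this

/-- The values of `S` are accessible only after multiplication by `x - x⁻¹`. The factor `X ^ 2 - 4`,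
whose value is the square of this, is inserted first and cancelled as a nonzero polynomial. -/
lemma C_mul_S (k m : ℤ) : C ℂ k * S ℂ (m - 1) = S ℂ (k + m - 1) - S ℂ (k - m - 1) := by
  refine mul_left_cancel₀ X_sq_sub_four_ne_zero (Polynomial.funext fun y => ?_)
  obtain ⟨x, hx, rfl⟩ := exists_add_inv_eq y
  have h1 := S_eval_add_inv hx (m - 1)
  have h2 := S_eval_add_inv hx (k + m - 1)
  have h4 := S_eval_add_inv hx (k - m - 1)
  simp only [eval_mul, eval_sub, eval_pow, eval_X, eval_ofNat, C_eval_add_inv hx]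
  have h3 : (x + x⁻¹) ^ 2 - 4 = (x - x⁻¹) * (x - x⁻¹) := by field_simp; ring
  rw [h3, mul_assoc, mul_assoc, mul_left_comm (x - x⁻¹) (x ^ k + _), h1, mul_sub (x - x⁻¹) (eval _ _),
    h2, h4]
  congr 1
  simp only [neg_sub, sub_add_cancel, zpow_add₀ hx, zpow_sub₀ hx, zpow_neg, zpow_one]
  field_simp
  ring

lemma S_mul_C_sub (k l : ℤ) :
    S ℂ (k - 1) * C ℂ l - C ℂ k * S ℂ (l - 1) = 2 * S ℂ (k - l - 1) := by
  rw [mul_comm, C_mul_S, C_mul_S, add_comm l k, show l - k - 1 = -(k - l) - 1 by ring, S_neg_sub_one]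
  ring

end Polynomial.Chebyshev

namespace OnsagerAlgebra

open Polynomial Polynomial.Chebyshev

/-- The three linear maps from which the isomorphism is built. -/
def chebC : (ℤ →₀ ℂ) →ₗ[ℂ] ℂ[X] := Finsupp.linearCombination ℂ fun k => Chebyshev.C ℂ k

/-- See `chebC`. -/
def chebS : (ℤ →₀ ℂ) →ₗ[ℂ] ℂ[X] := Finsupp.linearCombination ℂ fun k => Chebyshev.S ℂ (k - 1)

/-- See `chebC`. -/
def chebG : (ℕ+ →₀ ℂ) →ₗ[ℂ] ℂ[X] :=
  Finsupp.linearCombination ℂ fun m => Chebyshev.S ℂ ((m : ℤ) - 1)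

lemma chebC_single (k : ℤ) (r : ℂ) : chebC (Finsupp.single k r) = r • Chebyshev.C ℂ k := by
  simp [chebC]

lemma chebS_single (k : ℤ) (r : ℂ) : chebS (Finsupp.single k r) = r • Chebyshev.S ℂ (k - 1) := by
  simp [chebS]

lemma chebG_single (m : ℕ+) (r : ℂ) :
    chebG (Finsupp.single m r) = r • Chebyshev.S ℂ ((m : ℤ) - 1) := by
  simp [chebG]

lemma chebG_gVec (m : ℤ) : chebG (gVec m) = Chebyshev.S ℂ (m - 1) := by
  have key : ∀ n : ℕ+, chebG (gVec (n : ℤ)) = Chebyshev.S ℂ ((n : ℤ) - 1) := fun n => by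
    rw [gVec_coe, chebG_single, one_smul]
  rcases lt_trichotomy m 0 with h | rfl | h
  · obtain ⟨n, hn⟩ : ∃ n : ℕ+, (n : ℤ) = -m :=
      ⟨⟨(-m).toNat, by omega⟩, Int.toNat_of_nonneg (by omega)⟩
    have h1 := key n
    rw [hn, gVec_neg, map_neg, S_neg_sub_one] at h1
    exact neg_injective h1
  · simp [gVec]
  · obtain ⟨n, hn⟩ : ∃ n : ℕ+, (n : ℤ) = m :=
      ⟨⟨m.toNat, by omega⟩, Int.toNat_of_nonneg (by omega)⟩
    have h1 := key n
    rwa [hn] at h1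

lemma chebG_brAA (a b : ℤ →₀ ℂ) :
    chebG (brAA a b) = 2 * (chebS a * chebC b - chebC a * chebS b) := by
  induction a using Finsupp.induction_linear with
  | zero => simp
  | add a a' h h' => simp only [map_add, LinearMap.add_apply, h, h']; ring
  | single k r =>
    induction b using Finsupp.induction_linear with
    | zero => simp
    | add b b' h h' => simp only [map_add, h, h']; ring
    | single l s =>
      rw [brAA_single, map_smul, chebG_gVec, chebS_single, chebC_single, chebS_single,
        chebC_single]
      simp only [smul_eq_C_mul, map_mul, C_ofNat]
      linear_combination (-2 * Polynomial.C r * Polynomial.C s) * S_mul_C_sub k l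

lemma chebS_brAG (a : ℤ →₀ ℂ) (g : ℕ+ →₀ ℂ) : chebS (brAG a g) = -2 * (chebC a * chebG g) := by
  induction a using Finsupp.induction_linear with
  | zero => simp
  | add a a' h h' => simp only [map_add, LinearMap.add_apply, h, h']; ring
  | single k r =>
    induction g using Finsupp.induction_linear with
    | zero => simp
    | add b b' h h' => simp only [map_add, h, h']; ring
    | single m s =>
      rw [brAG_single, map_smul, map_sub, chebS_single, chebS_single, chebC_single,
        chebG_single]
      simp only [smul_eq_C_mul, map_mul, C_ofNat, map_one]
      linear_combination (2 * Polynomial.C r * Polynomial.C s) * C_mul_S k m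

lemma chebC_brAG (a : ℤ →₀ ℂ) (g : ℕ+ →₀ ℂ) :
    chebC (brAG a g) = -2 * ((X ^ 2 - 4) * (chebS a * chebG g)) := by
  induction a using Finsupp.induction_linear with
  | zero => simp
  | add a a' h h' => simp only [map_add, LinearMap.add_apply, h, h']; ring
  | single k r =>
    induction g using Finsupp.induction_linear with
    | zero => simp
    | add b b' h h' => simp only [map_add, h, h']; ring
    | single m s =>
      rw [brAG_single, map_smul, map_sub, chebC_single, chebC_single, chebS_single,
        chebG_single]
      simp only [smul_eq_C_mul, map_mul, C_ofNat, map_one]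
      linear_combination (2 * Polynomial.C r * Polynomial.C s) * S_mul_S k m

/-- The homomorphism `A_k ↦ H ⊗ C_k + (F - E) ⊗ S_{k-1}`, `G_m ↦ (E + F) ⊗ S_{m-1}`. -/
def toTwistedSl2 : OnsagerAlgebra →ₗ⁅ℂ⁆ TwistedSl2 (X ^ 2 - 4) where
  toFun x := ((-chebS x.1 + chebG x.2, chebS x.1 + chebG x.2, chebC x.1) : ℂ[X] × ℂ[X] × ℂ[X])
  map_add' x y := by
    refine Prod.ext ?_ (Prod.ext ?_ ?_)
    · change -chebS (x.1 + y.1) + chebG (x.2 + y.2) =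
        (-chebS x.1 + chebG x.2) + (-chebS y.1 + chebG y.2)
      rw [map_add, map_add]; ring
    · change chebS (x.1 + y.1) + chebG (x.2 + y.2) =
        (chebS x.1 + chebG x.2) + (chebS y.1 + chebG y.2)
      rw [map_add, map_add]; ring
    · exact map_add chebC x.1 y.1
  map_smul' t x := by
    refine Prod.ext ?_ (Prod.ext ?_ ?_)
    · change -chebS (t • x.1) + chebG (t • x.2) = t • (-chebS x.1 + chebG x.2)
      rw [map_smul, map_smul, smul_add, smul_neg]
    · change chebS (t • x.1) + chebG (t • x.2) = t • (chebS x.1 + chebG x.2)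
      rw [map_smul, map_smul, smul_add]
    · exact map_smul chebC t x.1
  map_lie' {x y} := by
    refine Prod.ext ?_ (Prod.ext ?_ ?_)
    · change -chebS (brAG x.1 y.2 - brAG y.1 x.2) + chebG (brAA x.1 y.1) =
        2 * (chebC x.1 * (-chebS y.1 + chebG y.2) - (-chebS x.1 + chebG x.2) * chebC y.1)
      rw [map_sub, chebS_brAG, chebS_brAG, chebG_brAA]; ring
    · change chebS (brAG x.1 y.2 - brAG y.1 x.2) + chebG (brAA x.1 y.1) =
        -2 * (chebC x.1 * (chebS y.1 + chebG y.2) - (chebS x.1 + chebG x.2) * chebC y.1)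
      rw [map_sub, chebS_brAG, chebS_brAG, chebG_brAA]; ring
    · change chebC (brAG x.1 y.2 - brAG y.1 x.2) = (X ^ 2 - 4) *
        ((-chebS x.1 + chebG x.2) * (chebS y.1 + chebG y.2) -
          (chebS x.1 + chebG x.2) * (-chebS y.1 + chebG y.2))
      rw [map_sub, chebC_brAG, chebC_brAG]; ring

/-- Dedekind's independence of characters; the exponents are distinguished by the absolute value at
`2`. -/
lemma linearIndependent_zpow : LinearIndependent ℂ fun (k : ℤ) (x : ℂˣ) => (x : ℂ) ^ k := by
  have h := (linearIndependent_monoidHom ℂˣ ℂ).comp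
    (fun k : ℤ => (Units.coeHom ℂ).comp (zpowGroupHom (α := ℂˣ) k)) (fun k l hkl => by
      have h2 := DFunLike.congr_fun hkl (Units.mk0 2 two_ne_zero)
      replace h2 := congrArg norm h2
      simp only [MonoidHom.comp_apply, zpowGroupHom_apply, Units.coeHom_apply,
        Units.val_zpow_eq_zpow_val, Units.val_mk0, norm_zpow, Complex.norm_ofNat] at h2
      exact zpow_right_injective₀ (by norm_num) (by norm_num) h2)
  have h1 : (fun (k : ℤ) (x : ℂˣ) => (x : ℂ) ^ k) = (fun f : ℂˣ →* ℂ => (f : ℂˣ → ℂ)) ∘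
      fun k : ℤ => (Units.coeHom ℂ).comp (zpowGroupHom (α := ℂˣ) k) := by
    funext k x
    simp
  rw [h1]
  exact h

/-- At `x + x⁻¹` the combination `C_k + (x - x⁻¹) * S_{k-1}` has the value `2 * x ^ k`, so a
relation between these pairs is a relation between powers of `x`. -/
lemma eq_zero_of_cheb {a : ℤ →₀ ℂ} (hC : chebC a = 0) (hS : chebS a = 0) : a = 0 := by
  refine linearIndependent_iff.mp linearIndependent_zpow a ?_
  funext x
  have hx : (x : ℂ) ≠ 0 := Units.ne_zero x
  have key : ∀ b : ℤ →₀ ℂ, (Finsupp.linearCombination ℂ fun (k : ℤ) (x : ℂˣ) => (x : ℂ) ^ k) b x =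
      1 / 2 * ((chebC b).eval (x + (x : ℂ)⁻¹) +
        (x - (x : ℂ)⁻¹) * (chebS b).eval (x + (x : ℂ)⁻¹)) := by
    intro b
    induction b using Finsupp.induction_linear with
    | zero => simp
    | add b b' h h' => simp only [map_add, Pi.add_apply, h, h', eval_add]; ring
    | single k r =>
      rw [chebC_single, chebS_single, eval_smul, eval_smul, C_eval_add_inv hx, smul_eq_mul,
        smul_eq_mul, mul_left_comm, S_eval_add_inv hx]
      simp
      ring
  rw [key, hC, hS]
  simp

/-- Bracketing with `A_0` embeds the span of the `G_m` in that of the `A_k`, where the preceding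
injectivity applies. -/
lemma eq_zero_of_chebG {g : ℕ+ →₀ ℂ} (hG : chebG g = 0) : g = 0 := by
  have h1 : brAG (Finsupp.single 0 1) g = 0 :=
    eq_zero_of_cheb (by rw [chebC_brAG, hG]; simp) (by rw [chebS_brAG, hG]; simp)
  have key : ∀ (f : ℕ+ →₀ ℂ) (m : ℕ+), brAG (Finsupp.single 0 1) f (m : ℤ) = -2 * f m := by
    intro f m
    induction f using Finsupp.induction_linear with
    | zero => simp
    | add b b' h h' => simp only [map_add, Finsupp.add_apply, h, h']; ring
    | single k r =>
      have hk := k.pos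
      have hm := m.pos
      rw [brAG_single]
      simp only [Finsupp.smul_apply, Finsupp.sub_apply, Finsupp.single_apply]
      have h1 : ¬ (0 - (k : ℤ) = m) := by omega
      have h2 : (0 + (k : ℤ) = m) ↔ k = m := by simp
      simp only [h1, h2, if_false, smul_eq_mul]
      split_ifs <;> ring
  ext m
  have h2 := key g m
  rw [h1] at h2
  simpa using h2

lemma toTwistedSl2_injective : Function.Injective toTwistedSl2 := by
  rw [injective_iff_map_eq_zero]
  intro x hx
  have h1 : -chebS x.1 + chebG x.2 = 0 := congrArg (fun u : ℂ[X] × ℂ[X] × ℂ[X] => u.1) hx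
  have h2 : chebS x.1 + chebG x.2 = 0 := congrArg (fun u : ℂ[X] × ℂ[X] × ℂ[X] => u.2.1) hx
  have h3 : chebC x.1 = 0 := congrArg (fun u : ℂ[X] × ℂ[X] × ℂ[X] => u.2.2) hx
  have h4 : (2 : ℂ[X]) * chebG x.2 = 0 := by linear_combination h1 + h2
  have h5 : (2 : ℂ[X]) * chebS x.1 = 0 := by linear_combination h2 - h1
  exact Prod.ext (eq_zero_of_cheb h3 ((mul_eq_zero.mp h5).resolve_left two_ne_zero))
    (eq_zero_of_chebG ((mul_eq_zero.mp h4).resolve_left two_ne_zero))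

/-- The recurrence makes the span of the `p n` stable under multiplication by `X`. As it contains a
nonzero constant, it is all of `ℂ[X]`. -/
lemma mem_span_of_recurrence {V : Type*} [AddCommGroup V] [Module ℂ V] (W : Submodule ℂ V)
    (φ : ℂ[X] →ₗ[ℂ] V) (p : ℤ → ℂ[X]) (hp0 : ∃ c : ℂ, c ≠ 0 ∧ p 0 = Polynomial.C c)
    (hp : ∀ n, X * p n = p (n + 1) + p (n - 1)) (hW : ∀ n, φ (p n) ∈ W) (r : ℂ[X]) : φ r ∈ W := by
  obtain ⟨c, hc, hp0⟩ := hp0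
  have h1 : ∀ n : ℕ, ∀ k : ℤ, φ (X ^ n * p k) ∈ W := by
    intro n
    induction n with
    | zero => intro k; simpa using hW k
    | succ n ih =>
      intro k
      rw [pow_succ, mul_assoc, hp, mul_add, map_add]
      exact W.add_mem (ih _) (ih _)
  induction r using Polynomial.induction_on' with
  | add r s hr hs => rw [map_add]; exact W.add_mem hr hs
  | monomial n a =>
    have h2 := W.smul_mem (a * c⁻¹) (h1 n 0)
    rw [← map_smul, hp0] at h2
    convert h2 using 2
    rw [smul_eq_C_mul, mul_left_comm, ← map_mul, inv_mul_cancel_right₀ hc, mul_comm,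
      C_mul_X_pow_eq_monomial]

lemma toTwistedSl2_surjective : Function.Surjective toTwistedSl2 := by
  set W : Submodule ℂ (TwistedSl2 (X ^ 2 - 4)) := LinearMap.range
    (toTwistedSl2 : OnsagerAlgebra →ₗ[ℂ] TwistedSl2 (X ^ 2 - 4)) with hWdef
  let φ (a b c : ℂ) : ℂ[X] →ₗ[ℂ] TwistedSl2 (X ^ 2 - 4) :=
    { toFun := fun r => ((a • r, b • r, c • r) : ℂ[X] × ℂ[X] × ℂ[X])
      map_add' := fun r s => Prod.ext (smul_add a r s) (Prod.ext (smul_add b r s) (smul_add c r s))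
      map_smul' := fun t r => Prod.ext (smul_comm a t r)
        (Prod.ext (smul_comm b t r) (smul_comm c t r)) }
  have hS0 : ∃ c : ℂ, c ≠ 0 ∧ Chebyshev.S ℂ 0 = Polynomial.C c := ⟨1, one_ne_zero, by simp⟩
  have hS' : ∀ n, X * Chebyshev.S ℂ n = Chebyshev.S ℂ (n + 1) + Chebyshev.S ℂ (n - 1) := fun n => by
    rw [S_sub_one ℂ n]; ring
  have hC' : ∀ n, X * Chebyshev.C ℂ n = Chebyshev.C ℂ (n + 1) + Chebyshev.C ℂ (n - 1) := fun n => by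
    rw [C_sub_one ℂ n]; ring
  have hC0 : ∃ c : ℂ, c ≠ 0 ∧ Chebyshev.C ℂ 0 = Polynomial.C c := ⟨2, two_ne_zero, by rw [C_zero, C_ofNat]⟩
  have h1 : ∀ r, φ 1 1 0 r ∈ W := mem_span_of_recurrence W (φ 1 1 0) _ hS0 hS' fun n => by
    refine ⟨((0, gVec (n + 1)) : (ℤ →₀ ℂ) × (ℕ+ →₀ ℂ)), ?_⟩
    refine Prod.ext ?_ (Prod.ext ?_ ?_)
    · change -chebS 0 + chebG (gVec (n + 1)) = (1 : ℂ) • _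
      rw [chebG_gVec]; simp
    · change chebS 0 + chebG (gVec (n + 1)) = (1 : ℂ) • _
      rw [chebG_gVec]; simp
    · change chebC 0 = (0 : ℂ) • _
      simp
  -- Since `C_k` is even and `S_{k-1}` odd in `k`, antisymmetrising `A_k` isolates the direction `F
  -- - E`. Symmetrising it isolates `H`.
  have h2 : ∀ r, φ (-1) 1 0 r ∈ W := mem_span_of_recurrence W (φ (-1) 1 0) _ hS0 hS' fun n => by
    refine ⟨((Finsupp.single (n + 1) (1 / 2) - Finsupp.single (-(n + 1)) (1 / 2), 0) :
      (ℤ →₀ ℂ) × (ℕ+ →₀ ℂ)), ?_⟩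
    have h3 : chebS (Finsupp.single (n + 1) (1 / 2) - Finsupp.single (-(n + 1)) (1 / 2)) =
        Chebyshev.S ℂ n := by
      rw [map_sub, chebS_single, chebS_single, S_neg_sub_one, add_sub_cancel_right]
      module
    refine Prod.ext ?_ (Prod.ext ?_ ?_)
    · change -chebS (_ - _) + chebG 0 = (-1 : ℂ) • _
      rw [h3]; simp
    · change chebS (_ - _) + chebG 0 = (1 : ℂ) • _
      rw [h3]; simp
    · change chebC (_ - _) = (0 : ℂ) • _
      rw [map_sub, chebC_single, chebC_single, Chebyshev.C_neg]; simp
  have h3 : ∀ r, φ 0 0 1 r ∈ W := mem_span_of_recurrence W (φ 0 0 1) _ hC0 hC' fun n => by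
    refine ⟨((Finsupp.single n (1 / 2) + Finsupp.single (-n) (1 / 2), 0) :
      (ℤ →₀ ℂ) × (ℕ+ →₀ ℂ)), ?_⟩
    have h4 : chebS (Finsupp.single n (1 / 2) + Finsupp.single (-n) (1 / 2)) = 0 := by
      rw [map_add, chebS_single, chebS_single, S_neg_sub_one]
      module
    refine Prod.ext ?_ (Prod.ext ?_ ?_)
    · change -chebS (_ + _) + chebG 0 = (0 : ℂ) • _
      rw [h4]; simp
    · change chebS (_ + _) + chebG 0 = (0 : ℂ) • _
      rw [h4]; simp
    · change chebC (_ + _) = (1 : ℂ) • _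
      rw [map_add, chebC_single, chebC_single, Chebyshev.C_neg]
      module
  rintro ⟨a, b, c⟩
  have h4 := W.add_mem (W.add_mem (h1 ((1 / 2 : ℂ) • (a + b))) (h2 ((1 / 2 : ℂ) • (b - a)))) (h3 c)
  obtain ⟨x, hx⟩ := h4
  refine ⟨x, hx.trans (Prod.ext ?_ (Prod.ext ?_ ?_))⟩
  · change (1 : ℂ) • ((1 / 2 : ℂ) • (a + b)) + (-1 : ℂ) • ((1 / 2 : ℂ) • (b - a)) + (0 : ℂ) • c = a
    module
  · change (1 : ℂ) • ((1 / 2 : ℂ) • (a + b)) + (1 : ℂ) • ((1 / 2 : ℂ) • (b - a)) + (0 : ℂ) • c = b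
    module
  · change (0 : ℂ) • ((1 / 2 : ℂ) • (a + b)) + (0 : ℂ) • ((1 / 2 : ℂ) • (b - a)) + (1 : ℂ) • c = c
    module

/-- The Onsager algebra is the twisted `𝔰𝔩₂` with two branch points. -/
def equivTwistedSl2 : OnsagerAlgebra ≃ₗ⁅ℂ⁆ TwistedSl2 (X ^ 2 - 4) :=
  LieEquiv.ofBijective toTwistedSl2 ⟨toTwistedSl2_injective, toTwistedSl2_surjective⟩

end OnsagerAlgebra

/-! ## Lie algebras of maps with a moving frame -/

namespace Sl2.IsTriple

variable {h e f : Sl2} (t : IsTriple h e f)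

include t

lemma lie_combination (a b c a' b' c' : ℂ) :
    ⁅a • e + b • f + c • h, a' • e + b' • f + c' • h⁆ =
      (2 * (c * a' - a * c')) • e + (-2 * (c * b' - b * c')) • f + (a * b' - b * a') • h := by
  have h1 : ⁅e, h⁆ = -((2 : ℂ) • e) := by rw [← t.lie_h_e, lie_skew]
  have h2 : ⁅f, h⁆ = -((-2 : ℂ) • f) := by rw [← t.lie_h_f, lie_skew]
  have h3 : ⁅f, e⁆ = -h := by rw [← lie_skew, t.lie_e_f]
  simp only [add_lie, lie_add, smul_lie, lie_smul, lie_self, t.lie_h_e, t.lie_h_f, t.lie_e_f, h1,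
    h2, h3]
  module

lemma form_combination (a b c : ℂ) :
    form f (a • e + b • f + c • h) = a ∧ form e (a • e + b • f + c • h) = b ∧
      form h (a • e + b • f + c • h) = 2 * c := by
  simp only [map_add, map_smul, smul_eq_mul, t.form_h_h, t.form_h_e, t.form_h_f, t.form_e_e,
    t.form_f_f, t.form_e_f, form_comm f e, form_comm e h, form_comm f h]
  refine ⟨?_, ?_, ?_⟩ <;> ring

/-- The homomorphism that takes one triple to another one. -/
lemma exists_lieHom {h' e' f' : Sl2} (t' : IsTriple h' e' f') :
    ∃ θ : Sl2 →ₗ⁅ℂ⁆ Sl2, ∀ x, θ x = form f x • e' + form e x • f' + (form h x / 2) • h' := by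
  refine ⟨{ toFun := fun x => form f x • e' + form e x • f' + (form h x / 2) • h',
            map_add' := fun x y => ?_, map_smul' := fun c x => ?_, map_lie' := fun {x y} => ?_ },
    fun _ => rfl⟩
  · simp only [map_add]; module
  · simp only [map_smul, smul_eq_mul, RingHom.id_apply]; module
  · have h1 := congrArg₂ (fun x y => (⁅x, y⁆ : Sl2)) (t.expand x) (t.expand y)
    rw [t.lie_combination] at h1
    rw [t'.lie_combination, h1, (t.form_combination _ _ _).1, (t.form_combination _ _ _).2.1,
      (t.form_combination _ _ _).2.2, mul_div_cancel_left₀ _ (two_ne_zero (α := ℂ))]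

end Sl2.IsTriple

section Frame

variable {X : Type*} {S : LieSubalgebra ℂ (X → Sl2)} {e f : X → Sl2}

lemma Polynomial.eq_zero_of_eval_comp {t : X → ℂ} (ht : Function.Surjective t) {A : ℂ[X]}
    (h : ∀ p, A.eval (t p) = 0) : A = 0 :=
  Polynomial.funext fun z => by
    obtain ⟨p, rfl⟩ := ht z
    rw [h p, Polynomial.eval_zero]

/-- A Lie algebra of maps with a frame whose coefficient modules are generated by `α`, `β` and `1`
over the polynomials in `t` is a twisted `𝔰𝔩₂`. -/
theorem TwistedSl2.nonempty_equiv {q : ℂ[X]} (hq : q ≠ 0) {t α β : X → ℂ}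
    (ht : Function.Surjective t) (htr : ∀ p, Sl2.IsTriple ⁅e p, f p⁆ (e p) (f p))
    (hαβ : ∀ p, α p * β p = q.eval (t p))
    (hS : ∀ a, a ∈ S ↔ ∃ A B C : ℂ[X], ∀ p, a p = (A.eval (t p) * α p) • e p +
      (B.eval (t p) * β p) • f p + C.eval (t p) • ⁅e p, f p⁆) :
    Nonempty (S ≃ₗ⁅ℂ⁆ TwistedSl2 q) := by
  let Φ : TwistedSl2 q →ₗ⁅ℂ⁆ S :=
    { toFun := fun u => ⟨fun p => (Polynomial.eval (t p) u.1 * α p) • e p +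
        (Polynomial.eval (t p) u.2.1 * β p) • f p + Polynomial.eval (t p) u.2.2 • ⁅e p, f p⁆,
        (hS _).mpr ⟨u.1, u.2.1, u.2.2, fun _ => rfl⟩⟩
      map_add' := fun u v => Subtype.ext (funext fun p => by
        change (Polynomial.eval (t p) (u.1 + v.1) * α p) • e p +
          (Polynomial.eval (t p) (u.2.1 + v.2.1) * β p) • f p +
            Polynomial.eval (t p) (u.2.2 + v.2.2) • ⁅e p, f p⁆ = (_ + _ + _) + (_ + _ + _)
        simp only [Polynomial.eval_add]
        module)
      map_smul' := fun c u => Subtype.ext (funext fun p => by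
        change (Polynomial.eval (t p) (c • u.1) * α p) • e p +
          (Polynomial.eval (t p) (c • u.2.1) * β p) • f p +
            Polynomial.eval (t p) (c • u.2.2) • ⁅e p, f p⁆ = c • (_ + _ + _)
        simp only [Polynomial.eval_smul, smul_eq_mul]
        module)
      map_lie' := fun {u v} => Subtype.ext (funext fun p => by
        change (Polynomial.eval (t p) (2 * (u.2.2 * v.1 - u.1 * v.2.2)) * α p) • e p +
          (Polynomial.eval (t p) (-2 * (u.2.2 * v.2.1 - u.2.1 * v.2.2)) * β p) • f p +
            Polynomial.eval (t p) (q * (u.1 * v.2.1 - u.2.1 * v.1)) • ⁅e p, f p⁆ =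
              ⁅(Polynomial.eval (t p) u.1 * α p) • e p + (Polynomial.eval (t p) u.2.1 * β p) • f p +
                Polynomial.eval (t p) u.2.2 • ⁅e p, f p⁆,
                (Polynomial.eval (t p) v.1 * α p) • e p + (Polynomial.eval (t p) v.2.1 * β p) • f p +
                Polynomial.eval (t p) v.2.2 • ⁅e p, f p⁆⁆
        rw [(htr p).lie_combination]
        simp only [Polynomial.eval_mul, Polynomial.eval_sub, Polynomial.eval_neg,
          Polynomial.eval_ofNat, ← hαβ]
        module) }
  refine ⟨(LieEquiv.ofBijective Φ ⟨?_, ?_⟩).symm⟩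
  · rw [injective_iff_map_eq_zero]
    intro u hu
    have h1 : ∀ p, (Polynomial.eval (t p) u.1 * α p) • e p +
        (Polynomial.eval (t p) u.2.1 * β p) • f p + Polynomial.eval (t p) u.2.2 • ⁅e p, f p⁆ = 0 :=
      fun p => congrFun (congrArg Subtype.val hu) p
    have h2 := fun p => (htr p).form_combination (Polynomial.eval (t p) u.1 * α p)
      (Polynomial.eval (t p) u.2.1 * β p) (Polynomial.eval (t p) u.2.2)
    simp only [h1, map_zero] at h2
    refine Prod.ext ?_ (Prod.ext ?_ ?_)
    -- The coefficient `A(t) α` vanishes, but `α` may have zeros. Multiplication by `β` gives the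
    -- polynomial identity `A q = 0`.
    · refine (mul_eq_zero.mp (?_ : u.1 * q = 0)).resolve_right hq
      refine Polynomial.eq_zero_of_eval_comp ht fun p => ?_
      rw [Polynomial.eval_mul, ← hαβ, ← mul_assoc, ← (h2 p).1, zero_mul]
    · refine (mul_eq_zero.mp (?_ : u.2.1 * q = 0)).resolve_right hq
      refine Polynomial.eq_zero_of_eval_comp ht fun p => ?_
      rw [Polynomial.eval_mul, ← hαβ, mul_left_comm, ← (h2 p).2.1, mul_zero]
    · refine Polynomial.eq_zero_of_eval_comp ht fun p => ?_
      simpa using (h2 p).2.2.symm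
  · rintro ⟨a, ha⟩
    obtain ⟨A, B, C, hABC⟩ := (hS a).mp ha
    exact ⟨((A, B, C) : ℂ[X] × ℂ[X] × ℂ[X]), Subtype.ext (funext fun p => (hABC p).symm)⟩

open Polynomial in
/-- Twisted algebras with two branch points are isomorphic to the Onsager algebra. -/
theorem TwistedSl2.nonempty_equiv_onsager {κ r s : ℂ} (hκ : κ ≠ 0) (hrs : r ≠ s) :
    Nonempty (TwistedSl2 (C κ * (Polynomial.X - C r) * (Polynomial.X - C s)) ≃ₗ⁅ℂ⁆
      OnsagerAlgebra) := by
  set q : ℂ[X] := C κ * (Polynomial.X - C r) * (Polynomial.X - C s) with hqdef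
  -- The substitution `X ↦ u X + v` moves the roots `r`, `s` to `2`, `-2`. The remaining constant `c
  -- = κ * u ^ 2` is absorbed in the first coordinate.
  set u : ℂ := (r - s) / 4 with hu
  set v : ℂ := (r + s) / 2 with hv
  have hu0 : u ≠ 0 := div_ne_zero (sub_ne_zero.mpr hrs) (by norm_num)
  let _ := invertibleOfNonzero hu0
  set ℓ := algEquivCMulXAddC u v with hℓ
  set c : ℂ := κ * u ^ 2 with hcdef
  have hc : c ≠ 0 := mul_ne_zero hκ (pow_ne_zero 2 hu0)
  have hq : ℓ q = C c * (Polynomial.X ^ 2 - 4) := by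
    refine Polynomial.funext fun z => ?_
    rw [hℓ, algEquivCMulXAddC_apply, hqdef]
    simp only [map_mul, map_sub, aeval_X, aeval_C, algebraMap_eq, eval_mul, eval_sub, eval_add,
      eval_C, eval_X, eval_pow, eval_ofNat]
    rw [hcdef, hu, hv]
    ring
  let Φ : TwistedSl2 q →ₗ⁅ℂ⁆ TwistedSl2 (Polynomial.X ^ 2 - 4) :=
    { toFun := fun w => ((C c * ℓ w.1, ℓ w.2.1, ℓ w.2.2) : ℂ[X] × ℂ[X] × ℂ[X])
      map_add' := fun w w' => by
        refine Prod.ext ?_ (Prod.ext (map_add ℓ w.2.1 w'.2.1) (map_add ℓ w.2.2 w'.2.2))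
        change C c * ℓ (w.1 + w'.1) = C c * ℓ w.1 + C c * ℓ w'.1
        rw [map_add, mul_add]
      map_smul' := fun t w => by
        refine Prod.ext ?_ (Prod.ext (map_smul ℓ t w.2.1) (map_smul ℓ t w.2.2))
        change C c * ℓ (t • w.1) = t • (C c * ℓ w.1)
        rw [map_smul, mul_smul_comm]
      map_lie' := fun {w w'} => by
        refine Prod.ext ?_ (Prod.ext ?_ ?_)
        · change C c * ℓ (2 * (w.2.2 * w'.1 - w.1 * w'.2.2)) =
            2 * (ℓ w.2.2 * (C c * ℓ w'.1) - (C c * ℓ w.1) * ℓ w'.2.2)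
          simp only [map_mul, map_sub, map_ofNat]
          ring
        · change ℓ (-2 * (w.2.2 * w'.2.1 - w.2.1 * w'.2.2)) =
            -2 * (ℓ w.2.2 * ℓ w'.2.1 - ℓ w.2.1 * ℓ w'.2.2)
          simp only [map_mul, map_sub, map_neg, map_ofNat]
        · change ℓ (q * (w.1 * w'.2.1 - w.2.1 * w'.1)) = (Polynomial.X ^ 2 - 4) *
            ((C c * ℓ w.1) * ℓ w'.2.1 - ℓ w.2.1 * (C c * ℓ w'.1))
          rw [map_mul, hq]
          simp only [map_mul, map_sub]
          ring }
  have hΦ : Function.Bijective Φ := by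
    constructor
    · rw [injective_iff_map_eq_zero]
      intro w hw
      have h1 : C c * ℓ w.1 = 0 := congrArg (fun u : ℂ[X] × ℂ[X] × ℂ[X] => u.1) hw
      have h2 : ℓ w.2.1 = 0 := congrArg (fun u : ℂ[X] × ℂ[X] × ℂ[X] => u.2.1) hw
      have h3 : ℓ w.2.2 = 0 := congrArg (fun u : ℂ[X] × ℂ[X] × ℂ[X] => u.2.2) hw
      exact Prod.ext ((map_eq_zero_iff ℓ ℓ.injective).mp
          ((mul_eq_zero.mp h1).resolve_left (C_ne_zero.mpr hc)))
        (Prod.ext ((map_eq_zero_iff ℓ ℓ.injective).mp h2)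
          ((map_eq_zero_iff ℓ ℓ.injective).mp h3))
    · rintro ⟨A, B, D⟩
      refine ⟨((ℓ.symm (C c⁻¹ * A), ℓ.symm B, ℓ.symm D) : ℂ[X] × ℂ[X] × ℂ[X]),
        Prod.ext ?_ (Prod.ext (ℓ.apply_symm_apply B) (ℓ.apply_symm_apply D))⟩
      change C c * ℓ (ℓ.symm (C c⁻¹ * A)) = A
      rw [ℓ.apply_symm_apply, ← mul_assoc, ← C_mul, mul_inv_cancel₀ hc, C_1, one_mul]
  exact ⟨(LieEquiv.ofBijective Φ hΦ).trans OnsagerAlgebra.equivTwistedSl2.symm⟩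

/-! ### The current algebra -/

/-- The class in the elliptic ring of `A(x) + B(x) y`. -/
lemma EllipticRing.exists_polynomial (τ : ℍ) (r : MvPolynomial (Fin 2) ℂ) : ∃ A B : ℂ[X],
    (Ideal.Quotient.mk _ r : EllipticRing τ) = Ideal.Quotient.mk _
      (Polynomial.aeval (MvPolynomial.X 0) A +
        Polynomial.aeval (MvPolynomial.X 0) B * MvPolynomial.X 1) := by
  set I : Ideal (MvPolynomial (Fin 2) ℂ) := Ideal.span
    {(MvPolynomial.X 1 ^ 2 - 4 * MvPolynomial.X 0 ^ 3 +
      MvPolynomial.C (tauPeriods τ).g₂ * MvPolynomial.X 0 +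
      MvPolynomial.C (tauPeriods τ).g₃ : MvPolynomial (Fin 2) ℂ)} with hI
  change ∃ A B : ℂ[X], Ideal.Quotient.mk I r = Ideal.Quotient.mk I _
  induction r using MvPolynomial.induction_on with
  | C a => exact ⟨Polynomial.C a, 0, by simp [MvPolynomial.algebraMap_eq]⟩
  | add p q hp hq =>
    obtain ⟨A, B, h⟩ := hp
    obtain ⟨A', B', h'⟩ := hq
    exact ⟨A + A', B + B', by simp only [map_add, map_mul, h, h']; ring⟩
  | mul_X p i hp =>
    obtain ⟨A, B, h⟩ := hp
    fin_cases i
    · refine ⟨A * Polynomial.X, B * Polynomial.X, ?_⟩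
      change Ideal.Quotient.mk I (p * MvPolynomial.X 0) = _
      simp only [map_mul, map_add, h, Polynomial.aeval_X]
      ring
    · refine ⟨B * (4 * Polynomial.X ^ 3 - Polynomial.C (tauPeriods τ).g₂ * Polynomial.X -
        Polynomial.C (tauPeriods τ).g₃), A, ?_⟩
      change Ideal.Quotient.mk I (p * MvPolynomial.X 1) = _
      rw [map_mul, h, ← map_mul, Ideal.Quotient.eq, hI, Ideal.mem_span_singleton]
      refine ⟨Polynomial.aeval (MvPolynomial.X 0) B, ?_⟩
      simp only [map_mul, map_sub, map_pow, map_ofNat, Polynomial.aeval_X, Polynomial.aeval_C,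
        MvPolynomial.algebraMap_eq]
      ring

/-- A Lie algebra of maps with a frame whose coefficients are the polynomials in the coordinates of
the Weierstrass curve is a current algebra. -/
theorem CurrentAlgebra.nonempty_equiv {τ : ℍ} {x y : X → ℂ}
    (hxy : ∀ p, y p ^ 2 = 4 * x p ^ 3 - (tauPeriods τ).g₂ * x p - (tauPeriods τ).g₃)
    (hinj : ∀ A B : ℂ[X], (∀ p, A.eval (x p) + B.eval (x p) * y p = 0) → A = 0 ∧ B = 0)
    (htr : ∀ p, Sl2.IsTriple ⁅e p, f p⁆ (e p) (f p))
    (hS : ∀ a, a ∈ S ↔ ∃ A B C A' B' C' : ℂ[X], ∀ p, a p =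
      (A.eval (x p) + A'.eval (x p) * y p) • e p + (B.eval (x p) + B'.eval (x p) * y p) • f p +
        (C.eval (x p) + C'.eval (x p) * y p) • ⁅e p, f p⁆) :
    Nonempty (S ≃ₗ⁅ℂ⁆ CurrentAlgebra τ) := by
  obtain ⟨h₀, -, hh₀⟩ := Sl2.exists_fixed (φ := (LieEquiv.refl : Sl2 ≃ₗ⁅ℂ⁆ Sl2))
    (isOfFinOrder_iff_pow_eq_one.mpr ⟨1, one_pos, rfl⟩)
  obtain ⟨e₀, f₀, t₀⟩ := Sl2.exists_isTriple hh₀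
  -- The isomorphism sends `r ⊗ v` to the map whose value at `p` is `r` evaluated at `(x p, y p)`
  -- times the image of `v` when a fixed triple is taken to the frame at `p`.
  choose θ hθ using fun p => t₀.exists_lieHom (htr p)
  let φ (p : X) : EllipticRing τ →ₐ[ℂ] ℂ := Ideal.Quotient.liftₐ _
    (MvPolynomial.aeval ![x p, y p]) (by
      have h : Ideal.span {(MvPolynomial.X 1 ^ 2 - 4 * MvPolynomial.X 0 ^ 3 +
          MvPolynomial.C (tauPeriods τ).g₂ * MvPolynomial.X 0 +
          MvPolynomial.C (tauPeriods τ).g₃ : MvPolynomial (Fin 2) ℂ)} ≤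
            RingHom.ker (MvPolynomial.aeval (R := ℂ) ![x p, y p]) := by
        rw [Ideal.span_le, Set.singleton_subset_iff]
        simp [RingHom.mem_ker, hxy]
        ring
      exact fun a ha => h ha)
  have hφ : ∀ (A B : ℂ[X]) (p : X), φ p (Ideal.Quotient.mk _
      (Polynomial.aeval (MvPolynomial.X 0) A + Polynomial.aeval (MvPolynomial.X 0) B *
        MvPolynomial.X 1)) = A.eval (x p) + B.eval (x p) * y p := by
    intro A B p
    change MvPolynomial.aeval ![x p, y p] _ = _
    rw [map_add, map_mul, ← Polynomial.aeval_algHom_apply, ← Polynomial.aeval_algHom_apply]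
    simp [Polynomial.coe_aeval_eq_eval]
  let Φ₁ : CurrentAlgebra τ →ₗ[ℂ] (X → Sl2) := LinearMap.pi fun p =>
    TensorProduct.lift ((LinearMap.lsmul ℂ Sl2).compl₂ (θ p : Sl2 →ₗ[ℂ] Sl2) ∘ₗ (φ p).toLinearMap)
  have hΦ₁ : ∀ r v p, Φ₁ (r ⊗ₜ v) p = φ p r • θ p v := fun _ _ _ => rfl
  let Φ : CurrentAlgebra τ →ₗ⁅ℂ⁆ (X → Sl2) :=
    { Φ₁ with
      map_lie' := fun {u v} => by
        change Φ₁ ⁅u, v⁆ = ⁅Φ₁ u, Φ₁ v⁆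
        induction u using TensorProduct.induction_on with
        | zero =>
          exact (congrArg Φ₁ (zero_lie (L := CurrentAlgebra τ) v)).trans ((map_zero Φ₁).trans ((zero_lie _).symm.trans
            (congrArg (fun w => ⁅w, Φ₁ v⁆) (map_zero Φ₁).symm)))
        | add u u' h h' =>
          exact (congrArg Φ₁ (add_lie u u' v)).trans ((map_add Φ₁ _ _).trans
            ((congrArg₂ (fun w w' => w + w') h h').trans ((add_lie _ _ _).symm.trans
              (congrArg (fun w => ⁅w, Φ₁ v⁆) (map_add Φ₁ u u').symm))))
        | tmul r a =>
          induction v using TensorProduct.induction_on with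
          | zero =>
            exact (congrArg Φ₁ (lie_zero (r ⊗ₜ a : CurrentAlgebra τ))).trans ((map_zero Φ₁).trans
              ((lie_zero _).symm.trans (congrArg (fun w => ⁅Φ₁ (r ⊗ₜ a), w⁆) (map_zero Φ₁).symm)))
          | add u u' h h' =>
            exact (congrArg Φ₁ (lie_add (r ⊗ₜ a : CurrentAlgebra τ) u u')).trans
              ((map_add Φ₁ _ _).trans ((congrArg₂ (fun w w' => w + w') h h').trans
                ((lie_add _ _ _).symm.trans
                  (congrArg (fun w => ⁅Φ₁ (r ⊗ₜ a), w⁆) (map_add Φ₁ u u').symm))))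
          | tmul s b =>
            funext p
            change Φ₁ ((r * s) ⊗ₜ ⁅a, b⁆) p = ⁅Φ₁ (r ⊗ₜ a) p, Φ₁ (s ⊗ₜ b) p⁆
            rw [hΦ₁, hΦ₁, hΦ₁, map_mul, LieHom.map_lie, smul_lie, lie_smul, smul_smul] }
  have hΦ : ∀ r v p, Φ (r ⊗ₜ v) p = φ p r • θ p v := fun _ _ _ => rfl
  have hsplit : ∀ w : CurrentAlgebra τ, ∃ r s u : EllipticRing τ,
      w = r ⊗ₜ e₀ + s ⊗ₜ f₀ + u ⊗ₜ h₀ := by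
    intro w
    induction w using TensorProduct.induction_on with
    | zero => exact ⟨0, 0, 0, by simp⟩
    | add w w' h h' =>
      obtain ⟨r, s, u, h⟩ := h
      obtain ⟨r', s', u', h'⟩ := h'
      refine ⟨r + r', s + s', u + u', ?_⟩
      rw [h, h', TensorProduct.add_tmul, TensorProduct.add_tmul, TensorProduct.add_tmul]
      abel
    | tmul r v =>
      refine ⟨Sl2.form f₀ v • r, Sl2.form e₀ v • r, (Sl2.form h₀ v / 2) • r, ?_⟩
      conv_lhs => rw [t₀.expand v]
      simp only [TensorProduct.tmul_add, TensorProduct.tmul_smul, TensorProduct.smul_tmul']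
  have hval : ∀ r s u p, Φ (r ⊗ₜ e₀ + s ⊗ₜ f₀ + u ⊗ₜ h₀) p =
      φ p r • e p + φ p s • f p + φ p u • ⁅e p, f p⁆ := by
    intro r s u p
    rw [map_add, map_add, Pi.add_apply, Pi.add_apply, hΦ, hΦ, hΦ, hθ, hθ, hθ]
    simp only [t₀.form_e_e, t₀.form_f_f, t₀.form_e_f, t₀.form_h_e, t₀.form_h_f, t₀.form_h_h,
      Sl2.form_comm f₀ e₀, Sl2.form_comm f₀ h₀, Sl2.form_comm e₀ h₀]
    module
  have hrep : ∀ r : EllipticRing τ, ∃ A B : ℂ[X], r = Ideal.Quotient.mk _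
      (Polynomial.aeval (MvPolynomial.X 0) A +
        Polynomial.aeval (MvPolynomial.X 0) B * MvPolynomial.X 1) := by
    intro r
    obtain ⟨r, rfl⟩ := Ideal.Quotient.mk_surjective r
    exact EllipticRing.exists_polynomial τ r
  have hzero : ∀ r : EllipticRing τ, (∀ p, φ p r = 0) → r = 0 := by
    intro r hr
    obtain ⟨A, B, rfl⟩ := hrep r
    obtain ⟨rfl, rfl⟩ := hinj A B fun p => by rw [← hφ, hr p]
    simp
  have hinjΦ : Function.Injective Φ := by
    rw [injective_iff_map_eq_zero]
    intro w hw
    obtain ⟨r, s, u, rfl⟩ := hsplit w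
    have h1 := fun p => (htr p).form_combination (φ p r) (φ p s) (φ p u)
    have h2 : ∀ p, φ p r • e p + φ p s • f p + φ p u • ⁅e p, f p⁆ = 0 := fun p => by
      rw [← hval, hw, Pi.zero_apply]
    simp only [h2, map_zero] at h1
    rw [hzero r fun p => (h1 p).1.symm, hzero s fun p => (h1 p).2.1.symm,
      hzero u fun p => by simpa using (h1 p).2.2.symm]
    simp
  refine ⟨((LieEquiv.ofInjective Φ hinjΦ).trans (LieEquiv.ofEq _ _ ?_)).symm⟩
  ext a
  rw [SetLike.mem_coe, SetLike.mem_coe, LieHom.mem_range, hS]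
  constructor
  · rintro ⟨w, rfl⟩
    obtain ⟨r, s, u, rfl⟩ := hsplit w
    obtain ⟨A, A', rfl⟩ := hrep r
    obtain ⟨B, B', rfl⟩ := hrep s
    obtain ⟨C, C', rfl⟩ := hrep u
    exact ⟨A, B, C, A', B', C', fun p => by rw [hval, hφ, hφ, hφ]⟩
  · rintro ⟨A, B, C, A', B', C', h⟩
    exact ⟨_, funext fun p => by rw [h p, ← hφ, ← hφ, ← hφ, ← hval]⟩

end Frame

/-! ## Weighted elliptic functions -/

lemma Polynomial.exists_eval_eq_pow_mul {A : ℂ[X]} {m r : ℕ} (h : ∀ i, A.coeff i ≠ 0 → i % m = r) :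
    ∃ B : ℂ[X], ∀ x, A.eval x = x ^ r * B.eval (x ^ m) := by
  refine ⟨∑ i ∈ A.support, Polynomial.monomial (i / m) (A.coeff i), fun x => ?_⟩
  rw [Polynomial.eval_finsetSum, Finset.mul_sum, Polynomial.eval_eq_sum, Polynomial.sum]
  refine Finset.sum_congr rfl fun i hi => ?_
  rw [Polynomial.eval_monomial, ← pow_mul, mul_left_comm, ← pow_add,
    ← h i (Polynomial.mem_support_iff.mp hi), Nat.mod_add_div]

/-- Under `z ↦ w * z` the functions `℘` and `℘'` are multiplied by `w⁻²` and `w⁻³`. Uniqueness of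
the representation allows coefficients to be compared, so only monomials of the prescribed weight
occur. -/
lemma PeriodPair.IsSemiElliptic.exists_polynomial_of_weight {P : PeriodPair} {g : ℂ → ℂ}
    (hg : P.IsElliptic g) {w : ℂˣ} (hw : ∀ z, (w : ℂ) * z ∈ P.lattice ↔ z ∈ P.lattice) {j : ℕ}
    (h : ∀ z ∉ P.lattice, g (w * z) = (w : ℂ) ^ j * g z) :
    ∃ A B : ℂ[X], (∀ z ∉ P.lattice, g z = A.eval (P.weierstrassP z) +
        B.eval (P.weierstrassP z) * P.derivWeierstrassP z) ∧
      (∀ i, A.coeff i ≠ 0 → orderOf w ∣ j + 2 * i) ∧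
        ∀ i, B.coeff i ≠ 0 → orderOf w ∣ j + 2 * i + 3 := by
  obtain ⟨A, B, hAB⟩ := hg.exists_polynomial
  have hw0 : (w : ℂ) ≠ 0 := w.ne_zero
  set c : ℂ := ((w : ℂ) ^ 2)⁻¹ with hc
  have h1 := P.polynomial_eq_zero
    (A := A.comp (Polynomial.C c * Polynomial.X) - Polynomial.C ((w : ℂ) ^ j) * A)
    (B := Polynomial.C ((w : ℂ) ^ 3)⁻¹ * B.comp (Polynomial.C c * Polynomial.X) -
      Polynomial.C ((w : ℂ) ^ j) * B) fun z hz => by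
    have h2 := h z hz
    rw [hAB _ (fun h => hz ((hw z).mp h)), hAB z hz, P.weierstrassP_homothety hw0 hw,
      P.derivWeierstrassP_homothety hw0 hw] at h2
    simp only [Polynomial.eval_sub, Polynomial.eval_mul, Polynomial.eval_comp, Polynomial.eval_C,
      Polynomial.eval_X]
    rw [show P.weierstrassP z / (w : ℂ) ^ 2 = c * P.weierstrassP z by rw [hc]; ring] at h2
    linear_combination h2
  have key : ∀ n : ℕ, (w : ℂ) ^ n = 1 → orderOf w ∣ n := fun n hn =>
    orderOf_dvd_of_pow_eq_one (Units.ext (by rw [Units.val_pow_eq_pow_val, hn, Units.val_one]))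
  refine ⟨A, B, hAB, fun i hi => key _ ?_, fun i hi => key _ ?_⟩
  · have h2 := congrArg (fun p => Polynomial.coeff p i) h1.1
    simp only [Polynomial.coeff_sub, Polynomial.comp_C_mul_X_coeff, Polynomial.coeff_C_mul,
      Polynomial.coeff_zero] at h2
    have h3 : c ^ i = (w : ℂ) ^ j := mul_left_cancel₀ hi (by linear_combination h2)
    rw [pow_add, ← h3, hc, pow_mul, ← mul_pow, inv_mul_cancel₀ (pow_ne_zero 2 hw0), one_pow]
  · have h2 := congrArg (fun p => Polynomial.coeff p i) h1.2
    simp only [Polynomial.coeff_sub, Polynomial.comp_C_mul_X_coeff, Polynomial.coeff_C_mul,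
      Polynomial.coeff_zero] at h2
    have h3 : ((w : ℂ) ^ 3)⁻¹ * c ^ i = (w : ℂ) ^ j :=
      mul_left_cancel₀ hi (by linear_combination h2)
    rw [add_assoc, pow_add, ← h3, hc, pow_add, pow_mul, inv_pow]
    have := pow_ne_zero i (pow_ne_zero 2 hw0)
    field_simp

/-- Regular functions with `g (γ z) = χ γ * g z`. -/
structure IsWeighted {L P : PeriodPair} {Γ : Type*} [Group Γ] (A : AffineAction L P Γ)
    (χ : Γ →* ℂˣ) (g : ℂ → ℂ) : Prop where
  regular : RegularOff L P g
  map_mul : ∀ γ, ∀ z ∉ P.lattice, g (A.a γ * z + A.b γ) = χ γ * g z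

namespace IsWeighted

variable {L P : PeriodPair} {Γ : Type*} [Group Γ] {A : AffineAction L P Γ} {χ : Γ →* ℂˣ}
  {g : ℂ → ℂ}

lemma isElliptic (h : IsWeighted A χ g) (hχ : ∀ k, A.a k = 1 → χ k = 1) : P.IsElliptic g where
  analyticAt := h.regular.analyticAt
  meromorphicAt_zero := h.regular.meromorphicAt 0
  map_add p hp z hz := by
    obtain ⟨k, hk, hpk⟩ := (A.mem_iff p).mp hp
    have h1 := h.regular.map_add _ hpk (z + A.b k) (P.add_notMem hz (A.b_mem hk))
    have h2 := h.map_mul k z hz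
    rw [hk, Units.val_one, one_mul, hχ k hk, Units.val_one] at h2
    rw [← h2, ← h1]
    congr 1
    ring

lemma map_mul' (h : IsWeighted A χ g) (hχ : ∀ k, A.a k = 1 → χ k = 1) (γ : Γ) {z : ℂ}
    (hz : z ∉ P.lattice) : g (A.a γ * z) = χ γ * g z := by
  rw [← h.map_mul γ z hz, (h.isElliptic hχ).map_add _ (A.b_mem_lattice γ) _
    (fun h => hz ((A.mul_mem_iff γ z).mp h)), one_mul]

lemma of_generator (hg : P.IsElliptic g) {γ₀ : Γ} (hγ₀ : ∀ γ, ∃ n : ℕ, A.a γ = A.a γ₀ ^ n)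
    {j : ℕ} (h : ∀ z ∉ P.lattice, g (A.a γ₀ * z) = (A.a γ₀ : ℂ) ^ j * g z) (hχ : χ = A.a ^ j) :
    IsWeighted A χ g where
  regular := A.isRegular_of_isElliptic hg
  map_mul γ z hz := by
    rw [hg.map_add _ (A.b_mem_lattice γ) _ (fun h => hz ((A.mul_mem_iff γ z).mp h)), one_mul, hχ,
      MonoidHom.pow_apply]
    obtain ⟨n, hn⟩ := hγ₀ γ
    rw [hn, Units.val_pow_eq_pow_val, Units.val_pow_eq_pow_val, Units.val_pow_eq_pow_val,
      ← pow_mul, mul_comm n, pow_mul]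
    have hmem : ∀ n : ℕ, (A.a γ₀ : ℂ) ^ n * z ∉ P.lattice := by
      intro n
      induction n with
      | zero => simpa using hz
      | succ n ih => rw [pow_succ', mul_assoc]; exact fun h => ih ((A.mul_mem_iff γ₀ _).mp h)
    clear hn
    induction n with
    | zero => simp
    | succ n ih => rw [pow_succ', mul_assoc, h _ (hmem n), ih, pow_succ', mul_assoc]

end IsWeighted

namespace AffineAction

variable {L P : PeriodPair} {Γ : Type*} [Group Γ]

/-- Only the image of `a`, a finite subgroup of `ℂˣ`, is cyclic; `γ₀` generates `Γ` merely up to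
translations. -/
lemma exists_generator [Finite Γ] (A : AffineAction L P Γ) :
    ∃ γ₀, ∀ γ, ∃ n : ℕ, A.a γ = A.a γ₀ ^ n := by
  have : Finite A.a.range := Finite.of_surjective A.a.rangeRestrict A.a.rangeRestrict_surjective
  have hcyc : IsCyclic A.a.range := isCyclic_of_injective_ringHom
    ((Units.coeHom ℂ).comp A.a.range.subtype)
    (Units.val_injective.comp Subtype.val_injective)
  obtain ⟨⟨_, γ₀, rfl⟩, hg⟩ := hcyc.exists_generator
  refine ⟨γ₀, fun γ => ?_⟩
  obtain ⟨n, hn⟩ := mem_powers_iff_mem_zpowers.mpr (hg ⟨A.a γ, γ, rfl⟩)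
  exact ⟨n, (congrArg Subtype.val hn).symm⟩

/-- A coordinate on the quotient by the group, together with generators of the modules of functions
of weights `a⁻¹` and `a`. -/
structure IsOrbitCoordinate (A : AffineAction L P Γ) (q : ℂ[X]) (t α β : ℂ → ℂ) : Prop where
  weight_t : IsWeighted A 1 t
  weight_α : IsWeighted A A.a⁻¹ α
  weight_β : IsWeighted A A.a β
  exists_one : ∀ g, IsWeighted A 1 g → ∃ B : ℂ[X], ∀ z ∉ P.lattice, g z = B.eval (t z)
  exists_inv : ∀ g, IsWeighted A A.a⁻¹ g → ∃ B : ℂ[X], ∀ z ∉ P.lattice, g z = B.eval (t z) * α z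
  exists_pos : ∀ g, IsWeighted A A.a g → ∃ B : ℂ[X], ∀ z ∉ P.lattice, g z = B.eval (t z) * β z
  mul : ∀ z ∉ P.lattice, α z * β z = q.eval (t z)
  surjective : ∀ c, ∃ z ∉ P.lattice, t z = c
  separates : ∀ z ∉ P.lattice, ∀ w ∉ P.lattice, t z = t w → ∃ γ, w - A.a γ * z ∈ P.lattice
  ramified : ∀ z ∉ P.lattice, q.eval (t z) = 0 → ∃ γ, A.a γ ≠ 1 ∧ A.a γ * z - z ∈ P.lattice

end AffineAction

/-! ## The coordinate on the quotient -/

lemma PeriodPair.IsSemiElliptic.pow {P : PeriodPair} {f : ℂ → ℂ} (hf : P.IsElliptic f) (n : ℕ) :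
    P.IsElliptic (fun z => f z ^ n) := by
  induction n with
  | zero => simpa using PeriodPair.IsSemiElliptic.const (P := P) 1
  | succ n ih => simpa only [pow_succ] using ih.mul_elliptic hf

namespace AffineAction

variable {L P : PeriodPair} {Γ : Type*} [Group Γ] {A : AffineAction L P Γ}

lemma exists_polynomial_of_isWeighted {γ₀ : Γ} {χ : Γ →* ℂˣ} {g : ℂ → ℂ} (hg : IsWeighted A χ g)
    {j : ℕ} (hχ : ∀ k, A.a k = 1 → χ k = 1) (hj : χ γ₀ = A.a γ₀ ^ j) :
    ∃ p q : ℂ[X], (∀ z ∉ P.lattice, g z = p.eval (P.weierstrassP z) +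
        q.eval (P.weierstrassP z) * P.derivWeierstrassP z) ∧
      (∀ i, p.coeff i ≠ 0 → orderOf (A.a γ₀) ∣ j + 2 * i) ∧
        ∀ i, q.coeff i ≠ 0 → orderOf (A.a γ₀) ∣ j + 2 * i + 3 :=
  (hg.isElliptic hχ).exists_polynomial_of_weight (A.mul_mem_iff γ₀) fun z hz => by
    rw [hg.map_mul' hχ γ₀ hz, hj, Units.val_pow_eq_pow_val]

lemma inv_eq_pow {γ₀ : Γ} (hγ₀ : ∀ γ, ∃ n : ℕ, A.a γ = A.a γ₀ ^ n) {n : ℕ}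
    (hn : orderOf (A.a γ₀) = n + 1) : A.a⁻¹ = A.a ^ n := by
  refine MonoidHom.ext fun γ => ?_
  obtain ⟨m, hm⟩ := hγ₀ γ
  rw [MonoidHom.inv_apply, MonoidHom.pow_apply, hm, inv_eq_iff_mul_eq_one, ← pow_succ',
    ← pow_mul, ← hn, mul_comm, pow_mul, pow_orderOf_eq_one, one_pow]

lemma weierstrassP_pow_mul (γ : Γ) (i : ℕ) (z : ℂ) :
    P.weierstrassP ((A.a γ : ℂ) ^ i * z) = P.weierstrassP z / ((A.a γ : ℂ) ^ i) ^ 2 := by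
  have := P.weierstrassP_homothety (Q := P) (c := A.a (γ ^ i)) (Units.ne_zero _) (A.mul_mem_iff _) z
  simpa using this

lemma derivWeierstrassP_pow_mul (γ : Γ) (i : ℕ) (z : ℂ) :
    P.derivWeierstrassP ((A.a γ : ℂ) ^ i * z) = P.derivWeierstrassP z / ((A.a γ : ℂ) ^ i) ^ 3 := by
  have := P.derivWeierstrassP_homothety (Q := P) (c := A.a (γ ^ i)) (Units.ne_zero _)
    (A.mul_mem_iff _) z
  simpa using this

/-- If a power of the generator takes `x` to `y`, one finds it from the `m`-th powers. -/
lemma exists_weierstrassP_eq {γ₀ : Γ} {m : ℕ} (hm : 0 < m)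
    (hprim : IsPrimitiveRoot ((A.a γ₀ : ℂ) ^ 2) m) {z w : ℂ}
    (h : P.weierstrassP z ^ m = P.weierstrassP w ^ m) :
    ∃ i, P.weierstrassP ((A.a γ₀ : ℂ) ^ i * z) = P.weierstrassP w := by
  simp only [weierstrassP_pow_mul]
  by_cases hw : P.weierstrassP w = 0
  · rw [hw, zero_pow hm.ne', pow_eq_zero_iff hm.ne'] at h
    exact ⟨0, by simp [h, hw]⟩
  have : NeZero m := ⟨hm.ne'⟩
  obtain ⟨i, -, hi⟩ := hprim.eq_pow_of_pow_eq_one (ξ := P.weierstrassP z / P.weierstrassP w)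
    (by rw [div_pow, h, div_self (pow_ne_zero m hw)])
  refine ⟨i, ?_⟩
  have h0 : (A.a γ₀ : ℂ) ≠ 0 := Units.ne_zero _
  rw [eq_div_iff hw] at hi
  rw [div_eq_iff (by positivity), ← hi]
  ring

/-- The coordinate when the image of `a` has even order `2 * m`. -/
theorem isOrbitCoordinate_of_even {γ₀ : Γ} (hγ₀ : ∀ γ, ∃ n : ℕ, A.a γ = A.a γ₀ ^ n) {m r : ℕ}
    (hm : 0 < m) (hr : r < m) (hord : orderOf (A.a γ₀) = 2 * m) (hr0 : m ∣ r + 2)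
    {q : ℂ[X]} (hq : ∀ z ∉ P.lattice,
      P.weierstrassP z ^ (m - 1 + r) * P.derivWeierstrassP z ^ 2 = q.eval (P.weierstrassP z ^ m)) :
    A.IsOrbitCoordinate q (fun z => P.weierstrassP z ^ m)
      (fun z => P.weierstrassP z ^ (m - 1) * P.derivWeierstrassP z)
      (fun z => P.weierstrassP z ^ r * P.derivWeierstrassP z) := by
  have h0 : (A.a γ₀ : ℂ) ≠ 0 := Units.ne_zero _
  have hinv := inv_eq_pow hγ₀ (n := 2 * m - 1) (by omega)
  have hprim : IsPrimitiveRoot (A.a γ₀ : ℂ) (2 * m) := by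
    rw [IsPrimitiveRoot.coe_units_iff, ← hord]; exact IsPrimitiveRoot.orderOf _
  have hprim2 : IsPrimitiveRoot ((A.a γ₀ : ℂ) ^ 2) m := hprim.pow (by omega) rfl
  have hneg : (A.a γ₀ : ℂ) ^ m = -1 := by
    have h1 := hprim.pow_eq_one
    rw [mul_comm, pow_mul] at h1
    exact (sq_eq_one_iff.mp h1).resolve_left
      (hprim.pow_ne_one_of_pos_of_lt hm.ne' (by omega))
  have hP : ∀ z, P.weierstrassP (A.a γ₀ * z) = P.weierstrassP z / (A.a γ₀ : ℂ) ^ 2 := fun z => by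
    simpa using weierstrassP_pow_mul (A := A) γ₀ 1 z
  have hP' : ∀ z, P.derivWeierstrassP (A.a γ₀ * z) = P.derivWeierstrassP z / (A.a γ₀ : ℂ) ^ 3 :=
    fun z => by simpa using derivWeierstrassP_pow_mul (A := A) γ₀ 1 z
  -- The divisibility says that `℘ ^ r * ℘'` has weight `a`, as `-2 * r - 3` is then congruent to
  -- `1` modulo `2 * m`.
  obtain ⟨s, hs⟩ := hr0
  -- The value of `℘` determines a point up to sign, and the sign is the rotation `(a γ₀) ^ m = -1`.
  have hsep : ∀ z ∉ P.lattice, ∀ w ∉ P.lattice, ∀ i : ℕ,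
      P.weierstrassP ((A.a γ₀ : ℂ) ^ i * z) = P.weierstrassP w →
        ∃ j, (j = i ∨ j = i + m) ∧ w - A.a (γ₀ ^ j) * z ∈ P.lattice := by
    intro z hz w hw i hi
    have hz' : (A.a γ₀ : ℂ) ^ i * z ∉ P.lattice := fun h =>
      hz ((A.mul_mem_iff (γ₀ ^ i) z).mp (by simpa using h))
    rcases (P.weierstrassP_eq_iff hz' hw).mp hi with h | h
    · exact ⟨i, .inl rfl, by simpa using h⟩
    · refine ⟨i + m, .inr rfl, ?_⟩
      rw [map_pow, Units.val_pow_eq_pow_val, pow_add, hneg]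
      simpa using h
  refine ⟨.of_generator (P.isElliptic_weierstrassP.pow m) hγ₀ (j := 0) ?_
      (MonoidHom.ext fun _ => by rw [MonoidHom.pow_apply, pow_zero, MonoidHom.one_apply]),
    .of_generator ((P.isElliptic_weierstrassP.pow _).mul_elliptic P.isElliptic_derivWeierstrassP)
      hγ₀ (j := 2 * m - 1) ?_ hinv,
    .of_generator ((P.isElliptic_weierstrassP.pow _).mul_elliptic P.isElliptic_derivWeierstrassP)
      hγ₀ (j := 1) ?_ (MonoidHom.ext fun _ => by rw [MonoidHom.pow_apply, pow_one]),
    fun g hg => ?_, fun g hg => ?_, fun g hg => ?_, fun z hz => ?_,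
    fun c => ?_, fun z hz w hw h => ?_, fun z hz h => ?_⟩
  · intro z hz
    rw [hP, div_pow, ← pow_mul, hprim.pow_eq_one]
    simp
  · intro z hz
    rw [hP, hP', div_pow, div_mul_div_comm, div_eq_iff (by positivity), mul_right_comm, ← pow_mul,
      ← pow_add, ← pow_add, show 2 * m - 1 + (2 * (m - 1) + 3) = 2 * m + 2 * m by omega, pow_add,
      hprim.pow_eq_one]
    ring
  · intro z hz
    rw [hP, hP', div_pow, div_mul_div_comm, div_eq_iff (by positivity), mul_right_comm, ← pow_mul,
      ← pow_add, ← pow_add, show 1 + (2 * r + 3) = 2 * m * s by rw [mul_assoc, ← hs]; ring, pow_mul,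
      hprim.pow_eq_one]
    ring
  -- In this and the next two cases parity modulo the even order eliminates `p` or `p'`, and the
  -- weight fixes the exponents of `℘` modulo `m`.
  · obtain ⟨p, p', h1, h2, h3⟩ := A.exists_polynomial_of_isWeighted (γ₀ := γ₀) hg (j := 0)
      (by simp) (by simp)
    rw [hord] at h2 h3
    have hp' : p' = 0 := by
      ext i
      by_contra hi
      obtain ⟨k, hk⟩ := h3 i hi
      rw [mul_assoc] at hk
      omega
    obtain ⟨B, hB⟩ := Polynomial.exists_eval_eq_pow_mul (A := p) (m := m) (r := 0) fun i hi => by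
      have := h2 i hi
      rw [zero_add] at this
      exact Nat.mod_eq_zero_of_dvd (Nat.dvd_of_mul_dvd_mul_left two_pos this)
    exact ⟨B, fun z hz => by rw [h1 z hz, hp', hB]; simp⟩
  · obtain ⟨p, p', h1, h2, h3⟩ := A.exists_polynomial_of_isWeighted (γ₀ := γ₀) hg (j := 2 * m - 1)
      (by simp +contextual) (by rw [hinv, MonoidHom.pow_apply])
    rw [hord] at h2 h3
    have hp : p = 0 := by
      ext i
      by_contra hi
      obtain ⟨k, hk⟩ := h2 i hi
      rw [mul_assoc] at hk
      omega
    obtain ⟨B, hB⟩ := Polynomial.exists_eval_eq_pow_mul (A := p') (m := m) (r := m - 1)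
      fun i hi => by
        have h4 : 2 * m ∣ 2 * (i + 1 + m) := by
          have := h3 i hi
          rwa [show 2 * m - 1 + 2 * i + 3 = 2 * (i + 1 + m) by omega] at this
        have h5 := Nat.dvd_of_mul_dvd_mul_left two_pos h4
        rw [Nat.dvd_add_left dvd_rfl] at h5
        obtain ⟨k, hk⟩ := h5
        obtain _ | k := k
        · omega
        rw [Nat.mul_succ] at hk
        rw [show i = m - 1 + m * k by omega, Nat.add_mul_mod_self_left, Nat.mod_eq_of_lt (by omega)]
    exact ⟨B, fun z hz => by rw [h1 z hz, hp, hB]; simp; ring⟩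
  · obtain ⟨p, p', h1, h2, h3⟩ := A.exists_polynomial_of_isWeighted (γ₀ := γ₀) hg (j := 1)
      (fun _ h => h) (by simp)
    rw [hord] at h2 h3
    have hp : p = 0 := by
      ext i
      by_contra hi
      obtain ⟨k, hk⟩ := h2 i hi
      rw [mul_assoc] at hk
      omega
    obtain ⟨B, hB⟩ := Polynomial.exists_eval_eq_pow_mul (A := p') (m := m) (r := r)
      fun i hi => by
        have h4 : 2 * m ∣ 2 * (i + 2) := by
          have := h3 i hi
          rwa [show 1 + 2 * i + 3 = 2 * (i + 2) by omega] at this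
        have h5 := Nat.dvd_of_mul_dvd_mul_left two_pos h4
        have h6 : i + 2 ≡ r + 2 [MOD m] :=
          ((Nat.modEq_zero_iff_dvd).mpr h5).trans ((Nat.modEq_zero_iff_dvd).mpr ⟨s, hs⟩).symm
        have h7 := Nat.ModEq.add_right_cancel' 2 h6
        rw [Nat.ModEq, Nat.mod_eq_of_lt hr] at h7
        exact h7
    exact ⟨B, fun z hz => by rw [h1 z hz, hp, hB]; simp; ring⟩
  · rw [← hq z hz, pow_add]
    ring
  · obtain ⟨x, hx⟩ := IsAlgClosed.exists_pow_nat_eq c hm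
    obtain ⟨z, hz, rfl⟩ := P.weierstrassP_surjective x
    exact ⟨z, hz, hx⟩
  · obtain ⟨i, hi⟩ := exists_weierstrassP_eq hm hprim2 h
    obtain ⟨j, -, hj⟩ := hsep z hz w hw i hi
    exact ⟨_, hj⟩
  · have hne : ∀ j : ℕ, 0 < j → j < 2 * m → A.a (γ₀ ^ j) ≠ 1 := fun j h1 h2 h3 =>
      hprim.pow_ne_one_of_pos_of_lt h1.ne' h2 (by simpa using congrArg Units.val h3)
    -- A zero of `℘` is fixed modulo `P` by `γ₀` or by `γ₀ ^ (1 + m)`, and `m > 1` whenever this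
    -- case arises. A zero of `℘'` is a half period, fixed by the rotation `-1`.
    rw [← hq z hz, mul_eq_zero] at h
    rcases h with h | h
    · have h1 : m - 1 + r ≠ 0 := fun h1 => by simp [h1] at h
      have h2 := pow_eq_zero_iff h1 |>.mp h
      obtain ⟨j, hj, hj'⟩ := hsep z hz z hz 1 (by simp [hP, h2])
      refine ⟨_, hne j (by omega) (by omega), ?_⟩
      simpa using P.lattice.neg_mem hj'
    · refine ⟨γ₀ ^ m, hne m hm (by omega), ?_⟩
      have h2 := (P.derivWeierstrassP_eq_zero_iff hz).mp (pow_eq_zero_iff two_ne_zero |>.mp h)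
      rw [map_pow, Units.val_pow_eq_pow_val, hneg]
      convert P.lattice.neg_mem h2 using 1
      ring

end AffineAction

namespace AffineAction

variable {L P : PeriodPair} {Γ : Type*} [Group Γ] {A : AffineAction L P Γ}

/-- For order three `℘'` is invariant and, as `g₂ = 0`, `℘ ^ 3` is a polynomial in `℘'`. The weight
fixes the exponents of `℘` modulo three. -/
lemma exists_polynomial_of_orderOf_eq_three {γ₀ : Γ} (hord : orderOf (A.a γ₀) = 3)
    (hg₂ : P.g₂ = 0) {χ : Γ →* ℂˣ} {g : ℂ → ℂ} (hg : IsWeighted A χ g) {j : ℕ} (hj3 : j < 3)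
    (hχ : ∀ k, A.a k = 1 → χ k = 1) (hj : χ γ₀ = A.a γ₀ ^ j) :
    ∃ B : ℂ[X], ∀ z ∉ P.lattice,
      g z = B.eval (P.derivWeierstrassP z) * P.weierstrassP z ^ j := by
  obtain ⟨p, p', h1, h2, h3⟩ := A.exists_polynomial_of_isWeighted hg hχ hj
  rw [hord] at h2 h3
  obtain ⟨B, hB⟩ := Polynomial.exists_eval_eq_pow_mul (A := p) (m := 3) (r := j) fun i hi => by
    have := h2 i hi
    omega
  obtain ⟨B', hB'⟩ := Polynomial.exists_eval_eq_pow_mul (A := p') (m := 3) (r := j) fun i hi => by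
    have := h3 i hi
    omega
  set s : ℂ[X] := Polynomial.C (1 / 4) * (Polynomial.X ^ 2 + Polynomial.C P.g₃) with hs
  refine ⟨B.comp s + B'.comp s * Polynomial.X, fun z hz => ?_⟩
  have h4 : P.weierstrassP z ^ 3 = s.eval (P.derivWeierstrassP z) := by
    have := P.derivWeierstrassP_sq z hz
    rw [hs]
    simp only [Polynomial.eval_mul, Polynomial.eval_C, Polynomial.eval_add, Polynomial.eval_pow,
      Polynomial.eval_X]
    rw [this, hg₂]
    ring
  rw [h1 z hz, hB, hB', h4]
  simp only [Polynomial.eval_add, Polynomial.eval_mul, Polynomial.eval_comp, Polynomial.eval_X]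
  ring

/-- The coordinate when the image of `a` has order three. -/
theorem isOrbitCoordinate_of_orderOf_eq_three {γ₀ : Γ} (hγ₀ : ∀ γ, ∃ n : ℕ, A.a γ = A.a γ₀ ^ n)
    (hord : orderOf (A.a γ₀) = 3) (hg₂ : P.g₂ = 0) {r : ℂ} (hr : r ^ 2 = -P.g₃) :
    A.IsOrbitCoordinate (Polynomial.C (1 / 4) * (Polynomial.X - Polynomial.C r) *
      (Polynomial.X - Polynomial.C (-r))) P.derivWeierstrassP
      (fun z => P.weierstrassP z ^ 2) (fun z => P.weierstrassP z ^ 1) := by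
  have h0 : (A.a γ₀ : ℂ) ≠ 0 := Units.ne_zero _
  have hinv := inv_eq_pow hγ₀ (n := 2) hord
  have hprim : IsPrimitiveRoot (A.a γ₀ : ℂ) 3 := by
    rw [IsPrimitiveRoot.coe_units_iff, ← hord]; exact IsPrimitiveRoot.orderOf _
  have h1 : (A.a γ₀ : ℂ) ^ 3 = 1 := hprim.pow_eq_one
  have hP : ∀ z, P.weierstrassP (A.a γ₀ * z) = P.weierstrassP z / (A.a γ₀ : ℂ) ^ 2 := fun z => by
    simpa using weierstrassP_pow_mul (A := A) γ₀ 1 z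
  have hP' : ∀ i z, P.derivWeierstrassP ((A.a γ₀ : ℂ) ^ i * z) = P.derivWeierstrassP z :=
    fun i z => by
      rw [derivWeierstrassP_pow_mul, ← pow_mul, mul_comm, pow_mul, h1, one_pow, div_one]
  have hsq : ∀ z ∉ P.lattice, P.derivWeierstrassP z ^ 2 = 4 * P.weierstrassP z ^ 3 - P.g₃ :=
    fun z hz => by rw [P.derivWeierstrassP_sq z hz, hg₂]; ring
  have hq : ∀ z ∉ P.lattice, P.weierstrassP z ^ 2 * P.weierstrassP z ^ 1 =
      (Polynomial.C (1 / 4) * (Polynomial.X - Polynomial.C r) *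
        (Polynomial.X - Polynomial.C (-r))).eval (P.derivWeierstrassP z) := fun z hz => by
    simp only [Polynomial.eval_mul, Polynomial.eval_C, Polynomial.eval_sub, Polynomial.eval_X]
    linear_combination (-1 / 4) * hsq z hz - (-1 / 4) * hr
  refine ⟨.of_generator P.isElliptic_derivWeierstrassP hγ₀ (j := 0) ?_
      (MonoidHom.ext fun _ => by rw [MonoidHom.pow_apply, pow_zero, MonoidHom.one_apply]),
    .of_generator (P.isElliptic_weierstrassP.pow _) hγ₀ (j := 2) ?_ hinv,
    .of_generator (P.isElliptic_weierstrassP.pow _) hγ₀ (j := 1) ?_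
      (MonoidHom.ext fun _ => by rw [MonoidHom.pow_apply, pow_one]), fun g hg => ?_, fun g hg => ?_,
    fun g hg => ?_, hq, fun c => ?_, fun z hz w hw h => ?_, fun z hz h => ?_⟩
  · intro z hz
    simpa using hP' 1 z
  · intro z hz
    rw [hP, div_pow, div_eq_iff (by positivity)]
    linear_combination (-P.weierstrassP z ^ 2) * ((A.a γ₀ : ℂ) ^ 3 + 1) * h1
  · intro z hz
    rw [hP, div_pow, div_eq_iff (by positivity)]
    linear_combination (-P.weierstrassP z) * h1
  · simpa using exists_polynomial_of_orderOf_eq_three hord hg₂ hg (j := 0) (by omega) (by simp)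
      (by simp)
  · exact exists_polynomial_of_orderOf_eq_three hord hg₂ hg (j := 2) (by omega)
      (by simp +contextual) (by rw [hinv, MonoidHom.pow_apply])
  · exact exists_polynomial_of_orderOf_eq_three hord hg₂ hg (j := 1) (by omega) (fun _ h => h)
      (by simp)
  -- Choosing `℘` prescribes `℘'` only up to sign, which is corrected by replacing `z` with `-z`.
  · obtain ⟨x, hx⟩ := IsAlgClosed.exists_pow_nat_eq ((c ^ 2 + P.g₃) / 4) three_pos
    obtain ⟨z, hz, rfl⟩ := P.weierstrassP_surjective x
    have h2 : P.derivWeierstrassP z ^ 2 = c ^ 2 := by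
      rw [hsq z hz, hx]
      ring
    rcases sq_eq_sq_iff_eq_or_eq_neg.mp h2 with h2 | h2
    · exact ⟨z, hz, h2⟩
    · exact ⟨-z, P.neg_notMem hz, by rw [P.derivWeierstrassP_neg, h2, neg_neg]⟩
  · have h2 : P.weierstrassP z ^ 3 = P.weierstrassP w ^ 3 := by
      have e1 := hsq z hz
      rw [h, hsq w hw] at e1
      linear_combination (-1 / 4) * e1
    obtain ⟨i, hi⟩ := exists_weierstrassP_eq three_pos
      (hprim.pow_of_coprime 2 (by norm_num)) h2
    have hz' : (A.a γ₀ : ℂ) ^ i * z ∉ P.lattice := fun h =>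
      hz ((A.mul_mem_iff (γ₀ ^ i) z).mp (by simpa using h))
    refine ⟨γ₀ ^ i, ?_⟩
    simpa using P.sub_mem_of_weierstrassP_eq hz' hw hi (by rw [hP', h])
  · refine ⟨γ₀, fun h2 => ?_, ?_⟩
    · rw [h2, orderOf_one] at hord
      omega
    rw [← hq z hz, ← pow_add, pow_eq_zero_iff (by omega)] at h
    have hz' : (A.a γ₀ : ℂ) * z ∉ P.lattice := fun h => hz ((A.mul_mem_iff γ₀ z).mp h)
    exact P.sub_mem_of_weierstrassP_eq hz hz' (by rw [hP, h, zero_div])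
      (by simpa using (hP' 1 z).symm)

/-- Either the action is by translations, or the quotient has a coordinate with three or two
ramification values. -/
theorem exists_isOrbitCoordinate [Finite Γ] (A : AffineAction L P Γ) : (∀ γ, A.a γ = 1) ∨
    A.IsOrbitCoordinate (4 * Polynomial.X ^ 3 - Polynomial.C P.g₂ * Polynomial.X -
      Polynomial.C P.g₃) P.weierstrassP P.derivWeierstrassP P.derivWeierstrassP ∨
    ∃ (κ r s : ℂ) (t α β : ℂ → ℂ), κ ≠ 0 ∧ r ≠ s ∧ A.IsOrbitCoordinate (Polynomial.C κ *
      (Polynomial.X - Polynomial.C r) * (Polynomial.X - Polynomial.C s)) t α β := by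
  obtain ⟨γ₀, hγ₀⟩ := A.exists_generator
  have hg₂ := A.g₂_mul γ₀
  have hg₃ := A.g₃_mul γ₀
  have hsq := P.derivWeierstrassP_sq
  -- Invariance of `g₂` and `g₃` forces `g₂ = 0` for orders 3 and 6, and `g₃ = 0` for order 4.
  have key : ∀ {c : ℂ} {n : ℕ}, c * (A.a γ₀ : ℂ) ^ n = c → ¬ orderOf (A.a γ₀) ∣ n → c = 0 := by
    intro c n h1 h2
    by_contra hc
    refine h2 (orderOf_dvd_of_pow_eq_one (Units.ext ?_))
    rw [Units.val_pow_eq_pow_val, Units.val_one]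
    exact mul_left_cancel₀ hc (by rw [h1, mul_one])
  have hord : orderOf (A.a γ₀) = 1 ∨ orderOf (A.a γ₀) = 2 ∨ orderOf (A.a γ₀) = 3 ∨
      orderOf (A.a γ₀) = 4 ∨ orderOf (A.a γ₀) = 6 := by
    rcases A.pow_four_or_pow_six_eq_one γ₀ with h | h
    · have h1 := orderOf_dvd_of_pow_eq_one h
      have h2 := Nat.le_of_dvd (by omega) h1
      interval_cases orderOf (A.a γ₀) <;> omega
    · have h1 := orderOf_dvd_of_pow_eq_one h
      have h2 := Nat.le_of_dvd (by omega) h1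
      interval_cases orderOf (A.a γ₀) <;> omega
  rcases hord with h | h | h | h | h
  · left
    intro γ
    obtain ⟨n, hn⟩ := hγ₀ γ
    rw [hn, orderOf_eq_one_iff.mp h, one_pow]
  · right; left
    have h1 := isOrbitCoordinate_of_even hγ₀ (m := 1) (r := 0) (by omega) (by omega) h (by omega)
      (q := 4 * Polynomial.X ^ 3 - Polynomial.C P.g₂ * Polynomial.X - Polynomial.C P.g₃)
      fun z hz => by simp [hsq z hz]
    simpa using h1
  · right; right
    have h2 : P.g₂ = 0 := key hg₂ (by rw [h]; omega)
    have h3 : P.g₃ ≠ 0 := P.g₂_ne_zero_or_g₃_ne_zero.resolve_left (by simp [h2])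
    obtain ⟨r, hr⟩ := IsAlgClosed.exists_pow_nat_eq (-P.g₃) two_pos
    refine ⟨_, _, _, _, _, _, by norm_num, fun h4 => ?_,
      isOrbitCoordinate_of_orderOf_eq_three hγ₀ h h2 hr⟩
    have h5 : r = 0 := by linear_combination h4 / 2
    rw [h5] at hr
    exact h3 (by linear_combination hr)
  · right; right
    have h2 : P.g₃ = 0 := key hg₃ (by rw [h]; omega)
    have h3 : P.g₂ ≠ 0 := P.g₂_ne_zero_or_g₃_ne_zero.resolve_right (by simp [h2])
    -- With `t = ℘ ^ 2` and `g₃ = 0`, `℘ * ℘' ^ 2 = 4 * t * (t - g₂ / 4)`.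
    refine ⟨4, 0, P.g₂ / 4, _, _, _, by norm_num, ?_, isOrbitCoordinate_of_even hγ₀ (m := 2)
      (r := 0) (by omega) (by omega) h (by omega) fun z hz => ?_⟩
    · exact (div_ne_zero h3 (by norm_num)).symm
    · simp [hsq z hz, h2]
      ring
  · right; right
    have h2 : P.g₂ = 0 := key hg₂ (by rw [h]; omega)
    have h3 : P.g₃ ≠ 0 := P.g₂_ne_zero_or_g₃_ne_zero.resolve_left (by simp [h2])
    -- With `t = ℘ ^ 3` and `g₂ = 0`, `℘ ^ 3 * ℘' ^ 2 = 4 * t * (t - g₃ / 4)`.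
    refine ⟨4, 0, P.g₃ / 4, _, _, _, by norm_num, ?_, isOrbitCoordinate_of_even hγ₀ (m := 3)
      (r := 1) (by omega) (by omega) h (by omega) fun z hz => ?_⟩
    · exact (div_ne_zero h3 (by norm_num)).symm
    · simp [hsq z hz, h2]
      ring

end AffineAction

/-! ## Invariant maps in a moving frame -/

lemma RegularOff.congr {L P : PeriodPair} {g g' : ℂ → ℂ} (h : RegularOff L P g)
    (hL : L.lattice ≤ P.lattice) (hg : ∀ z ∉ P.lattice, g z = g' z) : RegularOff L P g' where
  analyticAt z hz := (h.analyticAt z hz).congr (by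
    filter_upwards [P.isClosed_lattice.isOpen_compl.mem_nhds hz] with w hw using hg w hw)
  meromorphicAt z := (h.meromorphicAt z).congr (by
    filter_upwards [P.eventually_notMem z] with w hw using hg w hw)
  map_add l hl z hz := by
    rw [← hg z hz, ← hg _ (P.add_notMem hz (hL hl)), h.map_add l hl z hz]

namespace RegularVecOff

variable {L P : PeriodPair} {u v : ℂ → Sl2}

lemma lie (hu : RegularVecOff L P u) (hv : RegularVecOff L P v) :
    RegularVecOff L P (fun z => ⁅u z, v z⁆) := fun x => by
  simp only [← Sl2.form_lie_left]
  refine RegularVecOff.form (fun y => ?_) hv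
  simp only [← Sl2.form_lie_left]
  exact hu _

end RegularVecOff

section Character

variable {Γ : Type*} [Group Γ] (χ : Γ →* ℂˣ)

lemma character_mul_inv : χ * χ⁻¹ = 1 := MonoidHom.ext fun γ => mul_inv_cancel (χ γ)
lemma character_inv_mul : χ⁻¹ * χ = 1 := MonoidHom.ext fun γ => inv_mul_cancel (χ γ)
lemma character_mul_one : χ * 1 = χ := MonoidHom.ext fun γ => mul_one (χ γ)
lemma character_one_mul : 1 * χ = χ := MonoidHom.ext fun γ => one_mul (χ γ)
lemma character_inv_one : (1 : Γ →* ℂˣ)⁻¹ = 1 := MonoidHom.ext fun _ => inv_one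

end Character

section Frame

variable {L P : PeriodPair} {Γ : Type*} [Group Γ] {A : AffineAction L P Γ}

namespace IsWeighted

variable {χ χ' : Γ →* ℂˣ} {g g' : ℂ → ℂ}

lemma mul (h : IsWeighted A χ g) (h' : IsWeighted A χ' g') :
    IsWeighted A (χ * χ') (fun z => g z * g' z) where
  regular := h.regular.mul h'.regular
  map_mul γ z hz := by
    rw [h.map_mul γ z hz, h'.map_mul γ z hz, MonoidHom.mul_apply, Units.val_mul]
    ring

lemma eval (h : IsWeighted A 1 g) (p : ℂ[X]) : IsWeighted A 1 (fun z => p.eval (g z)) where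
  regular := by
    induction p using Polynomial.induction_on' with
    | add p q hp hq => simpa only [Polynomial.eval_add] using hp.add hq
    | monomial n c =>
      simp only [Polynomial.eval_monomial]
      refine (RegularOff.const c).mul ?_
      induction n with
      | zero => simpa using RegularOff.const 1
      | succ n ih => simpa only [pow_succ] using ih.mul h.regular
  map_mul γ z hz := by rw [h.map_mul γ z hz]; simp

end IsWeighted

namespace IsCovariant

variable {ρ : Γ →* (Sl2 ≃ₗ⁅ℂ⁆ Sl2)} {ψ ψ' χ : Γ →* ℂˣ} {u v : ℂ → Sl2} {g : ℂ → ℂ}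

lemma lie (hu : IsCovariant A ρ ψ u) (hv : IsCovariant A ρ ψ' v) :
    IsCovariant A ρ (ψ * ψ') (fun z => ⁅u z, v z⁆) where
  regular := hu.regular.lie hv.regular
  map_smul γ z hz := by
    rw [hu.map_smul γ z hz, hv.map_smul γ z hz, smul_lie, lie_smul, LieEquiv.map_lie, smul_smul,
      MonoidHom.mul_apply, Units.val_mul]

lemma form (hu : IsCovariant A ρ ψ u) (hv : IsCovariant A ρ ψ' v) :
    IsWeighted A (ψ * ψ') (fun z => Sl2.form (u z) (v z)) where
  regular := hu.regular.form hv.regular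
  map_mul γ z hz := by
    rw [hu.map_smul γ z hz, hv.map_smul γ z hz, _root_.map_smul, _root_.map_smul,
      LinearMap.smul_apply, Sl2.form_map, MonoidHom.mul_apply, Units.val_mul, smul_eq_mul,
      smul_eq_mul]
    ring

lemma smul (hg : IsWeighted A χ g) (hu : IsCovariant A ρ ψ u) :
    IsCovariant A ρ (χ * ψ) (fun z => g z • u z) where
  regular := RegularVecOff.smul hg.regular hu.regular
  map_smul γ z hz := by
    rw [hu.map_smul γ z hz, hg.map_mul γ z hz, _root_.map_smul, smul_smul, smul_smul,
      MonoidHom.mul_apply, Units.val_mul]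
    congr 1
    ring

lemma add (hu : IsCovariant A ρ ψ u) (hv : IsCovariant A ρ ψ v) :
    IsCovariant A ρ ψ (fun z => u z + v z) where
  regular := hu.regular.add hv.regular
  map_smul γ z hz := by
    rw [hu.map_smul γ z hz, hv.map_smul γ z hz, map_add, smul_add]

lemma congr (hu : IsCovariant A ρ ψ u) (h : ∀ z ∉ P.lattice, u z = v z) :
    IsCovariant A ρ ψ v where
  regular x := (hu.regular x).congr A.lattice_le fun z hz => by rw [h z hz]
  map_smul γ z hz := by rw [← h z hz, ← h _ (A.apply_notMem γ hz), hu.map_smul γ z hz]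

end IsCovariant

namespace IsMovingFrame

variable {ρ : Γ →* (Sl2 ≃ₗ⁅ℂ⁆ Sl2)} {u e f : ℂ → Sl2}

/-- The coordinates of `u` are, up to constants, its pairings with `f`, `e` and `⁅e, f⁆`. Invariance
of the form gives them the weights of these maps. -/
lemma isCovariant_one_iff (h : IsMovingFrame A ρ A.a e f) : IsCovariant A ρ 1 u ↔
    ∃ α β c : ℂ → ℂ, IsWeighted A A.a⁻¹ α ∧ IsWeighted A A.a β ∧ IsWeighted A 1 c ∧
      ∀ z ∉ P.lattice, u z = α z • e z + β z • f z + c z • ⁅e z, f z⁆ := by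
  have hlie := h.left.lie h.right
  rw [character_mul_inv] at hlie
  constructor
  · intro hu
    have h1 := h.right.form hu
    have h2 := h.left.form hu
    have h3 := hlie.form hu
    rw [character_mul_one] at h1 h2 h3
    replace h3 := h3.eval (Polynomial.C (1 / 2) * Polynomial.X)
    refine ⟨_, _, _, h1, h2, h3, fun z hz => ?_⟩
    conv_lhs => rw [(h.isTriple z hz).expand (u z)]
    simp only [Polynomial.eval_mul, Polynomial.eval_C, Polynomial.eval_X]
    congr 2
    ring
  · rintro ⟨α, β, c, hα, hβ, hc, hu⟩
    have h1 := IsCovariant.smul hα h.left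
    have h2 := IsCovariant.smul hβ h.right
    have h3 := IsCovariant.smul hc hlie
    rw [character_inv_mul] at h1
    rw [character_mul_inv] at h2
    rw [character_mul_one] at h3
    exact ((h1.add h2).add h3).congr fun z hz => (hu z hz).symm

theorem isCovariant_one_iff_of_isOrbitCoordinate (h : IsMovingFrame A ρ A.a e f) {q : ℂ[X]}
    {t α β : ℂ → ℂ} (ht : A.IsOrbitCoordinate q t α β) : IsCovariant A ρ 1 u ↔
      ∃ A B C : ℂ[X], ∀ z ∉ P.lattice, u z = (A.eval (t z) * α z) • e z +
        (B.eval (t z) * β z) • f z + C.eval (t z) • ⁅e z, f z⁆ := by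
  rw [h.isCovariant_one_iff]
  constructor
  · rintro ⟨α', β', c, hα, hβ, hc, hu⟩
    obtain ⟨p, hp⟩ := ht.exists_inv _ hα
    obtain ⟨p', hp'⟩ := ht.exists_pos _ hβ
    obtain ⟨p'', hp''⟩ := ht.exists_one _ hc
    exact ⟨p, p', p'', fun z hz => by rw [hu z hz, hp z hz, hp' z hz, hp'' z hz]⟩
  · rintro ⟨p, p', p'', hu⟩
    refine ⟨_, _, _, ?_, ?_, ht.weight_t.eval p'', hu⟩
    · simpa only [character_one_mul] using (ht.weight_t.eval p).mul ht.weight_α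
    · simpa only [character_one_mul] using (ht.weight_t.eval p').mul ht.weight_β

lemma isWeighted_one_iff (ha : ∀ γ, A.a γ = 1) {g : ℂ → ℂ} : IsWeighted A 1 g ↔ ∃ p q : ℂ[X],
    ∀ z ∉ P.lattice, g z = p.eval (P.weierstrassP z) +
      q.eval (P.weierstrassP z) * P.derivWeierstrassP z := by
  constructor
  · intro h
    exact (h.isElliptic (by simp)).exists_polynomial
  · rintro ⟨p, q, h⟩
    have key : ∀ g : ℂ → ℂ, P.IsElliptic g → IsWeighted A 1 g := fun g hg =>
      .of_generator hg (γ₀ := 1) (fun γ => ⟨0, by simp [ha]⟩) (j := 0) (fun z _ => by simp)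
        (MonoidHom.ext fun _ => by rw [MonoidHom.pow_apply, pow_zero, MonoidHom.one_apply])
    have h1 := (key _ P.isElliptic_weierstrassP).eval p
    have h2 := ((key _ P.isElliptic_weierstrassP).eval q).mul
      (key _ P.isElliptic_derivWeierstrassP)
    rw [character_mul_one] at h2
    refine ⟨(h1.regular.add h2.regular).congr A.lattice_le fun z hz => (h z hz).symm,
      fun γ z hz => ?_⟩
    rw [h z hz, h _ (A.apply_notMem γ hz), h1.map_mul γ z hz, h2.map_mul γ z hz]
    simp

theorem isCovariant_one_iff_of_forall_eq_one (h : IsMovingFrame A ρ A.a e f)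
    (ha : ∀ γ, A.a γ = 1) : IsCovariant A ρ 1 u ↔
      ∃ A B C A' B' C' : ℂ[X], ∀ z ∉ P.lattice, u z =
        (A.eval (P.weierstrassP z) + A'.eval (P.weierstrassP z) * P.derivWeierstrassP z) • e z +
        (B.eval (P.weierstrassP z) + B'.eval (P.weierstrassP z) * P.derivWeierstrassP z) • f z +
        (C.eval (P.weierstrassP z) + C'.eval (P.weierstrassP z) * P.derivWeierstrassP z) •
          ⁅e z, f z⁆ := by
  rw [h.isCovariant_one_iff, show A.a = 1 from MonoidHom.ext ha, character_inv_one]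
  constructor
  · rintro ⟨α', β', c, hα, hβ, hc, hu⟩
    obtain ⟨p, p', hp⟩ := (isWeighted_one_iff ha).mp hα
    obtain ⟨q, q', hq⟩ := (isWeighted_one_iff ha).mp hβ
    obtain ⟨r, r', hr⟩ := (isWeighted_one_iff ha).mp hc
    exact ⟨p, q, r, p', q', r', fun z hz => by rw [hu z hz, hp z hz, hq z hz, hr z hz]⟩
  · rintro ⟨p, q, r, p', q', r', hu⟩
    exact ⟨_, _, _, (isWeighted_one_iff ha).mpr ⟨p, p', fun _ _ => rfl⟩,
      (isWeighted_one_iff ha).mpr ⟨q, q', fun _ _ => rfl⟩,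
      (isWeighted_one_iff ha).mpr ⟨r, r', fun _ _ => rfl⟩, hu⟩

end IsMovingFrame

end Frame

/-! ## Holomorphic maps between tori are affine -/

namespace PeriodPair

variable {P Q : PeriodPair}

/-- A continuous function with values in a discrete set is locally constant. -/
lemma eventually_sub_eq_const {F G : ℂ → ℂ} {z : ℂ} (hF : ContinuousAt F z) (hG : ContinuousAt G z)
    (h : ∀ᶠ w in 𝓝 z, F w - G w ∈ P.lattice) : ∀ᶠ w in 𝓝 z, F w - G w = F z - G z := by
  have h1 := eventually_nhdsWithin_iff.mp (P.eventually_notMem (F z - G z))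
  have h2 := (hF.sub hG).tendsto.eventually h1
  filter_upwards [h, h2] with w h3 h4
  by_contra h5
  exact h4 h5 h3

lemma eq_zero_of_forall_mem {c d : ℂ} (h : ∀ z, c * z + d ∈ P.lattice) : c = 0 := by
  by_contra hc
  obtain ⟨z, hz⟩ := P.exists_notMem
  have := h ((z - d) / c)
  rw [mul_div_cancel₀ _ hc, sub_add_cancel] at this
  exact hz this

lemma exists_eq_const_of_periodic {f : ℂ → ℂ} (hf : Differentiable ℂ f)
    (hp : ∀ z, ∀ p ∈ P.lattice, f (z + p) = f z) : ∃ c, ∀ z, f z = c := by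
  have hcpt : IsCompact (Set.range f) :=
    IsZLattice.isCompact_range_of_periodic P.lattice _ hf.continuous fun z w hw => hp z w hw
  exact ⟨f 0, fun z => hf.apply_eq_apply_of_bounded hcpt.isBounded z 0⟩

end PeriodPair

/-- Local lifts of `f` differ by lattice constants, so their derivatives glue to an entire function
with the periods of `P`, hence to a constant `a`. After subtraction of `a * z` the lifts are locally
constant modulo `Q`, so constant on the connected plane. -/
theorem IsHolomorphicVia.exists_affine {X Y : Type*} {π : ℂ → X} {π' : ℂ → Y} {f : X → Y}
    {P Q : PeriodPair} (hπ : ∀ z w, z - w ∈ P.lattice → π z = π w)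
    (hπ' : ∀ z w, π' z = π' w ↔ z - w ∈ Q.lattice) (hf : IsHolomorphicVia π π' f) :
    ∃ a b : ℂ, ∀ z, f (π z) = π' (a * z + b) := by
  choose F hF hFf using hf
  have hcomp : ∀ z w l : ℂ, l ∈ P.lattice →
      (∀ᶠ v in 𝓝 w, π' (F z v) = f (π v)) → AnalyticAt ℂ (F z) w →
      ∀ᶠ v in 𝓝 w, F (w + l) (v + l) - F z v = F (w + l) (w + l) - F z w := by
    intro z w l hl h1 h2
    have h3 : Tendsto (fun v => v + l) (𝓝 w) (𝓝 (w + l)) :=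
      (continuous_add_const l).tendsto w
    refine PeriodPair.eventually_sub_eq_const (P := Q) (F := fun v => F (w + l) (v + l))
      (ContinuousAt.comp (f := fun v => v + l) (hF (w + l)).continuousAt
        (continuous_add_const l).continuousAt) h2.continuousAt ?_
    filter_upwards [h3.eventually (hFf (w + l)), h1] with v h4 h5
    rw [← hπ', h4, h5]
    exact congrArg f (hπ _ _ (by simpa using hl))
  have hder : ∀ z, ∀ᶠ w in 𝓝 z, deriv (F w) w = deriv (F z) w := by
    intro z
    filter_upwards [(hFf z).eventually_nhds, (hF z).eventually_analyticAt] with w h1 h2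
    have h3 := hcomp z w 0 (zero_mem _) h1 h2
    simp only [add_zero] at h3
    have h4 : F w =ᶠ[𝓝 w] fun v => F z v + (F w w - F z w) := by
      filter_upwards [h3] with v hv
      rw [← hv]
      ring
    rw [h4.deriv_eq, deriv_add_const]
  obtain ⟨a, ha⟩ := PeriodPair.exists_eq_const_of_periodic (P := P)
    (f := fun z => deriv (F z) z) (fun z => by
      refine (((hF z).deriv).congr ?_).differentiableAt
      filter_upwards [hder z] with w hw using hw.symm) fun z p hp => by
    have h1 := hcomp z z p hp (hFf z) (hF z)
    have h2 : (fun v => F (z + p) (v + p)) =ᶠ[𝓝 z]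
        fun v => F z v + (F (z + p) (z + p) - F z z) := by
      filter_upwards [h1] with v hv
      rw [← hv]
      ring
    have h3 := h2.deriv_eq
    rw [deriv_comp_add_const, deriv_add_const] at h3
    exact h3
  have hloc : IsLocallyConstant fun z => (Submodule.Quotient.mk (F z z - a * z) : Torus Q) := by
    rw [IsLocallyConstant.iff_eventually_eq]
    intro z
    have h1 : ∀ᶠ w in 𝓝 z, F z w - a * w = F z z - a * z := by
      obtain ⟨ε, hε, hball⟩ := Metric.eventually_nhds_iff_ball.mp
        ((hF z).eventually_analyticAt.and (hder z))
      filter_upwards [Metric.ball_mem_nhds z hε] with w hw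
      have hd : ∀ v ∈ Metric.ball z ε, HasDerivAt (fun v => F z v - a * v) 0 v := fun v hv => by
        have h2 := (hball v hv).1.differentiableAt.hasDerivAt
        rw [← (hball v hv).2, ha v] at h2
        have h3 := h2.sub ((hasDerivAt_id v).const_mul a)
        rw [mul_one, sub_self] at h3
        exact h3
      refine (convex_ball z ε).is_const_of_fderivWithin_eq_zero (𝕜 := ℂ)
        (f := fun v => F z v - a * v)
        (fun v hv => (hd v hv).differentiableAt.differentiableWithinAt)
        (fun v hv => ?_) hw (Metric.mem_ball_self hε)
      rw [fderivWithin_of_isOpen Metric.isOpen_ball hv]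
      exact (hd v hv).hasFDerivAt.fderiv.trans (by simp)
    filter_upwards [h1, hFf z, (hFf z).eventually_nhds] with w h2 h3 h4
    rw [← h2, Submodule.Quotient.eq, sub_sub_sub_cancel_right, ← hπ', h3, (hFf w).self_of_nhds]
  refine ⟨a, F 0 0 - a * 0, fun z => ?_⟩
  have h1 := hloc.apply_eq_of_preconnectedSpace z 0
  rw [Submodule.Quotient.eq] at h1
  rw [← (hFf z).self_of_nhds, hπ']
  convert h1 using 1
  ring

/-! ## The affine action defined by an action on a torus -/

/-- As `M` lies between `L` and `n⁻¹ L`, it is discrete and spans the plane over `ℝ`. It therefore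
has a basis of two independent periods. -/
theorem PeriodPair.exists_lattice_eq {L : PeriodPair} {M : Submodule ℤ ℂ} {n : ℕ} (hn : n ≠ 0)
    (hLM : L.lattice ≤ M) (hM : ∀ z ∈ M, n * z ∈ L.lattice) : ∃ P : PeriodPair, P.lattice = M := by
  have hn' : (n : ℂ) ≠ 0 := Nat.cast_ne_zero.mpr hn
  let Q : PeriodPair := ⟨L.ω₁ / n, L.ω₂ / n, by
    rw [LinearIndependent.pair_iff]
    intro s t h
    refine LinearIndependent.pair_iff.mp L.indep s t ?_
    simp only [Complex.real_smul] at h ⊢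
    field_simp at h
    rwa [mul_zero] at h⟩
  have hMQ : (M : Set ℂ) ⊆ Q.lattice := by
    intro z hz
    obtain ⟨a, b, hab⟩ := PeriodPair.mem_lattice.mp (hM z hz)
    refine PeriodPair.mem_lattice.mpr ⟨a, b, ?_⟩
    simp only [Q]
    field_simp
    rw [hab]
  have hd : DiscreteTopology M := DiscreteTopology.of_subset (t := (M : Set ℂ))
    (s := (Q.lattice : Set ℂ)) (inferInstanceAs (DiscreteTopology Q.lattice)) hMQ
  have hz : IsZLattice ℝ M := ⟨top_unique (by
    rw [← IsZLattice.span_top (K := ℝ) (L := L.lattice)]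
    exact Submodule.span_mono hLM)⟩
  have := ZLattice.module_free ℝ M
  have := ZLattice.module_finite ℝ M
  let b : Module.Basis (Fin 2) ℤ M := Module.finBasisOfFinrankEq ℤ M (by
    rw [ZLattice.rank ℝ M, Complex.finrank_real_complex])
  have hb : ⇑(b.ofZLatticeBasis ℝ M) = ![(b 0 : ℂ), (b 1 : ℂ)] := by
    funext i
    rw [Module.Basis.ofZLatticeBasis_apply]
    fin_cases i <;> rfl
  have hli := (b.ofZLatticeBasis ℝ M).linearIndependent
  have hspan := b.ofZLatticeBasis_span ℝ M
  rw [hb] at hli hspan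
  refine ⟨⟨b 0, b 1, hli⟩, Eq.trans ?_ hspan⟩
  rw [Matrix.range_cons_cons_empty]
  rfl

lemma torusProj_eq_iff {L : PeriodPair} {z w : ℂ} :
    torusProj L z = torusProj L w ↔ z - w ∈ L.lattice := Submodule.Quotient.eq _

lemma torusProj_surjective (L : PeriodPair) : Function.Surjective (torusProj L) :=
  Submodule.Quotient.mk_surjective _

lemma torusProj_zero (L : PeriodPair) : torusProj L 0 = 0 := rfl

lemma torusProj_add (L : PeriodPair) (z w : ℂ) :
    torusProj L (z + w) = torusProj L z + torusProj L w := rfl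

namespace AffineAction

variable {L : PeriodPair} {Γ : Type*} [Group Γ] [Finite Γ] [MulAction Γ (Torus L)]

/-- Each element lifts to an affine map whose linear part is unique, hence multiplicative in `γ`;
the constant part is determined only modulo `L`. The vectors of all translations form the lattice
`P`. -/
theorem exists_of_mulAction [FaithfulSMul Γ (Torus L)]
    (hσ : ∀ γ : Γ, IsHolomorphicVia (torusProj L) (torusProj L) (fun p => γ • p))
    (hΓ : ∀ γ : Γ, ∃ g k : Γ, γ = g * k ∧ g • (0 : Torus L) = 0 ∧
      ∃ α : Torus L, ∀ p : Torus L, k • p = p + α) :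
    ∃ (P : PeriodPair) (A : AffineAction L P Γ),
      ∀ γ z, γ • torusProj L z = torusProj L (A.a γ * z + A.b γ) := by
  have haff := fun γ => (hσ γ).exists_affine (P := L) (Q := L) (fun z w => torusProj_eq_iff.mpr)
    fun z w => torusProj_eq_iff
  choose a b hab using haff
  have huniq : ∀ a b a' b' : ℂ, (∀ z, torusProj L (a * z + b) = torusProj L (a' * z + b')) →
      a = a' := by
    intro a b a' b' h
    refine sub_eq_zero.mp (PeriodPair.eq_zero_of_forall_mem (P := L) (d := b - b') fun z => ?_)
    convert torusProj_eq_iff.mp (h z) using 1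
    ring
  have hone : a 1 = 1 := huniq _ (b 1) _ 0 fun z => by rw [← hab, one_smul, one_mul, add_zero]
  have hcomp : ∀ γ δ z, torusProj L (a (γ * δ) * z + b (γ * δ)) =
      torusProj L (a γ * (a δ * z + b δ) + b γ) := fun γ δ z => by
    rw [← hab, ← hab, ← hab, mul_smul]
  have hmul : ∀ γ δ, a (γ * δ) = a γ * a δ := fun γ δ =>
    huniq _ (b (γ * δ)) _ (a γ * b δ + b γ) fun z => by rw [hcomp]; congr 1; ring
  let χ : Γ →* ℂ := { toFun := a, map_one' := hone, map_mul' := hmul }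
  have hχ : ∀ γ, (χ.toHomUnits γ : ℂ) = a γ := fun γ => MonoidHom.coe_toHomUnits χ γ
  have hχ1 : ∀ γ, χ.toHomUnits γ = 1 ↔ a γ = 1 := fun γ => by
    rw [← hχ, Units.val_eq_one]
  have hb : ∀ γ δ, b (γ * δ) - (a γ * b δ + b γ) ∈ L.lattice := fun γ δ => by
    simpa using torusProj_eq_iff.mp (hcomp γ δ 0)
  have hL : ∀ γ, ∀ l ∈ L.lattice, a γ * l ∈ L.lattice := fun γ l hl => by
    have h1 := hab γ l
    rw [torusProj_eq_iff.mpr (show l - 0 ∈ L.lattice by simpa using hl), hab] at h1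
    simpa using L.lattice.neg_mem (torusProj_eq_iff.mp h1)
  have hb1 : b 1 ∈ L.lattice := by
    have h1 := hab 1 0
    rw [one_smul] at h1
    simpa using L.lattice.neg_mem (torusProj_eq_iff.mp h1)
  have hinv : ∀ k, a k = 1 → a k⁻¹ = 1 ∧ b k⁻¹ + b k ∈ L.lattice := by
    intro k hk
    have h1 := hmul k⁻¹ k
    rw [inv_mul_cancel, hone, hk, mul_one] at h1
    have h2 := hb k⁻¹ k
    rw [inv_mul_cancel, ← h1, one_mul] at h2
    refine ⟨h1.symm, ?_⟩
    convert L.lattice.sub_mem hb1 h2 using 1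
    ring
  let M : Submodule ℤ ℂ := AddSubgroup.toIntSubmodule
    { carrier := {z | ∃ k, a k = 1 ∧ z - b k ∈ L.lattice}
      zero_mem' := ⟨1, hone, L.lattice.sub_mem (zero_mem _) hb1⟩
      add_mem' := by
        rintro z w ⟨k, hk, hz⟩ ⟨k', hk', hw⟩
        refine ⟨k * k', by rw [hmul, hk, hk', one_mul], ?_⟩
        have h1 := hb k k'
        rw [hk] at h1
        convert L.lattice.sub_mem (L.lattice.add_mem hz hw) h1 using 1
        ring
      neg_mem' := by
        rintro z ⟨k, hk, hz⟩
        refine ⟨k⁻¹, (hinv k hk).1, ?_⟩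
        convert L.lattice.neg_mem (L.lattice.add_mem hz (hinv k hk).2) using 1
        ring }
  have hM : ∀ z, z ∈ M ↔ ∃ k, a k = 1 ∧ z - b k ∈ L.lattice := fun z => Iff.rfl
  have hpow : ∀ k, a k = 1 → ∀ n : ℕ, n * b k - b (k ^ n) ∈ L.lattice := by
    intro k hk n
    induction n with
    | zero => simpa using hb1
    | succ n ih =>
      have h1 := hb k (k ^ n)
      rw [hk, ← pow_succ'] at h1
      convert L.lattice.sub_mem ih h1 using 1
      push_cast
      ring
  -- The order of `Γ` annihilates every translation, so it multiplies `M` into `L`.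
  obtain ⟨P, hP⟩ := PeriodPair.exists_lattice_eq (L := L) (M := M) (n := Nat.card Γ)
    Nat.card_pos.ne' (fun l hl => (hM l).mpr ⟨1, hone, L.lattice.sub_mem hl hb1⟩) fun z hz => by
      obtain ⟨k, hk, hzk⟩ := (hM z).mp hz
      have h1 := hpow k hk (Nat.card Γ)
      rw [pow_card_eq_one'] at h1
      have h2 := L.lattice.smul_mem (Nat.card Γ : ℤ) hzk
      convert L.lattice.add_mem (L.lattice.add_mem h2 h1) hb1 using 1
      simp
      ring
  refine ⟨P, ⟨χ.toHomUnits, b, fun γ δ => by rw [hχ]; exact hb γ δ,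
    fun γ l hl => by rw [hχ]; exact hL γ l hl, fun γ h1 h2 => ?_, fun z => ?_, fun γ => ?_⟩,
    fun γ z => by rw [hχ]; exact hab γ z⟩
  · refine FaithfulSMul.eq_of_smul_eq_smul (α := Torus L) fun p => ?_
    obtain ⟨z, rfl⟩ := torusProj_surjective L p
    rw [one_smul, hab, (hχ1 γ).mp h1, torusProj_eq_iff]
    simpa using h2
  · simp only [hP, hM, hχ1]
  · obtain ⟨g, k, h1, h2, α, h3⟩ := hΓ γ
    refine ⟨g, k, h1, ?_, ?_⟩
    · rw [← torusProj_zero, hab, torusProj_eq_iff] at h2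
      simpa using h2
    · obtain ⟨d, rfl⟩ := torusProj_surjective L α
      rw [hχ1]
      exact huniq _ (b k) _ d fun z => by rw [← hab, h3, ← torusProj_add, one_mul]

end AffineAction

/-! ## Invariant maps on the punctured torus -/

lemma regularVecOff_iff {L P : PeriodPair} {u : ℂ → Sl2} :
    RegularVecOff L P u ↔ ∀ i j, RegularOff L P (fun z => (u z).val i j) := by
  constructor
  · intro h
    let m (a b c : ℂ) : Sl2 := ⟨!![a, b; c, -a], by
      change Matrix.trace !![a, b; c, -a] = 0
      simp [Matrix.trace_fin_two]⟩
    have h00 := h (m (1 / 2) 0 0)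
    have h01 := h (m 0 0 1)
    have h10 := h (m 0 1 0)
    have h11 := h (m (-1 / 2) 0 0)
    simp only [Sl2.form_apply, m] at h00 h01 h10 h11
    intro i j
    fin_cases i <;> fin_cases j
    · simpa using h00
    · simpa using h01
    · simpa using h10
    · simp only [Fin.mk_one, Fin.isValue, Sl2.apply_one_one]
      simpa [div_eq_mul_inv] using h11
  · intro h x
    simp only [Sl2.form_apply]
    exact (((RegularOff.const _).mul (h 0 0)).add ((RegularOff.const _).mul (h 1 0))).add
      ((RegularOff.const _).mul (h 0 1))

section Pullback

variable {L P : PeriodPair} {Γ : Type*} [Group Γ] [MulAction Γ (Torus L)]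

open Classical in
/-- The pullback to the plane of a map on the punctured torus, extended by zero. -/
def vecPullback (u : puncturedTorus L Γ → Sl2) (z : ℂ) : Sl2 :=
  if h : torusProj L z ∈ puncturedTorus L Γ then u ⟨torusProj L z, h⟩ else 0

lemma pullback_apply_eq (u : puncturedTorus L Γ → Sl2) (i j : Fin 2) :
    pullback (fun p => (u p).val i j) = fun z => (vecPullback u z).val i j := by
  funext z
  unfold pullback vecPullback
  split_ifs
  · rfl
  · rfl

/-- A lift of a point of the punctured torus. -/
def puncturedLift (p : puncturedTorus L Γ) : ℂ := (torusProj_surjective L p).choose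

lemma torusProj_puncturedLift (p : puncturedTorus L Γ) : torusProj L (puncturedLift p) = p :=
  (torusProj_surjective L p).choose_spec

namespace AffineAction

variable (A : AffineAction L P Γ)

/-- The affine action induces the given action on the torus. -/
def Lifts : Prop := ∀ γ z, γ • torusProj L z = torusProj L (A.a γ * z + A.b γ)

variable {A}

lemma Lifts.mem_puncturedTorus_iff (hA : A.Lifts) {z : ℂ} :
    torusProj L z ∈ puncturedTorus L Γ ↔ z ∉ P.lattice := by
  change ¬ torusProj L z ∈ MulAction.orbit Γ (0 : Torus L) ↔ _
  rw [not_iff_not, MulAction.mem_orbit_iff]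
  constructor
  · rintro ⟨γ, hγ⟩
    rw [← torusProj_zero, hA, torusProj_eq_iff, mul_zero, zero_add] at hγ
    simpa using P.lattice.sub_mem (A.b_mem_lattice γ) (A.lattice_le hγ)
  · intro hz
    obtain ⟨k, -, hk⟩ := (A.mem_iff z).mp hz
    refine ⟨k, ?_⟩
    rw [← torusProj_zero, hA, torusProj_eq_iff, mul_zero, zero_add]
    simpa using L.lattice.neg_mem hk

lemma Lifts.puncturedLift_notMem (hA : A.Lifts) (p : puncturedTorus L Γ) :
    puncturedLift p ∉ P.lattice := by
  rw [← hA.mem_puncturedTorus_iff, torusProj_puncturedLift]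
  exact p.2

lemma Lifts.vecPullback_apply (hA : A.Lifts) (u : puncturedTorus L Γ → Sl2) {z : ℂ}
    (hz : z ∉ P.lattice) :
    vecPullback u z = u ⟨torusProj L z, hA.mem_puncturedTorus_iff.mpr hz⟩ := by
  rw [vecPullback, dif_pos]

lemma Lifts.isRegularFn_iff (hA : A.Lifts) {g : puncturedTorus L Γ → ℂ} :
    IsRegularFn g ↔ RegularOff L P (pullback g) := by
  have hper : ∀ l ∈ L.lattice, ∀ z, pullback g (z + l) = pullback g z := by
    intro l hl z
    have h1 : torusProj L (z + l) = torusProj L z := torusProj_eq_iff.mpr (by simpa using hl)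
    classical
    exact congrArg (fun p => if h : p ∈ puncturedTorus L Γ then g ⟨p, h⟩ else 0) h1
  constructor
  · rintro ⟨h1, h2⟩
    refine ⟨fun z hz => h1 z (hA.mem_puncturedTorus_iff.mpr hz), fun z => ?_,
      fun l hl z _ => hper l hl z⟩
    by_cases hz : torusProj L z ∈ puncturedTorus L Γ
    · exact (h1 z hz).meromorphicAt
    · exact h2 z hz
  · intro h
    exact ⟨fun z hz => h.analyticAt z (hA.mem_puncturedTorus_iff.mp hz),
      fun z _ => h.meromorphicAt z⟩

theorem Lifts.mem_automorphicLieAlgebra_iff (hA : A.Lifts) {ρ : Γ →* (Sl2 ≃ₗ⁅ℂ⁆ Sl2)}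
    {u : puncturedTorus L Γ → Sl2} :
    u ∈ automorphicLieAlgebra (L := L) ρ ↔ IsCovariant A ρ 1 (vecPullback u) := by
  change ((∀ i j : Fin 2, IsRegularFn fun p => (u p).val i j) ∧
    ∀ (γ : Γ) (p : puncturedTorus L Γ), u (γ • p) = ρ γ (u p)) ↔ _
  have h1 : (∀ i j : Fin 2, IsRegularFn fun p => (u p).val i j) ↔
      RegularVecOff L P (vecPullback u) := by
    simp only [hA.isRegularFn_iff, pullback_apply_eq, regularVecOff_iff]
  have h2 : (∀ (γ : Γ) (p : puncturedTorus L Γ), u (γ • p) = ρ γ (u p)) ↔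
      ∀ γ, ∀ z ∉ P.lattice, vecPullback u (A.a γ * z + A.b γ) =
        (((1 : Γ →* ℂˣ) γ : ℂˣ) : ℂ) • ρ γ (vecPullback u z) := by
    refine forall_congr' fun γ => ⟨fun h z hz => ?_, fun h p => ?_⟩
    · rw [hA.vecPullback_apply u hz, hA.vecPullback_apply u (A.apply_notMem γ hz),
        MonoidHom.one_apply, Units.val_one, one_smul, ← h]
      congr 1
      exact Subtype.ext (hA γ z).symm
    · have hz := hA.puncturedLift_notMem p
      have h3 := h _ hz
      rw [hA.vecPullback_apply u hz, hA.vecPullback_apply u (A.apply_notMem γ hz),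
        MonoidHom.one_apply, Units.val_one, one_smul] at h3
      convert h3 using 2
      · refine Subtype.ext ?_
        exact (congrArg (γ • ·) (torusProj_puncturedLift p)).symm.trans (hA γ _)
      · refine congrArg u (Subtype.ext (torusProj_puncturedLift p).symm)
  rw [h1, h2]
  exact ⟨fun h => ⟨h.1, h.2⟩, fun h => ⟨h.1, h.2⟩⟩

/-- Since `v` has the periods `L`, it is determined by its values at the chosen lifts. -/
lemma Lifts.forall_vecPullback_eq_iff (hA : A.Lifts) {u : puncturedTorus L Γ → Sl2} {v : ℂ → Sl2}
    (hv : ∀ l ∈ L.lattice, ∀ z ∉ P.lattice, v (z + l) = v z) :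
    (∀ z ∉ P.lattice, vecPullback u z = v z) ↔ ∀ p, u p = v (puncturedLift p) := by
  constructor
  · intro h p
    rw [← h _ (hA.puncturedLift_notMem p), hA.vecPullback_apply u (hA.puncturedLift_notMem p)]
    exact congrArg u (Subtype.ext (torusProj_puncturedLift p).symm)
  · intro h z hz
    rw [hA.vecPullback_apply u hz, h]
    have h1 := torusProj_puncturedLift (⟨torusProj L z, hA.mem_puncturedTorus_iff.mpr hz⟩ :
      puncturedTorus L Γ)
    rw [torusProj_eq_iff] at h1
    rw [← hv _ h1 z hz, add_sub_cancel]

end AffineAction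

end Pullback

/-! ## The isomorphism type of the automorphic Lie algebra -/

lemma Polynomial.exists_eval_mul_eq {c : ℂ} (hc : c ≠ 0) (p : ℂ[X]) :
    ∃ p' : ℂ[X], ∀ x, p'.eval (c * x) = p.eval x :=
  ⟨p.comp (Polynomial.C c⁻¹ * Polynomial.X), fun x => by
    simp only [Polynomial.eval_comp, Polynomial.eval_mul, Polynomial.eval_C, Polynomial.eval_X,
      inv_mul_cancel_left₀ hc]⟩

namespace AffineAction

variable {L P : PeriodPair} {Γ : Type*} [Group Γ] {A : AffineAction L P Γ}

/-- This adjusts the coordinate from `P` to the homothetic lattice of `τ`. -/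
lemma IsOrbitCoordinate.scale {q q' : ℂ[X]} {t α β : ℂ → ℂ} (h : A.IsOrbitCoordinate q t α β)
    {m n k : ℂ} (hm : m ≠ 0) (hn : n ≠ 0) (hk : k ≠ 0)
    (hq : ∀ x, q'.eval (m * x) = n * k * q.eval x) :
    A.IsOrbitCoordinate q' (fun z => m * t z) (fun z => n * α z) (fun z => k * β z) := by
  have hmul : ∀ {χ : Γ →* ℂˣ} {g : ℂ → ℂ} (c : ℂ), IsWeighted A χ g →
      IsWeighted A χ (fun z => c * g z) := fun c hg =>
    ⟨(RegularOff.const c).mul hg.regular, fun γ z hz => by rw [hg.map_mul γ z hz]; ring⟩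
  refine ⟨hmul m h.weight_t, hmul n h.weight_α, hmul k h.weight_β, fun g hg => ?_, fun g hg => ?_,
    fun g hg => ?_, fun z hz => ?_, fun c => ?_, fun z hz w hw h' => ?_, fun z hz h' => ?_⟩
  · obtain ⟨p, hp⟩ := h.exists_one g hg
    obtain ⟨p', hp'⟩ := p.exists_eval_mul_eq hm
    exact ⟨p', fun z hz => by rw [hp z hz, hp']⟩
  · obtain ⟨p, hp⟩ := h.exists_inv g hg
    obtain ⟨p', hp'⟩ := p.exists_eval_mul_eq hm
    refine ⟨Polynomial.C n⁻¹ * p', fun z hz => ?_⟩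
    rw [hp z hz, Polynomial.eval_mul, Polynomial.eval_C, hp']
    field_simp
  · obtain ⟨p, hp⟩ := h.exists_pos g hg
    obtain ⟨p', hp'⟩ := p.exists_eval_mul_eq hm
    refine ⟨Polynomial.C k⁻¹ * p', fun z hz => ?_⟩
    rw [hp z hz, Polynomial.eval_mul, Polynomial.eval_C, hp']
    field_simp
  · rw [hq, ← h.mul z hz]
    ring
  · obtain ⟨z, hz, hz'⟩ := h.surjective (c / m)
    exact ⟨z, hz, by rw [hz', mul_div_cancel₀ _ hm]⟩
  · exact h.separates z hz w hw (mul_left_cancel₀ hm h')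
  · rw [hq] at h'
    exact h.ramified z hz ((mul_eq_zero.mp h').resolve_left (mul_ne_zero hn hk))

variable [MulAction Γ (Torus L)] [Finite Γ]

theorem Lifts.nonempty_equiv_twistedSl2 (hA : A.Lifts) {ρ : Γ →* (Sl2 ≃ₗ⁅ℂ⁆ Sl2)}
    (hρ : Function.Injective ρ) {q : ℂ[X]} (hq : q ≠ 0) {t α β : ℂ → ℂ}
    (h : A.IsOrbitCoordinate q t α β) :
    Nonempty (automorphicLieAlgebra (L := L) ρ ≃ₗ⁅ℂ⁆ TwistedSl2 q) := by
  obtain ⟨e, f, hef⟩ := A.exists_isMovingFrame hρ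
  have hs := hA.puncturedLift_notMem
  refine TwistedSl2.nonempty_equiv (e := fun p => e (puncturedLift p))
    (f := fun p => f (puncturedLift p)) hq (t := fun p => t (puncturedLift p))
    (α := fun p => α (puncturedLift p)) (β := fun p => β (puncturedLift p)) (fun c => ?_)
    (fun p => hef.isTriple _ (hs p)) (fun p => h.mul _ (hs p)) fun u => ?_
  · obtain ⟨z, hz, rfl⟩ := h.surjective c
    refine ⟨⟨torusProj L z, hA.mem_puncturedTorus_iff.mpr hz⟩, ?_⟩
    have h1 := torusProj_puncturedLift (⟨torusProj L z, hA.mem_puncturedTorus_iff.mpr hz⟩ :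
      puncturedTorus L Γ)
    rw [torusProj_eq_iff] at h1
    simpa using h.weight_t.regular.map_add _ h1 z hz
  · rw [hA.mem_automorphicLieAlgebra_iff, hef.isCovariant_one_iff_of_isOrbitCoordinate h]
    refine exists_congr fun a => exists_congr fun b => exists_congr fun c =>
      hA.forall_vecPullback_eq_iff fun l hl z hz => ?_
    rw [h.weight_t.regular.map_add l hl z hz, h.weight_α.regular.map_add l hl z hz,
      h.weight_β.regular.map_add l hl z hz, hef.left.regular.map_add hl hz,
      hef.right.regular.map_add hl hz]

theorem Lifts.nonempty_equiv_sAlgebra (hA : A.Lifts) {ρ : Γ →* (Sl2 ≃ₗ⁅ℂ⁆ Sl2)}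
    (hρ : Function.Injective ρ) (h : A.IsOrbitCoordinate (4 * Polynomial.X ^ 3 -
      Polynomial.C P.g₂ * Polynomial.X - Polynomial.C P.g₃) P.weierstrassP P.derivWeierstrassP
        P.derivWeierstrassP) {τ : ℍ} {c : ℂ} (hc : c ≠ 0)
    (hτ : ∀ z, c * z ∈ P.lattice ↔ z ∈ (tauPeriods τ).lattice) :
    Nonempty (automorphicLieAlgebra (L := L) ρ ≃ₗ⁅ℂ⁆ SAlgebra τ) := by
  -- The factors `c ^ 2` and `c ^ 3` are the weights of `℘` and `℘'` under homothety.
  refine hA.nonempty_equiv_twistedSl2 hρ (fun h0 => ?_) (h.scale (m := c ^ 2) (n := c ^ 3)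
    (k := c ^ 3) (pow_ne_zero _ hc) (pow_ne_zero _ hc) (pow_ne_zero _ hc) fun x => ?_)
  · simpa using congrArg (fun p : ℂ[X] => p.coeff 3) h0
  · simp only [Polynomial.eval_sub, Polynomial.eval_mul, Polynomial.eval_pow, Polynomial.eval_X,
      Polynomial.eval_C, Polynomial.eval_ofNat]
    rw [PeriodPair.g₂_homothety hc hτ, PeriodPair.g₃_homothety hc hτ]
    field_simp

theorem Lifts.nonempty_equiv_currentAlgebra (hA : A.Lifts) {ρ : Γ →* (Sl2 ≃ₗ⁅ℂ⁆ Sl2)}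
    (hρ : Function.Injective ρ) (ha : ∀ γ, A.a γ = 1) {τ : ℍ} {c : ℂ} (hc : c ≠ 0)
    (hτ : ∀ z, c * z ∈ P.lattice ↔ z ∈ (tauPeriods τ).lattice) :
    Nonempty (automorphicLieAlgebra (L := L) ρ ≃ₗ⁅ℂ⁆ CurrentAlgebra τ) := by
  obtain ⟨e, f, hef⟩ := A.exists_isMovingFrame hρ
  have hs := hA.puncturedLift_notMem
  have h2 : c ^ 2 ≠ 0 := pow_ne_zero _ hc
  have h3 : c ^ 3 ≠ 0 := pow_ne_zero _ hc
  have hx : ∀ l ∈ L.lattice, ∀ z, P.weierstrassP (z + l) = P.weierstrassP z := fun l hl z =>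
    P.weierstrassP_add_coe z ⟨l, A.lattice_le hl⟩
  have hy : ∀ l ∈ L.lattice, ∀ z, P.derivWeierstrassP (z + l) = P.derivWeierstrassP z :=
    fun l hl z => P.derivWeierstrassP_add_coe z ⟨l, A.lattice_le hl⟩
  have hscale : ∀ p p' : ℂ[X], ∃ r r' : ℂ[X], ∀ x y,
      r.eval (c ^ 2 * x) + r'.eval (c ^ 2 * x) * (c ^ 3 * y) = p.eval x + p'.eval x * y := by
    intro p p'
    obtain ⟨r, hr⟩ := p.exists_eval_mul_eq h2
    obtain ⟨r', hr'⟩ := p'.exists_eval_mul_eq h2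
    refine ⟨r, Polynomial.C (c ^ 3)⁻¹ * r', fun x y => ?_⟩
    rw [hr, Polynomial.eval_mul, hr', Polynomial.eval_C]
    field_simp
  have hunscale : ∀ r r' : ℂ[X], ∃ p p' : ℂ[X], ∀ x y,
      r.eval (c ^ 2 * x) + r'.eval (c ^ 2 * x) * (c ^ 3 * y) = p.eval x + p'.eval x * y := by
    intro r r'
    refine ⟨r.comp (Polynomial.C (c ^ 2) * Polynomial.X),
      Polynomial.C (c ^ 3) * r'.comp (Polynomial.C (c ^ 2) * Polynomial.X), fun x y => ?_⟩
    simp only [Polynomial.eval_comp, Polynomial.eval_mul, Polynomial.eval_C, Polynomial.eval_X]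
    ring
  refine CurrentAlgebra.nonempty_equiv (e := fun p => e (puncturedLift p))
    (f := fun p => f (puncturedLift p)) (x := fun p => c ^ 2 * P.weierstrassP (puncturedLift p))
    (y := fun p => c ^ 3 * P.derivWeierstrassP (puncturedLift p)) (fun p => ?_) (fun r r' h => ?_)
    (fun p => hef.isTriple _ (hs p)) fun u => ?_
  · have h4 := P.derivWeierstrassP_sq _ (hs p)
    rw [PeriodPair.g₂_homothety hc hτ, PeriodPair.g₃_homothety hc hτ] at h4
    field_simp at h4
    linear_combination h4
  · have h4 : ∀ z ∉ P.lattice, r.eval (c ^ 2 * P.weierstrassP z) +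
        r'.eval (c ^ 2 * P.weierstrassP z) * (c ^ 3 * P.derivWeierstrassP z) = 0 := by
      intro z hz
      have h1 := torusProj_puncturedLift (⟨torusProj L z, hA.mem_puncturedTorus_iff.mpr hz⟩ :
        puncturedTorus L Γ)
      rw [torusProj_eq_iff] at h1
      have h5 := h ⟨torusProj L z, hA.mem_puncturedTorus_iff.mpr hz⟩
      have h6 := hx _ h1 z
      have h7 := hy _ h1 z
      rw [add_sub_cancel] at h6 h7
      rwa [h6, h7] at h5
    have h5 := P.polynomial_eq_zero (A := r.comp (Polynomial.C (c ^ 2) * Polynomial.X))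
      (B := Polynomial.C (c ^ 3) * r'.comp (Polynomial.C (c ^ 2) * Polynomial.X)) fun z hz => by
        rw [← h4 z hz]
        simp only [Polynomial.eval_comp, Polynomial.eval_mul, Polynomial.eval_C, Polynomial.eval_X]
        ring
    constructor
    · refine Polynomial.funext fun x => ?_
      have := congrArg (Polynomial.eval (x / c ^ 2)) h5.1
      simpa [mul_div_cancel₀ _ h2] using this
    · refine Polynomial.funext fun x => ?_
      have := congrArg (Polynomial.eval (x / c ^ 2)) h5.2
      simpa [mul_div_cancel₀ _ h2, hc] using this
  · rw [hA.mem_automorphicLieAlgebra_iff, hef.isCovariant_one_iff_of_forall_eq_one ha]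
    have hiff : ∀ a b d a' b' d' : ℂ[X], (∀ z ∉ P.lattice, vecPullback u z =
        (a.eval (P.weierstrassP z) + a'.eval (P.weierstrassP z) * P.derivWeierstrassP z) • e z +
        (b.eval (P.weierstrassP z) + b'.eval (P.weierstrassP z) * P.derivWeierstrassP z) • f z +
        (d.eval (P.weierstrassP z) + d'.eval (P.weierstrassP z) * P.derivWeierstrassP z) •
          ⁅e z, f z⁆) ↔ ∀ p, u p = _ := fun a b d a' b' d' =>
      hA.forall_vecPullback_eq_iff fun l hl z hz => by
        rw [hx l hl, hy l hl, hef.left.regular.map_add hl hz, hef.right.regular.map_add hl hz]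
    simp only [hiff]
    constructor
    · rintro ⟨a, b, d, a', b', d', h⟩
      obtain ⟨r, r', hr⟩ := hscale a a'
      obtain ⟨s, s', hs⟩ := hscale b b'
      obtain ⟨t, t', ht⟩ := hscale d d'
      exact ⟨r, s, t, r', s', t', fun p => by rw [h p, hr, hs, ht]⟩
    · rintro ⟨r, s, t, r', s', t', h⟩
      obtain ⟨a, a', ha⟩ := hunscale r r'
      obtain ⟨b, b', hb⟩ := hunscale s s'
      obtain ⟨d, d', hd⟩ := hunscale t t'
      exact ⟨a, b, d, a', b', d', fun p => by rw [h p, ha, hb, hd]⟩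

end AffineAction

/-! ## Fixed points and branch points -/

lemma continuous_torusProj (L : PeriodPair) : Continuous (torusProj L) :=
  continuous_quot_mk

lemma isOpenMap_torusProj (L : PeriodPair) : IsOpenMap (torusProj L) :=
  Submodule.isOpenMap_mkQ L.lattice

lemma puncturedProj_eq_iff {L : PeriodPair} {Γ : Type*} [Group Γ] [MulAction Γ (Torus L)]
    {p p' : puncturedTorus L Γ} :
    puncturedProj L Γ p = puncturedProj L Γ p' ↔ ∃ γ : Γ, γ • p' = p := by
  unfold puncturedProj
  rw [Quotient.eq, MulAction.orbitRel_apply, MulAction.mem_orbit_iff]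

namespace AffineAction.Lifts

variable {L P : PeriodPair} {Γ : Type*} [Group Γ] [MulAction Γ (Torus L)] {A : AffineAction L P Γ}

lemma smul_eq_iff (hA : A.Lifts) {γ : Γ} {z w : ℂ} :
    γ • torusProj L z = torusProj L w ↔ A.a γ * z + A.b γ - w ∈ L.lattice := by
  rw [hA, torusProj_eq_iff]

/-- An affine map with linear part `a ≠ 1` fixes `b / (1 - a)`, whereas a nontrivial translation has
no fixed point on the torus. -/
lemma fixedPointFreeSubgroup_eq (hA : A.Lifts) : fixedPointFreeSubgroup L Γ = A.a.ker := by
  refine le_antisymm ((Subgroup.closure_le _).mpr fun γ hγ => ?_) fun γ hγ => ?_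
  · rw [SetLike.mem_coe, MonoidHom.mem_ker]
    by_contra h
    have h1 : 1 - (A.a γ : ℂ) ≠ 0 := fun h1 => h (Units.ext (by
      rw [Units.val_one]; linear_combination -h1))
    refine hγ (torusProj L (A.b γ / (1 - A.a γ))) (hA.smul_eq_iff.mpr ?_)
    convert L.lattice.zero_mem using 1
    field_simp
    ring
  · by_cases h1 : γ = 1
    · exact h1 ▸ one_mem _
    refine Subgroup.subset_closure fun p hp => h1 ?_
    obtain ⟨z, rfl⟩ := torusProj_surjective L p
    rw [hA.smul_eq_iff, MonoidHom.mem_ker.mp hγ] at hp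
    exact A.faithful γ hγ (by simpa using hp)

lemma torusQuotientProj_eq_iff (hA : A.Lifts) {z w : ℂ} :
    torusQuotientProj L Γ z = torusQuotientProj L Γ w ↔ z - w ∈ P.lattice := by
  have h1 : torusQuotientProj L Γ z = torusQuotientProj L Γ w ↔
      ∃ k : fixedPointFreeSubgroup L Γ, k • torusProj L w = torusProj L z := by
    unfold torusQuotientProj
    rw [Quotient.eq, MulAction.orbitRel_apply, MulAction.mem_orbit_iff]
  rw [h1, A.mem_iff]
  constructor
  · rintro ⟨⟨k, hk⟩, h⟩
    rw [hA.fixedPointFreeSubgroup_eq, MonoidHom.mem_ker] at hk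
    refine ⟨k, hk, ?_⟩
    have h2 := hA.smul_eq_iff.mp h
    rw [hk] at h2
    convert L.lattice.neg_mem h2 using 1
    push_cast
    ring
  · rintro ⟨k, hk, h⟩
    refine ⟨⟨k, by rw [hA.fixedPointFreeSubgroup_eq]; exact hk⟩, hA.smul_eq_iff.mpr ?_⟩
    rw [hk]
    convert L.lattice.neg_mem h using 1
    push_cast
    ring

/-- A point is a ramification point if and only if its stabilizer is nontrivial. -/
theorem not_injOn_iff [Finite Γ] (hA : A.Lifts) (p : puncturedTorus L Γ) :
    (∀ U ∈ 𝓝 p, ¬ Set.InjOn (puncturedProj L Γ) U) ↔ ∃ γ : Γ, γ ≠ 1 ∧ γ • p = p := by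
  obtain ⟨z, hz, hzp⟩ : ∃ z, z ∉ P.lattice ∧ torusProj L z = p :=
    ⟨_, hA.puncturedLift_notMem p, torusProj_puncturedLift p⟩
  constructor
  · intro h
    by_contra! hfix
    have h1 : ∀ γ : Γ, γ ≠ 1 → ∀ᶠ x : ℂ × ℂ in 𝓝 (z, z), A.a γ * x.1 + A.b γ - x.2 ∉ L.lattice := by
      intro γ hγ
      have h2 : A.a γ * z + A.b γ - z ∉ L.lattice := fun h2 => hfix γ hγ (Subtype.ext (by
        have := hA.smul_eq_iff.mpr h2
        rw [hzp] at this
        exact this))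
      have h3 : Continuous fun x : ℂ × ℂ => (A.a γ : ℂ) * x.1 + A.b γ - x.2 := by fun_prop
      have h4 : ∀ᶠ w in 𝓝 (A.a γ * z + A.b γ - z), w ∉ L.lattice :=
        L.isClosed_lattice.isOpen_compl.mem_nhds h2
      exact (h3.tendsto (z, z)).eventually h4
    -- As `Γ` is finite, one neighbourhood `V` of `z` works for all `γ ≠ 1`: none maps a point of
    -- `V` to a point of `V` modulo `L`.
    have h2 : ∀ᶠ x : ℂ × ℂ in 𝓝 (z, z), ∀ γ : Γ, γ ≠ 1 →
        A.a γ * x.1 + A.b γ - x.2 ∉ L.lattice := by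
      rw [eventually_all]
      intro γ
      by_cases hγ : γ = 1
      · exact .of_forall fun x h => absurd hγ h
      · filter_upwards [h1 γ hγ] with x hx _ using hx
    rw [nhds_prod_eq] at h2
    obtain ⟨V, hV, h3⟩ := mem_prod_self_iff.mp h2
    refine h (Subtype.val ⁻¹' (torusProj L '' V)) ?_ ?_
    · refine continuous_subtype_val.continuousAt.preimage_mem_nhds ?_
      rw [← hzp]
      exact (isOpenMap_torusProj L).image_mem_nhds hV
    · rintro q ⟨w, hw, hwq⟩ q' ⟨w', hw', hwq'⟩ hqq
      obtain ⟨γ, hγ⟩ := puncturedProj_eq_iff.mp hqq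
      have h4 : γ • torusProj L w' = torusProj L w := by
        rw [hwq, hwq']
        exact congrArg Subtype.val hγ
      by_cases hγ1 : γ = 1
      · rw [← hγ, hγ1, one_smul]
      · exact absurd (hA.smul_eq_iff.mp h4) (h3 (Set.mk_mem_prod hw' hw) γ hγ1)
  · rintro ⟨γ, hγ, hp⟩ U hU hinj
    have h1 : A.a γ * z + A.b γ - z ∈ L.lattice := by
      rw [← hA.smul_eq_iff, hzp]
      exact congrArg Subtype.val hp
    obtain ⟨V, hV, hVU⟩ := mem_nhds_subtype _ _ _ |>.mp hU
    have h2 : ∀ᶠ w in 𝓝 z, torusProj L w ∈ V := by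
      refine (continuous_torusProj L).continuousAt.preimage_mem_nhds ?_
      rwa [hzp]
    have h3 : ∀ᶠ w in 𝓝 z, torusProj L (A.a γ * w + A.b γ) ∈ V := by
      have h4 : Continuous fun w : ℂ => torusProj L (A.a γ * w + A.b γ) :=
        (continuous_torusProj L).comp (by fun_prop)
      refine h4.continuousAt.preimage_mem_nhds ?_
      rwa [torusProj_eq_iff.mpr h1, hzp]
    have h4 : ∀ᶠ w in 𝓝 z, w ∉ P.lattice := P.isClosed_lattice.isOpen_compl.mem_nhds hz
    -- Near a fixed point of `γ` both `w` and `γ w` lie in `U`. Injectivity identifies them, so the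
    -- affine map is locally the identity modulo `L` and `γ` is trivial.
    have h5 : ∀ᶠ w in 𝓝 z, A.a γ * w + A.b γ - w ∈ L.lattice := by
      filter_upwards [h2, h3, h4] with w hw2 hw3 hw4
      have hm := hA.mem_puncturedTorus_iff.mpr hw4
      have hm' := hA.mem_puncturedTorus_iff.mpr (A.apply_notMem γ hw4)
      have h6 := hinj (hVU (show (⟨_, hm'⟩ : puncturedTorus L Γ) ∈ Subtype.val ⁻¹' V from hw3))
        (hVU (show (⟨_, hm⟩ : puncturedTorus L Γ) ∈ Subtype.val ⁻¹' V from hw2))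
        (puncturedProj_eq_iff.mpr ⟨γ, Subtype.ext (hA γ w)⟩)
      exact torusProj_eq_iff.mp (congrArg Subtype.val h6)
    have h6 : A.a γ = 1 := by
      have h7 := PeriodPair.eventually_sub_eq_const (P := L)
        (F := fun w => A.a γ * w + A.b γ) (G := fun w => w) (z := z) (by fun_prop) (by fun_prop) h5
      have h8 : (fun w : ℂ => ((A.a γ : ℂ) - 1) * w) =ᶠ[𝓝 z] fun _ => ((A.a γ : ℂ) - 1) * z := by
        filter_upwards [h7] with w hw
        linear_combination hw
      have h9 := h8.deriv_eq
      rw [deriv_const_mul_id', deriv_const] at h9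
      exact Units.ext (sub_eq_zero.mp h9)
    refine hγ (A.faithful γ h6 ?_)
    rw [h6] at h1
    simpa using h1

lemma branchPoints_eq [Finite Γ] (hA : A.Lifts) : branchPoints L Γ =
    puncturedProj L Γ '' {p | ∃ γ : Γ, γ ≠ 1 ∧ γ • p = p} := by
  unfold branchPoints
  simp only [hA.not_injOn_iff]

lemma branchPoints_eq_empty [Finite Γ] (hA : A.Lifts) (ha : ∀ γ, A.a γ = 1) :
    branchPoints L Γ = ∅ := by
  rw [hA.branchPoints_eq, Set.image_eq_empty, Set.eq_empty_iff_forall_notMem]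
  rintro p ⟨γ, hγ, hp⟩
  have h1 := congrArg Subtype.val hp
  change γ • (p : Torus L) = p at h1
  rw [← torusProj_puncturedLift p, hA.smul_eq_iff, ha γ] at h1
  exact hγ (A.faithful γ (ha γ) (by simpa using h1))

/-- The branch points correspond to the zeros of the polynomial of an orbit coordinate. -/
theorem encard_branchPoints [Finite Γ] (hA : A.Lifts) {q : ℂ[X]} {t α β : ℂ → ℂ}
    (h : A.IsOrbitCoordinate q t α β) :
    (branchPoints L Γ).encard = {c : ℂ | q.eval c = 0}.encard := by
  have hsmul : ∀ (γ : Γ) (z : ℂ), z ∉ P.lattice → ∀ w,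
      γ • torusProj L z = torusProj L w → t w = t z := by
    intro γ z hz w hw
    have h1 := L.lattice.neg_mem (hA.smul_eq_iff.mp hw)
    have h2 := h.weight_t.regular.map_add _ h1 _ (A.apply_notMem γ hz)
    rw [h.weight_t.map_mul γ z hz, MonoidHom.one_apply, Units.val_one, one_mul] at h2
    rw [← h2]
    congr 1
    ring
  have hval : ∀ {γ : Γ} {p p' : puncturedTorus L Γ}, γ • p = p' →
      γ • torusProj L (puncturedLift p) = torusProj L (puncturedLift p') := by
    rintro γ p _ rfl
    rw [torusProj_puncturedLift, torusProj_puncturedLift]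
    rfl
  have hs := hA.puncturedLift_notMem
  -- The invariant function `t` induces an injection of the orbit space into `ℂ`, so branch points
  -- may be counted by their values.
  let T : MulAction.orbitRel.Quotient Γ (puncturedTorus L Γ) → ℂ :=
    Quotient.lift (fun p => t (puncturedLift p)) fun p p' hp => by
      obtain ⟨γ, hγ⟩ := MulAction.mem_orbit_iff.mp (MulAction.orbitRel_apply.mp hp)
      exact hsmul γ _ (hs p') _ (hval hγ)
  have hT : ∀ p, T (puncturedProj L Γ p) = t (puncturedLift p) := fun p => rfl
  -- A congruence modulo `P` becomes an equality on `T` after composing with a translation from `Γ`.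
  have htrans : ∀ (γ : Γ) (z w : ℂ), w - A.a γ * z ∈ P.lattice →
      ∃ δ, A.a δ = A.a γ ∧ δ • torusProj L z = torusProj L w := by
    intro γ z w hw
    obtain ⟨k, hk, hk'⟩ := (A.mem_iff _).mp (P.lattice.sub_mem hw (A.b_mem_lattice γ))
    refine ⟨k * γ, by rw [map_mul, hk, one_mul], ?_⟩
    rw [mul_smul, hA, hA.smul_eq_iff, hk]
    convert L.lattice.neg_mem hk' using 1
    push_cast
    ring
  have hinj : Function.Injective T := by
    rintro ⟨p⟩ ⟨p'⟩ hp
    obtain ⟨γ, hγ⟩ := h.separates _ (hs p') _ (hs p) (Eq.symm hp)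
    obtain ⟨δ, -, hδ⟩ := htrans γ _ _ hγ
    rw [torusProj_puncturedLift, torusProj_puncturedLift] at hδ
    exact puncturedProj_eq_iff.mpr ⟨δ, Subtype.ext hδ⟩
  rw [← hinj.encard_image, hA.branchPoints_eq]
  congr 1
  ext c
  constructor
  · rintro ⟨_, ⟨p, ⟨γ, hγ, hp⟩, rfl⟩, rfl⟩
    -- A nontrivial stabiliser element has `a γ ≠ 1`. At its fixed point the weight relation `α = (a
    -- γ)⁻¹ * α` forces `α = 0`, hence `q(t) = 0`.
    rw [Set.mem_ofPred_eq, hT, ← h.mul _ (hs p)]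
    have h1 := hA.smul_eq_iff.mp (hval hp)
    have hne : A.a γ ≠ 1 := fun h2 => by
      rw [h2] at h1
      exact hγ (A.faithful γ h2 (by simpa using h1))
    have h2 := h.weight_α.regular.map_add _ h1 _ (hs p)
    rw [add_sub_cancel, h.weight_α.map_mul γ _ (hs p)] at h2
    rw [mul_eq_zero]
    left
    by_contra h3
    have h4 := mul_right_cancel₀ h3 (h2.trans (one_mul _).symm)
    refine hne ?_
    rw [← inv_eq_one, ← MonoidHom.inv_apply]
    exact Units.ext h4
  · intro hc
    obtain ⟨z, hz, rfl⟩ := h.surjective c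
    obtain ⟨γ, hγ, hγz⟩ := h.ramified z hz hc
    have hm := hA.mem_puncturedTorus_iff.mpr hz
    obtain ⟨δ, hδ, hδz⟩ := htrans γ z z (by simpa using P.lattice.neg_mem hγz)
    refine ⟨_, ⟨⟨torusProj L z, hm⟩, ⟨δ, ?_, Subtype.ext hδz⟩, rfl⟩, ?_⟩
    · rintro rfl
      rw [map_one] at hδ
      exact hγ hδ.symm
    · rw [hT]
      refine hsmul 1 z hz _ ?_
      rw [one_smul, torusProj_puncturedLift]

end AffineAction.Lifts

/-! ## The classification of tori -/

/-- A biholomorphism lifts to an affine map, and injectivity says that its linear part matches the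
two lattices exactly. -/
theorem isBiholomorphicVia_iff {X Y : Type*} {π : ℂ → X} {π' : ℂ → Y} {P Q : PeriodPair}
    (hπs : Function.Surjective π) (hπ's : Function.Surjective π')
    (hπ : ∀ z w, π z = π w ↔ z - w ∈ P.lattice) (hπ' : ∀ z w, π' z = π' w ↔ z - w ∈ Q.lattice) :
    IsBiholomorphicVia π π' ↔ ∃ c ≠ 0, ∀ z, c * z ∈ Q.lattice ↔ z ∈ P.lattice := by
  constructor
  · rintro ⟨e, he, -⟩
    obtain ⟨c, b, hcb⟩ := he.exists_affine (fun z w => (hπ z w).mpr) hπ'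
    have hiff : ∀ z, c * z ∈ Q.lattice ↔ z ∈ P.lattice := fun z => by
      have h1 := hπ' (c * z + b) (c * 0 + b)
      rw [← hcb, ← hcb, e.apply_eq_iff_eq, hπ] at h1
      simpa using h1.symm
    refine ⟨c, ?_, hiff⟩
    rintro rfl
    obtain ⟨z, hz⟩ := P.exists_notMem
    exact hz ((hiff z).mp (by simp))
  · rintro ⟨c, hc, hiff⟩
    choose s hs using hπs
    have hval : ∀ z, π' (c * s (π z)) = π' (c * z) := fun z => by
      rw [hπ', ← mul_sub, hiff, ← hπ, hs]
    let e : X ≃ Y := Equiv.ofBijective (fun x => π' (c * s x)) ⟨fun x y h => by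
        simp only [hπ'] at h
        rwa [← mul_sub, hiff, ← hπ, hs, hs] at h, fun y => by
        obtain ⟨w, rfl⟩ := hπ's y
        exact ⟨π (w / c), by simp only [hval, mul_div_cancel₀ _ hc]⟩⟩
    have he : ∀ z, e (π z) = π' (c * z) := hval
    refine ⟨e, fun z => ⟨fun w => c * w, by fun_prop, .of_forall fun w => (he w).symm⟩,
      fun z => ⟨fun w => w / c, by fun_prop (disch := exact hc), .of_forall fun w => ?_⟩⟩
    rw [Equiv.eq_symm_apply, he, mul_div_cancel₀ _ hc]

theorem AffineAction.Lifts.isBiholomorphicVia_iff {L P : PeriodPair} {Γ : Type*} [Group Γ]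
    [MulAction Γ (Torus L)] {A : AffineAction L P Γ} (hA : A.Lifts) (Q : PeriodPair) :
    IsBiholomorphicVia (torusProj Q) (torusQuotientProj L Γ) ↔
      ∃ c ≠ 0, ∀ z, c * z ∈ P.lattice ↔ z ∈ Q.lattice :=
  _root_.isBiholomorphicVia_iff (torusProj_surjective Q)
    (Quotient.mk_surjective.comp (torusProj_surjective L)) (fun _ _ => torusProj_eq_iff)
    fun _ _ => hA.torusQuotientProj_eq_iff

lemma mem_tauPeriods_lattice {τ : ℍ} {z : ℂ} :
    z ∈ (tauPeriods τ).lattice ↔ ∃ m n : ℤ, (m : ℂ) + n * τ = z := by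
  rw [PeriodPair.mem_lattice]
  simp [tauPeriods]

lemma UpperHalfPlane.int_add_mul_inj {τ : ℍ} {m n m' n' : ℤ}
    (h : (m : ℂ) + n * τ = m' + n' * τ) : m = m' ∧ n = n' := by
  have h1 := congrArg Complex.im h
  have h2 := congrArg Complex.re h
  simp at h1 h2
  have h3 := h1.resolve_right τ.im_ne_zero
  subst h3
  simpa using h2

theorem PeriodPair.exists_tauPeriods (P : PeriodPair) :
    ∃ τ : ℍ, ∃ c ≠ 0, ∀ z, c * z ∈ P.lattice ↔ z ∈ (tauPeriods τ).lattice := by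
  have h0 : P.ω₁ ≠ 0 := fun h => by
    have := P.ω₁_div_two_notMem_lattice
    rw [h, zero_div] at this
    exact this P.lattice.zero_mem
  have him : (P.ω₂ / P.ω₁).im ≠ 0 := by
    intro h
    have h1 : P.ω₂ = ((P.ω₂ / P.ω₁).re : ℂ) * P.ω₁ := by
      rw [← Complex.ext_iff.mpr ⟨(Complex.ofReal_re _).symm, h.trans (Complex.ofReal_im _).symm⟩,
        div_mul_cancel₀ _ h0]
    have h2 := LinearIndependent.pair_iff.mp P.indep (P.ω₂ / P.ω₁).re (-1) (by
      simp only [Complex.real_smul]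
      rw [← h1]
      push_cast
      ring)
    norm_num at h2
  -- The ratio of the periods is not real; its sign is chosen so that it lies in the upper half
  -- plane.
  rcases lt_or_gt_of_ne him with h | h
  · refine ⟨⟨-(P.ω₂ / P.ω₁), by simpa using h⟩, P.ω₁, h0, fun z => ?_⟩
    rw [mem_tauPeriods_lattice, PeriodPair.mem_lattice]
    constructor
    · rintro ⟨m, n, h1⟩
      refine ⟨m, -n, mul_left_cancel₀ h0 (h1 ▸ ?_)⟩
      push_cast
      field_simp
    · rintro ⟨m, n, h1⟩
      refine ⟨m, -n, h1 ▸ ?_⟩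
      push_cast
      field_simp
  · refine ⟨⟨P.ω₂ / P.ω₁, h⟩, P.ω₁, h0, fun z => ?_⟩
    rw [mem_tauPeriods_lattice, PeriodPair.mem_lattice]
    constructor
    · rintro ⟨m, n, h1⟩
      refine ⟨m, n, mul_left_cancel₀ h0 (h1 ▸ ?_)⟩
      field_simp
    · rintro ⟨m, n, h1⟩
      refine ⟨m, n, h1 ▸ ?_⟩
      field_simp

/-- Two points of the upper half plane are equivalent under the modular group if and only if their
lattices are homothetic. -/
theorem UpperHalfPlane.mk_eq_mk_iff (τ τ' : ℍ) :
    (Quotient.mk (MulAction.orbitRel (Matrix.SpecialLinearGroup (Fin 2) ℤ) ℍ) τ =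
      Quotient.mk _ τ') ↔
      ∃ c ≠ 0, ∀ z, c * z ∈ (tauPeriods τ').lattice ↔ z ∈ (tauPeriods τ).lattice := by
  rw [Quotient.eq, MulAction.orbitRel_apply, MulAction.mem_orbit_iff]
  constructor
  · rintro ⟨g, rfl⟩
    have hdet : ((g 0 0 : ℤ) : ℂ) * g 1 1 - g 0 1 * g 1 0 = 1 := by
      have := g.det_coe
      rw [Matrix.det_fin_two] at this
      exact_mod_cast this
    have hne : ((g 1 0 : ℤ) : ℂ) * τ' + g 1 1 ≠ 0 := by
      intro h
      have h1 := UpperHalfPlane.int_add_mul_inj (τ := τ') (m := g 1 1) (n := g 1 0) (m' := 0)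
        (n' := 0) (by push_cast; linear_combination h)
      rw [h1.1, h1.2] at hdet
      simp at hdet
    have hg : ((g • τ' : ℍ) : ℂ) = ((g 0 0 : ℤ) * τ' + g 0 1) / ((g 1 0 : ℤ) * τ' + g 1 1) := by
      simpa using UpperHalfPlane.coe_specialLinearGroup_apply g τ'
    -- The homothety factor is the denominator of the Möbius transformation.
    refine ⟨_, hne, fun z => ?_⟩
    rw [mem_tauPeriods_lattice, mem_tauPeriods_lattice]
    constructor
    · rintro ⟨x, y, hxy⟩
      refine ⟨g 0 0 * x - g 0 1 * y, -g 1 0 * x + g 1 1 * y, mul_left_cancel₀ hne ?_⟩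
      rw [hg, ← hxy]
      field_simp
      push_cast
      linear_combination (x + y * (τ' : ℂ)) * hdet
    · rintro ⟨m, n, rfl⟩
      refine ⟨g 1 1 * m + g 0 1 * n, g 1 0 * m + g 0 0 * n, ?_⟩
      have h1 := mul_div_cancel₀ ((g 0 0 : ℤ) * (τ' : ℂ) + g 0 1) hne
      rw [← hg] at h1
      push_cast
      linear_combination -(n : ℂ) * h1
  · rintro ⟨c, hc, h⟩
    -- From `c = d + k τ'` and `c τ = b + a τ'` one reads off `τ = (a τ' + b) / (k τ' + d)`.
    obtain ⟨d, k, hdk⟩ := mem_tauPeriods_lattice.mp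
      ((h 1).mpr (mem_tauPeriods_lattice.mpr ⟨1, 0, by simp⟩))
    obtain ⟨b, a, hba⟩ := mem_tauPeriods_lattice.mp
      ((h τ).mpr (mem_tauPeriods_lattice.mpr ⟨0, 1, by simp⟩))
    obtain ⟨m₁, n₁, h₁⟩ := mem_tauPeriods_lattice.mp ((h c⁻¹).mp
      (mem_tauPeriods_lattice.mpr ⟨1, 0, by simp [hc]⟩))
    obtain ⟨m₂, n₂, h₂⟩ := mem_tauPeriods_lattice.mp ((h (c⁻¹ * τ')).mp
      (mem_tauPeriods_lattice.mpr ⟨0, 1, by simp [hc]⟩))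
    rw [mul_one] at hdk
    have e₁ := UpperHalfPlane.int_add_mul_inj (τ := τ') (m := m₁ * d + n₁ * b)
      (n := m₁ * k + n₁ * a) (m' := 1) (n' := 0) (by
        push_cast
        have : c * ((m₁ : ℂ) + n₁ * τ) = 1 := by rw [h₁, mul_inv_cancel₀ hc]
        linear_combination this + (m₁ : ℂ) * hdk + (n₁ : ℂ) * hba)
    have e₂ := UpperHalfPlane.int_add_mul_inj (τ := τ') (m := m₂ * d + n₂ * b)
      (n := m₂ * k + n₂ * a) (m' := 0) (n' := 1) (by
        push_cast
        have : c * ((m₂ : ℂ) + n₂ * τ) = τ' := by rw [h₂, mul_inv_cancel_left₀ hc]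
        linear_combination this + (m₂ : ℂ) * hdk + (n₂ : ℂ) * hba)
    -- The coordinates of `c⁻¹` and `c⁻¹ τ'` give an inverse integral matrix.
    have hunit : IsUnit (a * d - b * k) := by
      refine IsUnit.of_mul_eq_one (m₁ * n₂ - n₁ * m₂) ?_
      linear_combination (m₂ * k + n₂ * a) * e₁.1 + e₂.2 - (m₂ * d + n₂ * b) * e₁.2
    -- Comparing imaginary parts gives `|c|² Im τ = (a d - b k) Im τ'`.
    have hpos : 0 < a * d - b * k := by
      have hre := congrArg Complex.re hba
      have him := congrArg Complex.im hba
      rw [← hdk] at hre him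
      simp at hre him
      have hn : 0 < Complex.normSq c := Complex.normSq_pos.mpr hc
      rw [← hdk, Complex.normSq_apply] at hn
      simp at hn
      have h3 : ((d + k * τ'.re) * (d + k * τ'.re) + k * τ'.im * (k * τ'.im)) * τ.im =
          ((a * d - b * k : ℤ) : ℝ) * τ'.im := by
        push_cast
        linear_combination (-(d + k * τ'.re)) * him + (k * τ'.im) * hre
      have h4 := mul_pos hn τ.im_pos
      rw [h3] at h4
      exact_mod_cast pos_of_mul_pos_left h4 τ'.im_pos.le
    have hdet : a * d - b * k = 1 := by
      rcases Int.isUnit_iff.mp hunit with h | h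
      · exact h
      · omega
    refine ⟨⟨!![a, b; k, d], by rw [Matrix.det_fin_two_of, hdet]⟩, UpperHalfPlane.ext ?_⟩
    have hg := UpperHalfPlane.coe_specialLinearGroup_apply
      (⟨!![a, b; k, d], by rw [Matrix.det_fin_two_of, hdet]⟩ :
        Matrix.SpecialLinearGroup (Fin 2) ℤ) τ'
    rw [hg]
    simp
    rw [div_eq_iff (by rw [add_comm, hdk]; exact hc), add_comm, hba, add_comm _ (d : ℂ), hdk]
    ring

/-! ## The classification -/

lemma PeriodPair.encard_cubic_roots (P : PeriodPair) :
    {c : ℂ | (4 * Polynomial.X ^ 3 - Polynomial.C P.g₂ * Polynomial.X -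
      Polynomial.C P.g₃).eval c = 0}.encard = 3 := by
  obtain ⟨e₁, e₂, e₃, h12, h13, h23, hx⟩ := P.exists_cubic_roots
  rw [Set.encard_eq_three]
  refine ⟨e₁, e₂, e₃, h12, h13, h23, Set.ext fun c => ?_⟩
  simp only [Set.mem_ofPred_eq, Polynomial.eval_sub, Polynomial.eval_mul, Polynomial.eval_ofNat,
    Polynomial.eval_pow, Polynomial.eval_X, Polynomial.eval_C, hx, mul_eq_zero, sub_eq_zero,
    Set.mem_insert_iff, Set.mem_singleton_iff, OfNat.ofNat_ne_zero, false_or, or_assoc]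

lemma Polynomial.encard_quadratic_roots {κ r s : ℂ} (hκ : κ ≠ 0) (hrs : r ≠ s) :
    {c : ℂ | (Polynomial.C κ * (Polynomial.X - Polynomial.C r) *
      (Polynomial.X - Polynomial.C s)).eval c = 0}.encard = 2 := by
  rw [← Set.encard_pair hrs]
  congr 1
  ext c
  simp [hκ, sub_eq_zero]

theorem theorem1 (L : PeriodPair) {Γ : Type*} [Group Γ] [Finite Γ]
    [MulAction Γ (Torus L)] [FaithfulSMul Γ (Torus L)]
    (hσ : ∀ γ : Γ, IsHolomorphicVia (torusProj L) (torusProj L) (fun p => γ • p))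
    (hΓ : ∀ γ : Γ, ∃ g k : Γ, γ = g * k ∧ g • (0 : Torus L) = 0 ∧
      ∃ α : Torus L, ∀ p : Torus L, k • p = p + α)
    (ρ : Γ →* (Sl2 ≃ₗ⁅ℂ⁆ Sl2)) (hρ : Function.Injective ρ) :
    ((branchPoints L Γ).encard = 0 ∨ (branchPoints L Γ).encard = 2 ∨
      (branchPoints L Γ).encard = 3) ∧
    ∃ c : MulAction.orbitRel.Quotient (Matrix.SpecialLinearGroup (Fin 2) ℤ) UpperHalfPlane,
      (∀ τ : UpperHalfPlane, Quotient.mk _ τ = c ↔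
        IsBiholomorphicVia (torusProj (tauPeriods τ)) (torusQuotientProj L Γ)) ∧
      ((branchPoints L Γ).encard = 0 → ∀ τ : UpperHalfPlane, Quotient.mk _ τ = c →
        Nonempty (automorphicLieAlgebra (L := L) ρ ≃ₗ⁅ℂ⁆ CurrentAlgebra τ)) ∧
      ((branchPoints L Γ).encard = 2 →
        Nonempty (automorphicLieAlgebra (L := L) ρ ≃ₗ⁅ℂ⁆ OnsagerAlgebra)) ∧
      ((branchPoints L Γ).encard = 3 → ∀ τ : UpperHalfPlane, Quotient.mk _ τ = c →
        Nonempty (automorphicLieAlgebra (L := L) ρ ≃ₗ⁅ℂ⁆ SAlgebra τ)) := by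
  obtain ⟨P, A, hA⟩ := AffineAction.exists_of_mulAction hσ hΓ
  replace hA : A.Lifts := hA
  obtain ⟨τ₀, c₀, hc₀, h₀⟩ := P.exists_tauPeriods
  have hτ : ∀ τ : ℍ, (Quotient.mk (MulAction.orbitRel
      (Matrix.SpecialLinearGroup (Fin 2) ℤ) ℍ) τ = Quotient.mk _ τ₀) ↔
      ∃ c ≠ 0, ∀ z, c * z ∈ P.lattice ↔ z ∈ (tauPeriods τ).lattice := by
    intro τ
    rw [UpperHalfPlane.mk_eq_mk_iff]
    constructor
    · rintro ⟨c, hc, h⟩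
      exact ⟨c₀ * c, mul_ne_zero hc₀ hc, fun z => by rw [mul_assoc, h₀, h]⟩
    · rintro ⟨c, hc, h⟩
      refine ⟨c / c₀, div_ne_zero hc hc₀, fun z => ?_⟩
      rw [← h₀, ← h, ← mul_assoc, mul_div_cancel₀ _ hc₀]
  have hbiho : ∀ τ : ℍ, (Quotient.mk (MulAction.orbitRel
      (Matrix.SpecialLinearGroup (Fin 2) ℤ) ℍ) τ = Quotient.mk _ τ₀) ↔
      IsBiholomorphicVia (torusProj (tauPeriods τ)) (torusQuotientProj L Γ) := fun τ =>
    (hτ τ).trans (hA.isBiholomorphicVia_iff _).symm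
  -- Each of the three cases determines the number of branch points, so exactly one of the three
  -- isomorphism statements is not vacuous.
  rcases A.exists_isOrbitCoordinate with ha | h | ⟨κ, r, s, t, α, β, hκ, hrs, h⟩
  · have hcard : (branchPoints L Γ).encard = 0 := by
      rw [hA.branchPoints_eq_empty ha, Set.encard_empty]
    simp only [hcard]
    refine ⟨.inl trivial, Quotient.mk _ τ₀, hbiho, fun _ τ h => ?_, fun h => ?_, fun h => ?_⟩
    · obtain ⟨c, hc, hcτ⟩ := (hτ τ).mp h
      exact hA.nonempty_equiv_currentAlgebra hρ ha hc hcτ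
    · norm_num at h
    · norm_num at h
  · have hcard : (branchPoints L Γ).encard = 3 := by
      rw [hA.encard_branchPoints h, P.encard_cubic_roots]
    simp only [hcard]
    refine ⟨.inr (.inr trivial), Quotient.mk _ τ₀, hbiho, fun h => ?_, fun h => ?_,
      fun _ τ h' => ?_⟩
    · norm_num at h
    · norm_num at h
    · obtain ⟨c, hc, hcτ⟩ := (hτ τ).mp h'
      exact hA.nonempty_equiv_sAlgebra hρ h hc hcτ
  · have hcard : (branchPoints L Γ).encard = 2 := by
      rw [hA.encard_branchPoints h, Polynomial.encard_quadratic_roots hκ hrs]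
    simp only [hcard]
    refine ⟨.inr (.inl trivial), Quotient.mk _ τ₀, hbiho, fun h => ?_, fun _ => ?_, fun h => ?_⟩
    · norm_num at h
    · obtain ⟨φ⟩ := hA.nonempty_equiv_twistedSl2 hρ (mul_ne_zero (mul_ne_zero
        (Polynomial.C_ne_zero.mpr hκ) (Polynomial.X_sub_C_ne_zero r))
        (Polynomial.X_sub_C_ne_zero s)) h
      obtain ⟨ψ⟩ := TwistedSl2.nonempty_equiv_onsager hκ hrs
      exact ⟨φ.trans ψ⟩
    · norm_num at h

end
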